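/- Let $M$ be a connected closed (compact, without boundary) smooth Riemannian manifold with normalized volume measure $\mathrm{vol}$, let $\Gamma(M)$ be the space of smooth vector fields on $M$, let $\mathscr D$ be the group of smooth diffeomorphisms of $M$, and let $\mathcal P_\infty$ be the set of probability measures on $M$ with a smooth positive density with respect to $\mathrm{vol}$, with the quadratic Wasserstein distance. Put $p:\mathscr D\to\mathcal P_\infty$, $p(\varphi)=\varphi_\sharp\mathrm{vol}$. **The space $\mathcal P_\infty$.** For $\mu\in\mathcal P_\infty$ let $\bar T_\mu\mathcal P$ be the closure of $\{\nabla\psi:\psi\in C^\infty(M)\}$ in $L^2(M,TM,\mu)$ and $\Pi_\mu$ the orthogonal projection onto it. The Lie derivative $\mathcal L_{\nabla\psi}F(\mu)$ of a functional $F$ is $\frac{d}{dt}\big|_{t=0}F((U_t)_\sharp\mu)$, where $U$ is the flow of $\nabla\psi$. $F$ is of class $C^1_w$ if $\nabla\psi\mapsto\mathcal L_{\nabla\psi}F(\mu)$ is linear and $L^2(\mu)$-bounded for every $\mu$, with a bound independent of $\mu$, and $\mu\mapsto\mathcal L_{\nabla\zeta(\mu)}F(\mu)$ is continuous for all $\zeta\in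 C^{\infty,0}(M\times\mathcal P_\infty)$ (all $x$-derivatives exist and are jointly continuous). A function $\phi\in C^{\infty,0}(M\times\mathcal P_\infty)$ is in $C^{\infty,1}_w(M\times\mathcal P_\infty)$ if $\phi$ and all its $x$-derivatives are, at each fixed $x$, of class $C^1_w$ in $\mu$, and for all $\zeta\in C^{\infty,0}(M\times\mathcal P_\infty)$ the function $(x,\mu)\mapsto\mathcal L_{\nabla\zeta(\mu)}\phi(x,\mu)$ is in $C^{\infty,0}(M\times\mathcal P_\infty)$ and the Lie derivative commutes with all $x$-derivatives. For $\bar Z=\nabla\phi(\cdot)$ with such $\phi$ and $v=\nabla\psi$, the Levi-Civita connection of $\mathcal P_\infty$ is $$\bar\nabla_v\bar Z(\mu)=\Pi_\mu\big(\nabla_v\nabla\phi(\mu)\big)+\nabla\big(\mathcal L_v\phi(\mu)\big).$$ **The group $\mathscr D$.** $\mathscr D$ is regarded as the inverse limit of the Hilbert manifolds $\mathscr D^s$, $s>m/2$, $m=\dim M$, of $H^s$ homeomorphisms with $H^s$ inverse; maps on $\mathscr D$ are $C^k$ if for every $s>m/2$ they have a $C^k$ extension to $\mathscr D^j$ for some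 $j\ge s$. Put $T_\varphi\mathscr D=\{A\circ\varphi:A\in\Gamma(M)\}$ with the metric $\langle A\circ\varphi,B\circ\varphi\rangle_\varphi=\int_M\langle A(\varphi(x)),B(\varphi(x))\rangle\,d\mathrm{vol}(x)$, and let $\bar T_\varphi\mathscr D$ be its $L^2$-completion. $\Gamma^1(\mathscr D)$ is the space of vector fields $\varphi\mapsto\bm A(\varphi)\in T_\varphi\mathscr D$ such that $(x,\varphi)\mapsto\bm A(\varphi)(x)$ is of class $C^{\infty,1}$ on $M\times\mathscr D$. The Levi-Civita connection $\bm\nabla$ of $\mathscr D$ is determined by the Koszul formula, tested against all fields of $\Gamma^1(\mathscr D)$. The vertical space is $\mathscr V_\varphi\mathscr D=\ker T_\varphi p=\{Y\circ\varphi: Y\in\Gamma(M),\ \int_M\langle\nabla f,Y\rangle\,dp(\varphi)=0\ \ \forall f\in C^\infty(M)\}$, and $P_{\mathscr V_\varphi}$ is the orthogonal projection of $\bar T_\varphi\mathscr D$ onto its closure. The horizontal lift $\mathfrak h_\varphi:\bar T_{p(\varphi)}\mathcal P\to\bar T_\varphi\mathscr D$ is the continuous linear map with $\mathfrak h_\varphi(\nabla\psi)=\nabla\psi\circ\varphi$.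 The normal tensor is $$\mathcal N_\varphi(U\circ\varphi,A\circ\varphi)=P_{\mathscr V_\varphi}\big(((\nabla U)^T\cdot A)\circ\varphi\big),\qquad U,A\in\Gamma(M),$$ where $(\nabla U)^T$ is the pointwise adjoint of $X\mapsto\nabla_XU$. A vector field $\bar Z=\nabla\phi(\cdot)$ with $\phi\in C_w^{\infty,1}(M\times\mathcal P_\infty)$ belongs to $\Gamma^1(\mathcal P_\infty)$ if its horizontal lift $\bm Z(\varphi)=\mathfrak h_\varphi(\bar Z(p(\varphi)))=\nabla\phi(p(\varphi))\circ\varphi$ belongs to $\Gamma^1(\mathscr D)$. **Proposition.** Let $\bar Z_1,\bar Z_2\in\Gamma^1(\mathcal P_\infty)$ with horizontal lifts $\bm Z_1,\bm Z_2$, let $\varphi\in\mathscr D$ and $\mu=p(\varphi)$. Then the Levi-Civita derivative $\bm\nabla_{\bm Z_2(\varphi)}\bm Z_1(\varphi)\in T_\varphi\mathscr D$ exists, is uniquely determined by the Koszul formula, and, in $\bar T_\varphi\mathscr D$, $$\bm\nabla_{\bm Z_2(\varphi)}\bm Z_1(\varphi)=\mathfrak h_\varphi\Big(\bar\nabla_{\bar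 Z_2(\mu)}\bar Z_1(\mu)\Big)+\mathcal N_\varphi\big(\bm Z_1(\varphi),\bm Z_2(\varphi)\big).$$ -/

import Mathlib

open MeasureTheory Set Filter Bundle
open scoped Manifold ContDiff Topology

noncomputable section

namespace WassersteinDiff

variable {m : ℕ} {M : Type*} [MetricSpace M] [ChartedSpace (EuclideanSpace ℝ (Fin m)) M]
  [IsManifold (𝓡 m) ∞ M]

/-! ## Smooth functions, vector fields and diffeomorphisms of `M` -/

/-- `C^∞(M)`. -/
abbrev SmoothFun (m : ℕ) (M : Type*) [MetricSpace M]
    [ChartedSpace (EuclideanSpace ℝ (Fin m)) M] :=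
  C^∞⟮𝓡 m, M; 𝓘(ℝ, ℝ), ℝ⟯

/-- `Γ(M)`, the smooth vector fields on `M`. -/
abbrev VF (m : ℕ) (M : Type*) [MetricSpace M] [ChartedSpace (EuclideanSpace ℝ (Fin m)) M]
    [IsManifold (𝓡 m) ∞ M] :=
  ContMDiffSection (𝓡 m) (EuclideanSpace ℝ (Fin m)) ∞ (TangentSpace (𝓡 m) : M → Type _)

/-- The group `𝒟` of smooth diffeomorphisms of `M`. -/
abbrev DiffM (m : ℕ) (M : Type*) [MetricSpace M]
    [ChartedSpace (EuclideanSpace ℝ (Fin m)) M] :=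
  Diffeomorph (𝓡 m) (𝓡 m) M M ∞

/-- The derivation `f ↦ X f = df(X)` of `C^∞(M)` defined by a vector field `X`. -/
def dirD (X : VF m M) : SmoothFun m M →ₗ[ℝ] SmoothFun m M where
  toFun f := ⟨fun x => mvfderiv (𝓡 m) f x (X x), by
    have h1 := (f.contMDiff.contMDiff_tangentMap (m := ∞) (by simp)).comp X.contMDiff
    exact (contMDiff_snd_tangentBundle_modelSpace ℝ 𝓘(ℝ, ℝ)).comp h1⟩
  map_add' f g := by
    ext x
    have := congrArg (fun L => L (X x))
      (mvfderiv_add (f.mdifferentiableAt (x := x)) (g.mdifferentiableAt (x := x)))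
    exact this
  map_smul' r f := by
    ext x
    have := congrArg (fun L => L (X x))
      (mvfderiv_smul (I := 𝓡 m) (a := fun _ : M => r) mdifferentiableAt_const
        (f.mdifferentiableAt (x := x)))
    rw [mvfderiv_const] at this
    refine this.trans ?_
    simp only [add_apply, smul_apply, zero_apply, ContinuousLinearMap.smulRight_apply, zero_smul,
      add_zero]
    rfl

/-- Iterated derivatives: `iterD [X₁, …, X_k] f = X₁ (⋯ (X_k f))`. -/
def iterD : List (VF m M) → (SmoothFun m M →ₗ[ℝ] SmoothFun m M)
  | [] => LinearMap.id
  | X :: l => (dirD X).comp (iterD l)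

variable [RiemannianBundle (fun x : M => TangentSpace (𝓡 m) x)]
  [IsContMDiffRiemannianBundle (𝓡 m) ∞ (EuclideanSpace ℝ (Fin m))
    (fun x : M => TangentSpace (𝓡 m) x)]

/-- The smooth function `x ↦ ⟨A(x), B(x)⟩`. -/
def innerFun (A B : VF m M) : SmoothFun m M :=
  ⟨fun x => inner ℝ (A x) (B x), A.contMDiff.inner_bundle B.contMDiff⟩

theorem innerFun_self_nonneg (A : VF m M) (x : M) : 0 ≤ innerFun A A x :=
  real_inner_self_nonneg (F := TangentSpace (𝓡 m) x)

theorem innerFun_comm (A B : VF m M) (x : M) : innerFun A B x = innerFun B A x :=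
  real_inner_comm (F := TangentSpace (𝓡 m) x) _ _

theorem innerFun_add_left (A B C : VF m M) (x : M) :
    innerFun (A + B) C x = innerFun A C x + innerFun B C x :=
  inner_add_left (E := TangentSpace (𝓡 m) x) (𝕜 := ℝ) (A x) (B x) (C x)

theorem innerFun_smul_left (A B : VF m M) (r : ℝ) (x : M) :
    innerFun (r • A) B x = r * innerFun A B x :=
  real_inner_smul_left (F := TangentSpace (𝓡 m) x) (A x) (B x) r

/-! ## Gradient and Levi-Civita connection of `M` -/

/-- The Riemannian gradient `∇f`: the smooth vector field with `⟨∇f, X⟩ = X f` for all `X`. -/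
def grad (f : SmoothFun m M) : VF m M :=
  Classical.epsilon fun W : VF m M => ∀ X : VF m M, innerFun W X = dirD X f

/-- The Levi-Civita covariant derivative `∇_X Y` on `M`, given by the Koszul formula. -/
def nabla (X Y : VF m M) : VF m M :=
  Classical.epsilon fun W : VF m M => ∀ (Z : VF m M) (x : M),
    2 * inner ℝ (W x) (Z x) =
      dirD X (innerFun Y Z) x + dirD Y (innerFun Z X) x - dirD Z (innerFun X Y) x
        + inner ℝ (Z x) (VectorField.mlieBracket (𝓡 m) X Y x)
        - inner ℝ (Y x) (VectorField.mlieBracket (𝓡 m) X Z x)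
        - inner ℝ (X x) (VectorField.mlieBracket (𝓡 m) Y Z x)

/-- The vector field `(∇U)ᵀ · A`, where `(∇U)ᵀ` is the pointwise adjoint of `X ↦ ∇_X U`. -/
def adjNabla (U A : VF m M) : VF m M :=
  Classical.epsilon fun W : VF m M =>
    ∀ (X : VF m M) (x : M), inner ℝ (W x) (X x) = inner ℝ (A x) (nabla X U x)

/-! ## The normalized Riemannian volume -/

/-- The Gram matrix `(g_{ij})` of the metric in the chart around `p`, at the coordinate `y`. -/
def gram (p : M) (y : EuclideanSpace ℝ (Fin m)) : Matrix (Fin m) (Fin m) ℝ :=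
  let e := extChartAt (𝓡 m) p
  let del : Fin m → TangentSpace (𝓡 m) (e.symm y) := fun i =>
    mfderiv 𝓘(ℝ, EuclideanSpace ℝ (Fin m)) (𝓡 m) e.symm y (EuclideanSpace.single i (1 : ℝ))
  Matrix.of fun i j => inner ℝ (del i) (del j)

variable [MeasurableSpace M] [BorelSpace M]

/-- The Riemannian volume of the domain of the chart around `p`: in coordinates,
`√(det g_{ij})` times Lebesgue measure. -/
def chartVol (p : M) : Measure M :=
  (((volume.restrict (extChartAt (𝓡 m) p).target).withDensity
    fun y => ENNReal.ofReal (Real.sqrt (gram p y).det))).map (extChartAt (𝓡 m) p).symm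

/-- The Riemannian volume measure. The measures `chartVol p` agree on the overlaps of the charts,
so that their supremum is the measure obtained by glueing them. -/
def riemVol (m : ℕ) (M : Type*) [MetricSpace M] [ChartedSpace (EuclideanSpace ℝ (Fin m)) M]
    [IsManifold (𝓡 m) ∞ M] [RiemannianBundle (fun x : M => TangentSpace (𝓡 m) x)]
    [MeasurableSpace M] [BorelSpace M] : Measure M :=
  ⨆ p : M, chartVol (m := m) p

/-- The volume measure `vol`, renormalized to have total mass one. -/
def vol (m : ℕ) (M : Type*) [MetricSpace M] [ChartedSpace (EuclideanSpace ℝ (Fin m)) M]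
    [IsManifold (𝓡 m) ∞ M] [RiemannianBundle (fun x : M => TangentSpace (𝓡 m) x)]
    [MeasurableSpace M] [BorelSpace M] : Measure M :=
  (riemVol m M univ)⁻¹ • riemVol m M

instance isFiniteMeasure_vol : IsFiniteMeasure (vol m M) := by
  refine ⟨?_⟩
  rw [vol, Measure.smul_apply, smul_eq_mul]
  exact lt_of_le_of_lt (ENNReal.inv_mul_le_one _) ENNReal.one_lt_top

/-- The projection `p(φ) = φ_♯ vol`. -/
def pushVol (φ : DiffM m M) : Measure M := (vol m M).map φ

instance isFiniteMeasure_pushVol (φ : DiffM m M) : IsFiniteMeasure (pushVol φ) :=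
  Measure.isFiniteMeasure_map _ _

/-! ## The smooth Wasserstein space -/

/-- The quadratic Wasserstein distance. -/
def W2 (μ ν : Measure M) : ℝ :=
  Real.sqrt (sInf {c : ℝ | ∃ γ : Measure (M × M),
    γ.map Prod.fst = μ ∧ γ.map Prod.snd = ν ∧ c = ∫ q, dist q.1 q.2 ^ 2 ∂γ})

/-- The smooth Wasserstein space `𝒫_∞`: probability measures with a smooth positive density. -/
def PInf (m : ℕ) (M : Type*) [MetricSpace M] [ChartedSpace (EuclideanSpace ℝ (Fin m)) M]
    [IsManifold (𝓡 m) ∞ M] [RiemannianBundle (fun x : M => TangentSpace (𝓡 m) x)]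
    [MeasurableSpace M] [BorelSpace M] : Type _ :=
  {μ : Measure M // IsProbabilityMeasure μ ∧ ∃ ρ : SmoothFun m M, (∀ x, 0 < ρ x) ∧
    μ = (vol m M).withDensity fun x => ENNReal.ofReal (ρ x)}

/-- `𝒫_∞` carries the topology of the Wasserstein distance. -/
instance : TopologicalSpace (PInf m M) :=
  TopologicalSpace.generateFrom
    {B | ∃ (μ : PInf m M) (ε : ℝ), B = {ν : PInf m M | W2 μ.1 ν.1 < ε}}

/-! Functionals on `𝒫_∞` and maps `M × 𝒫_∞ → ℝ` are written as functions of a measure; only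
their values on `𝒫_∞` play a role, since flows of smooth vector fields preserve `𝒫_∞`. -/

/-- `ℓ` is the Lie derivative of `F` at `μ` in the direction `V_ψ = ∇ψ`: the derivative at `t = 0`
of `F((U_t)_♯ μ)`, where `U` is the flow of `∇ψ`. -/
def HasLieDerivP (F : Measure M → ℝ) (μ : Measure M) (ψ : SmoothFun m M) (ℓ : ℝ) : Prop :=
  ∃ U : ℝ → M → M, U 0 = id ∧
    (∀ x, IsMIntegralCurve (I := 𝓡 m) (fun t => U t x) (fun y => grad ψ y)) ∧
    HasDerivAt (fun t => F (μ.map (U t))) ℓ 0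

/-- The class `C^{∞,0}(M × 𝒫_∞)`: all derivatives in `x` are jointly continuous. -/
def IsCInf0 (ζ : Measure M → SmoothFun m M) : Prop :=
  ∀ l : List (VF m M), Continuous fun q : M × PInf m M => iterD l (ζ q.2.1) q.1

/-- The class `C¹_w(𝒫_∞)`: the functional is differentiable at every point, its derivatives along
the vector fields `μ ↦ ∇ζ(μ)` with `ζ ∈ C^{∞,0}` are continuous, and the norm of its gradient
(the best constant `C` below) is bounded on `𝒫_∞`. -/
structure IsC1w (m : ℕ) {M : Type*} [MetricSpace M] [ChartedSpace (EuclideanSpace ℝ (Fin m)) M]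
    [IsManifold (𝓡 m) ∞ M] [RiemannianBundle (fun x : M => TangentSpace (𝓡 m) x)]
    [IsContMDiffRiemannianBundle (𝓡 m) ∞ (EuclideanSpace ℝ (Fin m))
      (fun x : M => TangentSpace (𝓡 m) x)]
    [MeasurableSpace M] [BorelSpace M] (F : Measure M → ℝ) : Prop where
  differentiable : ∃ C : ℝ, ∀ μ : PInf m M, ∃ L : SmoothFun m M →ₗ[ℝ] ℝ,
    ∀ ψ : SmoothFun m M, HasLieDerivP F μ.1 ψ (L ψ) ∧
      |L ψ| ≤ C * Real.sqrt (∫ x, innerFun (grad ψ) (grad ψ) x ∂μ.1)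
  continuous_deriv : ∀ ζ : Measure M → SmoothFun m M, IsCInf0 ζ →
    ∃ D : PInf m M → ℝ, Continuous D ∧ ∀ μ : PInf m M, HasLieDerivP F μ.1 (ζ μ.1) (D μ)

/-- The class `C_w^{∞,1}(M × 𝒫_∞)`. -/
structure IsCwInf1 (ϕ : Measure M → SmoothFun m M) : Prop where
  cInf0 : IsCInf0 ϕ
  c1w : ∀ (l : List (VF m M)) (x : M), IsC1w m fun μ => iterD l (ϕ μ) x
  lie_cInf0 : ∀ ζ : Measure M → SmoothFun m M, IsCInf0 ζ →
    ∃ Lϕ : Measure M → SmoothFun m M, IsCInf0 Lϕ ∧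
      ∀ (μ : PInf m M) (l : List (VF m M)) (x : M),
        HasLieDerivP (fun ν => iterD l (ϕ ν) x) μ.1 (ζ μ.1) (iterD l (Lϕ μ.1) x)

/-- The function `x ↦ (ℒ_{V_ψ} ϕ)(x, μ)`. -/
def lieP (ϕ : Measure M → SmoothFun m M) (μ : Measure M) (ψ : SmoothFun m M) : SmoothFun m M :=
  Classical.epsilon fun g : SmoothFun m M => ∀ x, HasLieDerivP (fun ν => ϕ ν x) μ ψ (g x)

/-! ## `L²` spaces of vector fields along a diffeomorphism -/

variable [CompactSpace M]

/-- The space `{A ∘ φ : A ∈ Γ(M)}` with the inner product `∫ ⟨A(φ(x)), B(φ(x))⟩ dν(x)`; the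
element `A ∘ φ` is represented by `A`. -/
def PreL2 (_ν : Measure M) (_φ : DiffM m M) : Type _ := VF m M

section PreL2

variable (ν : Measure M) [IsFiniteMeasure ν] (φ : DiffM m M)

instance : AddCommGroup (PreL2 ν φ) := inferInstanceAs (AddCommGroup (VF m M))

instance : Module ℝ (PreL2 ν φ) := inferInstanceAs (Module ℝ (VF m M))


/-- `⟨A ∘ φ, B ∘ φ⟩ = ∫ ⟨A(φ(x)), B(φ(x))⟩ dν(x)`. -/
def PreL2.ip (A B : VF m M) : ℝ := ∫ x, innerFun A B (φ x) ∂ν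

theorem PreL2.integrable (A B : VF m M) : Integrable (fun x => innerFun A B (φ x)) ν :=
  ((innerFun A B).contMDiff.continuous.comp φ.continuous).integrable_of_hasCompactSupport
    (HasCompactSupport.of_compactSpace _)

instance PreL2.core : PreInnerProductSpace.Core ℝ (PreL2 ν φ) where
  inner A B := PreL2.ip ν φ A B
  conj_inner_symm A B := integral_congr_ae (ae_of_all _ fun x => innerFun_comm B A (φ x))
  re_inner_nonneg A := integral_nonneg fun x => innerFun_self_nonneg A (φ x)
  add_left A B C :=
    (integral_congr_ae (ae_of_all _ fun x => innerFun_add_left A B C (φ x))).trans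
      (integral_add (PreL2.integrable ν φ A C) (PreL2.integrable ν φ B C))
  smul_left A B r :=
    (integral_congr_ae (ae_of_all _ fun x => innerFun_smul_left A B r (φ x))).trans
      (integral_const_mul r _)

instance : SeminormedAddCommGroup (PreL2 ν φ) :=
  InnerProductSpace.Core.toSeminormedAddCommGroup (𝕜 := ℝ)

instance : InnerProductSpace ℝ (PreL2 ν φ) := InnerProductSpace.ofCore (PreL2.core ν φ)

/-- The `L²(ν)`-completion of `{A ∘ φ : A ∈ Γ(M)}`. -/
abbrev L2 : Type _ := UniformSpace.Completion (PreL2 ν φ)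

/-- The class of `A ∘ φ` in the completion. -/
def toL2 : VF m M → L2 ν φ := fun A =>
  UniformSpace.Completion.toComplₗᵢ (𝕜 := ℝ) (E := PreL2 ν φ) A

end PreL2

/-! ## Tangent spaces of `𝒫_∞`, connection on `𝒫_∞` -/

section Wasserstein

variable (μ : Measure M) [IsFiniteMeasure μ]

/-- `L²(M, TM, μ)`, the completion of `Γ(M)` for `∫ ⟨A, B⟩ dμ`. -/
abbrev L2P : Type _ := L2 μ (Diffeomorph.refl (𝓡 m) M ∞)

/-- The tangent space `T̄_μ 𝒫`: the closure in `L²(μ)` of the gradients of smooth functions. -/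
def TbarP : Submodule ℝ (L2P (m := m) μ) :=
  (Submodule.span ℝ (range fun ψ : SmoothFun m M => toL2 μ (Diffeomorph.refl (𝓡 m) M ∞) (grad ψ))
    ).topologicalClosure

/-- The vector `V_ψ = ∇ψ ∈ T̄_μ 𝒫`. -/
def gradP (ψ : SmoothFun m M) : TbarP (m := m) μ :=
  ⟨toL2 μ (Diffeomorph.refl (𝓡 m) M ∞) (grad ψ),
    Submodule.le_topologicalClosure _ (Submodule.subset_span ⟨ψ, rfl⟩)⟩

instance : CompleteSpace (TbarP (m := m) μ) :=
  inferInstanceAs (CompleteSpace (Submodule.topologicalClosure _))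

/-- The Levi-Civita connection of `𝒫_∞`: for `Z̄ = ∇ϕ(·)` and `v = ∇ψ ∈ T_μ 𝒫`,
`∇̄_v Z̄(μ) = Π_μ(∇_v ∇ϕ(μ)) + ∇ ℒ_v ϕ(μ)` with `Π_μ` the orthogonal projection onto `T̄_μ 𝒫`. -/
def nablaP (ϕ : Measure M → SmoothFun m M) (ψ : SmoothFun m M) : TbarP (m := m) μ :=
  (TbarP (m := m) μ).orthogonalProjectionOnto
      (toL2 μ (Diffeomorph.refl (𝓡 m) M ∞) (nabla (grad ψ) (grad (ϕ μ))))
    + gradP μ (lieP ϕ μ ψ)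

end Wasserstein

/-! ## Tangent spaces of `𝒟` and the submersion `p : 𝒟 → 𝒫_∞` -/

section Submersion

variable (φ : DiffM m M)

/-- `T̄_φ 𝒟`, the completion of `T_φ 𝒟 = {A ∘ φ : A ∈ Γ(M)}` for the Riemannian metric
`⟨A ∘ φ, B ∘ φ⟩_φ = ∫ ⟨A(φ(x)), B(φ(x))⟩ dvol(x)`. -/
abbrev TbarD : Type _ := L2 (vol m M) φ

/-- The tangent vector `A ∘ φ`, as an element of `T̄_φ 𝒟`. -/
def toTD (A : VF m M) : TbarD φ := toL2 (vol m M) φ A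

/-- The Riemannian metric of `𝒟`, `⟨A ∘ φ, B ∘ φ⟩_φ`. -/
def metricD (A B : VF m M) : ℝ := PreL2.ip (vol m M) φ A B

/-- The differential of `p` at `φ` on `A ∘ φ`, in the sense of distributions:
the derivative at `t = 0` of `∫ f d p(φ_t) = ∫ f(φ_t(x)) dvol(x)` along `∂_t φ_t |_{t = 0} = A ∘ φ`
is `∫ (A f)(φ(x)) dvol(x)`. -/
def tangentP (A : VF m M) (f : SmoothFun m M) : ℝ := ∫ x, dirD A f (φ x) ∂(vol m M)

/-- The closure in `T̄_φ 𝒟` of the vertical space `𝒱_φ 𝒟 = ker T_φ p`. -/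
def VbarD : Submodule ℝ (TbarD φ) :=
  (Submodule.span ℝ (toTD φ '' {Y : VF m M | tangentP φ Y = 0})).topologicalClosure

instance : CompleteSpace (VbarD φ) :=
  inferInstanceAs (CompleteSpace (Submodule.topologicalClosure _))

/-- The normal tensor `𝒩_φ(U ∘ φ, A ∘ φ) = P_{𝒱_φ}(((∇U)ᵀ · A) ∘ φ)`. -/
def normalTensor (U A : VF m M) : VbarD φ :=
  (VbarD φ).orthogonalProjectionOnto (toTD φ (adjNabla U A))

/-- The map `A ↦ A ∘ φ`, from `Γ(M)` with the norm of `L²(p(φ))` to `T_φ 𝒟`. -/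
def compIsometry :
    PreL2 (pushVol φ) (Diffeomorph.refl (𝓡 m) M ∞) →ₗᵢ[ℝ] PreL2 (vol m M) φ where
  toFun A := A
  map_add' _ _ := rfl
  map_smul' _ _ := rfl
  norm_map' A := by
    refine congrArg Real.sqrt ?_
    exact (integral_map φ.continuous.measurable.aemeasurable
      (innerFun A A).contMDiff.continuous.aestronglyMeasurable).symm

/-- The horizontal lift `𝔥_φ : T̄_{p(φ)} 𝒫 → T̄_φ 𝒟`, the continuous linear map with
`𝔥_φ(V_ψ) = ∇ψ ∘ φ`. -/
def horizLift : TbarP (m := m) (pushVol φ) →L[ℝ] TbarD φ :=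
  (((UniformSpace.Completion.toComplL (𝕜 := ℝ)).comp (compIsometry φ).toContinuousLinearMap).extend
    (UniformSpace.Completion.toComplL (𝕜 := ℝ))).comp (TbarP (m := m) (pushVol φ)).subtypeL

theorem horizLift_gradP (ψ : SmoothFun m M) :
    horizLift φ (gradP (pushVol φ) ψ) = toTD φ (grad ψ) :=
  ContinuousLinearMap.extend_eq _ UniformSpace.Completion.denseRange_coe
    (UniformSpace.Completion.isUniformInducing_coe _) _

end Submersion

/-! ## Differential calculus on `𝒟` as an inverse limit of the Hilbert manifolds `𝒟^s` -/

section Sobolev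

/-- The function `f ∘ φ`. -/
def compDiff (f : SmoothFun m M) (φ : DiffM m M) : SmoothFun m M :=
  ⟨fun x => f (φ x), f.contMDiff.comp φ.contMDiff⟩

/-- `ι = (ι_1, …, ι_N) : M → ℝ^N` is an embedding of the compact manifold `M`:
an injective immersion. -/
def IsEmb {N : ℕ} (ι : Fin N → SmoothFun m M) : Prop :=
  (Function.Injective fun (x : M) (i : Fin N) => ι i x) ∧
    ∀ (x : M) (v : TangentSpace (𝓡 m) x), (∀ i, mvfderiv (𝓡 m) (ι i) x v = 0) → v = 0

/-- The class of a smooth function in `L²(vol)`. -/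
def toLpVol : SmoothFun m M →ₗ[ℝ] Lp ℝ 2 (vol m M) where
  toFun f := ContinuousMap.toLp 2 (vol m M) ℝ ⟨f, f.contMDiff.continuous⟩
  map_add' f g := (ContinuousMap.toLp 2 (vol m M) ℝ).map_add
    ⟨f, f.contMDiff.continuous⟩ ⟨g, g.contMDiff.continuous⟩
  map_smul' r f := (ContinuousMap.toLp 2 (vol m M) ℝ).map_smul r ⟨f, f.contMDiff.continuous⟩

/-- Multi-indices of length at most `s` in `{1, …, N}`. -/
abbrev MultiIdx (N s : ℕ) : Type := Σ k : Fin (s + 1), (Fin k → Fin N)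

/-- All derivatives of order at most `s` of a smooth function along the vector fields `∇ι_i`, which
span every tangent space, as elements of `L²(vol)`. -/
def sobolevJet {N : ℕ} (ι : Fin N → SmoothFun m M) (s : ℕ) :
    SmoothFun m M →ₗ[ℝ] (MultiIdx N s → Lp ℝ 2 (vol m M)) :=
  LinearMap.pi fun α => toLpVol.comp (iterD (List.ofFn fun i => grad (ι (α.2 i))))

/-- The Sobolev space `H^s(M)`, the completion of `C^∞(M)` for the norm of the derivatives of order
at most `s` in `L²`, realized as a closure. -/
abbrev Sobolev {N : ℕ} (ι : Fin N → SmoothFun m M) (s : ℕ) : Type _ :=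
  (LinearMap.range (sobolevJet ι s)).topologicalClosure

/-- The underlying `L²` function of an element of `H^s(M)`: the derivative of order `0`. -/
def Sobolev.toLp {N s : ℕ} {ι : Fin N → SmoothFun m M} (u : Sobolev ι s) : Lp ℝ 2 (vol m M) :=
  u.1 ⟨0, Fin.elim0⟩

/-- A smooth function as an element of `H^s(M)`. -/
def Sobolev.ofSmooth {N : ℕ} (ι : Fin N → SmoothFun m M) (s : ℕ) (f : SmoothFun m M) :
    Sobolev ι s :=
  ⟨sobolevJet ι s f, Submodule.le_topologicalClosure _ (LinearMap.mem_range_self _ f)⟩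

/-- The inclusion `φ ↦ ι ∘ φ` of `𝒟` into `H^s(M, ℝ^N)`. -/
def inclD {N : ℕ} (ι : Fin N → SmoothFun m M) (s : ℕ) (φ : DiffM m M) : Fin N → Sobolev ι s :=
  fun i => Sobolev.ofSmooth ι s (compDiff (ι i) φ)

/-- `u ∈ H^s(M, ℝ^N)` is the map `ι ∘ g`. -/
def Represents {N s : ℕ} (ι : Fin N → SmoothFun m M) (u : Fin N → Sobolev ι s) (g : M → M) : Prop :=
  ∀ i, ((u i).toLp : M → ℝ) =ᵐ[vol m M] fun x => ι i (g x)

/-- The space `𝒟^s`, `s > m / 2`, of the homeomorphisms of `M` which are in `H^s(M, M)` together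
with their inverse, as a subset of `H^s(M, ℝ^N)` through the embedding `ι`. -/
def DSob {N : ℕ} (ι : Fin N → SmoothFun m M) (s : ℕ) : Set (Fin N → Sobolev ι s) :=
  {u | ∃ g : M ≃ₜ M, Represents ι u g ∧ ∃ v : Fin N → Sobolev ι s, Represents ι v g.symm}

/-- `F : 𝒟 → ℝ` is of class `C^k`: for all `s > m / 2` there is `j ≥ s` such that `F` has a `C^k`
extension to `𝒟^j`. A function on the submanifold `𝒟^j` of `H^j(M, ℝ^N)` is `C^k` if and only if it
is the restriction of a `C^k` function on an open neighbourhood. -/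
def IsCkD (k : ℕ) (F : DiffM m M → ℝ) : Prop :=
  ∃ (N : ℕ) (ι : Fin N → SmoothFun m M), IsEmb ι ∧ ∀ s : ℕ, m < 2 * s → ∃ j : ℕ, s ≤ j ∧
    ∃ U : Set (Fin N → Sobolev ι j), IsOpen U ∧ DSob ι j ⊆ U ∧
      ∃ Ψ : (Fin N → Sobolev ι j) → ℝ, ContDiffOn ℝ k Ψ U ∧ ∀ φ, Ψ (inclD ι j φ) = F φ

/-- `G : M × 𝒟 → ℝ` is of class `C^{0,k}`: it has an extension to `M × 𝒟^j` as above with `k`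
derivatives in the second variable, which are jointly continuous. -/
def IsC0kD (k : ℕ) (G : M → DiffM m M → ℝ) : Prop :=
  ∃ (N : ℕ) (ι : Fin N → SmoothFun m M), IsEmb ι ∧ ∀ s : ℕ, m < 2 * s → ∃ j : ℕ, s ≤ j ∧
    ∃ U : Set (Fin N → Sobolev ι j), IsOpen U ∧ DSob ι j ⊆ U ∧
      ∃ Ψ : M → (Fin N → Sobolev ι j) → ℝ, (∀ x, ContDiffOn ℝ k (Ψ x) U) ∧
        (∀ i ≤ k, ContinuousOn
          (fun q : M × (Fin N → Sobolev ι j) => iteratedFDeriv ℝ i (Ψ q.1) q.2) (univ ×ˢ U)) ∧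
        ∀ x φ, Ψ x (inclD ι j φ) = G x φ

/-- `C^{∞,k}(M × 𝒟)`: all derivatives in `x ∈ M` are of class `C^{0,k}`. -/
def IsCInfkD (k : ℕ) (G : DiffM m M → SmoothFun m M) : Prop :=
  ∀ l : List (VF m M), IsC0kD k fun x φ => iterD l (G φ) x

/-- A vector field on `𝒟`, `φ ↦ A(φ) ∘ φ` with `A(φ) ∈ Γ(M)`, is written as the map
`φ ↦ A(φ)`. -/
abbrev VFD (m : ℕ) (M : Type*) [MetricSpace M] [ChartedSpace (EuclideanSpace ℝ (Fin m)) M]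
    [IsManifold (𝓡 m) ∞ M] := DiffM m M → VF m M

/-- The class `Γ^k(𝒟)` of vector fields on `𝒟`: the map `(x, φ) ↦ A(φ)(φ(x)) ∈ TM` is of class
`C^{∞,k}`. Regularity of a map into `TM` is tested with the functions `df`, `f ∈ C^∞(M)`, on
`TM`. -/
def IsGammaD (k : ℕ) (A : VFD m M) : Prop :=
  ∀ f : SmoothFun m M, IsCInfkD k fun φ => compDiff (dirD (A φ) f) φ

/-- `ℓ` is the Lie derivative of `F : 𝒟 → ℝ` at `φ` in the direction `A ∘ φ`: the derivative at
`t = 0` of `F(φ_t)` along the smooth paths with `φ_0 = φ` and `∂_t φ_t |_{t = 0} = A ∘ φ`. -/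
def HasLieDerivD (F : DiffM m M → ℝ) (φ : DiffM m M) (A : VF m M) (ℓ : ℝ) : Prop :=
  ∀ c : ℝ → DiffM m M,
    ContMDiff (𝓘(ℝ, ℝ).prod (𝓡 m)) (𝓡 m) ∞ (fun q : ℝ × M => c q.1 q.2) → c 0 = φ →
    (∀ (x : M) (f : SmoothFun m M), HasDerivAt (fun t => f (c t x)) (dirD A f (φ x)) 0) →
    HasDerivAt (fun t => F (c t)) ℓ 0

/-- `X ∘ φ` is the value at `φ` of the Lie bracket `[A, B]`: `X F = A B F - B A F` at `φ` for all
functionals `F` of class `C²`. -/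
def IsBracketD (A B : VFD m M) (φ : DiffM m M) (X : VF m M) : Prop :=
  ∀ F : DiffM m M → ℝ, IsCkD 2 F → ∃ (FA FB : DiffM m M → ℝ) (r₁ r₂ : ℝ),
    (∀ ψ, HasLieDerivD F ψ (A ψ) (FA ψ)) ∧ (∀ ψ, HasLieDerivD F ψ (B ψ) (FB ψ)) ∧
    HasLieDerivD FB φ (A φ) r₁ ∧ HasLieDerivD FA φ (B φ) r₂ ∧ HasLieDerivD F φ X (r₁ - r₂)

/-- `W ∘ φ` is the value at `φ` of the Levi-Civita derivative `∇_A B`: the Koszul formula holds at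
`φ` for all `C ∈ Γ¹(𝒟)`. -/
def IsLeviCivitaD (A B : VFD m M) (φ : DiffM m M) (W : VF m M) : Prop :=
  ∀ C : VFD m M, IsGammaD 1 C → ∃ (r₁ r₂ r₃ : ℝ) (AB AC BC : VF m M),
    HasLieDerivD (fun ψ => metricD ψ (B ψ) (C ψ)) φ (A φ) r₁ ∧
    HasLieDerivD (fun ψ => metricD ψ (C ψ) (A ψ)) φ (B φ) r₂ ∧
    HasLieDerivD (fun ψ => metricD ψ (A ψ) (B ψ)) φ (C φ) r₃ ∧
    IsBracketD A B φ AB ∧ IsBracketD A C φ AC ∧ IsBracketD B C φ BC ∧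
    2 * metricD φ W (C φ) =
      r₁ + r₂ - r₃ + metricD φ (C φ) AB - metricD φ (B φ) AC - metricD φ (A φ) BC

/-- The Levi-Civita derivative `∇_A B (φ) ∈ T_φ 𝒟`. -/
def nablaD (A B : VFD m M) (φ : DiffM m M) : VF m M :=
  Classical.epsilon fun W : VF m M => IsLeviCivitaD A B φ W

/-- The horizontal lift to `𝒟` of the vector field `Z̄ = ∇ϕ(·)` on `𝒫_∞`:
`Z(φ) = 𝔥_φ(Z̄(p(φ))) = ∇ϕ(p(φ)) ∘ φ`. -/
def liftD (ϕ : Measure M → SmoothFun m M) : VFD m M := fun φ => grad (ϕ (pushVol φ))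

/-- `Z̄ = ∇ϕ(·)` belongs to `Γ¹(𝒫_∞)`: `ϕ ∈ C_w^{∞,1}(M × 𝒫_∞)`, and the horizontal lift of `Z̄`
belongs to `Γ¹(𝒟)`. -/
def IsGamma1P (ϕ : Measure M → SmoothFun m M) : Prop :=
  IsCwInf1 ϕ ∧ IsGammaD 1 (liftD ϕ)

end Sobolev

end WassersteinDiff

end

open WassersteinDiff

/-! Write a field on `𝒟` as `φ ↦ B(φ) ∘ φ`. Along a path through `φ` with velocity `A ∘ φ`, the
function `(B(φ) f) ∘ φ` has derivative `(Ḃ f + A B f) ∘ φ`: a vector field `Ḃ` on `M` records the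
change of `B`, the second term the displacement of the base point (`HasPartialD`,
`IsGammaD.exists_hasPartialD`). Hence the metric obeys a product rule, the bracket of `A` and `B` is
`Ḃ - Ȧ` plus the bracket on `M` (`isBracketD_of_hasPartialD`), and in the Koszul formula of `𝒟` the
dotted terms cancel down to `2⟨Ḃ, C⟩`, the rest being the integrated Koszul formula of `M`. So the
Levi-Civita derivative on `𝒟` is `(∇_A B + Ḃ) ∘ φ`, with `∇` the connection of `M`
(`isLeviCivitaD_of_hasPartialD`). It is unique because the fields `φ ↦ C ∘ φ` with `C` fixed lie in
`Γ¹(𝒟)`, which is a Sobolev embedding (`isGammaD_const`, `IsLeviCivitaD.unique`).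

When `B` is the lift of `∇ϕ₁` and `A` that of `∇ϕ₂`, the field `Ḃ` is the gradient of the Lie
derivative of `ϕ₁` (`HasPartialD.eq_grad`), which is horizontal. There remains `∇_{∇ϕ₂} ∇ϕ₁`. Its
horizontal part is the lift of its projection `Π_μ`. Its vertical projection is the normal tensor,
because the Hessian of `ϕ₁` is symmetric (`adjNabla_grad`). Nothing else is left by the Helmholtz
decomposition (`toTD_eq_horizLift_add`): smooth gradients and smooth divergence-free fields together
span a dense subspace of `L²(μ)`.

The Helmholtz decomposition is obtained without elliptic theory. Let `w` be orthogonal to all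
gradients and `Y` a smooth field near `w`. The divergence of `Y` is small as a distribution, since
its pairing with `f` is `⟨∇f, Y - w⟩`. Mollifying in charts gives corrections of small `L²` norm
that replace this divergence by a smooth function `S` (`IsChartDensity.exists_smoothing`). Each
value of `S` is a pairing of `Y` with a gradient whose norm is bounded in terms of the mollification
scale; so the scale is fixed first and `Y` is then taken so close to `w` that `S` is uniformly
small. Finally a field with divergence `S`, and with `L²` norm bounded by the supremum of `S`, is
subtracted (`exists_hasDiv`). That field is made of integrals along rays in charts and of transport
of mass through overlapping charts, where connectedness enters. Thus `w` is a limit of smooth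
divergence-free fields (`exists_approx_vertical`).

The supporting facts are: flows of smooth fields are smooth, so that every tangent vector is the
velocity of a path and Lie derivatives are unique; `C^∞(M)` is closed under limits with all
derivatives; and `p(φ)` has a smooth positive density. -/

noncomputable section

set_option linter.unusedSectionVars false
set_option linter.overlappingInstances false

namespace WassersteinDiff

variable {m : ℕ} {M : Type*} [MetricSpace M] [ChartedSpace (EuclideanSpace ℝ (Fin m)) M]
  [IsManifold (𝓡 m) ∞ M]

/-- The topology of the tangent bundle. -/
abbrev tangentTopology : TopologicalSpace
    (TotalSpace (EuclideanSpace ℝ (Fin m)) (TangentSpace (𝓡 m) : M → Type _)) :=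
  inferInstance

attribute [local instance] tangentTopology

/-! ## Calculus of vector fields -/

theorem dirD_apply (X : VF m M) (f : SmoothFun m M) (x : M) :
    dirD X f x = mvfderiv (𝓡 m) f x (X x) := rfl

theorem dirD_mul (X : VF m M) (f g : SmoothFun m M) :
    dirD X (f * g) = f * dirD X g + g * dirD X f := by
  ext x
  have := congrArg (fun L => L (X x))
    (mvfderiv_mul (f.mdifferentiableAt (x := x)) (g.mdifferentiableAt (x := x)))
  exact this

theorem dirD_add_left (X Y : VF m M) (f : SmoothFun m M) :
    dirD (X + Y) f = dirD X f + dirD Y f := by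
  ext x
  exact map_add (mvfderiv (𝓡 m) f x) (X x) (Y x)

theorem dirD_sub_left (X Y : VF m M) (f : SmoothFun m M) :
    dirD (X - Y) f = dirD X f - dirD Y f := by
  ext x
  exact map_sub (mvfderiv (𝓡 m) f x) (X x) (Y x)

theorem dirD_smul_left (r : ℝ) (X : VF m M) (f : SmoothFun m M) :
    dirD (r • X) f = r • dirD X f := by
  ext x
  exact map_smul (mvfderiv (𝓡 m) f x) r (X x)

/-- Multiplication of a vector field by a function. -/
def mulVF (a : SmoothFun m M) (X : VF m M) : VF m M :=
  ⟨fun x => a x • X x, a.contMDiff.smul_section X.contMDiff⟩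

theorem mulVF_apply (a : SmoothFun m M) (X : VF m M) (x : M) : mulVF a X x = a x • X x := rfl

theorem dirD_mulVF (a : SmoothFun m M) (X : VF m M) (f : SmoothFun m M) :
    dirD (mulVF a X) f = a * dirD X f := by
  ext x
  exact map_smul (mvfderiv (𝓡 m) f x) (a x) (X x)

theorem VF.sum_apply {ι : Type*} (s : Finset ι) (X : ι → VF m M) (x : M) :
    (∑ i ∈ s, X i) x = ∑ i ∈ s, X i x := by
  have := congrFun (map_sum (ContMDiffSection.coeAddHom (𝓡 m) (EuclideanSpace ℝ (Fin m)) ∞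
    (TangentSpace (𝓡 m) : M → Type _)) X s) x
  rw [Finset.sum_apply] at this
  exact this

theorem dirD_sum_left {ι : Type*} (s : Finset ι) (X : ι → VF m M) (f : SmoothFun m M) :
    dirD (∑ i ∈ s, X i) f = ∑ i ∈ s, dirD (X i) f := by
  classical
  induction s using Finset.induction_on with
  | empty =>
    ext x
    exact map_zero (mvfderiv (𝓡 m) f x)
  | insert a s ha h => rw [Finset.sum_insert ha, Finset.sum_insert ha, dirD_add_left, h]

theorem smoothFun_sum_apply {ι : Type*} (s : Finset ι) (f : ι → SmoothFun m M) (x : M) :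
    (∑ i ∈ s, f i) x = ∑ i ∈ s, f i x := by
  have := congrFun (map_sum (ContMDiffMap.coeFnAddMonoidHom (I := 𝓡 m) (N := M) (I' := 𝓘(ℝ, ℝ))
    (G := ℝ) (n := ∞)) f s) x
  simpa using this

/-! ### Charts -/

theorem contDiffOn_comp_extChartAt_symm (p : M) (f : SmoothFun m M) :
    ContDiffOn ℝ ∞ (f ∘ (extChartAt (𝓡 m) p).symm) (extChartAt (𝓡 m) p).target :=
  (f.contMDiff.comp_contMDiffOn (contMDiffOn_extChartAt_symm p)).contDiffOn

theorem extChartAt_target_mem_nhds_of_mem {p : M} {y : EuclideanSpace ℝ (Fin m)}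
    (hy : y ∈ (extChartAt (𝓡 m) p).target) : (extChartAt (𝓡 m) p).target ∈ 𝓝 y :=
  (isOpen_extChartAt_target p).mem_nhds hy

theorem mdifferentiableAt_extChartAt_symm {p : M} {y : EuclideanSpace ℝ (Fin m)}
    (hy : y ∈ (extChartAt (𝓡 m) p).target) :
    MDifferentiableAt 𝓘(ℝ, EuclideanSpace ℝ (Fin m)) (𝓡 m) (extChartAt (𝓡 m) p).symm y :=
  ((contMDiffOn_extChartAt_symm (n := ∞) p).contMDiffAt
    (extChartAt_target_mem_nhds_of_mem hy)).mdifferentiableAt (by simp)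

theorem mvfderiv_chart (p : M) (f : SmoothFun m M) {y : EuclideanSpace ℝ (Fin m)}
    (hy : y ∈ (extChartAt (𝓡 m) p).target) (v : EuclideanSpace ℝ (Fin m)) :
    fderiv ℝ (f ∘ (extChartAt (𝓡 m) p).symm) y v =
      mvfderiv (𝓡 m) f ((extChartAt (𝓡 m) p).symm y)
        (mfderiv 𝓘(ℝ, EuclideanSpace ℝ (Fin m)) (𝓡 m) (extChartAt (𝓡 m) p).symm y v) := by
  have h := mvfderiv_comp (I := 𝓘(ℝ, EuclideanSpace ℝ (Fin m))) (I' := 𝓡 m)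
    (g := f) (f := (extChartAt (𝓡 m) p).symm) y
    (f.mdifferentiableAt) (mdifferentiableAt_extChartAt_symm hy)
  have h2 := congrArg (fun L => L v) h
  refine Eq.trans ?_ h2
  rw [mvfderiv]
  simp [mfderiv_eq_fderiv]
  rfl


/-- A smooth function with compact support in the target of a chart, transplanted to `M`. -/
theorem exists_chartFun (p : M) {g : EuclideanSpace ℝ (Fin m) → ℝ} (hg : ContDiff ℝ ∞ g)
    (hc : HasCompactSupport g) (hs : tsupport g ⊆ (extChartAt (𝓡 m) p).target) :
    ∃ f : SmoothFun m M, (∀ x ∈ (extChartAt (𝓡 m) p).source, f x = g (extChartAt (𝓡 m) p x)) ∧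
      ∀ x ∉ (extChartAt (𝓡 m) p).symm '' tsupport g, f x = 0 := by
  classical
  set e := extChartAt (𝓡 m) p
  have hK : IsClosed (e.symm '' tsupport g) :=
    (hc.isCompact.image_of_continuousOn
      ((continuousOn_extChartAt_symm p).mono hs)).isClosed
  have hKs : e.symm '' tsupport g ⊆ e.source := by
    rintro _ ⟨y, hy, rfl⟩
    exact e.map_target (hs hy)
  let F : M → ℝ := fun x => if x ∈ e.source then g (e x) else 0
  have h0 : ∀ x ∉ e.symm '' tsupport g, F x = 0 := by
    intro x hx
    by_cases h : x ∈ e.source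
    · simp only [F, h, if_true]
      by_contra hne
      exact hx ⟨e x, subset_tsupport _ hne, e.left_inv h⟩
    · simp [F, h]
  -- On the chart domain `F` is a smooth function of the coordinates. A point outside has a
  -- neighbourhood missing the image of the support, which is compact and hence closed; there `F`
  -- vanishes.
  have hF : ContMDiff (𝓡 m) 𝓘(ℝ, ℝ) ∞ F := by
    intro x
    by_cases h : x ∈ e.source
    · have : F =ᶠ[𝓝 x] g ∘ e := by
        filter_upwards [(isOpen_extChartAt_source p).mem_nhds h] with z hz
        simp only [F, Function.comp]
        exact if_pos hz
      refine ContMDiffAt.congr_of_eventuallyEq ?_ this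
      exact hg.contMDiff.contMDiffAt.comp x
        ((contMDiffOn_extChartAt (n := ∞)).contMDiffAt ((isOpen_extChartAt_source p).mem_nhds h |>
          fun h => by rwa [extChartAt_source] at h))
    · have : F =ᶠ[𝓝 x] fun _ => 0 := by
        filter_upwards [hK.isOpen_compl.mem_nhds fun hx => h (hKs hx)] with z hz
        exact h0 z hz
      exact contMDiffAt_const.congr_of_eventuallyEq this
  exact ⟨⟨F, hF⟩, fun x hx => if_pos hx, h0⟩

theorem isInvertible_mfderiv_extChartAt_symm {p : M} {y : EuclideanSpace ℝ (Fin m)}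
    (hy : y ∈ (extChartAt (𝓡 m) p).target) :
    (mfderiv 𝓘(ℝ, EuclideanSpace ℝ (Fin m)) (𝓡 m) (extChartAt (𝓡 m) p).symm y).IsInvertible := by
  have := isInvertible_mfderivWithin_extChartAt_symm (I := 𝓡 m) hy
  simpa using this

theorem mfderiv_extChartAt_symm_comp {p x : M} (hx : x ∈ (extChartAt (𝓡 m) p).source)
    (v : TangentSpace (𝓡 m) x) :
    mfderiv 𝓘(ℝ, EuclideanSpace ℝ (Fin m)) (𝓡 m) (extChartAt (𝓡 m) p).symm
      (extChartAt (𝓡 m) p x) (mfderiv (𝓡 m) 𝓘(ℝ, EuclideanSpace ℝ (Fin m))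
        (extChartAt (𝓡 m) p) x v) = v := by
  have := mfderivWithin_extChartAt_symm_comp_mfderiv_extChartAt' (I := 𝓡 m) hx
  simp only [ModelWithCorners.Boundaryless.range_eq_univ, mfderivWithin_univ] at this
  exact congrArg (fun L => L v) this

theorem mfderiv_extChartAt_comp_symm {p : M} {y : EuclideanSpace ℝ (Fin m)}
    (hy : y ∈ (extChartAt (𝓡 m) p).target) (v : EuclideanSpace ℝ (Fin m)) :
    mfderiv (𝓡 m) 𝓘(ℝ, EuclideanSpace ℝ (Fin m)) (extChartAt (𝓡 m) p)
      ((extChartAt (𝓡 m) p).symm y) (mfderiv 𝓘(ℝ, EuclideanSpace ℝ (Fin m)) (𝓡 m)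
        (extChartAt (𝓡 m) p).symm y v) = v := by
  have := mfderiv_extChartAt_comp_mfderivWithin_extChartAt_symm (I := 𝓡 m) hy
  simp only [ModelWithCorners.Boundaryless.range_eq_univ, mfderivWithin_univ] at this
  exact congrArg (fun L => L v) this

/-- The vector field with constant coordinates in a chart is smooth. -/
theorem contMDiffAt_chartField (p : M) {V : EuclideanSpace ℝ (Fin m) → EuclideanSpace ℝ (Fin m)}
    (hV : ContDiff ℝ ∞ V) {x : M} (hx : x ∈ (extChartAt (𝓡 m) p).source) :
    ContMDiffAt (𝓡 m) (𝓡 m).tangent ∞ (fun x => (⟨x, VectorField.mpullback (𝓡 m)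
      𝓘(ℝ, EuclideanSpace ℝ (Fin m)) (extChartAt (𝓡 m) p) V x⟩ : TangentBundle (𝓡 m) M)) x := by
  refine ContMDiffAt.mpullback_vectorField_preimage (n := ∞) ?_ ?_
    (isInvertible_mfderiv_extChartAt hx) (by simp)
  · exact (contMDiffAt_vectorSpace_iff_contDiffAt).2 hV.contDiffAt
  · exact contMDiffAt_extChartAt' (by rwa [extChartAt_source] at hx)

theorem mpullback_extChartAt {p x : M} (V : EuclideanSpace ℝ (Fin m) → EuclideanSpace ℝ (Fin m))
    (hx : x ∈ (extChartAt (𝓡 m) p).source) :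
    VectorField.mpullback (𝓡 m) 𝓘(ℝ, EuclideanSpace ℝ (Fin m)) (extChartAt (𝓡 m) p) V x =
      mfderiv 𝓘(ℝ, EuclideanSpace ℝ (Fin m)) (𝓡 m) (extChartAt (𝓡 m) p).symm
        (extChartAt (𝓡 m) p x) (V (extChartAt (𝓡 m) p x)) := by
  have h := isInvertible_mfderiv_extChartAt (I := 𝓡 m) hx
  have h2 := mfderiv_extChartAt_comp_symm (p := p) ((extChartAt (𝓡 m) p).map_source hx)
    (V (extChartAt (𝓡 m) p x))
  rw [(extChartAt (𝓡 m) p).left_inv hx] at h2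
  exact h.inverse_apply_eq.2 h2.symm

/-- A smooth vector field with compact support in the target of a chart, transplanted to `M`. -/
theorem exists_chartVF (p : M) {V : EuclideanSpace ℝ (Fin m) → EuclideanSpace ℝ (Fin m)}
    (hV : ContDiff ℝ ∞ V) (hc : HasCompactSupport V)
    (hs : tsupport V ⊆ (extChartAt (𝓡 m) p).target) :
    ∃ X : VF m M, (∀ x ∈ (extChartAt (𝓡 m) p).source,
      X x = mfderiv 𝓘(ℝ, EuclideanSpace ℝ (Fin m)) (𝓡 m) (extChartAt (𝓡 m) p).symm
        (extChartAt (𝓡 m) p x) (V (extChartAt (𝓡 m) p x))) ∧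
      ∀ x ∉ (extChartAt (𝓡 m) p).symm '' tsupport V, X x = 0 := by
  classical
  set e := extChartAt (𝓡 m) p
  have hK : IsClosed (e.symm '' tsupport V) :=
    (hc.isCompact.image_of_continuousOn
      ((continuousOn_extChartAt_symm p).mono hs)).isClosed
  have hKs : e.symm '' tsupport V ⊆ e.source := by
    rintro _ ⟨y, hy, rfl⟩
    exact e.map_target (hs hy)
  let F : ∀ x : M, TangentSpace (𝓡 m) x := fun x => if x ∈ e.source then VectorField.mpullback (𝓡 m)
      𝓘(ℝ, EuclideanSpace ℝ (Fin m)) (extChartAt (𝓡 m) p) V x else 0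
  have hF1 : ∀ x ∈ e.source, F x = mfderiv 𝓘(ℝ, EuclideanSpace ℝ (Fin m)) (𝓡 m) e.symm
        (e x) (V (e x)) := fun x hx => (if_pos hx).trans (mpullback_extChartAt V hx)
  have h0 : ∀ x ∉ e.symm '' tsupport V, F x = 0 := by
    intro x hx
    by_cases h : x ∈ e.source
    · rw [hF1 x h]
      have : V (e x) = 0 := by
        by_contra hne
        exact hx ⟨e x, subset_tsupport _ hne, e.left_inv h⟩
      rw [this]
      exact map_zero _
    · simp [F, h]
  refine ⟨⟨F, fun x => ?_⟩, hF1, h0⟩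
  by_cases h : x ∈ e.source
  · refine (contMDiffAt_chartField p hV h).congr_of_eventuallyEq ?_
    filter_upwards [(isOpen_extChartAt_source p).mem_nhds h] with z hz
    exact congrArg (TotalSpace.mk z) (if_pos hz)
  · have hz : ContMDiffAt (𝓡 m) (𝓡 m).tangent ∞
      (fun x => (⟨x, 0⟩ : TangentBundle (𝓡 m) M)) x :=
        (0 : VF m M).contMDiff.contMDiffAt
    refine hz.congr_of_eventuallyEq ?_
    filter_upwards [hK.isOpen_compl.mem_nhds fun hx => h (hKs hx)] with z hz
    exact congrArg (TotalSpace.mk z) (h0 z hz)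

/-- The coordinates of a vector field in a chart. -/
def coordVF (p : M) (X : VF m M) (y : EuclideanSpace ℝ (Fin m)) : EuclideanSpace ℝ (Fin m) :=
  VectorField.mpullback 𝓘(ℝ, EuclideanSpace ℝ (Fin m)) (𝓡 m) (extChartAt (𝓡 m) p).symm X y

theorem contDiffOn_coordVF (p : M) (X : VF m M) :
    ContDiffOn ℝ ∞ (coordVF p X) (extChartAt (𝓡 m) p).target := by
  intro y hy
  refine ContDiffAt.contDiffWithinAt ?_
  have h1 := ((contMDiffOn_extChartAt_symm (I := 𝓡 m) (n := ∞) p).contMDiffAt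
    (extChartAt_target_mem_nhds_of_mem hy))
  exact contMDiffAt_vectorSpace_iff_contDiffAt.1 <|
    ContMDiffAt.mpullback_vectorField_preimage (n := ∞) (m := ∞) X.contMDiff.contMDiffAt h1
    (isInvertible_mfderiv_extChartAt_symm hy) (by simp)

theorem mfderiv_symm_coordVF {p : M} (X : VF m M) {y : EuclideanSpace ℝ (Fin m)}
    (hy : y ∈ (extChartAt (𝓡 m) p).target) :
    mfderiv 𝓘(ℝ, EuclideanSpace ℝ (Fin m)) (𝓡 m) (extChartAt (𝓡 m) p).symm y (coordVF p X y) =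
      X ((extChartAt (𝓡 m) p).symm y) := by
  have h := isInvertible_mfderiv_extChartAt_symm hy
  exact (h.inverse_apply_eq.1 rfl).symm

theorem dirD_chart {p : M} (X : VF m M) (f : SmoothFun m M) {y : EuclideanSpace ℝ (Fin m)}
    (hy : y ∈ (extChartAt (𝓡 m) p).target) :
    dirD X f ((extChartAt (𝓡 m) p).symm y) =
      fderiv ℝ (f ∘ (extChartAt (𝓡 m) p).symm) y (coordVF p X y) := by
  rw [mvfderiv_chart p f hy, mfderiv_symm_coordVF X hy]
  rfl

theorem two_le_infty : (2 : WithTop ℕ∞) ≤ ∞ := by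
  have : ((2 : ℕ∞) : WithTop ℕ∞) ≤ ((⊤ : ℕ∞) : WithTop ℕ∞) := WithTop.coe_le_coe.2 le_top
  exact this

/-! ### Cutoff functions and partitions of unity -/

theorem exists_cutoff {V : Type*} [NormedAddCommGroup V] [NormedSpace ℝ V] [FiniteDimensional ℝ V]
    {K U : Set V} (hK : IsCompact K) (hU : IsOpen U) (h : K ⊆ U) :
    ∃ g : V → ℝ, ContDiff ℝ ∞ g ∧ HasCompactSupport g ∧ tsupport g ⊆ U ∧
      (∀ᶠ y in 𝓝ˢ K, g y = 1) ∧ ∀ y, g y ∈ Icc (0 : ℝ) 1 := by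
  obtain ⟨L, hL, hKL, hLU⟩ := exists_compact_between hK hU h
  obtain ⟨f, h1, h0, h01⟩ := exists_contMDiffMap_one_nhds_of_subset_interior (n := ⊤) 𝓘(ℝ, V)
    hK.isClosed hKL
  have hs : Function.support f ⊆ L := by
    intro x hx
    by_contra hxL
    exact hx (h0 x hxL)
  have ht : tsupport f ⊆ L := closure_minimal hs hL.isClosed
  exact ⟨f, f.contMDiff.contDiff, HasCompactSupport.of_support_subset_isCompact hL hs,
    ht.trans hLU, h1, h01⟩

theorem exists_cutoff_manifold [CompactSpace M] {K U : Set M} (hK : IsClosed K) (hU : IsOpen U)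
    (h : K ⊆ U) :
    ∃ g : SmoothFun m M, tsupport g ⊆ U ∧ (∀ᶠ y in 𝓝ˢ K, g y = 1) ∧ ∀ y, g y ∈ Icc (0 : ℝ) 1 := by
  obtain ⟨L, hL, hKL, hLU⟩ := exists_compact_between hK.isCompact hU h
  obtain ⟨f, h1, h0, h01⟩ := exists_contMDiffMap_one_nhds_of_subset_interior (n := ⊤) (𝓡 m)
    hK hKL
  have hs : Function.support f ⊆ L := by
    intro x hx
    by_contra hxL
    exact hx (h0 x hxL)
  exact ⟨f, (closure_minimal hs hL.isClosed).trans hLU, h1, h01⟩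

/-- Finite smooth partitions of unity. -/
theorem exists_partition [CompactSpace M] (N : M → Set M) (hN : ∀ p, N p ∈ 𝓝 p) :
    ∃ (s : Finset M) (ρ : M → SmoothFun m M), (∑ p ∈ s, ρ p = 1) ∧
      (∀ p ∈ s, tsupport (ρ p) ⊆ N p) ∧ ∀ p x, 0 ≤ ρ p x := by
  classical
  obtain ⟨s, hs⟩ := isCompact_univ.elim_nhds_subcover' (fun p (_ : p ∈ (univ : Set M)) =>
    interior (N p)) (fun p _ => interior_mem_nhds.2 (hN p))
  obtain ⟨f, hf⟩ := SmoothPartitionOfUnity.exists_isSubordinate (𝓡 m) (isClosed_univ (X := M))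
    (fun p : s => interior (N p.1)) (fun p => isOpen_interior) (by
      intro x hx
      obtain ⟨i, hi, hx⟩ := mem_iUnion₂.1 (hs (mem_univ x))
      exact mem_iUnion.2 ⟨⟨i, hi⟩, hx⟩)
  let t : Finset M := s.image Subtype.val
  have ht : ∀ p ∈ t, ∃ q : s, q.1.1 = p := by
    intro p hp
    obtain ⟨q, hq, rfl⟩ := Finset.mem_image.1 hp
    exact ⟨⟨q, hq⟩, rfl⟩
  -- The partition is indexed by the subcover; extending it by zero to all points of `M` lets later
  -- sums run over a `Finset M`.
  let ρ : M → SmoothFun m M := fun p => if h : ∃ q : s, q.1.1 = p then f h.choose else 0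
  have hρ : ∀ q : s, ρ q.1.1 = f q := by
    intro q
    have h : ∃ q' : s, q'.1.1 = q.1.1 := ⟨q, rfl⟩
    have h2 : h.choose = q := Subtype.ext (Subtype.ext h.choose_spec)
    simp only [ρ, dif_pos h, h2]
  refine ⟨t, ρ, ?_, ?_, ?_⟩
  · ext x
    have h1 := f.sum_eq_one (mem_univ x)
    rw [finsum_eq_sum_of_fintype] at h1
    rw [smoothFun_sum_apply, Finset.sum_image (fun a _ b _ h => Subtype.ext h)]
    rw [← Finset.sum_coe_sort]
    simp only [hρ]
    exact h1
  · intro p hp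
    obtain ⟨q, rfl⟩ := ht p hp
    rw [hρ]
    exact (hf q).trans interior_subset
  · intro p x
    by_cases h : ∃ q : s, q.1.1 = p
    · simp only [ρ, dif_pos h]
      exact f.nonneg _ _
    · simp only [ρ, dif_neg h]
      exact le_rfl

/-- These are chart coordinates and coordinate fields, multiplied by a cutoff equal to one near `p`
so that they become global. Where the cutoff is one they are dual to each other. -/
theorem exists_localFrame (p : M) : ∃ N ∈ 𝓝 p, IsOpen N ∧
    ∃ (ξ : Fin m → SmoothFun m M) (F : Fin m → VF m M),
    (∀ x ∈ N, ∀ v : TangentSpace (𝓡 m) x, v = ∑ i, mvfderiv (𝓡 m) (ξ i) x v • F i x) ∧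
    ∀ x ∈ N, ∀ i j, dirD (F i) (ξ j) x = if i = j then 1 else 0 := by
  classical
  set e := extChartAt (𝓡 m) p
  have hpt : e p ∈ e.target := mem_extChartAt_target p
  obtain ⟨g, hg, hc, hs, h1, -⟩ := exists_cutoff (isCompact_singleton (x := e p))
    (isOpen_extChartAt_target p) (singleton_subset_iff.2 hpt)
  rw [nhdsSet_singleton] at h1
  obtain ⟨O, hO1, hO, hpO⟩ := eventually_nhds_iff.1 h1
  have hpr : ∀ i : Fin m, ContDiff ℝ ∞ fun y : EuclideanSpace ℝ (Fin m) => y i := fun i =>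
    (EuclideanSpace.proj (𝕜 := ℝ) i).contDiff
  have hξ : ∀ i : Fin m, ∃ f : SmoothFun m M, ∀ x ∈ e.source, f x = g (e x) * e x i := fun i => by
    obtain ⟨f, hf, -⟩ := exists_chartFun p (g := fun y => g y * y i) (hg.mul (hpr i)) hc.mul_right
      ((closure_mono (Function.support_mul_subset_left _ _)).trans hs)
    exact ⟨f, hf⟩
  have hF : ∀ i : Fin m, ∃ X : VF m M, ∀ x ∈ e.source,
      X x = mfderiv 𝓘(ℝ, EuclideanSpace ℝ (Fin m)) (𝓡 m) e.symm
        (e x) (g (e x) • EuclideanSpace.single i (1 : ℝ)) := fun i => by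
    obtain ⟨f, hf, -⟩ := exists_chartVF p (V := fun y => g y • EuclideanSpace.single i (1 : ℝ))
      (hg.smul contDiff_const) hc.smul_right
      ((closure_mono (Function.support_smul_subset_left _ _)).trans hs)
    exact ⟨f, hf⟩
  choose ξ hξ using hξ
  choose F hF using hF
  let N := e.source ∩ e ⁻¹' O
  have hNo : IsOpen N := by
    simpa only [N, e, extChartAt_source] using isOpen_extChartAt_preimage (I := 𝓡 m) p hO
  have hgN : ∀ x ∈ N, g (e x) = 1 := fun x hx => hO1 _ hx.2
  have hd : ∀ x ∈ N, ∀ i, ∀ v : EuclideanSpace ℝ (Fin m), mvfderiv (𝓡 m) (ξ i) x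
      (mfderiv 𝓘(ℝ, EuclideanSpace ℝ (Fin m)) (𝓡 m) e.symm (e x) v) = v i := by
    intro x hx i v
    have hy : e x ∈ e.target := e.map_source hx.1
    have h2 := mvfderiv_chart p (ξ i) hy v
    change _ = mvfderiv (𝓡 m) (ξ i) (e.symm (e x)) _ at h2
    have h3 : (ξ i ∘ e.symm) =ᶠ[𝓝 (e x)] fun y => y i := by
      filter_upwards [(isOpen_extChartAt_target p).mem_nhds hy, hO.mem_nhds hx.2] with y hy1 hy2
      rw [Function.comp, hξ i _ (e.map_target hy1), e.right_inv hy1, hO1 y hy2, one_mul]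
    rw [h3.fderiv_eq] at h2
    have h4 : fderiv ℝ (fun y : EuclideanSpace ℝ (Fin m) => y i) (e x) v = v i := by
      rw [show (fun y : EuclideanSpace ℝ (Fin m) => y i) =
        (EuclideanSpace.proj i : EuclideanSpace ℝ (Fin m) →L[ℝ] ℝ) from rfl, ContinuousLinearMap.fderiv]
      rfl
    rw [h4] at h2
    rw [h2]
    have h5 : e.symm (e x) = x := e.left_inv hx.1
    rw [h5]
  refine ⟨N, hNo.mem_nhds ⟨mem_extChartAt_source p, hpO⟩, hNo, ξ, F, ?_, ?_⟩
  · intro x hx v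
    obtain ⟨w, hw⟩ : ∃ w : EuclideanSpace ℝ (Fin m),
        v = mfderiv 𝓘(ℝ, EuclideanSpace ℝ (Fin m)) (𝓡 m) e.symm (e x) w :=
      ⟨_, (mfderiv_extChartAt_symm_comp hx.1 v).symm⟩
    have hw2 : w = ∑ i, w i • (EuclideanSpace.single i (1 : ℝ)) := by
      ext j
      simp [Finset.sum_apply, Pi.single_apply]
    have h6 : ∀ i, F i x = mfderiv 𝓘(ℝ, EuclideanSpace ℝ (Fin m)) (𝓡 m) e.symm (e x)
        (EuclideanSpace.single i (1 : ℝ)) := by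
      intro i
      rw [hF i x hx.1, hgN x hx, one_smul]
    have h7 : ∀ i, mvfderiv (𝓡 m) (ξ i) x v = w i := by
      intro i
      rw [hw]
      exact hd x hx i w
    simp only [h6, h7]
    rw [hw]
    conv_lhs => rw [hw2]
    exact (map_sum _ _ _).trans (Finset.sum_congr rfl fun i _ => map_smul _ _ _)
  · intro x hx i j
    have h8 : dirD (F i) (ξ j) x = mvfderiv (𝓡 m) (ξ j) x (F i x) := rfl
    rw [h8, hF i x hx.1]
    refine (hd x hx j _).trans ?_
    rw [hgN x hx, one_smul]
    simp [eq_comm]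

/-! ### Lie brackets -/

/-- The Lie bracket of vector fields. -/
def bracketVF (X Y : VF m M) : VF m M :=
  ⟨VectorField.mlieBracket (𝓡 m) X Y, fun x => by
    have : IsManifold (𝓡 m) (minSmoothness ℝ 2) M := by
      rw [minSmoothness_of_isRCLikeNormedField]
      exact IsManifold.of_le (n := ∞) (two_le_infty)
    have : IsManifold (𝓡 m) (((⊤ : ℕ∞) : WithTop ℕ∞) + 1) M := by simpa using ‹IsManifold (𝓡 m) ∞ M›
    exact ContMDiffAt.mlieBracket_vectorField (n := ⊤) (m := ⊤) X.contMDiff.contMDiffAt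
      Y.contMDiff.contMDiffAt (by simp [minSmoothness_of_isRCLikeNormedField])⟩

/-- In a chart both second derivatives of `f` contain the same Hessian term, by symmetry of second
derivatives. It cancels, and the first-order terms form the coordinate bracket. -/
theorem dirD_bracketVF (X Y : VF m M) (f : SmoothFun m M) :
    dirD (bracketVF X Y) f = dirD X (dirD Y f) - dirD Y (dirD X f) := by
  ext x
  set e := extChartAt (𝓡 m) x
  have hx : x ∈ e.source := mem_extChartAt_source x
  have hy : e x ∈ e.target := mem_extChartAt_target x
  have hb : bracketVF X Y x = mfderiv 𝓘(ℝ, EuclideanSpace ℝ (Fin m)) (𝓡 m) e.symm (e x)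
      (VectorField.lieBracket ℝ (coordVF x X) (coordVF x Y) (e x)) := by
    refine Eq.trans ?_ (mpullback_extChartAt (p := x) (x := x)
      (VectorField.lieBracket ℝ (coordVF x X) (coordVF x Y)) hx)
    change VectorField.mlieBracketWithin (𝓡 m) X Y univ x = _
    rw [VectorField.mlieBracketWithin_apply]
    simp only [ModelWithCorners.Boundaryless.range_eq_univ, preimage_univ, univ_inter,
      VectorField.mpullbackWithin_univ]
    exact congrArg (mfderiv (𝓡 m) 𝓘(ℝ, EuclideanSpace ℝ (Fin m)) e x).inverse
      (congrFun (VectorField.lieBracketWithin_univ (𝕜 := ℝ) (V := coordVF x X) (W := coordVF x Y)) _)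
  have hu : ∀ u : SmoothFun m M, ∀ Z : VF m M, dirD Z u x =
      fderiv ℝ (u ∘ e.symm) (e x) (coordVF x Z (e x)) := by
    intro u Z
    have := dirD_chart (p := x) Z u hy
    change dirD Z u (e.symm (e x)) = _ at this
    rw [← this, show e.symm (e x) = x from e.left_inv hx]
  have hZ : ∀ Z : VF m M, (dirD Z f ∘ e.symm) =ᶠ[𝓝 (e x)]
      fun y => fderiv ℝ (f ∘ e.symm) y (coordVF x Z y) := by
    intro Z
    filter_upwards [(isOpen_extChartAt_target x).mem_nhds hy] with y hy
    exact dirD_chart Z f hy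
  have hf2 : ContDiffAt ℝ ∞ (f ∘ e.symm) (e x) := (contDiffOn_comp_extChartAt_symm x f).contDiffAt
    (extChartAt_target_mem_nhds_of_mem hy)
  have hfd : DifferentiableAt ℝ (fderiv ℝ (f ∘ e.symm)) (e x) :=
    (hf2.fderiv_right (m := 1) two_le_infty).differentiableAt (by simp)
  have hVd : ∀ Z : VF m M, DifferentiableAt ℝ (coordVF x Z) (e x) := fun Z =>
    ((contDiffOn_coordVF x Z).contDiffAt
      (extChartAt_target_mem_nhds_of_mem hy)).differentiableAt (by simp)
  have hsymm : IsSymmSndFDerivAt ℝ (f ∘ e.symm) (e x) := hf2.isSymmSndFDerivAt (by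
    rw [minSmoothness_of_isRCLikeNormedField]; exact two_le_infty)
  have h2 : ∀ Z Z' : VF m M, dirD Z (dirD Z' f) x =
      fderiv ℝ (f ∘ e.symm) (e x) (fderiv ℝ (coordVF x Z') (e x) (coordVF x Z (e x))) +
        fderiv ℝ (fderiv ℝ (f ∘ e.symm)) (e x) (coordVF x Z (e x)) (coordVF x Z' (e x)) := by
    intro Z Z'
    rw [hu (dirD Z' f) Z, (hZ Z').fderiv_eq,
      (hfd.hasFDerivAt.clm_apply (hVd Z').hasFDerivAt).fderiv]
    rfl
  have h3 := mvfderiv_chart x f hy (VectorField.lieBracket ℝ (coordVF x X) (coordVF x Y) (e x))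
  change _ = mvfderiv (𝓡 m) f (e.symm (e x)) _ at h3
  have h5 : e.symm (e x) = x := e.left_inv hx
  have h4 : dirD (bracketVF X Y) f x = fderiv ℝ (f ∘ e.symm) (e x)
      (VectorField.lieBracket ℝ (coordVF x X) (coordVF x Y) (e x)) := by
    rw [dirD_apply, hb, h3, h5]
    rfl
  refine h4.trans ?_
  have h6 : (dirD X (dirD Y f) - dirD Y (dirD X f)) x =
    dirD X (dirD Y f) x - dirD Y (dirD X f) x := rfl
  rw [h6, h2, h2, VectorField.lieBracket_eq, map_sub, hsymm (coordVF x X (e x)) (coordVF x Y (e x))]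
  ring

theorem two_mul_apply (f : SmoothFun m M) (x : M) : (2 * f) x = 2 * f x := by
  rw [two_mul, two_mul]
  rfl

/-! ### Global frames -/

/-- A finite family of functions `ξ_i` and vector fields `F_i` with `v = ∑ dξ_i(v) F_i` for all
tangent vectors `v`. -/
structure IsFrame {n : ℕ} (ξ : Fin n → SmoothFun m M) (F : Fin n → VF m M) : Prop where
  eq_sum : ∀ (x : M) (v : TangentSpace (𝓡 m) x), v = ∑ i, mvfderiv (𝓡 m) (ξ i) x v • F i x

/-- Only the fields are multiplied by the partition of unity, not the functions: the local sum at
`p` then gives `ρ p x • v`, and these add up to `v`. No linear independence is needed, so a global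
family exists on every compact manifold. -/
theorem exists_isFrame (m : ℕ) (M : Type*) [MetricSpace M]
    [ChartedSpace (EuclideanSpace ℝ (Fin m)) M] [IsManifold (𝓡 m) ∞ M] [CompactSpace M] :
    ∃ (n : ℕ) (ξ : Fin n → SmoothFun m M) (F : Fin n → VF m M), IsFrame ξ F := by
  classical
  have hloc := fun p : M => exists_localFrame (m := m) p
  choose N hN _ ξ F hF _ using hloc
  obtain ⟨s, ρ, h1, h2, -⟩ := exists_partition (m := m) N hN
  let κ := s × Fin m
  let ε := Fintype.equivFin κ
  refine ⟨Fintype.card κ, fun i => ξ (ε.symm i).1 (ε.symm i).2,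
    fun i => mulVF (ρ (ε.symm i).1) (F (ε.symm i).1 (ε.symm i).2), ⟨fun x v => ?_⟩⟩
  rw [ε.symm.sum_comp (fun k : κ => mvfderiv (𝓡 m) (ξ k.1 k.2) x v • mulVF (ρ k.1) (F k.1 k.2) x),
    Fintype.sum_prod_type]
  have h3 : ∀ p : s, ∑ j, mvfderiv (𝓡 m) (ξ p j) x v • mulVF (ρ p) (F p j) x = ρ p x • v := by
    intro p
    by_cases hx : x ∈ N p
    · conv_rhs => rw [hF p x hx v, Finset.smul_sum]
      exact Finset.sum_congr rfl fun j _ => smul_comm _ _ _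
    · have h0 : ρ p x = 0 := by
        by_contra hne
        exact hx (h2 p p.2 (subset_tsupport _ hne))
      rw [h0, zero_smul]
      refine Finset.sum_eq_zero fun j _ => ?_
      rw [mulVF_apply, h0, zero_smul, smul_zero]
  simp only [h3]
  rw [← Finset.sum_smul, Finset.sum_coe_sort s (fun p => ρ p x), ← smoothFun_sum_apply, h1]
  exact (one_smul ℝ v).symm

theorem IsFrame.vf_eq {n : ℕ} {ξ : Fin n → SmoothFun m M} {F : Fin n → VF m M} (h : IsFrame ξ F)
    (X : VF m M) : X = ∑ i, mulVF (dirD X (ξ i)) (F i) := by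
  ext x
  rw [VF.sum_apply]
  exact h.eq_sum x (X x)

theorem IsFrame.dirD_eq {n : ℕ} {ξ : Fin n → SmoothFun m M} {F : Fin n → VF m M} (h : IsFrame ξ F)
    (X : VF m M) (f : SmoothFun m M) : dirD X f = ∑ i, dirD X (ξ i) * dirD (F i) f := by
  conv_lhs => rw [h.vf_eq X]
  rw [dirD_sum_left]
  simp only [dirD_mulVF]

section Compact

variable [CompactSpace M]

/-- Reduces identities between vector fields to commutative algebra with derivations. -/
theorem VF.ext_dirD {X Y : VF m M} (h : ∀ f, dirD X f = dirD Y f) : X = Y := by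
  obtain ⟨n, ξ, F, hF⟩ := exists_isFrame m M
  rw [hF.vf_eq X, hF.vf_eq Y]
  simp only [h]

theorem bracketVF_add_right (X Y Z : VF m M) :
    bracketVF X (Y + Z) = bracketVF X Y + bracketVF X Z := by
  refine VF.ext_dirD fun f => ?_
  simp only [dirD_bracketVF, dirD_add_left, map_add]
  ring

theorem bracketVF_mulVF_right (X Z : VF m M) (a : SmoothFun m M) :
    bracketVF X (mulVF a Z) = mulVF a (bracketVF X Z) + mulVF (dirD X a) Z := by
  refine VF.ext_dirD fun f => ?_
  simp only [dirD_bracketVF, dirD_add_left, dirD_mulVF, dirD_mul]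
  ring

theorem bracketVF_swap (X Y : VF m M) : bracketVF X Y = - bracketVF Y X := by
  rw [eq_neg_iff_add_eq_zero]
  refine VF.ext_dirD fun f => ?_
  rw [dirD_add_left, dirD_bracketVF, dirD_bracketVF]
  have : dirD (0 : VF m M) f = 0 := by
    ext x
    exact map_zero (mvfderiv (𝓡 m) f x)
  rw [this]
  ring

end Compact

/-! ### Gradients and the Levi-Civita connection -/

variable [RiemannianBundle (fun x : M => TangentSpace (𝓡 m) x)]
  [IsContMDiffRiemannianBundle (𝓡 m) ∞ (EuclideanSpace ℝ (Fin m))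
    (fun x : M => TangentSpace (𝓡 m) x)]

theorem innerFun_symm (A B : VF m M) : innerFun A B = innerFun B A := by
  ext x; exact innerFun_comm A B x

theorem innerFun_add (A B C : VF m M) : innerFun (A + B) C = innerFun A C + innerFun B C := by
  ext x; exact innerFun_add_left A B C x

theorem innerFun_add_right (A B C : VF m M) : innerFun A (B + C) = innerFun A B + innerFun A C := by
  rw [innerFun_symm, innerFun_add, innerFun_symm B, innerFun_symm C]

theorem innerFun_mulVF (a : SmoothFun m M) (A B : VF m M) :
    innerFun (mulVF a A) B = a * innerFun A B := by
  ext x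
  exact real_inner_smul_left (F := TangentSpace (𝓡 m) x) (A x) (B x) (a x)

theorem innerFun_mulVF_right (a : SmoothFun m M) (A B : VF m M) :
    innerFun A (mulVF a B) = a * innerFun A B := by
  rw [innerFun_symm, innerFun_mulVF, innerFun_symm]

theorem innerFun_sub (A B C : VF m M) : innerFun (A - B) C = innerFun A C - innerFun B C := by
  ext x
  exact inner_sub_left (E := TangentSpace (𝓡 m) x) (𝕜 := ℝ) (A x) (B x) (C x)

theorem innerFun_neg_right (A B : VF m M) : innerFun A (-B) = - innerFun A B := by
  ext x
  exact inner_neg_right (E := TangentSpace (𝓡 m) x) (𝕜 := ℝ) (A x) (B x)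

theorem innerFun_sum {ι : Type*} (s : Finset ι) (A : ι → VF m M) (B : VF m M) :
    innerFun (∑ i ∈ s, A i) B = ∑ i ∈ s, innerFun (A i) B := by
  ext x
  rw [smoothFun_sum_apply]
  change inner ℝ ((∑ i ∈ s, A i) x) (B x) = _
  rw [VF.sum_apply]
  exact sum_inner (E := TangentSpace (𝓡 m) x) (𝕜 := ℝ) s _ _

theorem innerFun_ext {A B : VF m M} (h : ∀ Z, innerFun A Z = innerFun B Z) : A = B := by
  have h1 : innerFun (A - B) (A - B) = 0 := by
    rw [innerFun_sub, h, sub_self]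
  ext x
  have h2 : inner ℝ ((A - B) x) ((A - B) x) = 0 := congrArg (fun f : SmoothFun m M => f x) h1
  have h3 : (A - B) x = 0 := inner_self_eq_zero (E := TangentSpace (𝓡 m) x) (𝕜 := ℝ).1 h2
  exact sub_eq_zero.1 h3

/-- The quotient is smooth near the support of `ρ` and vanishes off it. It serves to divide by a
Gram determinant that is nonzero only near a point. -/
theorem exists_div_smoothFun {ρ d : SmoothFun m M} (h : ∀ x ∈ tsupport ρ, d x ≠ 0) :
    ∃ a : SmoothFun m M, a * d = ρ ∧ ∀ x, ρ x = 0 → a x = 0 := by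
  have ha : ContMDiff (𝓡 m) 𝓘(ℝ, ℝ) ∞ fun x => ρ x * (d x)⁻¹ := by
    refine contMDiff_of_tsupport fun x hx => ?_
    have hx2 : x ∈ tsupport ρ := closure_mono (Function.support_mul_subset_left _ _) hx
    have h2 : ContMDiffAt (𝓡 m) 𝓘(ℝ, ℝ) ∞ (fun x => (d x)⁻¹) x :=
      (contDiffAt_inv ℝ (h x hx2)).contMDiffAt.comp x d.contMDiff.contMDiffAt
    exact ρ.contMDiff.contMDiffAt.mul h2
  refine ⟨⟨_, ha⟩, ?_, fun x hx => (congrArg (· * (d x)⁻¹) hx).trans (zero_mul _)⟩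
  ext x
  change ρ x * (d x)⁻¹ * d x = ρ x
  by_cases hx : ρ x = 0
  · simp [hx]
  · have := h x (subset_tsupport _ hx)
    field_simp

/-- Locally the gradient is `∑ g^{ij} (∂_i f) ∂_j`. The inverse Gram matrix is replaced by the
adjugate over the ring of smooth functions, and the partition function `ρ p` is divided by the
determinant; the local fields then sum to the gradient. -/
theorem exists_grad [CompactSpace M] (f : SmoothFun m M) :
    ∃ W : VF m M, ∀ X : VF m M, innerFun W X = dirD X f := by
  classical
  have hloc := fun p : M => exists_localFrame (m := m) p
  choose N hN _ ξ F hF hδ using hloc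
  obtain ⟨s, ρ, h1, h2, -⟩ := exists_partition (m := m) N hN
  let G : M → Matrix (Fin m) (Fin m) (SmoothFun m M) := fun p =>
    Matrix.of fun i j => innerFun (F p i) (F p j)
  -- A null vector of the Gram matrix at `x` would give the coefficients of a tangent vector of norm
  -- zero, whose coordinates `dξ_j` vanish by duality of the frame.
  have hdet : ∀ p, ∀ x ∈ N p, (G p).det x ≠ 0 := by
    intro p x hx h0
    let ev : SmoothFun m M →+* ℝ :=
      { toFun := fun f => f x
        map_one' := rfl
        map_mul' := fun _ _ => rfl
        map_zero' := rfl
        map_add' := fun _ _ => rfl }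
    have h3 : ((G p).map ev).det = 0 := by
      rw [show (G p).map ev = ev.mapMatrix (G p) from rfl, ← RingHom.map_det]
      exact h0
    obtain ⟨v, hv0, hv⟩ := Matrix.exists_mulVec_eq_zero_iff.2 h3
    let w : TangentSpace (𝓡 m) x := ∑ i, v i • F p i x
    have hw : inner ℝ w w = 0 := by
      have h4 : ∀ i, inner ℝ (F p i x) w = 0 := by
        intro i
        have h5 := congrFun hv i
        have h6 : inner ℝ (F p i x) w = ∑ j, v j * inner ℝ (F p i x) (F p j x) := by
          refine (inner_sum (E := TangentSpace (𝓡 m) x) (𝕜 := ℝ) _ _ _).trans ?_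
          exact Finset.sum_congr rfl fun j _ =>
            real_inner_smul_right (F := TangentSpace (𝓡 m) x) _ _ _
        rw [h6]
        refine Eq.trans ?_ h5
        simp only [Matrix.mulVec, dotProduct]
        exact Finset.sum_congr rfl fun j _ => mul_comm _ _
      refine (sum_inner (E := TangentSpace (𝓡 m) x) (𝕜 := ℝ) _ _ _).trans ?_
      refine Finset.sum_eq_zero fun i _ => ?_
      refine (real_inner_smul_left (F := TangentSpace (𝓡 m) x) _ _ _).trans ?_
      rw [h4, mul_zero]
    have hw0 : w = 0 := inner_self_eq_zero (E := TangentSpace (𝓡 m) x) (𝕜 := ℝ).1 hw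
    refine hv0 (funext fun j => ?_)
    have h7 : mvfderiv (𝓡 m) (ξ p j) x w = v j := by
      refine (map_sum _ _ _).trans ?_
      have : ∀ i, mvfderiv (𝓡 m) (ξ p j) x (v i • F p i x) = v i * if i = j then 1 else 0 := by
        intro i
        refine (map_smul _ _ _).trans ?_
        rw [← hδ p x hx i j]
        rfl
      simp only [this]
      simp
    rw [hw0] at h7
    rw [← h7]
    exact map_zero _
  have ha : ∀ p : s, ∃ a : SmoothFun m M, a * (G p).det = ρ p ∧
      ∀ x, ρ p x = 0 → a x = 0 := fun p =>
    exists_div_smoothFun fun x hx => hdet p x (h2 p p.2 hx)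
  choose a ha ha0 using ha
  let W : s → VF m M := fun p => ∑ i, ∑ j, mulVF (a p * (dirD (F p i) f * (G p).adjugate i j)) (F p j)
  have hWF : ∀ p k, innerFun (W p) (F p k) = ρ p * dirD (F p k) f := by
    intro p k
    simp only [W, innerFun_sum, innerFun_mulVF]
    have h8 : ∀ i, ∑ j, (G p).adjugate i j * innerFun (F p j) (F p k) =
        if i = k then (G p).det else 0 := by
      intro i
      have := congrFun (congrFun (Matrix.adjugate_mul (G p)) i) k
      rw [Matrix.mul_apply] at this
      refine this.trans ?_
      simp [Matrix.one_apply]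
    calc _ = ∑ i, a p * dirD (F p i) f * ∑ j, (G p).adjugate i j * innerFun (F p j) (F p k) := by
          refine Finset.sum_congr rfl fun i _ => ?_
          rw [Finset.mul_sum]
          exact Finset.sum_congr rfl fun j _ => by ring
      _ = a p * (G p).det * dirD (F p k) f := by
          simp only [h8]
          simp
          ring
      _ = _ := by rw [ha]
  have hW : ∀ (p : s) X, innerFun (W p) X = ρ p * dirD X f := by
    intro p X
    ext x
    by_cases hx : x ∈ N p
    · have h9 := hF p x hx (X x)
      have h10 : ∀ k, inner ℝ (W p x) (F p k x) = ρ p x * dirD (F p k) f x := fun k =>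
        congrArg (fun f : SmoothFun m M => f x) (hWF p k)
      change inner ℝ (W p x) (X x) = ρ p x * mvfderiv (𝓡 m) f x (X x)
      rw [h9]
      refine (inner_sum (E := TangentSpace (𝓡 m) x) (𝕜 := ℝ) _ _ _).trans ?_
      have h11 : mvfderiv (𝓡 m) f x (∑ i, mvfderiv (𝓡 m) (ξ p i) x (X x) • F p i x) =
        ∑ i, mvfderiv (𝓡 m) (ξ p i) x (X x) • dirD (F p i) f x :=
        (map_sum _ _ _).trans (Finset.sum_congr rfl fun i _ => map_smul _ _ _)
      rw [h11, Finset.mul_sum]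
      refine Finset.sum_congr rfl fun i _ => ?_
      refine (real_inner_smul_right (F := TangentSpace (𝓡 m) x) _ _ _).trans ?_
      rw [h10, smul_eq_mul]
      ring
    · have hx0 : ρ p x = 0 := by
        by_contra hne
        exact hx (h2 p p.2 (subset_tsupport _ hne))
      have h12 : innerFun (W p) X = a p * ∑ i, ∑ j,
          dirD (F p i) f * (G p).adjugate i j * innerFun (F p j) X := by
        simp only [W, innerFun_sum, innerFun_mulVF, Finset.mul_sum, mul_assoc]
      rw [h12]
      change a p x * _ = ρ p x * _
      rw [hx0, ha0 p x hx0, zero_mul, zero_mul]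
  refine ⟨∑ p, W p, fun X => ?_⟩
  rw [innerFun_sum]
  simp only [hW]
  rw [← Finset.sum_mul, Finset.sum_coe_sort s ρ, h1, one_mul]

theorem innerFun_grad [CompactSpace M] (f : SmoothFun m M) (X : VF m M) :
    innerFun (grad f) X = dirD X f :=
  Classical.epsilon_spec (exists_grad f) X

/-- A `C^∞(M)`-linear form on vector fields is represented by a vector field. -/
theorem exists_vf_of_tensorial [CompactSpace M] (K : VF m M → SmoothFun m M)
    (hadd : ∀ X Y, K (X + Y) = K X + K Y) (hmul : ∀ a X, K (mulVF a X) = a * K X) :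
    ∃ W : VF m M, ∀ X, innerFun W X = K X := by
  classical
  obtain ⟨n, ξ, F, hF⟩ := exists_isFrame m M
  refine ⟨∑ i, mulVF (K (F i)) (grad (ξ i)), fun X => ?_⟩
  have hsum : ∀ (s : Finset (Fin n)) (Y : Fin n → VF m M), K (∑ i ∈ s, Y i) = ∑ i ∈ s, K (Y i) := by
    intro s Y
    induction s using Finset.induction_on with
    | empty =>
      have := hadd 0 0
      rw [add_zero] at this
      simpa using this
    | insert a s ha h => rw [Finset.sum_insert ha, Finset.sum_insert ha, hadd, h]
  conv_rhs => rw [hF.vf_eq X, hsum]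
  rw [innerFun_sum]
  refine Finset.sum_congr rfl fun i _ => ?_
  rw [innerFun_mulVF, innerFun_grad, hmul, mul_comm]

/-- The right-hand side of the Koszul formula on `M`. -/
def koszul (X Y Z : VF m M) : SmoothFun m M :=
  dirD X (innerFun Y Z) + dirD Y (innerFun Z X) - dirD Z (innerFun X Y)
    + innerFun Z (bracketVF X Y) - innerFun Y (bracketVF X Z) - innerFun X (bracketVF Y Z)

/-- The Koszul expression is linear over functions in `Z`: the derivatives of the factor cancel
between the directional and the bracket terms. A field representing it therefore exists, and the
choice in `nabla` is not a default value. -/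
theorem two_mul_innerFun_nabla [CompactSpace M] (X Y Z : VF m M) :
    2 * innerFun (nabla X Y) Z = koszul X Y Z := by
  have hex : ∃ W : VF m M, ∀ Z : VF m M, innerFun W Z = (1 / 2 : ℝ) • koszul X Y Z := by
    refine exists_vf_of_tensorial (fun Z => (1 / 2 : ℝ) • koszul X Y Z) (fun Z Z' => ?_)
      fun a Z => ?_
    · rw [← smul_add]
      congr 1
      simp only [koszul, innerFun_add, innerFun_add_right, dirD_add_left, bracketVF_add_right,
        map_add]
      ring
    · rw [mul_smul_comm]
      congr 1
      simp only [koszul, innerFun_mulVF, innerFun_mulVF_right, dirD_mulVF, bracketVF_mulVF_right,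
        innerFun_add_right, dirD_mul]
      rw [innerFun_symm X Z]
      ring
  have hex2 : ∃ W : VF m M, ∀ (Z : VF m M) (x : M),
    2 * inner ℝ (W x) (Z x) =
      dirD X (innerFun Y Z) x + dirD Y (innerFun Z X) x - dirD Z (innerFun X Y) x
        + inner ℝ (Z x) (VectorField.mlieBracket (𝓡 m) X Y x)
        - inner ℝ (Y x) (VectorField.mlieBracket (𝓡 m) X Z x)
        - inner ℝ (X x) (VectorField.mlieBracket (𝓡 m) Y Z x) := by
    obtain ⟨W, hW⟩ := hex
    refine ⟨W, fun Z x => ?_⟩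
    have h1 : innerFun W Z x = (1 / 2 : ℝ) * koszul X Y Z x :=
      congrArg (fun f : SmoothFun m M => f x) (hW Z)
    change 2 * innerFun W Z x = koszul X Y Z x
    rw [h1]
    ring
  have hs := Classical.epsilon_spec hex2
  ext x
  rw [two_mul_apply]
  exact hs Z x

/-- Existence of the adjoint field rests on linearity of `∇_X U` over functions in `X`. Antisymmetry
of the bracket moves `X` to the second slot, where the Leibniz rule is available. -/
theorem innerFun_adjNabla [CompactSpace M] (U A X : VF m M) :
    innerFun (adjNabla U A) X = innerFun A (nabla X U) := by
  have two_cancel : ∀ {f g : SmoothFun m M}, 2 * f = 2 * g → f = g := by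
    intro f g h
    ext x
    have h1 := congrArg (fun f : SmoothFun m M => f x) h
    simp only [two_mul_apply] at h1
    linarith
  have hex : ∃ W : VF m M, ∀ X : VF m M, innerFun W X = innerFun A (nabla X U) := by
    refine exists_vf_of_tensorial (fun X => innerFun A (nabla X U)) (fun X Y => ?_) fun a X => ?_
    · rw [← innerFun_add_right]
      congr 1
      refine innerFun_ext fun Z => two_cancel ?_
      rw [innerFun_add, mul_add]
      simp only [two_mul_innerFun_nabla, koszul]
      rw [bracketVF_swap (X + Y) U, bracketVF_swap (X + Y) Z, bracketVF_swap X U,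
        bracketVF_swap Y U, bracketVF_swap X Z, bracketVF_swap Y Z]
      simp only [innerFun_add, innerFun_add_right, dirD_add_left, bracketVF_add_right,
        map_add, innerFun_neg_right]
      ring
    · rw [← innerFun_mulVF_right]
      congr 1
      refine innerFun_ext fun Z => two_cancel ?_
      rw [innerFun_mulVF, mul_left_comm]
      simp only [two_mul_innerFun_nabla, koszul]
      rw [bracketVF_swap (mulVF a X) U, bracketVF_swap (mulVF a X) Z, bracketVF_swap X U,
        bracketVF_swap X Z]
      simp only [innerFun_mulVF, innerFun_mulVF_right, dirD_mulVF, bracketVF_mulVF_right,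
        innerFun_add_right, dirD_mul, innerFun_neg_right]
      rw [innerFun_symm U X, innerFun_symm Z X]
      ring
  have hex2 : ∃ W : VF m M, ∀ (X : VF m M) (x : M), inner ℝ (W x) (X x) =
      inner ℝ (A x) (nabla X U x) := by
    obtain ⟨W, hW⟩ := hex
    exact ⟨W, fun X x => congrArg (fun f : SmoothFun m M => f x) (hW X)⟩
  have hs := Classical.epsilon_spec hex2
  ext x
  exact hs X x

/-- For a gradient field `U`, the operator `X ↦ ∇_X U` is symmetric. -/
theorem adjNabla_grad [CompactSpace M] (f : SmoothFun m M) (A : VF m M) :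
    adjNabla (grad f) A = nabla A (grad f) := by
  have two_cancel : ∀ {f g : SmoothFun m M}, 2 * f = 2 * g → f = g := by
    intro f g h
    ext x
    have h1 := congrArg (fun f : SmoothFun m M => f x) h
    simp only [two_mul_apply] at h1
    linarith
  refine innerFun_ext fun X => two_cancel ?_
  rw [innerFun_adjNabla, innerFun_symm A, two_mul_innerFun_nabla, two_mul_innerFun_nabla]
  simp only [koszul]
  -- Every pairing with `grad f` becomes a derivative of `f` and every bracket a commutator, so both
  -- Koszul expressions become the same combination of iterated derivatives.
  rw [innerFun_symm X (grad f), innerFun_symm A (grad f)]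
  simp only [innerFun_grad, dirD_bracketVF]
  rw [innerFun_symm A X, bracketVF_swap (grad f) A, bracketVF_swap (grad f) X,
    innerFun_neg_right, innerFun_neg_right]
  ring

/-! ## Smoothness of flows -/

/-! ### Composition operators on Banach spaces of continuous maps -/

section Nemytskii

variable {K : Type} [TopologicalSpace K] [CompactSpace K]

/-- A continuous bilinear map acts on continuous functions. -/
def bilinC {E F G : Type} [NormedAddCommGroup E] [NormedSpace ℝ E] [NormedAddCommGroup F]
    [NormedSpace ℝ F] [NormedAddCommGroup G] [NormedSpace ℝ G] (L : G →L[ℝ] E →L[ℝ] F) :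
    C(K, G) →L[ℝ] C(K, E) →L[ℝ] C(K, F) :=
  LinearMap.mkContinuous₂
    (LinearMap.mk₂ ℝ (fun (A : C(K, G)) (h : C(K, E)) =>
      (⟨fun x => L (A x) (h x), (L.continuous.comp A.continuous).clm_apply h.continuous⟩ : C(K, F)))
      (fun A B h => by ext x; simp) (fun c A h => by ext x; simp)
      (fun A h h' => by ext x; simp) (fun c A h => by ext x; simp)) ‖L‖
    (fun A h => by
      refine (ContinuousMap.norm_le _ (by positivity)).2 fun x => ?_
      refine (L.le_opNorm₂ _ _).trans ?_
      gcongr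
      · exact A.norm_coe_le_norm x
      · exact h.norm_coe_le_norm x)

/-- Pointwise application as a continuous bilinear map. -/
def applyC (K : Type) [TopologicalSpace K] [CompactSpace K] (E F : Type) [NormedAddCommGroup E]
    [NormedSpace ℝ E] [NormedAddCommGroup F] [NormedSpace ℝ F] :
    C(K, E →L[ℝ] F) →L[ℝ] C(K, E) →L[ℝ] C(K, F) :=
  bilinC (ContinuousLinearMap.id ℝ (E →L[ℝ] F))

/-- The derivative of `g` is uniformly continuous near the compact range of `α`, so the mean value
estimate holds with the same `ε` at all points. -/
theorem hasFDerivAt_comp_continuousMap {E F : Type} [NormedAddCommGroup E]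
    [NormedSpace ℝ E] [NormedAddCommGroup F] [NormedSpace ℝ F] {g : E → F} (hg : ContDiff ℝ ∞ g)
    (α : C(K, E)) :
    HasFDerivAt (fun α : C(K, E) => (⟨g, hg.continuous⟩ : C(E, F)).comp α)
      (applyC K E F ((⟨fderiv ℝ g, hg.continuous_fderiv (by simp)⟩ : C(E, E →L[ℝ] F)).comp α)) α := by
  rw [hasFDerivAt_iff_isLittleO, Asymptotics.isLittleO_iff]
  intro ε hε
  have hcont : Continuous (fderiv ℝ g) := hg.continuous_fderiv (by simp)
  have hcomp : IsCompact (range α) := isCompact_range α.continuous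
  have hunif := hcomp.uniformContinuousAt_of_continuousAt (f := fderiv ℝ g)
    (fun x _ => hcont.continuousAt) (Metric.dist_mem_uniformity hε)
  obtain ⟨δ, hδ, hδ2⟩ := Metric.mem_uniformity_dist.1 hunif
  filter_upwards [Metric.ball_mem_nhds α hδ] with β hβ
  refine (ContinuousMap.norm_le _ (by positivity)).2 fun x => ?_
  have hx : dist (β x) (α x) < δ := (ContinuousMap.dist_apply_le_dist x).trans_lt hβ
  have hball : ∀ y ∈ Metric.ball (α x) δ, ‖fderiv ℝ g y - fderiv ℝ g (α x)‖ ≤ ε := by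
    intro y hy
    have h := hδ2 (a := α x) (b := y) (by rw [dist_comm]; exact hy) ⟨x, rfl⟩
    rw [← dist_eq_norm, dist_comm]
    exact h.le
  have h1 := (convex_ball (α x) δ).norm_image_sub_le_of_norm_hasFDerivWithin_le' (f := g)
    (f' := fderiv ℝ g) (φ := fderiv ℝ g (α x))
    (fun y _ => ((hg.differentiable (by simp)) y).hasFDerivAt.hasFDerivWithinAt) hball
    (Metric.mem_ball_self hδ) hx
  refine h1.trans ?_
  refine mul_le_mul_of_nonneg_left ?_ hε.le
  exact (β - α).norm_coe_le_norm x

-- The derivative is again a composition operator, with `fderiv ℝ g` in place of `g`, followed by a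
-- continuous linear map. The target space changes in the induction, so it is quantified inside.
set_option synthInstance.maxHeartbeats 200000 in
theorem contDiff_comp_continuousMap_nat (n : ℕ) {E : Type} [NormedAddCommGroup E]
    [NormedSpace ℝ E] : ∀ {F : Type} [NormedAddCommGroup F] [NormedSpace ℝ F] {g : E → F}
    (hg : ContDiff ℝ ∞ g),
    ContDiff ℝ n (fun α : C(K, E) => (⟨g, hg.continuous⟩ : C(E, F)).comp α) := by
  induction n with
  | zero =>
    intro F _ _ g hg
    exact contDiff_zero.2 (continuous_iff_continuousAt.2 fun α =>
      (hasFDerivAt_comp_continuousMap hg α).continuousAt)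
  | succ n ih =>
    intro F _ _ g hg
    refine (contDiff_succ_iff_hasFDerivAt (n := n)).2 ⟨_, ?_, hasFDerivAt_comp_continuousMap hg⟩
    exact (applyC K E F).contDiff.comp (ih (hg.fderiv_right (m := ∞) (by simp)))

end Nemytskii

/-! ### Local flows from the inverse function theorem -/

section LocalFlow

variable {E : Type} [NormedAddCommGroup E] [NormedSpace ℝ E] [CompleteSpace E]

/-- The interval on which local flows are parametrized. -/
abbrev FlowInt : Type := Icc (-2 : ℝ) 2

/-- The point `0` of the interval. -/
theorem flowInt_le : (-2 : ℝ) ≤ 2 := by norm_num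

/-- Integration from `0` of curves on `[-2, 2]`. -/
def integrateC (E : Type) [NormedAddCommGroup E] [NormedSpace ℝ E] :
    C(FlowInt, E) →L[ℝ] C(FlowInt, E) :=
  LinearMap.mkContinuous
    { toFun := fun α => ⟨fun s => ∫ u in (0 : ℝ)..s, IccExtend flowInt_le α u, by
        have h : Continuous fun s : ℝ => ∫ u in (0 : ℝ)..s, IccExtend flowInt_le α u :=
          intervalIntegral.continuous_primitive
            (fun a b => (α.continuous.Icc_extend' (h := flowInt_le)).intervalIntegrable a b) 0
        exact h.comp continuous_subtype_val⟩
      map_add' := fun α β => by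
        ext s
        change ∫ u in (0 : ℝ)..s, (IccExtend flowInt_le α u + IccExtend flowInt_le β u) = _
        exact intervalIntegral.integral_add
          ((α.continuous.Icc_extend' (h := flowInt_le)).intervalIntegrable _ _)
          ((β.continuous.Icc_extend' (h := flowInt_le)).intervalIntegrable _ _)
      map_smul' := fun c α => by
        ext s
        change ∫ u in (0 : ℝ)..s, c • (IccExtend flowInt_le α u) = _
        exact intervalIntegral.integral_smul _ _ } 2
    (fun α => by
      refine (ContinuousMap.norm_le _ (by positivity)).2 fun s => ?_
      refine (intervalIntegral.norm_integral_le_of_norm_le_const (C := ‖α‖)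
        (fun u _ => α.norm_coe_le_norm _)).trans ?_
      rw [mul_comm]
      refine mul_le_mul_of_nonneg_right ?_ (norm_nonneg _)
      rw [sub_zero]
      exact abs_le.2 s.2)

theorem hasDerivAt_integrateC (α : C(FlowInt, E)) {s : ℝ} (hs : s ∈ Ioo (-2 : ℝ) 2) :
    HasDerivAt (fun s => IccExtend flowInt_le (integrateC E α) s) (IccExtend flowInt_le α s) s := by
  have hc : Continuous (IccExtend flowInt_le α) := α.continuous.Icc_extend'
  have h1 : HasDerivAt (fun s => ∫ u in (0 : ℝ)..s, IccExtend flowInt_le α u)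
      (IccExtend flowInt_le α s) s := hc.integral_hasStrictDerivAt 0 s |>.hasDerivAt
  refine h1.congr_of_eventuallyEq ?_
  filter_upwards [Ioo_mem_nhds hs.1 hs.2] with u hu
  exact IccExtend_of_mem flowInt_le _ (Ioo_subset_Icc_self hu)

/-- Smooth dependence on the initial point and the time scale of the solutions of
`α' = t X(α)`. -/
theorem exists_local_flow {X : E → E} (hX : ContDiff ℝ ∞ X) (y₀ : E) {r : ℝ} (hr : 0 < r) (n : ℕ)
    (hn : n ≠ 0) :
    ∃ α : E × ℝ → ℝ → E, ContDiffAt ℝ n (fun q => α q 1) (y₀, 0) ∧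
      ∀ᶠ q in 𝓝 (y₀, (0 : ℝ)), α q 0 = q.1 ∧ ∀ s ∈ Ioo (-2 : ℝ) 2,
        HasDerivAt (α q) (q.2 • X (α q s)) s ∧ α q s ∈ Metric.ball y₀ r := by
  let C := C(FlowInt, E)
  let NX : C → C := fun α => (⟨X, hX.continuous⟩ : C(E, E)).comp α
  have hNX : ContDiff ℝ n NX := contDiff_comp_continuousMap_nat n hX
  let cst : E →L[ℝ] C := ContinuousLinearMap.const ℝ FlowInt
  let J := integrateC E
  -- `G (q, α) = (q, 0)` says that `α` solves the integral equation with initial point `q.1` and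
  -- time scale `q.2`. At time scale zero the derivative in `α` is the identity whatever `X` is, so
  -- the fixed interval `[-2, 2]` may be kept.
  let G : (E × ℝ) × C → (E × ℝ) × C := fun z => (z.1, z.2 - cst z.1.1 - z.1.2 • J (NX z.2))
  have hJN : ContDiff ℝ n fun z : (E × ℝ) × C => J (NX z.2) :=
    J.contDiff.comp (hNX.comp contDiff_snd)
  have hG : ContDiff ℝ n G := by
    refine contDiff_fst.prodMk ((contDiff_snd.sub ?_).sub ?_)
    · exact cst.contDiff.comp (contDiff_fst.comp contDiff_fst)
    · exact (contDiff_snd.comp contDiff_fst).smul hJN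
  let c₀ : C := cst y₀
  let z₀ : (E × ℝ) × C := ((y₀, 0), c₀)
  let b : C := J (NX c₀)
  let A1 : (E × ℝ) →L[ℝ] C := cst.comp (ContinuousLinearMap.fst ℝ E ℝ) +
    (ContinuousLinearMap.toSpanSingleton ℝ b).comp (ContinuousLinearMap.snd ℝ E ℝ)
  -- The derivative of `G` at `z₀` is unipotent triangular; `f2` is its inverse.
  let f1 : (E × ℝ) × C →L[ℝ] (E × ℝ) × C := (ContinuousLinearMap.fst ℝ _ _).prod
    (ContinuousLinearMap.snd ℝ _ _ - A1.comp (ContinuousLinearMap.fst ℝ _ _))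
  let f2 : (E × ℝ) × C →L[ℝ] (E × ℝ) × C := (ContinuousLinearMap.fst ℝ _ _).prod
    (ContinuousLinearMap.snd ℝ _ _ + A1.comp (ContinuousLinearMap.fst ℝ _ _))
  let f' : ((E × ℝ) × C) ≃L[ℝ] (E × ℝ) × C := ContinuousLinearEquiv.equivOfInverse f1 f2
    (fun z => by simp [f1, f2]) (fun z => by simp [f1, f2])
  have hf' : HasFDerivAt G (f' : (E × ℝ) × C →L[ℝ] (E × ℝ) × C) z₀ := by
    have h1 : HasFDerivAt (fun z : (E × ℝ) × C => z.1) (ContinuousLinearMap.fst ℝ (E × ℝ) C) z₀ :=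
      hasFDerivAt_fst
    have h2 : HasFDerivAt (fun z : (E × ℝ) × C => z.2) (ContinuousLinearMap.snd ℝ (E × ℝ) C) z₀ :=
      hasFDerivAt_snd
    have h3 := ((cst.comp ((ContinuousLinearMap.fst ℝ E ℝ).comp
      (ContinuousLinearMap.fst ℝ (E × ℝ) C))).hasFDerivAt (x := z₀))
    have h4 := (((ContinuousLinearMap.snd ℝ E ℝ).comp
      (ContinuousLinearMap.fst ℝ (E × ℝ) C)).hasFDerivAt (x := z₀))
    have h5 : HasFDerivAt (fun z : (E × ℝ) × C => J (NX z.2)) _ z₀ :=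
      ((hJN.differentiable (by exact_mod_cast hn)) z₀).hasFDerivAt
    have h6 := h1.prodMk ((h2.sub h3).sub (h4.smul h5))
    refine h6.congr_fderiv ?_
    refine ContinuousLinearMap.ext fun z => ?_
    change _ = f1 z
    simp [f1, A1, z₀, b, sub_sub]
  have hn' : (n : WithTop ℕ∞) ≠ 0 := by exact_mod_cast hn
  have hGz : G z₀ = ((y₀, 0), 0) := by simp [G, z₀, c₀]
  let Φ := (hG.contDiffAt (x := z₀)).localInverse hf' hn'
  have hΦ : ContDiffAt ℝ n Φ ((y₀, 0), 0) := by
    have := (hG.contDiffAt (x := z₀)).to_localInverse hf' hn'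
    rwa [hGz] at this
  have hΦ0 : Φ ((y₀, 0), 0) = z₀ := by
    have := (hG.contDiffAt (x := z₀)).localInverse_apply_image hf' hn'
    rwa [hGz] at this
  have hright : ∀ᶠ w in 𝓝 (((y₀, 0), 0) : (E × ℝ) × C), G (Φ w) = w := by
    have h := (hG.contDiffAt (x := z₀)).hasStrictFDerivAt' hf' hn'
    have := h.eventually_right_inverse
    rw [hGz] at this
    exact this
  let a : E × ℝ → C := fun q => (Φ (q, 0)).2
  have ha : ContDiffAt ℝ n a (y₀, 0) := by
    have h1 : ContDiffAt ℝ n (fun q : E × ℝ => Φ (q, 0)) (y₀, 0) :=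
      hΦ.comp (y₀, (0 : ℝ)) (contDiffAt_id.prodMk contDiffAt_const)
    exact contDiff_snd.contDiffAt.comp (y₀, (0 : ℝ)) h1
  have ha0 : a (y₀, 0) = c₀ := by
    change (Φ ((y₀, 0), 0)).2 = c₀
    rw [hΦ0]
  have hsol : ∀ᶠ q in 𝓝 (y₀, (0 : ℝ)), a q = cst q.1 + q.2 • J (NX (a q)) := by
    have hc : Tendsto (fun q : E × ℝ => (q, (0 : C))) (𝓝 (y₀, 0)) (𝓝 ((y₀, 0), 0)) :=
      (continuous_id.prodMk continuous_const).tendsto _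
    filter_upwards [hc.eventually hright] with q hq
    have h1 : (Φ (q, 0)).1 = q := congrArg Prod.fst hq
    have h2 : (Φ (q, 0)).2 - cst (Φ (q, 0)).1.1 - (Φ (q, 0)).1.2 • J (NX (Φ (q, 0)).2) = 0 :=
      congrArg Prod.snd hq
    rw [h1] at h2
    have h3 := sub_eq_zero.1 h2
    exact sub_eq_iff_eq_add'.1 h3
  have hnear : ∀ᶠ q in 𝓝 (y₀, (0 : ℝ)), a q ∈ Metric.ball c₀ r := by
    have := ha.continuousAt
    rw [ContinuousAt, ha0] at this
    exact this.eventually (Metric.ball_mem_nhds c₀ hr)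
  refine ⟨fun q s => IccExtend flowInt_le (a q) s, ?_, ?_⟩
  · let ev : C →L[ℝ] E := ContinuousMap.evalCLM ℝ (⟨1, by norm_num, by norm_num⟩ : FlowInt)
    refine (ev.contDiff.contDiffAt.comp (y₀, (0 : ℝ)) ha).congr_of_eventuallyEq ?_
    refine Eventually.of_forall fun q => ?_
    exact IccExtend_of_mem flowInt_le _ (by norm_num)
  · filter_upwards [hsol, hnear] with q hq hq2
    have hval : ∀ s ∈ Ioo (-2 : ℝ) 2, IccExtend flowInt_le (a q) s =
        q.1 + q.2 • IccExtend flowInt_le (J (NX (a q))) s := by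
      intro s hs
      simp only [IccExtend_of_mem flowInt_le _ (Ioo_subset_Icc_self hs)]
      exact congrArg (fun β : C => β ⟨s, Ioo_subset_Icc_self hs⟩) hq
    refine ⟨?_, fun s hs => ⟨?_, ?_⟩⟩
    · rw [hval 0 (by norm_num), IccExtend_of_mem flowInt_le _ (by norm_num : (0 : ℝ) ∈ Icc (-2 : ℝ) 2)]
      have : (J (NX (a q))) ⟨0, by norm_num⟩ = 0 := intervalIntegral.integral_same
      rw [this, smul_zero, add_zero]
    · have h1 := ((hasDerivAt_integrateC (NX (a q)) hs).const_smul q.2).const_add q.1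
      have h2 : IccExtend flowInt_le (NX (a q)) s = X (IccExtend flowInt_le (a q) s) := rfl
      rw [h2] at h1
      refine h1.congr_of_eventuallyEq ?_
      filter_upwards [Ioo_mem_nhds hs.1 hs.2] with u hu
      exact hval u hu
    · change dist (a q (projIcc _ _ flowInt_le s)) y₀ < r
      have : c₀ (projIcc _ _ flowInt_le s) = y₀ := rfl
      rw [← this]
      exact (ContinuousMap.dist_apply_le_dist _).trans_lt hq2

end LocalFlow


theorem contMDiff_vf (X : VF m M) (n : WithTop ℕ∞) (hn : n ≤ ∞) :
    ContMDiff (𝓡 m) (𝓡 m).tangent n (fun x => (⟨x, X x⟩ : TangentBundle (𝓡 m) M)) :=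
  X.contMDiff.of_le hn

/-- The flow of `X` at time `t` is the flow of `t X` at time one, so smoothness of `q ↦ β q 1` is
joint smoothness of the flow in time and space. -/
theorem exists_local_flow_manifold (X : VF m M) (x₀ : M) (n : ℕ) (hn : n ≠ 0) :
    ∃ β : ℝ × M → ℝ → M,
      ContMDiffAt (𝓘(ℝ, ℝ).prod (𝓡 m)) (𝓡 m) n (fun q => β q 1) (0, x₀) ∧
      ∀ᶠ q in 𝓝 ((0 : ℝ), x₀), β q 0 = q.2 ∧
        IsMIntegralCurveOn (I := 𝓡 m) (β q) (fun x => (q.1 • X) x) (Ioo (-2) 2) := by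
  have he0 := mem_extChartAt_target (I := 𝓡 m) x₀
  set e := extChartAt (𝓡 m) x₀ with he
  obtain ⟨r, hr, hrs⟩ := Metric.mem_nhds_iff.1 (extChartAt_target_mem_nhds_of_mem he0)
  obtain ⟨g, hg, hgc, hgs, hg1, -⟩ := exists_cutoff
    (isCompact_closedBall (e x₀) (r / 2)) (Metric.isOpen_ball (x := e x₀) (ε := r))
    (Metric.closedBall_subset_ball (by linarith))
  -- The cutoff makes the coordinate field globally smooth. The solutions used stay in the ball of
  -- radius `r / 2`, where the cutoff is one, so they are integral curves of `X` itself.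
  set V : EuclideanSpace ℝ (Fin m) → EuclideanSpace ℝ (Fin m) := fun y => g y • coordVF x₀ X y
  have hV : ContDiff ℝ ∞ V := by
    rw [contDiff_iff_contDiffAt]
    intro y
    by_cases hy : y ∈ e.target
    · exact hg.contDiffAt.smul ((contDiffOn_coordVF x₀ X).contDiffAt
        (extChartAt_target_mem_nhds_of_mem hy))
    · have : V =ᶠ[𝓝 y] fun _ => 0 := by
        have h1 : y ∉ tsupport g := fun h => hy (hrs (hgs h))
        filter_upwards [(isClosed_tsupport g).isOpen_compl.mem_nhds h1] with z hz
        simp [V, image_eq_zero_of_notMem_tsupport hz]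
      exact contDiffAt_const.congr_of_eventuallyEq this
  obtain ⟨α, hα1, hα2⟩ := exists_local_flow hV (e x₀) (half_pos hr) n hn
  have hcont : ContinuousAt (fun q : ℝ × M => (e q.2, q.1)) ((0 : ℝ), x₀) :=
    ((continuousAt_extChartAt (I := 𝓡 m) x₀).comp (x := ((0 : ℝ), x₀)) continuousAt_snd).prodMk
      continuousAt_fst
  have hev := hcont.eventually hα2
  have hsrc : ∀ᶠ q : ℝ × M in 𝓝 ((0 : ℝ), x₀), q.2 ∈ e.source :=
    continuousAt_snd.eventually (extChartAt_source_mem_nhds (I := 𝓡 m) x₀)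
  have hα0 := hα2.self_of_nhds
  refine ⟨fun q s => e.symm (α (e q.2, q.1) s), ?_, ?_⟩
  · have h1 : ContMDiffAt (𝓘(ℝ, ℝ).prod (𝓡 m)) 𝓘(ℝ, EuclideanSpace ℝ (Fin m) × ℝ) n
        (fun q : ℝ × M => (e q.2, q.1)) ((0 : ℝ), x₀) := by
      refine ContMDiffAt.prodMk_space ?_ contMDiffAt_fst
      exact (contMDiffAt_extChartAt (I := 𝓡 m) (x := x₀) (n := n)).comp ((0 : ℝ), x₀)
        contMDiffAt_snd
    have h2 : ContMDiffAt 𝓘(ℝ, EuclideanSpace ℝ (Fin m) × ℝ) 𝓘(ℝ, EuclideanSpace ℝ (Fin m)) n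
        (fun q : EuclideanSpace ℝ (Fin m) × ℝ => α q 1) (e x₀, (0 : ℝ)) := hα1.contMDiffAt
    have h3 : ContMDiffAt 𝓘(ℝ, EuclideanSpace ℝ (Fin m)) (𝓡 m) n e.symm
        (α (e x₀, (0 : ℝ)) 1) := by
      have : IsManifold (𝓡 m) n M := IsManifold.of_le (n := ∞) (by exact_mod_cast le_top)
      refine (contMDiffOn_extChartAt_symm x₀).contMDiffAt
        (extChartAt_target_mem_nhds_of_mem ?_)
      exact hrs (Metric.ball_subset_ball (by linarith) ((hα0.2 1 (by norm_num)).2))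
    exact h3.comp ((0 : ℝ), x₀) (h2.comp ((0 : ℝ), x₀) h1)
  · filter_upwards [hev, hsrc] with q hq hs
    refine ⟨by rw [hq.1]; exact e.left_inv hs, fun s hs' => ?_⟩
    obtain ⟨h1, h2⟩ := hq.2 s hs'
    have h3 : α (e q.2, q.1) s ∈ e.target :=
      hrs (Metric.ball_subset_ball (by linarith) h2)
    have h4 : HasMFDerivAt 𝓘(ℝ, EuclideanSpace ℝ (Fin m)) (𝓡 m) e.symm (α (e q.2, q.1) s) _ :=
      (mdifferentiableAt_extChartAt_symm h3).hasMFDerivAt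
    have h5 := h4.comp s h1.hasFDerivAt.hasMFDerivAt
    refine HasMFDerivAt.hasMFDerivWithinAt ?_
    have h6 : V (α (e q.2, q.1) s) = coordVF x₀ X (α (e q.2, q.1) s) := by
      have := (eventually_nhdsSet_iff_forall.1 hg1 _
        (Metric.ball_subset_closedBall h2)).self_of_nhds
      simp [V, this]
    have h7 := mfderiv_symm_coordVF X h3
    rw [h6] at h5
    have h8 : (1 : ℝ →L[ℝ] ℝ).smulRight ((q.1 • X) (e.symm (α (e q.2, q.1) s))) =
        (mfderiv 𝓘(ℝ, EuclideanSpace ℝ (Fin m)) (𝓡 m) e.symm (α (e q.2, q.1) s)).comp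
        (ContinuousLinearMap.toSpanSingleton ℝ (q.1 • coordVF x₀ X (α (e q.2, q.1) s))) := by
      refine ContinuousLinearMap.ext_ring ?_
      have h9 := (mfderiv 𝓘(ℝ, EuclideanSpace ℝ (Fin m)) (𝓡 m) e.symm
        (α (e q.2, q.1) s)).map_smul q.1 (coordVF x₀ X (α (e q.2, q.1) s))
      rw [h7] at h9
      refine Eq.trans ?_ (h9.symm.trans ?_)
      · exact one_smul ℝ _
      · exact congrArg _ (one_smul ℝ _).symm
    exact h8 ▸ h5

/-! ### Global flows on a compact manifold -/

variable [CompactSpace M]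

/-- Compactness gives a positive existence time common to all starting points, and curves that can
always be prolonged by a fixed time exist for all times. -/
theorem exists_integralCurve (X : VF m M) (x : M) :
    ∃ γ : ℝ → M, γ 0 = x ∧ IsMIntegralCurve (I := 𝓡 m) γ (fun x => X x) := by
  have hX := contMDiff_vf X 1 (by simp)
  have : ∀ᶠ t in 𝓝 (0 : ℝ), ∀ y ∈ (univ : Set M), ∃ γ : ℝ → M, γ 0 = y ∧
      IsMIntegralCurveOn (I := 𝓡 m) γ (fun x => (t • X) x) (Ioo (-2) 2) := by
    refine isCompact_univ.eventually_forall_of_forall_eventually fun y _ => ?_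
    obtain ⟨β, -, h⟩ := exists_local_flow_manifold X y 1 one_ne_zero
    filter_upwards [h] with q hq
    exact ⟨β q, hq⟩
  obtain ⟨ε, hε, h⟩ := Metric.eventually_nhds_iff.1 this
  have hε2 := h (y := ε / 2) (by rw [Real.dist_0_eq_abs, abs_of_pos] <;> linarith)
  refine exists_isMIntegralCurve_of_isMIntegralCurveOn hX hε (fun y => ?_) x
  obtain ⟨γ, h0, hγ⟩ := hε2 y (mem_univ _)
  have hv : ((2 / ε) • fun x => ((ε / 2) • X) x) = fun x => X x := by
    funext x
    have : (2 / ε) * (ε / 2) = 1 := by field_simp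
    exact (smul_smul _ _ _).trans ((congrArg (· • X x) this).trans (one_smul _ _))
  -- Running a curve of `(ε / 2) X` at speed `2 / ε` gives a curve of `X`, and `(-2, 2)` becomes
  -- `(-ε, ε)`.
  refine ⟨_, ?_, hv ▸ ((hγ.comp_mul (2 / ε)).mono ?_)⟩
  · simpa using h0
  · intro t ht
    have : ε ≠ 0 := hε.ne'
    constructor
    · rw [mul_div_assoc', lt_div_iff₀ hε]; linarith [ht.1]
    · rw [mul_div_assoc', div_lt_iff₀ hε]; linarith [ht.2]

/-- The flow of a vector field, as a family of maps. -/
def flowFun (X : VF m M) (t : ℝ) (x : M) : M := (exists_integralCurve X x).choose t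

theorem flowFun_zero (X : VF m M) (x : M) : flowFun X 0 x = x :=
  (exists_integralCurve X x).choose_spec.1

theorem isMIntegralCurve_flowFun (X : VF m M) (x : M) :
    IsMIntegralCurve (I := 𝓡 m) (fun t => flowFun X t x) (fun x => X x) :=
  (exists_integralCurve X x).choose_spec.2

theorem eq_flowFun (X : VF m M) {γ : ℝ → M}
    (hγ : IsMIntegralCurve (I := 𝓡 m) γ (fun x => X x)) (t : ℝ) : γ t = flowFun X t (γ 0) :=
  congrFun (isMIntegralCurve_Ioo_eq_of_contMDiff_boundaryless (t₀ := 0) (contMDiff_vf X 1 (by simp))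
    hγ (isMIntegralCurve_flowFun X (γ 0)) (flowFun_zero X _).symm) t

theorem flowFun_add (X : VF m M) (s t : ℝ) (x : M) :
    flowFun X (s + t) x = flowFun X s (flowFun X t x) := by
  have := eq_flowFun X ((isMIntegralCurve_flowFun X x).comp_add t) s
  simpa using this

/-- By uniqueness of integral curves the global flow coincides with the smooth local one. The time
interval may depend on `n`, hence a finite order of differentiability. -/
theorem eventually_contMDiffAt_flowFun (X : VF m M) (n : ℕ) (hn : n ≠ 0) :
    ∀ᶠ t in 𝓝 (0 : ℝ), ∀ y ∈ (univ : Set M), ContMDiffAt (𝓘(ℝ, ℝ).prod (𝓡 m)) (𝓡 m) n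
      (fun q : ℝ × M => flowFun X q.1 q.2) (t, y) := by
  refine isCompact_univ.eventually_forall_of_forall_eventually fun y _ => ?_
  obtain ⟨β, h1, h⟩ := exists_local_flow_manifold X y n hn
  have : IsManifold (𝓡 m) n M := IsManifold.of_le (n := ∞) (by exact_mod_cast le_top)
  refine (contMDiffAt_iff_contMDiffAt_nhds (by simp)).1 ?_
  refine h1.congr_of_eventuallyEq ?_
  filter_upwards [h] with q hq
  have h2 : IsMIntegralCurve (I := 𝓡 m) ((fun t => flowFun X t q.2) ∘ (· * q.1))
    (fun x => (q.1 • X) x) := (isMIntegralCurve_flowFun X q.2).comp_mul q.1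
  have h3 := isMIntegralCurveOn_Ioo_eqOn_of_contMDiff_boundaryless (t₀ := 0) (by norm_num)
    (contMDiff_vf (q.1 • X) 1 (by simp)) hq.2 (h2.isMIntegralCurveOn _)
    (by simp [hq.1, flowFun_zero])
  have := h3 (x := 1) (by norm_num)
  simpa using this.symm

/-- Since the flow at time `t` is the square of the flow at time `t / 2`, regularity of order `n +
1` doubles its time interval at each step and so reaches all times; this is done for each finite
order separately. -/
theorem contMDiff_flowFun (X : VF m M) :
    ContMDiff (𝓘(ℝ, ℝ).prod (𝓡 m)) (𝓡 m) ∞ (fun q : ℝ × M => flowFun X q.1 q.2) := by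
  refine contMDiff_infty.2 fun n => ?_
  refine ContMDiff.of_le (n := ((n + 1 : ℕ) : WithTop ℕ∞)) ?_ (by exact_mod_cast Nat.le_succ n)
  obtain ⟨ε, hε, h⟩ := Metric.eventually_nhds_iff.1
    (eventually_contMDiffAt_flowFun X (n + 1) n.succ_ne_zero)
  have key : ∀ k : ℕ, ∀ q : ℝ × M, |q.1| < 2 ^ k * ε →
      ContMDiffAt (𝓘(ℝ, ℝ).prod (𝓡 m)) (𝓡 m) (n + 1 : ℕ)
        (fun q : ℝ × M => flowFun X q.1 q.2) q := by
    intro k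
    induction k with
    | zero => exact fun q hq => h (by simpa using hq) q.2 (mem_univ _)
    | succ k ih =>
      intro q hq
      have h0 : |q.1 / 2| < 2 ^ k * ε := by
        rw [abs_div, abs_two, div_lt_iff₀ two_pos]; rw [pow_succ] at hq; linarith
      have heq : (fun q : ℝ × M => flowFun X q.1 q.2) =
          (fun q : ℝ × M => flowFun X q.1 q.2) ∘
            fun q : ℝ × M => (q.1 / 2, flowFun X (q.1 / 2) q.2) := by
        funext q
        simp [← flowFun_add]
      have h1 : ContMDiffAt (𝓘(ℝ, ℝ).prod (𝓡 m)) 𝓘(ℝ, ℝ) (n + 1 : ℕ)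
          (fun q : ℝ × M => q.1 / 2) q := by
        have : ContMDiffAt 𝓘(ℝ, ℝ) 𝓘(ℝ, ℝ) (n + 1 : ℕ) (fun t : ℝ => t / 2) q.1 :=
          (contDiff_id.div_const 2).contMDiff.contMDiffAt
        exact this.comp q contMDiffAt_fst
      have h2 : ContMDiffAt (𝓘(ℝ, ℝ).prod (𝓡 m)) (𝓡 m) (n + 1 : ℕ)
          (fun q : ℝ × M => flowFun X (q.1 / 2) q.2) q :=
        (ih (q.1 / 2, q.2) h0).comp q (h1.prodMk contMDiffAt_snd)
      rw [heq]
      exact (ih (q.1 / 2, flowFun X (q.1 / 2) q.2) h0).comp q (h1.prodMk h2)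
  intro q
  obtain ⟨k, hk⟩ := pow_unbounded_of_one_lt (|q.1| / ε) one_lt_two
  exact key k q ((div_lt_iff₀ hε).1 hk)

/-- The flow of a vector field of a compact manifold, as a family of diffeomorphisms. -/
def flow (X : VF m M) (t : ℝ) : DiffM m M where
  toFun := flowFun X t
  invFun := flowFun X (-t)
  left_inv x := by rw [← flowFun_add]; simp [flowFun_zero]
  right_inv x := by rw [← flowFun_add]; simp [flowFun_zero]
  contMDiff_toFun := (contMDiff_flowFun X).comp (contMDiff_const.prodMk contMDiff_id)
  contMDiff_invFun := (contMDiff_flowFun X).comp (contMDiff_const.prodMk contMDiff_id)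

theorem flow_zero (X : VF m M) : flow X 0 = Diffeomorph.refl (𝓡 m) M ∞ :=
  Diffeomorph.ext fun x => flowFun_zero X x

theorem hasDerivAt_comp_integralCurve {X : VF m M} {γ : ℝ → M}
    (hγ : IsMIntegralCurve (I := 𝓡 m) γ (fun x => X x)) (f : SmoothFun m M) (t : ℝ) :
    HasDerivAt (fun s => f (γ s)) (dirD X f (γ t)) t := by
  have h := (f.mdifferentiableAt (x := γ t)).hasMFDerivAt.comp t (hγ t)
  set D : ℝ →L[ℝ] ℝ := (mfderiv (𝓡 m) 𝓘(ℝ, ℝ) f (γ t)).comp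
    ((1 : ℝ →L[ℝ] ℝ).smulRight (X (γ t))) with hD
  have h1 : HasFDerivAt (f ∘ γ) D t := hasMFDerivAt_iff_hasFDerivAt.1 h
  refine (HasFDerivAt.hasDerivAt h1).congr_deriv ?_
  exact congrArg (mvfderiv (𝓡 m) f (γ t)) (one_smul ℝ (X (γ t)))


/-! ## Limits of smooth functions -/

section Limit

variable [CompactSpace M]

/-- A smooth function as an element of the Banach space `C(M, ℝ)`. -/
def toC : SmoothFun m M →ₗ[ℝ] C(M, ℝ) where
  toFun f := ⟨f, f.contMDiff.continuous⟩
  map_add' _ _ := rfl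
  map_smul' _ _ := rfl

theorem toC_apply (f : SmoothFun m M) (x : M) : toC f x = f x := rfl

theorem toC_injective : Function.Injective (toC : SmoothFun m M →ₗ[ℝ] C(M, ℝ)) := fun f g h => by
  ext x; exact congrFun (congrArg DFunLike.coe h) x

theorem IsFrame.fderiv_chart {n : ℕ} {ξ : Fin n → SmoothFun m M} {F : Fin n → VF m M}
    (h : IsFrame ξ F) (p : M) (f : SmoothFun m M) {y : EuclideanSpace ℝ (Fin m)}
    (hy : y ∈ (extChartAt (𝓡 m) p).target) :
    fderiv ℝ (f ∘ (extChartAt (𝓡 m) p).symm) y = ∑ i, dirD (F i) f ((extChartAt (𝓡 m) p).symm y) •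
      fderiv ℝ (ξ i ∘ (extChartAt (𝓡 m) p).symm) y := by
  refine ContinuousLinearMap.ext fun v => ?_
  have h1 := mvfderiv_chart p f hy v
  have h2 := h.eq_sum _ (mfderiv 𝓘(ℝ, EuclideanSpace ℝ (Fin m)) (𝓡 m)
    (extChartAt (𝓡 m) p).symm y v)
  have h3 := congrArg (mvfderiv (𝓡 m) f ((extChartAt (𝓡 m) p).symm y)) h2
  rw [map_sum] at h3
  rw [h1, h3, _root_.sum_apply]
  refine Finset.sum_congr rfl fun i _ => ?_
  rw [map_smul, _root_.smul_apply, mvfderiv_chart p (ξ i) hy v, smul_eq_mul,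
    smul_eq_mul, mul_comm]
  rfl

/-- The chart differential of `u t` is a combination of its frame derivatives with fixed
coefficients, bounded near `y`. These differentials converge uniformly there, so the limit is
differentiable with the limiting differential. -/
theorem hasFDerivAt_chart_limit {n : ℕ} {ξ : Fin n → SmoothFun m M} {F : Fin n → VF m M}
    (h : IsFrame ξ F) {ι : Type*} {L : Filter ι} [NeBot L] {u : ι → SmoothFun m M} {K : C(M, ℝ)}
    {K' : Fin n → C(M, ℝ)} (hK : Tendsto (fun t => toC (u t)) L (𝓝 K))
    (hK' : ∀ i, Tendsto (fun t => toC (dirD (F i) (u t))) L (𝓝 (K' i))) (p : M)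
    {y : EuclideanSpace ℝ (Fin m)} (hy : y ∈ (extChartAt (𝓡 m) p).target) :
    HasFDerivAt (K ∘ (extChartAt (𝓡 m) p).symm) (∑ i, K' i ((extChartAt (𝓡 m) p).symm y) •
      fderiv ℝ (ξ i ∘ (extChartAt (𝓡 m) p).symm) y) y := by
  set e := extChartAt (𝓡 m) p with he
  have hcd : ∀ i, ContinuousAt (fderiv ℝ (ξ i ∘ e.symm)) y := fun i =>
    ((contDiffOn_comp_extChartAt_symm p (ξ i)).continuousOn_fderiv_of_isOpen
      (isOpen_extChartAt_target p) (by simp)).continuousAt (extChartAt_target_mem_nhds_of_mem hy)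
  have hbd : ∀ᶠ z in 𝓝 y, z ∈ e.target ∧ ∀ i, ‖fderiv ℝ (ξ i ∘ e.symm) z‖ <
      ‖fderiv ℝ (ξ i ∘ e.symm) y‖ + 1 := by
    refine Filter.Eventually.and (extChartAt_target_mem_nhds_of_mem hy) ?_
    exact Filter.eventually_all.2 fun i => (hcd i).norm.eventually_lt continuousAt_const
      (by linarith)
  obtain ⟨s, hs, hso, hys⟩ := eventually_nhds_iff.1 hbd
  refine hasFDerivAt_of_tendstoUniformlyOn (l := L) (f := fun t => u t ∘ e.symm)
    (g' := fun z => ∑ i, K' i (e.symm z) • fderiv ℝ (ξ i ∘ e.symm) z)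
    (f' := fun t z => ∑ i, toC (dirD (F i) (u t)) (e.symm z) • fderiv ℝ (ξ i ∘ e.symm) z) hso ?_ ?_
    ?_ hys
  · rw [Metric.tendstoUniformlyOn_iff]
    intro ε hε
    have h0 : Tendsto (fun t => ∑ i, ‖K' i - toC (dirD (F i) (u t))‖ *
        (‖fderiv ℝ (ξ i ∘ e.symm) y‖ + 1)) L (𝓝 0) := by
      rw [show (0 : ℝ) = ∑ i : Fin n, ‖K' i - K' i‖ * (‖fderiv ℝ (ξ i ∘ e.symm) y‖ + 1) by simp]
      exact tendsto_finsetSum _ fun i _ => ((tendsto_const_nhds.sub (hK' i)).norm).mul_const _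
    filter_upwards [h0.eventually_lt_const hε] with t ht z hz
    refine lt_of_le_of_lt ?_ ht
    rw [dist_eq_norm, ← Finset.sum_sub_distrib]
    refine (norm_sum_le _ _).trans (Finset.sum_le_sum fun i _ => ?_)
    rw [← sub_smul, norm_smul]
    exact mul_le_mul ((K' i - toC (dirD (F i) (u t))).norm_coe_le_norm (e.symm z))
      ((hs z hz).2 i).le (norm_nonneg _) (norm_nonneg _)
  · intro t z hz
    have h1 : DifferentiableAt ℝ (u t ∘ e.symm) z :=
      ((contDiffOn_comp_extChartAt_symm p (u t)).contDiffAt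
        (extChartAt_target_mem_nhds_of_mem (hs z hz).1)).differentiableAt (by simp)
    have := h1.hasFDerivAt
    rwa [h.fderiv_chart p (u t) (hs z hz).1] at this
  · intro z _
    exact ((continuous_eval_const (e.symm z)).tendsto K).comp hK

/-- The limit `K l` has chart differential built from the limits `K (F i :: l)`, so induction on the
order makes every `K l` smooth. The frame expansion of a general `X` passes to the limit and
identifies `K (X :: l)` with the derivative of `K l`. -/
theorem exists_smoothFun_limit {ι : Type*} {L : Filter ι} [NeBot L] {u : ι → SmoothFun m M}
    {K : List (VF m M) → C(M, ℝ)}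
    (hK : ∀ l, Tendsto (fun t => toC (iterD l (u t))) L (𝓝 (K l))) :
    ∃ k : SmoothFun m M, ∀ l, toC (iterD l k) = K l := by
  obtain ⟨n, ξ, F, h⟩ := exists_isFrame m M
  have hder : ∀ l p {y}, y ∈ (extChartAt (𝓡 m) p).target →
      HasFDerivAt (K l ∘ (extChartAt (𝓡 m) p).symm)
        (∑ i, K (F i :: l) ((extChartAt (𝓡 m) p).symm y) •
        fderiv ℝ (ξ i ∘ (extChartAt (𝓡 m) p).symm) y) y := fun l p y hy =>
    hasFDerivAt_chart_limit h (hK l) (fun i => hK (F i :: l)) p hy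
  have hcd : ∀ p : M, ∀ k : ℕ, ∀ l, ContDiffOn ℝ k (K l ∘ (extChartAt (𝓡 m) p).symm)
      (extChartAt (𝓡 m) p).target := by
    intro p k
    induction k with
    | zero =>
      exact fun l => contDiffOn_zero.2 ((K l).continuous.comp_continuousOn
        (continuousOn_extChartAt_symm p))
    | succ k ih =>
      intro l
      push_cast
      rw [contDiffOn_succ_iff_fderiv_of_isOpen (isOpen_extChartAt_target p)]
      refine ⟨fun y hy => (hder l p hy).differentiableAt.differentiableWithinAt, by simp, ?_⟩
      refine ContDiffOn.congr (f := fun y => ∑ i, K (F i :: l) ((extChartAt (𝓡 m) p).symm y) •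
        fderiv ℝ (ξ i ∘ (extChartAt (𝓡 m) p).symm) y) ?_ fun y hy => (hder l p hy).fderiv
      refine ContDiffOn.sum fun i _ => (ih (F i :: l)).smul ?_
      exact (contDiffOn_comp_extChartAt_symm p (ξ i)).fderiv_of_isOpen
        (isOpen_extChartAt_target p) (by exact_mod_cast le_top)
  have hsm : ∀ l, ContMDiff (𝓡 m) 𝓘(ℝ, ℝ) ∞ (K l) := by
    intro l x
    rw [contMDiffAt_iff_source]
    have h1 : ContDiffOn ℝ ∞ (K l ∘ (extChartAt (𝓡 m) x).symm) (extChartAt (𝓡 m) x).target :=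
      contDiffOn_infty.2 fun k => hcd x k l
    exact (h1.contDiffAt (extChartAt_target_mem_nhds_of_mem
      (mem_extChartAt_target x))).contMDiffAt.contMDiffWithinAt
  have hex : ∀ l, ∃ k : SmoothFun m M, toC k = K l := fun l => ⟨⟨K l, hsm l⟩, rfl⟩
  choose k hk using hex
  have hk' : ∀ l, (k l : M → ℝ) = K l := fun l => congrArg DFunLike.coe (hk l)
  refine ⟨k [], fun l => ?_⟩
  induction l with
  | nil => exact hk []
  | cons X l ih =>
    have h1 : iterD l (k []) = k l := toC_injective (ih.trans (hk l).symm)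
    have hF : ∀ (i : Fin n) (x : M), dirD (F i) (k l) x =
        K (F i :: l) x := by
      intro i x
      have hx := mem_extChartAt_target (I := 𝓡 m) x
      have h2 := dirD_chart (F i) (k l) hx
      rw [extChartAt_to_inv] at h2
      rw [h2, hk', (hder l x hx).fderiv]
      have h3 : ∀ t, dirD (F i) (iterD l (u t)) x =
          ∑ j, dirD (F i) (ξ j) x * dirD (F j) (iterD l (u t)) x := by
        intro t
        rw [h.dirD_eq (F i) (iterD l (u t)), smoothFun_sum_apply]; rfl
      have h4 : Tendsto (fun t => dirD (F i) (iterD l (u t)) x) L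
          (𝓝 (∑ j, dirD (F i) (ξ j) x * K (F j :: l) x)) := by
        simp only [h3]
        exact tendsto_finsetSum _ fun j _ => ((((continuous_eval_const x).tendsto _).comp
          (hK (F j :: l)))).const_mul _
      have h5 := tendsto_nhds_unique h4 (show Tendsto _ L (𝓝 (K (F i :: l) x)) from
        (((continuous_eval_const x).tendsto (K (F i :: l))).comp (hK (F i :: l))))
      rw [← h5, _root_.sum_apply]
      refine Finset.sum_congr rfl fun j _ => ?_
      rw [extChartAt_to_inv, _root_.smul_apply, smul_eq_mul, mul_comm]
      congr 1
      have := dirD_chart (F i) (ξ j) hx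
      rw [extChartAt_to_inv] at this
      exact this.symm
    ext x
    show dirD X (iterD l (k [])) x = _
    rw [h1, h.dirD_eq X, smoothFun_sum_apply]
    have h3 : ∀ t, toC (iterD (X :: l) (u t)) x =
        ∑ j, dirD X (ξ j) x * dirD (F j) (iterD l (u t)) x := by
      intro t
      show dirD X (iterD l (u t)) x = _
      rw [h.dirD_eq X (iterD l (u t)), smoothFun_sum_apply]; rfl
    have h4 : Tendsto (fun t => toC (iterD (X :: l) (u t)) x) L
        (𝓝 (∑ j, dirD X (ξ j) x * K (F j :: l) x)) := by
      simp only [h3]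
      exact tendsto_finsetSum _ fun j _ => ((((continuous_eval_const x).tendsto _).comp
        (hK (F j :: l)))).const_mul _
    have h5 := tendsto_nhds_unique h4 (((continuous_eval_const x).tendsto _).comp (hK (X :: l)))
    rw [← h5]
    refine Finset.sum_congr rfl fun j _ => ?_
    rw [← hF j x]; rfl

/-- `k` is the derivative of `G` at `t₀` in the topology of `C^∞(M)`. -/
def HasCInfDerivAt (G : ℝ → SmoothFun m M) (k : SmoothFun m M) (t₀ : ℝ) : Prop :=
  ∀ l, HasDerivAt (fun t => toC (iterD l (G t))) (toC (iterD l k)) t₀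

/-- The difference quotients converge together with all their derivatives, so the separate uniform
limits come from one smooth function. -/
theorem exists_hasCInfDerivAt {G : ℝ → SmoothFun m M} {t₀ : ℝ}
    (h : ∀ l, ∃ K : C(M, ℝ), HasDerivAt (fun t => toC (iterD l (G t))) K t₀) :
    ∃ k, HasCInfDerivAt G k t₀ := by
  choose K hK using h
  obtain ⟨k, hk⟩ := exists_smoothFun_limit (L := 𝓝[≠] t₀)
    (u := fun t => (t - t₀)⁻¹ • (G t - G t₀)) (K := K) fun l => by
      refine (hasDerivAt_iff_tendsto_slope.1 (hK l)).congr fun t => ?_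
      rw [map_smul, map_sub, map_smul, map_sub]; rfl
  exact ⟨k, fun l => (hk l) ▸ hK l⟩

theorem HasCInfDerivAt.hasDerivAt {G : ℝ → SmoothFun m M} {k : SmoothFun m M} {t₀ : ℝ}
    (h : HasCInfDerivAt G k t₀) (x : M) : HasDerivAt (fun t => G t x) (k x) t₀ := by
  have h1 : HasFDerivAt (fun f : C(M, ℝ) => f x) (ContinuousMap.evalCLM ℝ x) (toC (G t₀)) :=
    (ContinuousMap.evalCLM ℝ x : C(M, ℝ) →L[ℝ] ℝ).hasFDerivAt
  exact h1.comp_hasDerivAt t₀ (h [])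

end Limit


/-! ## Smooth families of functions -/

section UniformDeriv

/-- By compactness `g' s` is uniformly close to `D` for `s` near `t`. The mean value inequality for
`r ↦ g r x - r * D x` then bounds the remainder uniformly in `x`. -/
theorem hasDerivAt_continuousMap_of_continuousAt {K : Type*} [TopologicalSpace K] [CompactSpace K]
    {g : ℝ → C(K, ℝ)} {g' : ℝ → K → ℝ} {t : ℝ} {D : C(K, ℝ)}
    (hder : ∀ᶠ s in 𝓝 t, ∀ x, HasDerivAt (fun r => g r x) (g' s x) s)
    (hcont : ∀ x, ContinuousAt (fun q : ℝ × K => g' q.1 q.2) (t, x)) (hD : ∀ x, D x = g' t x) :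
    HasDerivAt g D t := by
  rw [hasDerivAt_iff_isLittleO, Asymptotics.isLittleO_iff]
  intro ε hε
  have h1 : ∀ᶠ s in 𝓝 t, ∀ x ∈ (univ : Set K), |g' s x - D x| < ε := by
    refine isCompact_univ.eventually_forall_of_forall_eventually fun x _ => ?_
    have h2 : ContinuousAt (fun q : ℝ × K => |g' q.1 q.2 - D q.2|) (t, x) :=
      ((hcont x).sub (D.continuous.continuousAt.comp continuousAt_snd)).abs
    exact h2.eventually_lt continuousAt_const (by simpa [hD] using hε)
  obtain ⟨δ, hδ, h⟩ := Metric.eventually_nhds_iff_ball.1 (h1.and hder)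
  filter_upwards [Metric.ball_mem_nhds t hδ] with s hs
  rw [ContinuousMap.norm_le _ (by positivity)]
  intro x
  have h3 := (convex_ball t δ).norm_image_sub_le_of_norm_hasDerivWithin_le
    (f := fun r => g r x - r * D x) (f' := fun r => g' r x - D x) (C := ε)
    (fun r hr => (((h r hr).2 x).sub ((hasDerivAt_id r).mul_const (D x))).hasDerivWithinAt.congr_deriv
      (by simp)) (fun r hr => ((h r hr).1 x (mem_univ _)).le) (Metric.mem_ball_self hδ) hs
  refine le_trans (le_of_eq ?_) h3
  congr 1
  simp only [ContinuousMap.sub_apply, ContinuousMap.smul_apply, smul_eq_mul]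
  ring

end UniformDeriv

section SmoothPath

/-- A family of functions depending smoothly on a real parameter. -/
def IsSmoothPath (G : ℝ → SmoothFun m M) : Prop :=
  ContMDiff (𝓘(ℝ, ℝ).prod (𝓡 m)) 𝓘(ℝ, ℝ) ∞ fun q : ℝ × M => G q.1 q.2

theorem IsSmoothPath.contDiffOn_chart {G : ℝ → SmoothFun m M} (h : IsSmoothPath G) (p : M) :
    ContDiffOn ℝ ∞ (fun z : ℝ × EuclideanSpace ℝ (Fin m) =>
      G z.1 ((extChartAt (𝓡 m) p).symm z.2)) (univ ×ˢ (extChartAt (𝓡 m) p).target) := by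
  rw [← contMDiffOn_iff_contDiffOn]
  refine ContMDiff.comp_contMDiffOn (g := fun q : ℝ × M => G q.1 q.2) (I' := 𝓘(ℝ, ℝ).prod (𝓡 m)) h
    (ContMDiffOn.prodMk (f := fun z : ℝ × EuclideanSpace ℝ (Fin m) => z.1)
    (g := fun z : ℝ × EuclideanSpace ℝ (Fin m) => (extChartAt (𝓡 m) p).symm z.2) ?_ ?_)
  · exact contDiff_fst.contMDiff.contMDiffOn
  · exact (contMDiffOn_extChartAt_symm p).comp contDiff_snd.contMDiff.contMDiffOn fun z hz => hz.2

theorem contMDiffAt_prod_of_chart {H : ℝ × M → ℝ} {q : ℝ × M}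
    {K : ℝ × EuclideanSpace ℝ (Fin m) → ℝ}
    (hK : ContDiffAt ℝ ∞ K (q.1, extChartAt (𝓡 m) q.2 q.2))
    (h : ∀ᶠ z in 𝓝 q, H z = K (z.1, extChartAt (𝓡 m) q.2 z.2)) :
    ContMDiffAt (𝓘(ℝ, ℝ).prod (𝓡 m)) 𝓘(ℝ, ℝ) ∞ H q := by
  refine ContMDiffAt.congr_of_eventuallyEq ?_ h
  have h1 : ContMDiffAt (𝓘(ℝ, ℝ).prod (𝓡 m)) 𝓘(ℝ, ℝ × EuclideanSpace ℝ (Fin m)) ∞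
      (fun z : ℝ × M => (z.1, extChartAt (𝓡 m) q.2 z.2)) q := by
    refine ContMDiffAt.prodMk_space contMDiffAt_fst ?_
    exact (contMDiffAt_extChartAt (I := 𝓡 m) (x := q.2) (n := ∞)).comp q contMDiffAt_snd
  exact ContMDiffAt.comp q (g := K) (I' := 𝓘(ℝ, ℝ × EuclideanSpace ℝ (Fin m)))
    hK.contMDiffAt h1

theorem univ_prod_target_mem_nhds {p : M} {t : ℝ} {y : EuclideanSpace ℝ (Fin m)}
    (hy : y ∈ (extChartAt (𝓡 m) p).target) :
    (univ : Set ℝ) ×ˢ (extChartAt (𝓡 m) p).target ∈ 𝓝 (t, y) :=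
  prod_mem_nhds univ_mem (extChartAt_target_mem_nhds_of_mem hy)

theorem IsSmoothPath.hasFDerivAt_chart {G : ℝ → SmoothFun m M} (h : IsSmoothPath G) (p : M) (t : ℝ)
    {y : EuclideanSpace ℝ (Fin m)} (hy : y ∈ (extChartAt (𝓡 m) p).target) :
    HasFDerivAt (fun z : ℝ × EuclideanSpace ℝ (Fin m) => G z.1 ((extChartAt (𝓡 m) p).symm z.2))
      (fderiv ℝ (fun z : ℝ × EuclideanSpace ℝ (Fin m) =>
        G z.1 ((extChartAt (𝓡 m) p).symm z.2)) (t, y)) (t, y) :=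
  (((h.contDiffOn_chart p).contDiffAt (univ_prod_target_mem_nhds hy)).differentiableAt
    (by simp)).hasFDerivAt

theorem IsSmoothPath.contDiffAt_fderiv_chart {G : ℝ → SmoothFun m M} (h : IsSmoothPath G) (p : M)
    (t : ℝ) {y : EuclideanSpace ℝ (Fin m)} (hy : y ∈ (extChartAt (𝓡 m) p).target) :
    ContDiffAt ℝ ∞ (fderiv ℝ (fun z : ℝ × EuclideanSpace ℝ (Fin m) =>
        G z.1 ((extChartAt (𝓡 m) p).symm z.2))) (t, y) :=
  ((h.contDiffOn_chart p).contDiffAt (univ_prod_target_mem_nhds hy)).fderiv_right (by simp)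

theorem IsSmoothPath.dirD {G : ℝ → SmoothFun m M} (h : IsSmoothPath G) (X : VF m M) :
    IsSmoothPath fun t => dirD X (G t) := by
  intro q
  have hq := mem_extChartAt_target (I := 𝓡 m) q.2
  refine contMDiffAt_prod_of_chart (K := fun z => fderiv ℝ (fun z : ℝ × EuclideanSpace ℝ (Fin m) =>
        G z.1 ((extChartAt (𝓡 m) q.2).symm z.2)) z (0, coordVF q.2 X z.2)) ?_ ?_
  · refine (h.contDiffAt_fderiv_chart q.2 q.1 hq).clm_apply (contDiffAt_const.prodMk ?_)
    exact ((contDiffOn_coordVF q.2 X).contDiffAt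
      (extChartAt_target_mem_nhds_of_mem hq)).comp (q.1, extChartAt (𝓡 m) q.2 q.2) contDiffAt_snd
  · filter_upwards [continuousAt_snd.eventually (extChartAt_source_mem_nhds (I := 𝓡 m) q.2)]
      with z hz
    have hz' := (extChartAt (𝓡 m) q.2).map_source hz
    have h1 := dirD_chart X (G z.1) hz'
    rw [(extChartAt (𝓡 m) q.2).left_inv hz] at h1
    rw [h1]
    have h2 := (h.hasFDerivAt_chart q.2 z.1 hz').comp (extChartAt (𝓡 m) q.2 z.2)
      (hasFDerivAt_prodMk_right z.1 (extChartAt (𝓡 m) q.2 z.2))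
    have h3 : fderiv ℝ (G z.1 ∘ (extChartAt (𝓡 m) q.2).symm) (extChartAt (𝓡 m) q.2 z.2) = _ :=
      h2.fderiv
    rw [h3]
    simp

theorem IsSmoothPath.iterD {G : ℝ → SmoothFun m M} (h : IsSmoothPath G) (l : List (VF m M)) :
    IsSmoothPath fun t => iterD l (G t) := by
  induction l with
  | nil => exact h
  | cons X l ih => exact ih.dirD X

theorem IsSmoothPath.contMDiff_deriv {G : ℝ → SmoothFun m M} (h : IsSmoothPath G) :
    (∀ t x, HasDerivAt (fun s => G s x) (deriv (fun s => G s x) t) t) ∧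
      ContMDiff (𝓘(ℝ, ℝ).prod (𝓡 m)) 𝓘(ℝ, ℝ) ∞ fun q : ℝ × M => deriv (fun s => G s q.2) q.1 := by
  have key : ∀ p : M, ∀ t, ∀ x ∈ (extChartAt (𝓡 m) p).source,
      HasDerivAt (fun s => G s x) (fderiv ℝ (fun z : ℝ × EuclideanSpace ℝ (Fin m) =>
        G z.1 ((extChartAt (𝓡 m) p).symm z.2)) (t, extChartAt (𝓡 m) p x) (1, 0)) t := by
    intro p t x hx
    have h2 := HasFDerivAt.comp (f := fun s : ℝ => (s, extChartAt (𝓡 m) p x)) t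
      (h.hasFDerivAt_chart p t ((extChartAt (𝓡 m) p).map_source hx))
      (hasFDerivAt_prodMk_left t (extChartAt (𝓡 m) p x))
    have h3 := h2.hasDerivAt
    simp only [ContinuousLinearMap.comp_apply, ContinuousLinearMap.inl_apply] at h3
    refine h3.congr_of_eventuallyEq (Eventually.of_forall fun s => ?_)
    exact congrArg (G s) ((extChartAt (𝓡 m) p).left_inv hx).symm
  refine ⟨fun t x => (key x t x (mem_extChartAt_source x)).differentiableAt.hasDerivAt, fun q => ?_⟩
  have hq := mem_extChartAt_target (I := 𝓡 m) q.2
  refine contMDiffAt_prod_of_chart (K := fun z => fderiv ℝ (fun z : ℝ × EuclideanSpace ℝ (Fin m) =>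
        G z.1 ((extChartAt (𝓡 m) q.2).symm z.2)) z (1, 0)) ?_ ?_
  · exact (h.contDiffAt_fderiv_chart q.2 q.1 hq).clm_apply contDiffAt_const
  · filter_upwards [continuousAt_snd.eventually (extChartAt_source_mem_nhds (I := 𝓡 m) q.2)]
      with z hz
    exact (key q.2 z.1 z.2 hz).deriv

/-- Each iterated space derivative of the family is again jointly smooth, so its pointwise time
derivative is a derivative in the supremum norm. -/
theorem IsSmoothPath.exists_deriv [CompactSpace M] {G : ℝ → SmoothFun m M} (h : IsSmoothPath G) :
    ∃ G' : ℝ → SmoothFun m M, IsSmoothPath G' ∧ ∀ t, HasCInfDerivAt G (G' t) t := by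
  obtain ⟨h1, h2⟩ := h.contMDiff_deriv
  refine ⟨fun t => ⟨fun x => deriv (fun s => G s x) t,
    h2.comp (contMDiff_const.prodMk contMDiff_id)⟩, h2, fun t => ?_⟩
  obtain ⟨k, hk⟩ := exists_hasCInfDerivAt (G := G) (t₀ := t) fun l => by
    obtain ⟨h3, h4⟩ := (h.iterD l).contMDiff_deriv
    refine ⟨⟨fun x => deriv (fun s => WassersteinDiff.iterD l (G s) x) t,
      h4.continuous.comp (Continuous.prodMk continuous_const continuous_id)⟩, ?_⟩
    exact hasDerivAt_continuousMap_of_continuousAt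
      (g' := fun t x => deriv (fun s => WassersteinDiff.iterD l (G s) x) t)
      (Eventually.of_forall fun s x => h3 s x) (fun x => h4.continuous.continuousAt) fun x => rfl
  have hk' : (⟨fun x => deriv (fun s => G s x) t,
      h2.comp (contMDiff_const.prodMk contMDiff_id)⟩ : SmoothFun m M) = k :=
    ContMDiffMap.ext fun x => (h1 t x).unique (hk.hasDerivAt x)
  show HasCInfDerivAt G (⟨fun x => deriv (fun s => G s x) t,
      h2.comp (contMDiff_const.prodMk contMDiff_id)⟩ : SmoothFun m M) t
  rw [hk']
  exact hk

end SmoothPath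

/-! ### Smooth paths of diffeomorphisms -/

section Diff

variable [CompactSpace M]

/-- `c` is a smooth path in the group of diffeomorphisms, through `φ` at time `0` with
velocity `A ∘ φ`. -/
structure IsPathD (c : ℝ → DiffM m M) (φ : DiffM m M) (A : VF m M) : Prop where
  smooth : ContMDiff (𝓘(ℝ, ℝ).prod (𝓡 m)) (𝓡 m) ∞ (fun q : ℝ × M => c q.1 q.2)
  zero : c 0 = φ
  velocity : ∀ (x : M) (f : SmoothFun m M), HasDerivAt (fun t => f (c t x)) (dirD A f (φ x)) 0

theorem IsPathD.isSmoothPath {c : ℝ → DiffM m M} {φ : DiffM m M} {A : VF m M} (h : IsPathD c φ A)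
    (f : SmoothFun m M) : IsSmoothPath fun t => compDiff f (c t) :=
  f.contMDiff.comp h.smooth

theorem IsPathD.hasCInfDerivAt {c : ℝ → DiffM m M} {φ : DiffM m M} {A : VF m M}
    (h : IsPathD c φ A) (f : SmoothFun m M) :
    HasCInfDerivAt (fun t => compDiff f (c t)) (compDiff (dirD A f) φ) 0 := by
  obtain ⟨G', -, h2⟩ := (h.isSmoothPath f).exists_deriv
  convert h2 0 using 1
  ext x
  exact (h.velocity x f).unique ((h2 0).hasDerivAt x)

/-- Provides a path with any prescribed velocity. `HasLieDerivD` quantifies over all such paths, so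
it would not determine a value without one. -/
theorem isPathD_flow (A : VF m M) (φ : DiffM m M) : IsPathD (fun t => φ.trans (flow A t)) φ A where
  smooth := (contMDiff_flowFun A).comp (contMDiff_fst.prodMk (φ.contMDiff.comp contMDiff_snd))
  zero := by rw [flow_zero]; exact Diffeomorph.ext fun x => rfl
  velocity x f := by
    have := hasDerivAt_comp_integralCurve (isMIntegralCurve_flowFun A (φ x)) f 0
    rwa [flowFun_zero] at this

end Diff


/-! ## Differentiation along paths of diffeomorphisms -/

section PathDerivative

variable [RiemannianBundle (fun x : M => TangentSpace (𝓡 m) x)]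
  [IsContMDiffRiemannianBundle (𝓡 m) ∞ (EuclideanSpace ℝ (Fin m))
    (fun x : M => TangentSpace (𝓡 m) x)]
  [MeasurableSpace M] [BorelSpace M] [CompactSpace M]

theorem ofSmooth_coe {N : ℕ} (ι : Fin N → SmoothFun m M) (s : ℕ) (f : SmoothFun m M)
    (α : MultiIdx N s) : (Sobolev.ofSmooth ι s f).1 α =
      ContinuousMap.toLp 2 (vol m M) ℝ (toC (iterD (List.ofFn fun i => grad (ι (α.2 i))) f)) := rfl

/-- A smooth function as an element of `H^s(M)`, as a linear map. -/
def ofSmoothL {N : ℕ} (ι : Fin N → SmoothFun m M) (s : ℕ) : SmoothFun m M →ₗ[ℝ] Sobolev ι s where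
  toFun f := Sobolev.ofSmooth ι s f
  map_add' f g := Subtype.ext (map_add (sobolevJet ι s) f g)
  map_smul' r f := Subtype.ext (map_smul (sobolevJet ι s) r f)

theorem HasCInfDerivAt.ofSmooth {G : ℝ → SmoothFun m M} {k : SmoothFun m M} {t : ℝ}
    (h : HasCInfDerivAt G k t) {N : ℕ} (ι : Fin N → SmoothFun m M) (s : ℕ) :
    HasDerivAt (fun t => Sobolev.ofSmooth ι s (G t)) (Sobolev.ofSmooth ι s k) t := by
  have h1 : HasDerivAt (fun t => (Sobolev.ofSmooth ι s (G t)).1) (Sobolev.ofSmooth ι s k).1 t := by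
    refine hasDerivAt_pi.2 fun α => ?_
    simp only [ofSmooth_coe]
    exact (ContinuousMap.toLp 2 (vol m M) ℝ : C(M, ℝ) →L[ℝ] Lp ℝ 2 (vol m M)).hasFDerivAt.comp_hasDerivAt
      t (h (List.ofFn fun i => grad (ι (α.2 i))))
  rw [hasDerivAt_iff_tendsto_slope] at h1 ⊢
  rw [tendsto_subtype_rng]
  exact h1

theorem inclD_mem_DSob {N : ℕ} (ι : Fin N → SmoothFun m M) (j : ℕ) (φ : DiffM m M) :
    inclD ι j φ ∈ DSob ι j := by
  have h : ∀ (ψ : DiffM m M) (i : Fin N), ((inclD ι j ψ i).toLp : M → ℝ) =ᵐ[vol m M]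
      fun x => ι i (ψ x) := fun ψ i =>
    ContinuousMap.coeFn_toLp (p := 2) (𝕜 := ℝ) (vol m M) (toC (compDiff (ι i) ψ))
  exact ⟨φ.toHomeomorph, h φ, inclD ι j φ.symm, h φ.symm⟩

/-- The velocity at `φ` of a path in the Sobolev space. -/
def velD {N : ℕ} (ι : Fin N → SmoothFun m M) (s : ℕ) (φ : DiffM m M) (A : VF m M) :
    Fin N → Sobolev ι s :=
  fun i => Sobolev.ofSmooth ι s (compDiff (dirD A (ι i)) φ)

theorem IsPathD.hasDerivAt_inclD {c : ℝ → DiffM m M} {φ : DiffM m M} {A : VF m M}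
    (h : IsPathD c φ A) {N : ℕ} (ι : Fin N → SmoothFun m M) (s : ℕ) :
    HasDerivAt (fun t => inclD ι s (c t)) (velD ι s φ A) 0 :=
  hasDerivAt_pi.2 fun i => (h.hasCInfDerivAt (ι i)).ofSmooth ι s

theorem IsPathD.exists_continuous_deriv_inclD {c : ℝ → DiffM m M} {φ : DiffM m M} {A : VF m M}
    (h : IsPathD c φ A) {N : ℕ} (ι : Fin N → SmoothFun m M) (s : ℕ) :
    ∃ V : ℝ → Fin N → Sobolev ι s, Continuous V ∧
      ∀ t, HasDerivAt (fun t => inclD ι s (c t)) (V t) t := by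
  have h1 := fun i => (h.isSmoothPath (ι i)).exists_deriv
  choose G' hG hd using h1
  refine ⟨fun t i => Sobolev.ofSmooth ι s (G' i t), continuous_pi fun i => ?_, fun t =>
    hasDerivAt_pi.2 fun i => (hd i t).ofSmooth ι s⟩
  obtain ⟨G'', -, h2⟩ := (hG i).exists_deriv
  exact continuous_iff_continuousAt.2 fun t => ((h2 t).ofSmooth ι s).continuousAt

/-- Chain rule through the extension to the Sobolev space. The derivative depends on the path only
through its velocity, so one `K` serves all paths; joint continuity makes the derivative uniform in
`x`. -/
theorem IsC0kD.exists_hasDerivAt {F : DiffM m M → SmoothFun m M}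
    (hF : IsC0kD 1 fun x φ => F φ x) (φ : DiffM m M) (A : VF m M) :
    ∃ K : C(M, ℝ), ∀ c : ℝ → DiffM m M, IsPathD c φ A →
      HasDerivAt (fun t => toC (F (c t))) K 0 := by
  obtain ⟨N, ι, -, hs⟩ := hF
  -- Any order above `m / 2` would do: a single extension is enough.
  obtain ⟨j, -, U, hU, hDU, Ψ, hΨ, hΨc, hΨF⟩ := hs (m + 1) (by omega)
  have hmem : ∀ ψ, inclD ι j ψ ∈ U := fun ψ => hDU (inclD_mem_DSob ι j ψ)
  have hc1 := hΨc 1 le_rfl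
  refine ⟨⟨fun x => iteratedFDeriv ℝ 1 (Ψ x) (inclD ι j φ) fun _ => velD ι j φ A, ?_⟩,
    fun c hc => ?_⟩
  · have h1 : Continuous fun x => iteratedFDeriv ℝ 1 (Ψ x) (inclD ι j φ) :=
      hc1.comp_continuous (f := fun x => (x, inclD ι j φ)) (by fun_prop)
        fun x => ⟨mem_univ _, hmem φ⟩
    exact h1.eval continuous_const
  · obtain ⟨V, hV, hd⟩ := hc.exists_continuous_deriv_inclD ι j
    have hV0 : V 0 = velD ι j φ A := (hd 0).unique (hc.hasDerivAt_inclD ι j)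
    have hcc : Continuous fun t => inclD ι j (c t) :=
      continuous_iff_continuousAt.2 fun t => (hd t).continuousAt
    refine hasDerivAt_continuousMap_of_continuousAt (g' := fun t x =>
      iteratedFDeriv ℝ 1 (Ψ x) (inclD ι j (c t)) fun _ => V t)
      (Eventually.of_forall fun t x => ?_) (fun x => ?_) fun x => ?_
    · have h1 : HasFDerivAt (Ψ x) (fderiv ℝ (Ψ x) (inclD ι j (c t))) (inclD ι j (c t)) :=
        (((hΨ x).contDiffAt (hU.mem_nhds (hmem _))).differentiableAt (by simp)).hasFDerivAt
      have h2 := h1.comp_hasDerivAt t (hd t)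
      rw [iteratedFDeriv_one_apply]
      refine h2.congr_of_eventuallyEq (Eventually.of_forall fun s => ?_)
      exact (hΨF x (c s)).symm
    · have h1 : Continuous fun q : ℝ × M => iteratedFDeriv ℝ 1 (Ψ q.2) (inclD ι j (c q.1)) :=
        hc1.comp_continuous (f := fun q : ℝ × M => (q.2, inclD ι j (c q.1)))
          (continuous_snd.prodMk (hcc.comp continuous_fst))
          fun q => ⟨mem_univ _, hmem _⟩
      exact (h1.eval (by fun_prop)).continuousAt
    · simp only [hV0, hc.zero]; rfl

theorem IsCInfkD.exists_hasCInfDerivAt {F : DiffM m M → SmoothFun m M} (hF : IsCInfkD 1 F)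
    (φ : DiffM m M) (A : VF m M) :
    ∃ k, ∀ c : ℝ → DiffM m M, IsPathD c φ A → HasCInfDerivAt (fun t => F (c t)) k 0 := by
  have h1 := fun l => (hF l).exists_hasDerivAt φ A (F := fun φ => iterD l (F φ))
  choose K hK using h1
  obtain ⟨k, hk⟩ := WassersteinDiff.exists_hasCInfDerivAt fun l => ⟨K l, hK l _ (isPathD_flow A φ)⟩
  refine ⟨k, fun c hc l => ?_⟩
  rw [(hk l).unique (hK l _ (isPathD_flow A φ))]
  exact hK l c hc

end PathDerivative


/-! ### Second derivatives and Lie brackets on the diffeomorphism group -/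

section SecondDeriv

variable {V : Type*} [NormedAddCommGroup V] [NormedSpace ℝ V]

/-- The second derivative `D²Ψ(p)(v, w)`. -/
def secondDeriv (Ψ : V → ℝ) (p v w : V) : ℝ := fderiv ℝ (fderiv ℝ Ψ) p v w

theorem secondDeriv_comm {Ψ : V → ℝ} {p : V} (h : ContDiffAt ℝ 2 Ψ p) (v w : V) :
    secondDeriv Ψ p v w = secondDeriv Ψ p w v :=
  (h.isSymmSndFDerivAt (by simp)).eq v w

theorem hasDerivAt_fderiv_apply {Ψ : V → ℝ} {γ v : ℝ → V} {γ' v' : V} {t : ℝ}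
    (h : ContDiffAt ℝ 2 Ψ (γ t)) (hγ : HasDerivAt γ γ' t) (hv : HasDerivAt v v' t) :
    HasDerivAt (fun t => fderiv ℝ Ψ (γ t) (v t))
      (secondDeriv Ψ (γ t) γ' (v t) + fderiv ℝ Ψ (γ t) v') t :=
  ((((h.fderiv_right (m := 1) (by norm_num)).differentiableAt
    (by simp)).hasFDerivAt).comp_hasDerivAt t hγ).clm_apply hv

end SecondDeriv

section Bracket

variable [RiemannianBundle (fun x : M => TangentSpace (𝓡 m) x)]
  [IsContMDiffRiemannianBundle (𝓡 m) ∞ (EuclideanSpace ℝ (Fin m))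
    (fun x : M => TangentSpace (𝓡 m) x)]
  [MeasurableSpace M] [BorelSpace M] [CompactSpace M]

/-- `Ḃ` is the derivative of `B` in the direction `A ∘ φ`, apart from the displacement of the base
point. -/
def HasPartialD (B : VFD m M) (φ : DiffM m M) (A Bdot : VF m M) : Prop :=
  ∀ c, IsPathD c φ A → ∀ f, HasCInfDerivAt (fun t => compDiff (dirD (B (c t)) f) (c t))
    (compDiff (dirD Bdot f + dirD A (dirD (B φ) f)) φ) 0

theorem compDiff_apply (f : SmoothFun m M) (φ : DiffM m M) (x : M) : compDiff f φ x = f (φ x) := rfl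

/-- The derivatives of the frame components `B ξ_i`, corrected for the motion of the base point, are
taken as components of `Ḃ`. The product rule applied to `B f = ∑ (B ξ_i) (F_i f)` shows that this
field works for every `f`. -/
theorem IsGammaD.exists_hasPartialD {B : VFD m M} (hB : IsGammaD 1 B) (φ : DiffM m M)
    (A : VF m M) : ∃ Bdot, HasPartialD B φ A Bdot := by
  obtain ⟨n, ξ, F, h⟩ := exists_isFrame m M
  choose k hk using fun f => (hB f).exists_hasCInfDerivAt φ A
  let g : Fin n → SmoothFun m M := fun i => compDiff (k (ξ i)) φ.symm - dirD A (dirD (B φ) (ξ i))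
  refine ⟨∑ i, mulVF (g i) (F i), fun c hc f => ?_⟩
  convert hk f c hc using 1
  ext x
  have h1 : ∀ t, compDiff (dirD (B (c t)) f) (c t) x =
      ∑ i, dirD (B (c t)) (ξ i) (c t x) * dirD (F i) f (c t x) := by
    intro t
    rw [compDiff_apply, h.dirD_eq, smoothFun_sum_apply]; rfl
  have h2 := (hk f c hc).hasDerivAt x
  simp only [h1] at h2
  have h3 : ∀ i, HasDerivAt (fun t => dirD (B (c t)) (ξ i) (c t x) * dirD (F i) f (c t x))
      (k (ξ i) x * dirD (F i) f (φ x) +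
        dirD (B φ) (ξ i) (φ x) * dirD A (dirD (F i) f) (φ x)) 0 := by
    intro i
    have := ((hk (ξ i) c hc).hasDerivAt x).fun_mul (hc.velocity x (dirD (F i) f))
    simpa only [compDiff_apply, hc.zero] using this
  rw [h2.unique (HasDerivAt.fun_sum fun i _ => h3 i), compDiff_apply, h.dirD_eq (B φ) f,
    dirD_sum_left, map_sum]
  simp only [ContMDiffMap.coe_add, Pi.add_apply, smoothFun_sum_apply, dirD_mulVF, dirD_mul]
  rw [← Finset.sum_add_distrib]
  refine Finset.sum_congr rfl fun i _ => ?_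
  have h4 : g i (φ x) = k (ξ i) x - dirD A (dirD (B φ) (ξ i)) (φ x) := by
    show k (ξ i) (φ.symm (φ x)) - _ = _
    rw [φ.symm_apply_apply]
  simp only [ContMDiffMap.coe_mul, Pi.mul_apply, h4]
  ring

theorem hasLieDerivD_iff {F : DiffM m M → ℝ} {φ : DiffM m M} {A : VF m M} {ℓ : ℝ} :
    HasLieDerivD F φ A ℓ ↔ ∀ c, IsPathD c φ A → HasDerivAt (fun t => F (c t)) ℓ 0 :=
  ⟨fun h c hc => h c hc.1 hc.2 hc.3, fun h c h1 h2 h3 => h c ⟨h1, h2, h3⟩⟩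

theorem HasLieDerivD.unique {F : DiffM m M → ℝ} {φ : DiffM m M} {A : VF m M} {ℓ ℓ' : ℝ}
    (h : HasLieDerivD F φ A ℓ) (h' : HasLieDerivD F φ A ℓ') : ℓ = ℓ' :=
  (hasLieDerivD_iff.1 h _ (isPathD_flow A φ)).unique (hasLieDerivD_iff.1 h' _ (isPathD_flow A φ))

theorem hasLieDerivD_of_differentiableAt {N : ℕ} {ι : Fin N → SmoothFun m M} {j : ℕ}
    {Ψ : (Fin N → Sobolev ι j) → ℝ} {F : DiffM m M → ℝ} (hF : ∀ φ, Ψ (inclD ι j φ) = F φ)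
    (φ : DiffM m M) (A : VF m M) (h : DifferentiableAt ℝ Ψ (inclD ι j φ)) :
    HasLieDerivD F φ A (fderiv ℝ Ψ (inclD ι j φ) (velD ι j φ A)) := by
  refine hasLieDerivD_iff.2 fun c hc => ?_
  have h1 : HasFDerivAt Ψ (fderiv ℝ Ψ (inclD ι j φ)) (inclD ι j (c 0)) := by
    rw [hc.zero]; exact h.hasFDerivAt
  exact (h1.comp_hasDerivAt 0 (hc.hasDerivAt_inclD ι j)).congr_of_eventuallyEq
    (Eventually.of_forall fun t => (hF (c t)).symm)

/-- With `Ψ` an extension of `F`, the second derivative of `Ψ` enters both iterated Lie derivatives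
and cancels by symmetry. What remains is the first derivative of `Ψ` on the difference of the
accelerations, namely `Ḃ - Ȧ` plus the commutator of the fields on `M`. -/
theorem isBracketD_of_hasPartialD {A B : VFD m M} {φ : DiffM m M} {Adot Bdot : VF m M}
    (hA : HasPartialD A φ (B φ) Adot) (hB : HasPartialD B φ (A φ) Bdot) :
    IsBracketD A B φ (Bdot - Adot + bracketVF (A φ) (B φ)) := by
  rintro F ⟨N, ι, -, hs⟩
  obtain ⟨j, -, U, hU, hDU, Ψ, hΨ, hΨF⟩ := hs (m + 1) (by omega)
  have hat : ∀ ψ, ContDiffAt ℝ 2 Ψ (inclD ι j ψ) := fun ψ =>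
    hΨ.contDiffAt (hU.mem_nhds (hDU (inclD_mem_DSob ι j ψ)))
  have hdiff : ∀ ψ, DifferentiableAt ℝ Ψ (inclD ι j ψ) := fun ψ =>
    (hat ψ).differentiableAt (by simp)
  have hsec : ∀ (A B : VFD m M) (Bdot : VF m M), HasPartialD B φ (A φ) Bdot →
      HasLieDerivD (fun ψ => fderiv ℝ Ψ (inclD ι j ψ) (velD ι j ψ (B ψ))) φ (A φ)
        (secondDeriv Ψ (inclD ι j φ) (velD ι j φ (A φ)) (velD ι j φ (B φ)) +
          fderiv ℝ Ψ (inclD ι j φ) fun i => Sobolev.ofSmooth ι j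
            (compDiff (dirD Bdot (ι i) + dirD (A φ) (dirD (B φ) (ι i))) φ)) := by
    intro A B Bdot hB
    refine hasLieDerivD_iff.2 fun c hc => ?_
    have h3 : HasDerivAt (fun t => velD ι j (c t) (B (c t))) (fun i => Sobolev.ofSmooth ι j
            (compDiff (dirD Bdot (ι i) + dirD (A φ) (dirD (B φ) (ι i))) φ)) 0 :=
      hasDerivAt_pi.2 fun i => (hB c hc (ι i)).ofSmooth ι j
    have h4 := hasDerivAt_fderiv_apply (hat (c 0)) (hc.hasDerivAt_inclD ι j) h3
    simpa only [hc.zero] using h4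
  refine ⟨_, _, _, _, fun ψ => hasLieDerivD_of_differentiableAt hΨF ψ (A ψ) (hdiff ψ),
    fun ψ => hasLieDerivD_of_differentiableAt hΨF ψ (B ψ) (hdiff ψ), hsec A B Bdot hB,
    hsec B A Adot hA, ?_⟩
  convert hasLieDerivD_of_differentiableAt hΨF φ (Bdot - Adot + bracketVF (A φ) (B φ)) (hdiff φ)
    using 1
  have hsymm := secondDeriv_comm (hat φ) (velD ι j φ (A φ)) (velD ι j φ (B φ))
  rw [hsymm, add_sub_add_left_eq_sub, ← map_sub]
  congr 1
  funext i
  refine (map_sub (ofSmoothL ι j) _ _).symm.trans (congrArg (ofSmoothL ι j) ?_)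
  rw [dirD_add_left, dirD_sub_left, dirD_bracketVF]
  ext x
  simp only [ContMDiffMap.coe_sub, ContMDiffMap.coe_add, Pi.sub_apply, Pi.add_apply, compDiff_apply]
  ring

/-- An embedding stays one when coordinates are added. Given functions may thus be taken among the
coordinates of `ι`, which makes `φ ↦ f ∘ φ` the restriction of a linear map of `H^s(M, ℝ^N)`. -/
theorem exists_isEmb_extending {k : ℕ} (f : Fin k → SmoothFun m M) :
    ∃ (N : ℕ) (ι : Fin N → SmoothFun m M) (σ : Fin k → Fin N), IsEmb ι ∧ ∀ i, ι (σ i) = f i := by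
  obtain ⟨n, e, he, hce, hinj⟩ := exists_embedding_euclidean_of_compact (I := 𝓡 m) (M := M)
  have hpr : ∀ i, ContDiff ℝ ∞ (fun v : EuclideanSpace ℝ (Fin n) => v i) := fun i =>
    (EuclideanSpace.proj (𝕜 := ℝ) i).contDiff
  let η : Fin n → SmoothFun m M := fun i => ⟨fun x => e x i, (hpr i).contMDiff.comp he⟩
  refine ⟨n + k, Fin.append η f, Fin.natAdd n, ⟨fun x y hxy => ?_, fun x v hv => ?_⟩,
    fun i => Fin.append_right η f i⟩
  · refine hce.injective (PiLp.ext fun i => ?_)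
    have := congrFun hxy (Fin.castAdd k i)
    exact (by simpa only [Fin.append_left] using this : η i x = η i y)
  · refine hinj x ?_
    rw [map_zero]
    refine PiLp.ext fun i => ?_
    have h1 := hv (Fin.castAdd k i)
    rw [Fin.append_left] at h1
    have h2 : HasMFDerivAt (𝓡 m) 𝓘(ℝ, ℝ) (η i) x
        ((EuclideanSpace.proj (𝕜 := ℝ) i).comp (mfderiv (𝓡 m) (𝓡 n) e x)) :=
      ((EuclideanSpace.proj (𝕜 := ℝ) i).hasFDerivAt.hasMFDerivAt).comp x
        (he.mdifferentiableAt (by simp)).hasMFDerivAt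
    have h3 := congrArg (fun L => L v) h2.mfderiv
    exact h3.symm.trans h1

/-- The functional `φ ↦ ∫ g (f ∘ φ) dvol` is smooth. -/
theorem isCkD_integral (f g : SmoothFun m M) :
    IsCkD 2 fun φ : DiffM m M => ∫ x, g x * f (φ x) ∂(vol m M) := by
  obtain ⟨N, ι, σ, hι, hσ⟩ := exists_isEmb_extending (fun _ : Fin 1 => f)
  refine ⟨N, ι, hι, fun s _ => ⟨s, le_rfl, univ, isOpen_univ, subset_univ _,
    fun u => inner ℝ (toLpVol g) (u (σ 0)).toLp, ?_, fun φ => ?_⟩⟩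
  · refine ContDiff.contDiffOn ?_
    have h1 : ContDiff ℝ 2 fun u : Fin N → Sobolev ι s => (u (σ 0)).toLp := by
      let L : (Fin N → Sobolev ι s) →L[ℝ] Lp ℝ 2 (vol m M) :=
        (ContinuousLinearMap.proj ⟨0, Fin.elim0⟩).comp
          ((LinearMap.range (sobolevJet ι s)).topologicalClosure.subtypeL.comp
            (ContinuousLinearMap.proj (σ 0)))
      exact L.contDiff
    exact contDiff_const.inner ℝ h1
  · show inner ℝ (toLpVol g) (inclD ι s φ (σ 0)).toLp = _
    rw [L2.inner_def]
    refine integral_congr_ae ?_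
    have h1 := ContinuousMap.coeFn_toLp (p := 2) (𝕜 := ℝ) (vol m M) (toC g)
    have h2 := ContinuousMap.coeFn_toLp (p := 2) (𝕜 := ℝ) (vol m M) (toC (compDiff (ι (σ 0)) φ))
    filter_upwards [h1, h2] with x hx1 hx2
    have e1 : (toLpVol g : M → ℝ) x = g x := hx1
    have e2 : ((inclD ι s φ (σ 0)).toLp : M → ℝ) x = f (φ x) := by
      rw [← hσ 0]; exact hx2
    rw [e1, e2]
    simp [mul_comm]

end Bracket


/-! ### The metric and the Koszul formula on the diffeomorphism group -/

section Koszul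

variable [RiemannianBundle (fun x : M => TangentSpace (𝓡 m) x)]
  [IsContMDiffRiemannianBundle (𝓡 m) ∞ (EuclideanSpace ℝ (Fin m))
    (fun x : M => TangentSpace (𝓡 m) x)]
  [MeasurableSpace M] [BorelSpace M] [CompactSpace M]

/-- The functional `f ↦ ∫ f(φ(x)) dvol(x)`. -/
def intD (φ : DiffM m M) : SmoothFun m M →ₗ[ℝ] ℝ where
  toFun f := ∫ x, f (φ x) ∂(vol m M)
  map_add' f g := integral_add
    ((f.contMDiff.continuous.comp φ.continuous).integrable_of_hasCompactSupport
      (HasCompactSupport.of_compactSpace _))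
    ((g.contMDiff.continuous.comp φ.continuous).integrable_of_hasCompactSupport
      (HasCompactSupport.of_compactSpace _))
  map_smul' r _ := integral_const_mul r _

theorem metricD_eq (φ : DiffM m M) (A B : VF m M) : metricD φ A B = intD φ (innerFun A B) := rfl

theorem hasDerivAt_integral_continuousMap {g : ℝ → C(M, ℝ)} {D : C(M, ℝ)} {t : ℝ}
    (h : HasDerivAt g D t) :
    HasDerivAt (fun t => ∫ x, g t x ∂(vol m M)) (∫ x, D x ∂(vol m M)) t := by
  have hint : ∀ f : C(M, ℝ), Integrable f (vol m M) := fun f =>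
    f.continuous.integrable_of_hasCompactSupport (HasCompactSupport.of_compactSpace _)
  let I : C(M, ℝ) →ₗ[ℝ] ℝ :=
    { toFun := fun f => ∫ x, f x ∂(vol m M)
      map_add' := fun f g => integral_add (hint f) (hint g)
      map_smul' := fun r f => integral_const_mul r _ }
  let J : C(M, ℝ) →L[ℝ] ℝ := I.mkContinuous ((vol m M).real univ) fun f => by
    have := norm_integral_le_of_norm_le_const (μ := vol m M) (f := f) (C := ‖f‖)
      (ae_of_all _ fun x => f.norm_coe_le_norm x)
    rwa [mul_comm] at this
  exact J.hasFDerivAt.comp_hasDerivAt t h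

theorem IsFrame.innerFun_eq {n : ℕ} {ξ : Fin n → SmoothFun m M} {F : Fin n → VF m M}
    (h : IsFrame ξ F) (B C : VF m M) :
    innerFun B C = ∑ i, ∑ j, dirD B (ξ i) * dirD C (ξ j) * innerFun (F j) (F i) := by
  conv_lhs => rw [h.vf_eq B]
  rw [innerFun_sum]
  refine Finset.sum_congr rfl fun i _ => ?_
  rw [innerFun_mulVF, innerFun_symm, h.vf_eq C, innerFun_sum, Finset.mul_sum]
  refine Finset.sum_congr rfl fun j _ => ?_
  rw [innerFun_mulVF, ← h.vf_eq C, mul_assoc]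

/-- In a frame the integrand is a sum of products of functions whose derivatives `HasPartialD`
supplies. The displacement terms regroup to the derivative of `⟨B, C⟩` along `A` on `M`. -/
theorem hasLieDerivD_metricD {B C : VFD m M} {φ : DiffM m M} {A Bdot Cdot : VF m M}
    (hB : HasPartialD B φ A Bdot) (hC : HasPartialD C φ A Cdot) :
    HasLieDerivD (fun ψ => metricD ψ (B ψ) (C ψ)) φ A
      (intD φ (innerFun Bdot (C φ) + innerFun (B φ) Cdot + dirD A (innerFun (B φ) (C φ)))) := by
  obtain ⟨n, ξ, F, h⟩ := exists_isFrame m M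
  refine hasLieDerivD_iff.2 fun c hc => ?_
  have h1 : ∀ i j, HasDerivAt (fun t => toC (compDiff (dirD (B (c t)) (ξ i)) (c t)) *
      toC (compDiff (dirD (C (c t)) (ξ j)) (c t)) * toC (compDiff (innerFun (F j) (F i)) (c t)))
      (toC (compDiff ((dirD Bdot (ξ i) + dirD A (dirD (B φ) (ξ i))) * dirD (C φ) (ξ j) *
        innerFun (F j) (F i) + dirD (B φ) (ξ i) * (dirD Cdot (ξ j) + dirD A (dirD (C φ) (ξ j))) *
        innerFun (F j) (F i) + dirD (B φ) (ξ i) * dirD (C φ) (ξ j) *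
          dirD A (innerFun (F j) (F i))) φ)) 0 := by
    intro i j
    have := ((hB c hc (ξ i) []).mul (hC c hc (ξ j) [])).mul (hc.hasCInfDerivAt (innerFun (F j) (F i)) [])
    refine this.congr_deriv ?_
    ext x
    simp only [hc.zero, Pi.mul_apply]
    show ((dirD Bdot (ξ i) (φ x) + dirD A (dirD (B φ) (ξ i)) (φ x)) * dirD (C φ) (ξ j) (φ x) +
      dirD (B φ) (ξ i) (φ x) * (dirD Cdot (ξ j) (φ x) + dirD A (dirD (C φ) (ξ j)) (φ x))) *
      innerFun (F j) (F i) (φ x) + dirD (B φ) (ξ i) (φ x) * dirD (C φ) (ξ j) (φ x) *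
      dirD A (innerFun (F j) (F i)) (φ x) = (dirD Bdot (ξ i) (φ x) + dirD A (dirD (B φ) (ξ i)) (φ x))
      * dirD (C φ) (ξ j) (φ x) * innerFun (F j) (F i) (φ x) +
      dirD (B φ) (ξ i) (φ x) * (dirD Cdot (ξ j) (φ x) + dirD A (dirD (C φ) (ξ j)) (φ x)) *
      innerFun (F j) (F i) (φ x) + dirD (B φ) (ξ i) (φ x) * dirD (C φ) (ξ j) (φ x) *
      dirD A (innerFun (F j) (F i)) (φ x)
    ring
  have h2 := hasDerivAt_integral_continuousMap (m := m)
    (HasDerivAt.fun_sum fun i (_ : i ∈ Finset.univ) => HasDerivAt.fun_sum fun j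
      (_ : j ∈ Finset.univ) => h1 i j)
  have h3 : ∀ ψ : DiffM m M, metricD ψ (B ψ) (C ψ) = ∫ x, (∑ i, ∑ j,
      toC (compDiff (dirD (B ψ) (ξ i)) ψ) * toC (compDiff (dirD (C ψ) (ξ j)) ψ) *
        toC (compDiff (innerFun (F j) (F i)) ψ) : C(M, ℝ)) x ∂(vol m M) := by
    intro ψ
    rw [metricD_eq, h.innerFun_eq]
    refine integral_congr_ae (ae_of_all _ fun x => ?_)
    simp only [smoothFun_sum_apply, ContinuousMap.coe_sum, Finset.sum_apply]
    rfl
  simp only [h3]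
  refine h2.congr_deriv (integral_congr_ae (ae_of_all _ fun x => ?_))
  rw [h.innerFun_eq Bdot, h.innerFun_eq (B φ) Cdot, h.innerFun_eq (B φ) (C φ)]
  simp only [map_sum, dirD_mul, ContinuousMap.coe_sum, Finset.sum_apply, ContMDiffMap.coe_add,
    Pi.add_apply, smoothFun_sum_apply, toC_apply, compDiff_apply, ContMDiffMap.coe_mul, Pi.mul_apply,
    ← Finset.sum_add_distrib]
  refine Finset.sum_congr rfl fun i _ => Finset.sum_congr rfl fun j _ => ?_
  ring

/-- Six dotted fields occur, one for each ordered pair of distinct fields among `A`, `B`, `C`. In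
the Koszul sum they cancel except for the derivative of `B` along `A`, which appears twice; the
undotted terms are the integrated Koszul formula of `M`. -/
theorem isLeviCivitaD_of_hasPartialD {A B : VFD m M} {φ : DiffM m M} {Bdot : VF m M}
    (hA : IsGammaD 1 A) (hB : IsGammaD 1 B) (hAB : HasPartialD B φ (A φ) Bdot) :
    IsLeviCivitaD A B φ (nabla (A φ) (B φ) + Bdot) := by
  intro C hC
  obtain ⟨CB, hCB⟩ := hB.exists_hasPartialD φ (C φ)
  obtain ⟨AC, hAC⟩ := hC.exists_hasPartialD φ (A φ)
  obtain ⟨BC, hBC⟩ := hC.exists_hasPartialD φ (B φ)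
  obtain ⟨BA, hBA⟩ := hA.exists_hasPartialD φ (B φ)
  obtain ⟨CA, hCA⟩ := hA.exists_hasPartialD φ (C φ)
  refine ⟨_, _, _, _, _, _, hasLieDerivD_metricD hAB hAC, hasLieDerivD_metricD hBC hBA,
    hasLieDerivD_metricD hCA hCB, isBracketD_of_hasPartialD hBA hAB,
    isBracketD_of_hasPartialD hCA hAC, isBracketD_of_hasPartialD hCB hBC, ?_⟩
  simp only [metricD_eq]
  have h2 := congrArg (intD φ) (two_mul_innerFun_nabla (A φ) (B φ) (C φ))
  have h3 : intD φ (2 * innerFun (nabla (A φ) (B φ)) (C φ)) =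
      2 * intD φ (innerFun (nabla (A φ) (B φ)) (C φ)) := by
    rw [show (2 : SmoothFun m M) * innerFun (nabla (A φ) (B φ)) (C φ) =
      (2 : ℝ) • innerFun (nabla (A φ) (B φ)) (C φ) from by ext x; exact two_mul_apply _ x, map_smul,
      smul_eq_mul]
  rw [h3, koszul] at h2
  simp only [sub_eq_add_neg, innerFun_add, innerFun_add_right, innerFun_neg_right, map_add,
    map_neg] at h2 ⊢
  rw [innerFun_symm (C φ) Bdot, innerFun_symm (C φ) BA, innerFun_symm (B φ) CA,
    innerFun_symm (A φ) BC]
  linear_combination h2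

end Koszul


/-! ## The Riemannian volume -/

section Gram

variable [RiemannianBundle (fun x : M => TangentSpace (𝓡 m) x)]
  [IsContMDiffRiemannianBundle (𝓡 m) ∞ (EuclideanSpace ℝ (Fin m))
    (fun x : M => TangentSpace (𝓡 m) x)]

/-- The Riemannian metric at `x`. -/
def metricAt (x : M) (a b : TangentSpace (𝓡 m) x) : ℝ := inner ℝ a b

theorem gram_apply (p : M) (y : EuclideanSpace ℝ (Fin m)) (i j : Fin m) :
    gram p y i j = metricAt ((extChartAt (𝓡 m) p).symm y)
      (mfderiv 𝓘(ℝ, EuclideanSpace ℝ (Fin m)) (𝓡 m) (extChartAt (𝓡 m) p).symm y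
        (EuclideanSpace.single i (1 : ℝ)))
      (mfderiv 𝓘(ℝ, EuclideanSpace ℝ (Fin m)) (𝓡 m) (extChartAt (𝓡 m) p).symm y
        (EuclideanSpace.single j (1 : ℝ))) := rfl

theorem exists_chartVF_const (p : M) {y₀ : EuclideanSpace ℝ (Fin m)}
    (hy : y₀ ∈ (extChartAt (𝓡 m) p).target) (v : EuclideanSpace ℝ (Fin m)) :
    ∃ X : VF m M, ∀ᶠ y in 𝓝 y₀, X ((extChartAt (𝓡 m) p).symm y) =
      mfderiv 𝓘(ℝ, EuclideanSpace ℝ (Fin m)) (𝓡 m) (extChartAt (𝓡 m) p).symm y v := by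
  obtain ⟨g, hg, hgc, hgs, hg1, -⟩ := exists_cutoff (isCompact_singleton (x := y₀))
    (isOpen_extChartAt_target (I := 𝓡 m) p) (singleton_subset_iff.2 hy)
  obtain ⟨X, hX, -⟩ := exists_chartVF p (V := fun y => g y • v) (hg.smul contDiff_const)
    hgc.smul_right ((tsupport_smul_subset_left g _).trans hgs)
  refine ⟨X, ?_⟩
  filter_upwards [extChartAt_target_mem_nhds_of_mem hy, (eventually_nhdsSet_iff_forall.1 hg1) y₀ rfl]
    with y hy' hg'
  have h := hX _ ((extChartAt (𝓡 m) p).map_target hy')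
  rw [(extChartAt (𝓡 m) p).right_inv hy', hg', one_smul] at h
  exact h

/-- Near each coordinate point the coordinate fields are restrictions of global smooth fields, whose
pairing is a smooth function. -/
theorem contDiffOn_gram (p : M) (i j : Fin m) :
    ContDiffOn ℝ ∞ (fun y => gram p y i j) (extChartAt (𝓡 m) p).target := by
  intro y hy
  obtain ⟨X, hX⟩ := exists_chartVF_const p hy (EuclideanSpace.single i (1 : ℝ))
  obtain ⟨Y, hY⟩ := exists_chartVF_const p hy (EuclideanSpace.single j (1 : ℝ))
  refine (((contDiffOn_comp_extChartAt_symm p (innerFun X Y)).contDiffAt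
    (extChartAt_target_mem_nhds_of_mem hy)).congr_of_eventuallyEq ?_).contDiffWithinAt
  filter_upwards [hX, hY] with z h1 h2
  rw [gram_apply, ← h1, ← h2]; rfl

theorem contDiffOn_det_gram (p : M) :
    ContDiffOn ℝ ∞ (fun y => (gram p y).det) (extChartAt (𝓡 m) p).target := by
  simp only [Matrix.det_apply]
  refine ContDiffOn.sum fun σ _ => ContDiffOn.const_smul _ ?_
  exact contDiffOn_prod fun i _ => contDiffOn_gram p _ _

theorem single_sum (v : EuclideanSpace ℝ (Fin m)) :
    v = ∑ i, v i • EuclideanSpace.single i (1 : ℝ) := by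
  refine PiLp.ext fun j => ?_
  simp [Finset.sum_apply, Pi.single_apply]

theorem gram_posDef (p : M) {y : EuclideanSpace ℝ (Fin m)} (hy : y ∈ (extChartAt (𝓡 m) p).target) :
    (gram p y).PosDef := by
  set D := mfderiv 𝓘(ℝ, EuclideanSpace ℝ (Fin m)) (𝓡 m) (extChartAt (𝓡 m) p).symm y with hD
  have hDsum : ∀ v : EuclideanSpace ℝ (Fin m),
      D v = ∑ i, v i • D (EuclideanSpace.single i (1 : ℝ)) := by
    intro v
    conv_lhs => rw [single_sum v]
    refine (map_sum D _ _).trans (Finset.sum_congr rfl fun i _ => ?_)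
    exact D.map_smul (v i) (EuclideanSpace.single i (1 : ℝ))
  refine Matrix.PosDef.of_dotProduct_mulVec_pos ?_ fun x hx => ?_
  · ext i j
    exact real_inner_comm (F := TangentSpace (𝓡 m) ((extChartAt (𝓡 m) p).symm y)) _ _
  · have h1 : (star x) ⬝ᵥ (gram p y).mulVec x = inner ℝ (D (WithLp.toLp 2 x)) (D (WithLp.toLp 2 x)) := by
      rw [hDsum (WithLp.toLp 2 x), sum_inner]
      simp only [dotProduct, Matrix.mulVec]
      refine Finset.sum_congr rfl fun i _ => ?_
      rw [inner_sum, Finset.mul_sum]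
      refine Finset.sum_congr rfl fun j _ => ?_
      rw [real_inner_smul_left, real_inner_smul_right]
      show x i * (gram p y i j * x j) = _
      rw [gram_apply, metricAt]
      ring
    rw [h1]
    refine real_inner_self_pos.2 fun h0 => hx ?_
    have h2 := mfderiv_extChartAt_comp_symm hy (WithLp.toLp 2 x)
    rw [← hD, h0, map_zero] at h2
    exact congrArg WithLp.ofLp h2.symm

/-- The density of the Riemannian volume in the chart around `p`. -/
def dens (p : M) (y : EuclideanSpace ℝ (Fin m)) : ℝ := Real.sqrt (gram p y).det

theorem dens_pos (p : M) {y : EuclideanSpace ℝ (Fin m)} (hy : y ∈ (extChartAt (𝓡 m) p).target) :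
    0 < dens p y := Real.sqrt_pos.2 (gram_posDef p hy).det_pos

theorem contDiffOn_dens (p : M) : ContDiffOn ℝ ∞ (dens (m := m) p) (extChartAt (𝓡 m) p).target :=
  (contDiffOn_det_gram p).sqrt fun _ hy => (gram_posDef p hy).det_pos.ne'

/-- The expression of a diffeomorphism in charts. -/
def chartMap (φ : DiffM m M) (p q : M) (y : EuclideanSpace ℝ (Fin m)) : EuclideanSpace ℝ (Fin m) :=
  extChartAt (𝓡 m) q (φ ((extChartAt (𝓡 m) p).symm y))

theorem contDiffAt_chartMap (φ : DiffM m M) {p q : M} {y : EuclideanSpace ℝ (Fin m)}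
    (hy : y ∈ (extChartAt (𝓡 m) p).target)
    (hq : φ ((extChartAt (𝓡 m) p).symm y) ∈ (extChartAt (𝓡 m) q).source) :
    ContDiffAt ℝ ∞ (chartMap φ p q) y := by
  rw [← contMDiffAt_iff_contDiffAt]
  refine ContMDiffAt.comp y (g := extChartAt (𝓡 m) q) (I' := 𝓡 m)
    (contMDiffAt_extChartAt' (by rwa [← extChartAt_source (𝓡 m)])) ?_
  exact (φ.contMDiff.contMDiffAt).comp y ((contMDiffOn_extChartAt_symm p).contMDiffAt
    (extChartAt_target_mem_nhds_of_mem hy))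

/-- The Gram matrices are related by `Jᵀ G J` with `J` the Jacobian matrix of the change of charts;
determinants and square roots give the transformation rule that makes the chart volumes compatible.
-/
theorem dens_eq_chartMap {p q : M} {y : EuclideanSpace ℝ (Fin m)}
    (hy : y ∈ (extChartAt (𝓡 m) p).target)
    (hq : (extChartAt (𝓡 m) p).symm y ∈ (extChartAt (𝓡 m) q).source) :
    dens p y = |(fderiv ℝ (chartMap (Diffeomorph.refl (𝓡 m) M ∞) p q) y).det| *
      dens q (chartMap (Diffeomorph.refl (𝓡 m) M ∞) p q y) := by
  set T := chartMap (Diffeomorph.refl (𝓡 m) M ∞) p q with hT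
  set eq := extChartAt (𝓡 m) q with heq
  have hTy : T y ∈ eq.target := eq.map_source hq
  have hsymm : ∀ᶠ z in 𝓝 y, (extChartAt (𝓡 m) p).symm z = eq.symm (T z) := by
    have : ContinuousAt (extChartAt (𝓡 m) p).symm y := continuousAt_extChartAt_symm'' hy
    filter_upwards [this.eventually (extChartAt_source_mem_nhds' hq)] with z hz
    exact (eq.left_inv hz).symm
  have hpt : (extChartAt (𝓡 m) p).symm y = eq.symm (T y) := hsymm.self_of_nhds
  have hTd : HasFDerivAt T (fderiv ℝ T y) y :=
    ((contDiffAt_chartMap (Diffeomorph.refl (𝓡 m) M ∞) hy hq).differentiableAt (by simp)).hasFDerivAt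
  have hD : HasMFDerivAt 𝓘(ℝ, EuclideanSpace ℝ (Fin m)) (𝓡 m) (extChartAt (𝓡 m) p).symm y
      ((mfderiv 𝓘(ℝ, EuclideanSpace ℝ (Fin m)) (𝓡 m) eq.symm (T y)).comp (fderiv ℝ T y)) :=
    ((mdifferentiableAt_extChartAt_symm hTy).hasMFDerivAt.comp y
      hTd.hasMFDerivAt).congr_of_eventuallyEq hsymm
  set J : Matrix (Fin m) (Fin m) ℝ := Matrix.of fun k i =>
    fderiv ℝ T y (EuclideanSpace.single i (1 : ℝ)) k with hJ
  have hdet : (fderiv ℝ T y).det = J.det := by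
    have h1 := LinearMap.det_toMatrix (EuclideanSpace.basisFun (Fin m) ℝ).toBasis
      (fderiv ℝ T y : EuclideanSpace ℝ (Fin m) →ₗ[ℝ] EuclideanSpace ℝ (Fin m))
    rw [ContinuousLinearMap.det, ← h1]
    congr 1
  have hgram : gram p y = J.transpose * gram q (T y) * J := by
    ext i j
    rw [gram_apply, hD.mfderiv]
    have hsum : ∀ i, (mfderiv 𝓘(ℝ, EuclideanSpace ℝ (Fin m)) (𝓡 m) eq.symm (T y))
        (fderiv ℝ T y (EuclideanSpace.single i (1 : ℝ))) = ∑ k, J k i •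
          mfderiv 𝓘(ℝ, EuclideanSpace ℝ (Fin m)) (𝓡 m) eq.symm (T y)
            (EuclideanSpace.single k (1 : ℝ)) := by
      intro i
      conv_lhs => rw [single_sum (fderiv ℝ T y (EuclideanSpace.single i (1 : ℝ)))]
      refine (map_sum (mfderiv 𝓘(ℝ, EuclideanSpace ℝ (Fin m)) (𝓡 m) eq.symm (T y)) _ _).trans
        (Finset.sum_congr rfl fun k _ => ?_)
      exact (mfderiv 𝓘(ℝ, EuclideanSpace ℝ (Fin m)) (𝓡 m) eq.symm (T y)).map_smul _ _
    -- The two inner products live at base points that are equal but written differently.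
    have hmet : ∀ (x x' : M), x = x' → ∀ a b : EuclideanSpace ℝ (Fin m),
        metricAt (m := m) x a b = metricAt (m := m) x' a b := by
      rintro x _ rfl a b; rfl
    refine (hmet _ _ hpt _ _).trans ?_
    have h1 : metricAt (m := m) (eq.symm (T y)) (∑ k, J k i •
          mfderiv 𝓘(ℝ, EuclideanSpace ℝ (Fin m)) (𝓡 m) eq.symm (T y)
            (EuclideanSpace.single k (1 : ℝ))) (∑ k, J k j •
          mfderiv 𝓘(ℝ, EuclideanSpace ℝ (Fin m)) (𝓡 m) eq.symm (T y)
            (EuclideanSpace.single k (1 : ℝ))) = (J.transpose * gram q (T y) * J) i j := by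
      rw [metricAt, sum_inner]
      simp only [inner_sum, real_inner_smul_left, real_inner_smul_right, Matrix.mul_apply,
        Finset.sum_mul, Matrix.transpose_apply]
      rw [Finset.sum_comm]
      refine Finset.sum_congr rfl fun k _ => Finset.sum_congr rfl fun l _ => ?_
      rw [gram_apply, metricAt]
      ring
    rw [← hsum, ← hsum] at h1
    exact h1
  rw [dens, hgram, Matrix.det_mul, Matrix.det_mul, Matrix.det_transpose, hdet, dens,
    show J.det * (gram q (T y)).det * J.det = J.det ^ 2 * (gram q (T y)).det by ring,
    Real.sqrt_mul (sq_nonneg _), Real.sqrt_sq_eq_abs]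

end Gram


/-! ### Gluing the chart volumes -/

section Volume

variable [RiemannianBundle (fun x : M => TangentSpace (𝓡 m) x)]
  [IsContMDiffRiemannianBundle (𝓡 m) ∞ (EuclideanSpace ℝ (Fin m))
    (fun x : M => TangentSpace (𝓡 m) x)]
  [MeasurableSpace M] [BorelSpace M]

theorem measurableSet_source (p : M) : MeasurableSet (extChartAt (𝓡 m) p).source :=
  (isOpen_extChartAt_source (I := 𝓡 m) p).measurableSet

theorem measurableSet_target (p : M) : MeasurableSet (extChartAt (𝓡 m) p).target :=
  (isOpen_extChartAt_target (I := 𝓡 m) p).measurableSet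

theorem measurableSet_target_inter (p : M) {s : Set M} (hs : MeasurableSet s) :
    MeasurableSet ((extChartAt (𝓡 m) p).target ∩ (extChartAt (𝓡 m) p).symm ⁻¹' s) := by
  have h := (continuousOn_extChartAt_symm (I := 𝓡 m) p).domRestrict.measurable hs
  have h2 := (measurableSet_target (m := m) p).subtype_image h
  convert h2 using 1
  ext y
  simp [and_comm]

theorem aemeasurable_symm (p : M) {D : Set (EuclideanSpace ℝ (Fin m))} (hD : MeasurableSet D)
    (h : D ⊆ (extChartAt (𝓡 m) p).target) :
    AEMeasurable (extChartAt (𝓡 m) p).symm (volume.restrict D) :=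
  ((continuousOn_extChartAt_symm (I := 𝓡 m) p).mono h).aemeasurable hD

/-- The expression `σ` of the density of `μ` in the chart around `p`. -/
def chartMeasure (p : M) (σ : EuclideanSpace ℝ (Fin m) → ℝ) : Measure M :=
  ((volume.restrict (extChartAt (𝓡 m) p).target).withDensity fun y => ENNReal.ofReal (σ y)).map
    (extChartAt (𝓡 m) p).symm

theorem chartMeasure_apply (p : M) (σ : EuclideanSpace ℝ (Fin m) → ℝ) {s : Set M}
    (hs : MeasurableSet s) : chartMeasure p σ s =
      ∫⁻ y in (extChartAt (𝓡 m) p).target ∩ (extChartAt (𝓡 m) p).symm ⁻¹' s,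
        ENNReal.ofReal (σ y) := by
  rw [chartMeasure, Measure.map_apply_of_aemeasurable _ hs, withDensity_apply',
    Measure.restrict_restrict' (measurableSet_target p), inter_comm]
  exact (aemeasurable_symm p (measurableSet_target p) subset_rfl).mono_ac
    (withDensity_absolutelyContinuous _ _)

theorem chartVol_eq (p : M) : chartVol (m := m) p = chartMeasure (m := m) p (dens p) := rfl

/-- Change of variables, for an arbitrary diffeomorphism: the identity gives independence of the
chart, and `φ.symm` gives the density of the image measure. -/
theorem chartMeasure_image (φ : DiffM m M) (p q : M) (σ : EuclideanSpace ℝ (Fin m) → ℝ) {s : Set M}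
    (hs : MeasurableSet s) (hp : s ⊆ (extChartAt (𝓡 m) p).source)
    (hq : φ '' s ⊆ (extChartAt (𝓡 m) q).source) :
    chartMeasure q σ (φ '' s) = chartMeasure p
      (fun y => |(fderiv ℝ (chartMap φ p q) y).det| * σ (chartMap φ p q y)) s := by
  have hφs : MeasurableSet (φ '' s) := φ.toHomeomorph.measurableEmbedding.measurableSet_image.2 hs
  rw [chartMeasure_apply q σ hφs, chartMeasure_apply p _ hs]
  set D := (extChartAt (𝓡 m) p).target ∩ (extChartAt (𝓡 m) p).symm ⁻¹' s with hD
  have hmem : ∀ y ∈ D, φ ((extChartAt (𝓡 m) p).symm y) ∈ (extChartAt (𝓡 m) q).source :=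
    fun y hy => hq (mem_image_of_mem _ hy.2)
  have himg : (extChartAt (𝓡 m) q).target ∩ (extChartAt (𝓡 m) q).symm ⁻¹' (φ '' s) =
      chartMap φ p q '' D := by
    ext z
    constructor
    · rintro ⟨hz, x, hx, hxz⟩
      refine ⟨extChartAt (𝓡 m) p x, ⟨(extChartAt (𝓡 m) p).map_source (hp hx), ?_⟩, ?_⟩
      · rw [mem_preimage, (extChartAt (𝓡 m) p).left_inv (hp hx)]; exact hx
      · rw [chartMap, (extChartAt (𝓡 m) p).left_inv (hp hx), hxz, (extChartAt (𝓡 m) q).right_inv hz]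
    · rintro ⟨y, hy, rfl⟩
      refine ⟨(extChartAt (𝓡 m) q).map_source (hmem y hy), ?_⟩
      rw [mem_preimage, chartMap, (extChartAt (𝓡 m) q).left_inv (hmem y hy)]
      exact mem_image_of_mem _ hy.2
  have hinj : InjOn (chartMap φ p q) D := by
    intro y hy y' hy' h
    have h1 := (extChartAt (𝓡 m) q).injOn (hmem y hy) (hmem y' hy') h
    have h2 := φ.injective h1
    exact (extChartAt (𝓡 m) p).symm.injOn hy.1 hy'.1 h2
  rw [himg, lintegral_image_eq_lintegral_abs_det_fderiv_mul volume
    (measurableSet_target_inter p hs) (fun y hy => ((contDiffAt_chartMap φ hy.1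
      (hmem y hy)).differentiableAt (by simp)).hasFDerivAt.hasFDerivWithinAt) hinj]
  refine lintegral_congr fun y => ?_
  rw [ENNReal.ofReal_mul (abs_nonneg _)]

theorem chartMeasure_congr (p : M) {σ σ' : EuclideanSpace ℝ (Fin m) → ℝ} {s : Set M}
    (hs : MeasurableSet s) (h : ∀ y ∈ (extChartAt (𝓡 m) p).target,
      (extChartAt (𝓡 m) p).symm y ∈ s → σ y = σ' y) : chartMeasure p σ s = chartMeasure p σ' s := by
  rw [chartMeasure_apply p σ hs, chartMeasure_apply p σ' hs]
  exact setLIntegral_congr_fun (measurableSet_target_inter p hs)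
    fun y hy => by simp only [h y hy.1 hy.2]

theorem chartVol_eq_of_subset {p q : M} {s : Set M} (hs : MeasurableSet s)
    (hp : s ⊆ (extChartAt (𝓡 m) p).source) (hq : s ⊆ (extChartAt (𝓡 m) q).source) :
    chartVol (m := m) q s = chartVol (m := m) p s := by
  have h := chartMeasure_image (Diffeomorph.refl (𝓡 m) M ∞) p q (dens q) hs hp (by simpa using hq)
  rw [show (Diffeomorph.refl (𝓡 m) M ∞ : M → M) '' s = s from image_id s] at h
  rw [chartVol_eq, h, chartVol_eq]
  exact chartMeasure_congr p hs fun y hy hys => (dens_eq_chartMap hy (hq hys)).symm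

theorem chartVol_compl_source (p : M) {s : Set M} (hs : MeasurableSet s) :
    chartVol (m := m) p s = chartVol (m := m) p (s ∩ (extChartAt (𝓡 m) p).source) := by
  rw [chartVol_eq, chartMeasure_apply p _ hs,
    chartMeasure_apply p _ (hs.inter (measurableSet_source p))]
  congr 2
  ext y
  exact ⟨fun h => ⟨h.1, h.2, (extChartAt (𝓡 m) p).map_target h.1⟩, fun h => ⟨h.1, h.2.1⟩⟩

theorem restrict_chartVol_inter (p q : M) :
    (chartVol (m := m) q).restrict (extChartAt (𝓡 m) p).source =
      (chartVol (m := m) p).restrict (extChartAt (𝓡 m) q).source := by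
  refine Measure.ext fun s hs => ?_
  have hp := measurableSet_source (m := m) p
  have hq := measurableSet_source (m := m) q
  rw [Measure.restrict_apply hs, Measure.restrict_apply hs, chartVol_compl_source q (hs.inter hp),
    chartVol_compl_source p (hs.inter hq), inter_right_comm]
  exact chartVol_eq_of_subset ((hs.inter hq).inter hp) inter_subset_right
    (inter_subset_left.trans inter_subset_right)

/-- On a small closed coordinate ball the density is bounded. Finitely many such neighbourhoods will
bound the total volume. -/
theorem exists_finite_chartVol (p : M) : ∃ N ∈ 𝓝 p, N ⊆ (extChartAt (𝓡 m) p).source ∧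
    MeasurableSet N ∧ chartVol (m := m) p N < ⊤ := by
  set e := extChartAt (𝓡 m) p with he
  obtain ⟨r, hr, hrs⟩ := Metric.nhds_basis_closedBall.mem_iff.1 (extChartAt_target_mem_nhds_of_mem
    (mem_extChartAt_target (I := 𝓡 m) p))
  refine ⟨e.source ∩ e ⁻¹' Metric.ball (e p) r, ?_, inter_subset_left, ?_, ?_⟩
  · exact (continuousOn_extChartAt p).isOpen_inter_preimage (isOpen_extChartAt_source p)
      Metric.isOpen_ball |>.mem_nhds ⟨mem_extChartAt_source p, Metric.mem_ball_self hr⟩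
  · exact ((continuousOn_extChartAt p).isOpen_inter_preimage (isOpen_extChartAt_source p)
      Metric.isOpen_ball).measurableSet
  · have hm := ((continuousOn_extChartAt (I := 𝓡 m) p).isOpen_inter_preimage
      (isOpen_extChartAt_source p) (Metric.isOpen_ball (x := e p) (ε := r))).measurableSet
    rw [chartVol_eq, chartMeasure_apply p _ hm]
    obtain ⟨C, hC⟩ := (isCompact_closedBall (e p) r).exists_bound_of_continuousOn
      ((contDiffOn_dens p).continuousOn.mono hrs)
    refine lt_of_le_of_lt (lintegral_mono_set (t := Metric.closedBall (e p) r) ?_) ?_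
    · rintro y ⟨hy, -, hy'⟩
      rw [mem_preimage, e.right_inv hy] at hy'
      exact Metric.ball_subset_closedBall hy'
    · refine lt_of_le_of_lt (setLIntegral_mono' (g := fun _ => ENNReal.ofReal C)
        Metric.isClosed_closedBall.measurableSet fun y hy =>
          ENNReal.ofReal_le_ofReal ((le_abs_self _).trans (hC y hy))) ?_
      rw [setLIntegral_const]
      exact ENNReal.mul_lt_top ENNReal.ofReal_lt_top measure_closedBall_lt_top

theorem chartVol_le_riemVol (p : M) : chartVol (m := m) p ≤ riemVol m M :=
  le_iSup (fun p : M => chartVol (m := m) p) p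

theorem chartVol_pos (p : M) {U : Set M} (hU : IsOpen U) (hp : p ∈ U) :
    0 < chartVol (m := m) p U := by
  rw [chartVol_eq, chartMeasure_apply p _ hU.measurableSet, pos_iff_ne_zero]
  have hD := (continuousOn_extChartAt_symm (I := 𝓡 m) p).isOpen_inter_preimage
    (isOpen_extChartAt_target p) hU
  intro h0
  have hmeas : AEMeasurable (fun y => ENNReal.ofReal (dens p y)) (volume.restrict
      ((extChartAt (𝓡 m) p).target ∩ (extChartAt (𝓡 m) p).symm ⁻¹' U)) :=
    (((contDiffOn_dens p).continuousOn.mono inter_subset_left).aemeasurable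
      hD.measurableSet).ennreal_ofReal
  rw [lintegral_eq_zero_iff' hmeas, EventuallyEq, ae_restrict_iff' hD.measurableSet] at h0
  have h1 : volume ((extChartAt (𝓡 m) p).target ∩ (extChartAt (𝓡 m) p).symm ⁻¹' U) = 0 := by
    refine measure_mono_null (fun y hy => ?_) h0
    simp only [mem_compl_iff]
    intro h
    have := h hy
    simp only [Pi.zero_apply, ENNReal.ofReal_eq_zero] at this
    exact absurd (dens_pos p hy.1) (not_lt.2 this)
  exact (hD.measure_pos volume ⟨extChartAt (𝓡 m) p p, mem_extChartAt_target p, by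
    rw [mem_preimage, extChartAt_to_inv]; exact hp⟩).ne' h1

variable [CompactSpace M]

/-- The sum of the chart volumes weighted by a partition of unity restricts correctly to each chart
domain, as the chart volumes agree on overlaps. It dominates every chart volume and thus bounds the
supremum `riemVol` from above. -/
theorem exists_glued_chartVol : ∃ ν : Measure M, ν univ < ⊤ ∧
    ∀ q : M, ν.restrict (extChartAt (𝓡 m) q).source = chartVol (m := m) q := by
  choose N hN hNs hNm hNf using fun p : M => exists_finite_chartVol (m := m) p
  obtain ⟨s, ρ, h1, h2, h3⟩ := exists_partition (m := m) N hN
  have hρm : ∀ p, Measurable fun x => ENNReal.ofReal (ρ p x) := fun p =>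
    (ρ p).contMDiff.continuous.measurable.ennreal_ofReal
  have hρ0 : ∀ p ∈ s, ∀ x ∉ N p, ENNReal.ofReal (ρ p x) = 0 := fun p hp x hx => by
    rw [show ρ p x = 0 from by_contra fun hne => hx (h2 p hp (subset_tsupport _ hne)),
      ENNReal.ofReal_zero]
  have hsum : ∀ x, ∑ p ∈ s, ENNReal.ofReal (ρ p x) = 1 := by
    intro x
    rw [← ENNReal.ofReal_sum_of_nonneg fun p hp => h3 p x, ← smoothFun_sum_apply, h1]
    exact ENNReal.ofReal_one
  refine ⟨∑ p ∈ s, (chartVol (m := m) p).withDensity fun x => ENNReal.ofReal (ρ p x), ?_,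
    fun q => ?_⟩
  · rw [Measure.finsetSum_apply, ENNReal.sum_lt_top]
    intro p hp
    rw [withDensity_apply _ MeasurableSet.univ, Measure.restrict_univ]
    refine lt_of_le_of_lt ?_ (hNf p)
    rw [← lintegral_indicator_one (hNm p)]
    refine lintegral_mono fun x => ?_
    by_cases hx : x ∈ N p
    · rw [indicator_of_mem hx, Pi.one_apply, ← hsum x]
      exact Finset.single_le_sum (f := fun p => ENNReal.ofReal (ρ p x)) (fun _ _ => zero_le) hp
    · rw [hρ0 p hp x hx]; exact zero_le
  · refine Measure.ext fun t ht => ?_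
    have hq := measurableSet_source (m := m) q
    rw [Measure.restrict_apply ht, Measure.finsetSum_apply]
    have h4 : chartVol (m := m) q t = ∑ p ∈ s, ∫⁻ x in t, ENNReal.ofReal (ρ p x)
        ∂(chartVol (m := m) q) := by
      rw [← lintegral_finsetSum _ fun p _ => hρm p]
      simp only [hsum, lintegral_one, Measure.restrict_apply_univ]
    rw [h4]
    refine Finset.sum_congr rfl fun p hp => ?_
    rw [withDensity_apply _ (ht.inter hq)]
    -- The weight `ρ p` lives in the chart of `p`, so the integral is unchanged by restricting to
    -- that domain, where the two chart volumes may be exchanged.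
    have h5 : ∀ x, ENNReal.ofReal (ρ p x) =
        (extChartAt (𝓡 m) p).source.indicator (fun x => ENNReal.ofReal (ρ p x)) x := by
      intro x
      by_cases hx : x ∈ (extChartAt (𝓡 m) p).source
      · rw [indicator_of_mem hx]
      · rw [indicator_of_notMem hx, hρ0 p hp x fun h => hx (hNs p h)]
    rw [← Measure.restrict_restrict ht, ← restrict_chartVol_inter]
    conv_rhs => rw [lintegral_congr h5, lintegral_indicator (measurableSet_source p),
      Measure.restrict_restrict (measurableSet_source p), inter_comm]
    rw [← Measure.restrict_restrict ht]

theorem riemVol_univ_lt_top : riemVol m M univ < ⊤ := by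
  obtain ⟨ν, h1, h2⟩ := exists_glued_chartVol (m := m) (M := M)
  exact ((iSup_le fun q => (h2 q).symm.le.trans Measure.restrict_le_self : riemVol m M ≤ ν)
    univ).trans_lt h1

theorem restrict_riemVol (q : M) :
    (riemVol m M).restrict (extChartAt (𝓡 m) q).source = chartVol (m := m) q := by
  obtain ⟨ν, h1, h2⟩ := exists_glued_chartVol (m := m) (M := M)
  have h3 : riemVol m M ≤ ν := iSup_le fun q => (h2 q).symm.le.trans Measure.restrict_le_self
  refine le_antisymm ((Measure.restrict_mono subset_rfl h3).trans (h2 q).le) ?_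
  have h4 := Measure.restrict_mono (s := (extChartAt (𝓡 m) q).source) subset_rfl
    (chartVol_le_riemVol (m := m) q)
  refine le_trans (le_of_eq ?_) h4
  rw [← h2 q, Measure.restrict_restrict (measurableSet_source q), inter_self]

/-- The normalizing constant of the volume. -/
def volConst (m : ℕ) (M : Type*) [MetricSpace M] [ChartedSpace (EuclideanSpace ℝ (Fin m)) M]
    [IsManifold (𝓡 m) ∞ M] [RiemannianBundle (fun x : M => TangentSpace (𝓡 m) x)]
    [MeasurableSpace M] [BorelSpace M] : ℝ := (riemVol m M univ)⁻¹.toReal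

variable [Nonempty M]

theorem riemVol_univ_pos : 0 < riemVol m M univ := by
  obtain ⟨p⟩ := ‹Nonempty M›
  exact (chartVol_pos (m := m) p isOpen_univ (mem_univ p)).trans_le (chartVol_le_riemVol p univ)

theorem volConst_pos : 0 < volConst m M :=
  ENNReal.toReal_pos (ENNReal.inv_ne_zero.2 riemVol_univ_lt_top.ne)
    (ENNReal.inv_ne_top.2 riemVol_univ_pos.ne')

theorem vol_eq : vol m M = ENNReal.ofReal (volConst m M) • riemVol m M := by
  rw [volConst, ENNReal.ofReal_toReal (ENNReal.inv_ne_top.2 riemVol_univ_pos.ne'), vol]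

instance isProbabilityMeasure_vol : IsProbabilityMeasure (vol m M) := ⟨by
  rw [vol, Measure.smul_apply, smul_eq_mul]
  exact ENNReal.inv_mul_cancel riemVol_univ_pos.ne' riemVol_univ_lt_top.ne⟩

instance isProbabilityMeasure_pushVol (φ : DiffM m M) : IsProbabilityMeasure (pushVol φ) :=
  Measure.isProbabilityMeasure_map φ.continuous.measurable.aemeasurable

instance isOpenPosMeasure_vol : (vol m M).IsOpenPosMeasure := ⟨fun U hU ⟨p, hp⟩ => by
  rw [vol_eq, Measure.smul_apply, smul_eq_mul]
  exact mul_ne_zero (by simpa using volConst_pos)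
    ((chartVol_pos (m := m) p hU hp).trans_le (chartVol_le_riemVol p U)).ne'⟩

theorem restrict_vol (p : M) : (vol m M).restrict (extChartAt (𝓡 m) p).source =
    chartMeasure (m := m) p fun y => volConst m M * dens p y := by
  refine Measure.ext fun s hs => ?_
  rw [vol_eq, Measure.restrict_smul, restrict_riemVol, Measure.smul_apply, chartVol_eq,
    chartMeasure_apply p _ hs, chartMeasure_apply p _ hs, smul_eq_mul, ← lintegral_const_mul'' _ ?_]
  · refine lintegral_congr fun y => ?_
    rw [ENNReal.ofReal_mul volConst_pos.le]
  · exact ((contDiffOn_dens p).continuousOn.mono inter_subset_left).aemeasurable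
      (measurableSet_target_inter p hs) |>.ennreal_ofReal

end Volume


/-! ### Smooth densities of image measures -/

section PushVol

variable [RiemannianBundle (fun x : M => TangentSpace (𝓡 m) x)]
  [IsContMDiffRiemannianBundle (𝓡 m) ∞ (EuclideanSpace ℝ (Fin m))
    (fun x : M => TangentSpace (𝓡 m) x)]
  [MeasurableSpace M] [BorelSpace M]

theorem lintegral_restrict_of_eq_zero {α : Type*} [MeasurableSpace α] {μ : Measure α} {N t : Set α}
    (hN : MeasurableSet N) (ht : MeasurableSet t) {g : α → ENNReal} (h : ∀ x ∉ N, g x = 0) :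
    ∫⁻ x in t, g x ∂μ = ∫⁻ x in t, g x ∂(μ.restrict N) := by
  have h5 : ∀ x, g x = N.indicator g x := fun x => by
    by_cases hx : x ∈ N
    · rw [indicator_of_mem hx]
    · rw [indicator_of_notMem hx, h x hx]
  rw [lintegral_congr h5, lintegral_indicator hN, Measure.restrict_restrict hN,
    Measure.restrict_restrict ht, inter_comm]

theorem setLIntegral_chartMeasure (p : M) {σ : EuclideanSpace ℝ (Fin m) → ℝ}
    (hσ : ContinuousOn σ (extChartAt (𝓡 m) p).target) {f : M → ENNReal} {s : Set M}
    (hs : MeasurableSet s)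
    (hf : ContinuousOn f (s ∩ (extChartAt (𝓡 m) p).source)) :
    ∫⁻ x in s, f x ∂(chartMeasure p σ) =
      ∫⁻ y in (extChartAt (𝓡 m) p).target ∩ (extChartAt (𝓡 m) p).symm ⁻¹' s,
        ENNReal.ofReal (σ y) * f ((extChartAt (𝓡 m) p).symm y) := by
  set e := extChartAt (𝓡 m) p with he
  have hD := measurableSet_target_inter (m := m) p hs
  have hsource := measurableSet_source (m := m) p
  have h1 : (chartMeasure p σ).restrict s = ((volume.restrict (e.target ∩ e.symm ⁻¹' s)).withDensity
      fun y => ENNReal.ofReal (σ y)).map e.symm := by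
    refine Measure.ext fun t ht => ?_
    rw [Measure.restrict_apply ht, chartMeasure_apply p σ (ht.inter hs),
      Measure.map_apply_of_aemeasurable _ ht, withDensity_apply', Measure.restrict_restrict' hD]
    · congr 2
      ext y
      exact ⟨fun h => ⟨h.2.1, h.1, h.2.2⟩, fun h => ⟨h.2.1, h.1, h.2.2⟩⟩
    · exact (aemeasurable_symm p hD inter_subset_left).mono_ac (withDensity_absolutelyContinuous _ _)
  have hfc : ContinuousOn (fun y => f (e.symm y)) (e.target ∩ e.symm ⁻¹' s) :=
    hf.comp ((continuousOn_extChartAt_symm p).mono inter_subset_left) fun y hy =>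
      ⟨hy.2, e.map_target hy.1⟩
  have hσm : AEMeasurable (fun y => ENNReal.ofReal (σ y)) (volume.restrict (e.target ∩ e.symm ⁻¹' s)) :=
    ((hσ.mono inter_subset_left).aemeasurable hD).ennreal_ofReal
  rw [h1, lintegral_map', lintegral_withDensity_eq_lintegral_mul₀ hσm
    (hfc.aemeasurable hD)]
  · rfl
  · rw [← h1]
    have h2 : AEMeasurable f ((chartMeasure p σ).restrict (s ∩ e.source)) :=
      hf.aemeasurable (hs.inter hsource)
    refine h2.mono_measure (le_of_eq ?_)
    refine Measure.ext fun t ht => ?_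
    rw [Measure.restrict_apply ht, Measure.restrict_apply ht, chartMeasure_apply p σ (ht.inter hs),
      chartMeasure_apply p σ (ht.inter (hs.inter hsource))]
    congr 2
    ext y
    exact ⟨fun h => ⟨h.1, h.2.1, h.2.2, e.map_target h.1⟩, fun h => ⟨h.1, h.2.1, h.2.2.1⟩⟩
  · exact (aemeasurable_symm p hD inter_subset_left).mono_ac (withDensity_absolutelyContinuous _ _)

variable [CompactSpace M]

/-- The global density is `∑ ρ_p r_p`. At every point some `ρ_p` is positive, and there the local
density is positive as well. -/
theorem exists_smooth_density_of_local {μ ν : Measure M} {N : M → Set M} {r : M → M → ℝ}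
    (hNo : ∀ p, IsOpen (N p)) (hpN : ∀ p, p ∈ N p)
    (hr : ∀ p, ContMDiffOn (𝓡 m) 𝓘(ℝ, ℝ) ∞ (r p) (N p)) (hr0 : ∀ p, ∀ x ∈ N p, 0 < r p x)
    (hμ : ∀ p, μ.restrict (N p) = (ν.restrict (N p)).withDensity fun x => ENNReal.ofReal (r p x)) :
    ∃ R : SmoothFun m M, (∀ x, 0 < R x) ∧ μ = ν.withDensity fun x => ENNReal.ofReal (R x) := by
  obtain ⟨s, ρ, h1, h2, h3⟩ := exists_partition (m := m) N fun p => (hNo p).mem_nhds (hpN p)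
  have hρm : ∀ p, Measurable fun x => ENNReal.ofReal (ρ p x) := fun p =>
    (ρ p).contMDiff.continuous.measurable.ennreal_ofReal
  have hρ0 : ∀ p ∈ s, ∀ x ∉ N p, ρ p x = 0 := fun p hp x hx =>
    by_contra fun hne => hx (h2 p hp (subset_tsupport _ hne))
  have hR : ∀ p, ∃ R : SmoothFun m M, p ∈ s → ∀ x, R x = ρ p x * r p x := by
    intro p
    by_cases hp : p ∈ s
    · refine ⟨⟨fun x => ρ p x * r p x, fun x => ?_⟩, fun _ _ => rfl⟩
      by_cases hx : x ∈ N p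
      · exact (ρ p).contMDiff.contMDiffAt.mul ((hr p).contMDiffAt ((hNo p).mem_nhds hx))
      · have h4 : x ∉ tsupport (ρ p) := fun h => hx (h2 p hp h)
        refine (contMDiffAt_const (c := (0 : ℝ))).congr_of_eventuallyEq ?_
        filter_upwards [(isClosed_tsupport (ρ p)).isOpen_compl.mem_nhds h4] with z hz
        rw [image_eq_zero_of_notMem_tsupport hz, zero_mul]
    · exact ⟨0, fun h => absurd h hp⟩
  choose R hR using hR
  have hRnn : ∀ p ∈ s, ∀ x, 0 ≤ R p x := by
    intro p hp x
    rw [hR p hp]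
    by_cases hx : x ∈ N p
    · exact mul_nonneg (h3 p x) (hr0 p x hx).le
    · rw [hρ0 p hp x hx, zero_mul]
  have hsum : ∀ x, ∑ p ∈ s, ρ p x = 1 := by
    intro x
    rw [← smoothFun_sum_apply, h1]; rfl
  refine ⟨∑ p ∈ s, R p, fun x => ?_, Measure.ext fun t ht => ?_⟩
  · rw [smoothFun_sum_apply]
    obtain ⟨p, hp, hne⟩ : ∃ p ∈ s, ρ p x ≠ 0 := by
      by_contra! h
      have := hsum x
      rw [Finset.sum_eq_zero h] at this
      exact zero_ne_one this
    refine Finset.sum_pos' (fun p hp => hRnn p hp x) ⟨p, hp, ?_⟩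
    rw [hR p hp]
    exact mul_pos (lt_of_le_of_ne (h3 p x) hne.symm)
      (hr0 p x (by_contra fun hx => hne (hρ0 p hp x hx)))
  · have hRm : ∀ p, Measurable fun x => ENNReal.ofReal (R p x) := fun p =>
      (R p).contMDiff.continuous.measurable.ennreal_ofReal
    have h4 : μ t = ∑ p ∈ s, ∫⁻ x in t, ENNReal.ofReal (ρ p x) ∂μ := by
      rw [← lintegral_finsetSum _ fun p _ => hρm p]
      simp only [← ENNReal.ofReal_sum_of_nonneg fun p (_ : p ∈ s) => h3 p _, hsum,
        ENNReal.ofReal_one, lintegral_one, Measure.restrict_apply_univ]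
    have h5 : ∀ x, ENNReal.ofReal ((∑ p ∈ s, R p) x) = ∑ p ∈ s, ENNReal.ofReal (R p x) := fun x => by
      rw [smoothFun_sum_apply, ENNReal.ofReal_sum_of_nonneg fun p hp => hRnn p hp x]
    rw [h4, withDensity_apply _ ht, lintegral_congr h5, lintegral_finsetSum _ fun p _ => hRm p]
    refine Finset.sum_congr rfl fun p hp => ?_
    have hm := (hNo p).measurableSet
    rw [lintegral_restrict_of_eq_zero (μ := μ) hm ht fun x hx => by
        rw [hρ0 p hp x hx, ENNReal.ofReal_zero],
      lintegral_restrict_of_eq_zero (μ := ν) hm ht fun x hx => by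
        rw [hR p hp, hρ0 p hp x hx, zero_mul, ENNReal.ofReal_zero], hμ p,
      restrict_withDensity ht, lintegral_withDensity_eq_lintegral_mul₀ _ (hρm p).aemeasurable]
    · rw [Measure.restrict_restrict ht]
      refine setLIntegral_congr_fun (ht.inter hm) fun x hx => ?_
      simp only [Pi.mul_apply]
      rw [hR p hp, mul_comm (ρ p x), ENNReal.ofReal_mul (hr0 p x hx.2).le]
    · rw [Measure.restrict_restrict ht]
      exact (((hr p).continuousOn.mono inter_subset_right).aemeasurable
        (ht.inter hm)).ennreal_ofReal

theorem det_eq_matrix_det (L : EuclideanSpace ℝ (Fin m) →L[ℝ] EuclideanSpace ℝ (Fin m)) :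
    L.det = (Matrix.of fun k i => L (EuclideanSpace.single i (1 : ℝ)) k).det := by
  have h1 := LinearMap.det_toMatrix (EuclideanSpace.basisFun (Fin m) ℝ).toBasis
    (L : EuclideanSpace ℝ (Fin m) →ₗ[ℝ] EuclideanSpace ℝ (Fin m))
  rw [ContinuousLinearMap.det, ← h1]
  congr 1

theorem contDiff_det : ContDiff ℝ ∞
    fun L : EuclideanSpace ℝ (Fin m) →L[ℝ] EuclideanSpace ℝ (Fin m) => L.det := by
  simp only [det_eq_matrix_det, Matrix.det_apply, Matrix.of_apply]
  refine ContDiff.sum fun σ _ => ContDiff.const_smul _ ?_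
  refine contDiff_prod fun i _ => ?_
  exact ((EuclideanSpace.proj (𝕜 := ℝ) (σ i)).comp (ContinuousLinearMap.apply ℝ
    (EuclideanSpace ℝ (Fin m)) (EuclideanSpace.single i (1 : ℝ)))).contDiff

theorem det_fderiv_chartMap_ne_zero (φ : DiffM m M) {p q : M} {y : EuclideanSpace ℝ (Fin m)}
    (hy : y ∈ (extChartAt (𝓡 m) p).target)
    (hq : φ ((extChartAt (𝓡 m) p).symm y) ∈ (extChartAt (𝓡 m) q).source) :
    (fderiv ℝ (chartMap φ p q) y).det ≠ 0 := by
  have hTy : chartMap φ p q y ∈ (extChartAt (𝓡 m) q).target := (extChartAt (𝓡 m) q).map_source hq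
  have hback : φ.symm ((extChartAt (𝓡 m) q).symm (chartMap φ p q y)) =
      (extChartAt (𝓡 m) p).symm y := by
    rw [chartMap, (extChartAt (𝓡 m) q).left_inv hq, φ.symm_apply_apply]
  have hsrc : φ.symm ((extChartAt (𝓡 m) q).symm (chartMap φ p q y)) ∈ (extChartAt (𝓡 m) p).source := by
    rw [hback]; exact (extChartAt (𝓡 m) p).map_target hy
  have h1 := ((contDiffAt_chartMap φ hy hq).differentiableAt (by simp)).hasFDerivAt
  have h2 := ((contDiffAt_chartMap φ.symm hTy hsrc).differentiableAt (by simp)).hasFDerivAt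
  have h3 := h2.comp y h1
  have h4 : chartMap φ.symm q p ∘ chartMap φ p q =ᶠ[𝓝 y] id := by
    have hc : ContinuousAt (fun z => φ ((extChartAt (𝓡 m) p).symm z)) y :=
      φ.continuous.continuousAt.comp (continuousAt_extChartAt_symm'' hy)
    filter_upwards [hc.eventually (extChartAt_source_mem_nhds' hq),
      extChartAt_target_mem_nhds_of_mem hy] with z hz hz'
    simp only [Function.comp_apply, chartMap, id]
    rw [(extChartAt (𝓡 m) q).left_inv hz, φ.symm_apply_apply, (extChartAt (𝓡 m) p).right_inv hz']
  have h5 := h3.unique ((hasFDerivAt_id y).congr_of_eventuallyEq h4)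
  have h6 := congrArg ContinuousLinearMap.det h5
  intro h0
  have h7 : (fderiv ℝ (chartMap φ.symm q p) (chartMap φ p q y)).det *
      (fderiv ℝ (chartMap φ p q) y).det = 1 := by
    refine (LinearMap.det_comp _ _).symm.trans (Eq.trans h6 ?_)
    exact LinearMap.det_id
  rw [h0, mul_zero] at h7
  exact zero_ne_one h7

variable [Nonempty M]

/-- In charts at `p` and `φ⁻¹(p)` the density is the absolute Jacobian determinant of `φ⁻¹` times a
quotient of volume densities. The determinant never vanishes, so its absolute value is smooth. This
makes `p(φ)` a point of `𝒫_∞`. -/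
theorem exists_smooth_density_pushVol (φ : DiffM m M) : ∃ R : SmoothFun m M, (∀ x, 0 < R x) ∧
    pushVol φ = (vol m M).withDensity fun x => ENNReal.ofReal (R x) := by
  set T := fun p : M => chartMap φ.symm p (φ.symm p) with hT
  let N : M → Set M := fun p => (extChartAt (𝓡 m) p).source ∩
    φ.symm ⁻¹' (extChartAt (𝓡 m) (φ.symm p)).source
  let r₀ : M → EuclideanSpace ℝ (Fin m) → ℝ := fun p y => |(fderiv ℝ (T p) y).det| *
    dens (φ.symm p) (T p y) / dens p y
  have hNo : ∀ p, IsOpen (N p) := fun p => (isOpen_extChartAt_source p).inter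
    ((isOpen_extChartAt_source _).preimage φ.symm.continuous)
  have key : ∀ p, ∀ x ∈ N p, extChartAt (𝓡 m) p x ∈ (extChartAt (𝓡 m) p).target ∧
      φ.symm ((extChartAt (𝓡 m) p).symm (extChartAt (𝓡 m) p x)) ∈
        (extChartAt (𝓡 m) (φ.symm p)).source := fun p x hx =>
    ⟨(extChartAt (𝓡 m) p).map_source hx.1, by rw [(extChartAt (𝓡 m) p).left_inv hx.1]; exact hx.2⟩
  have hTt : ∀ p, ∀ x ∈ N p, T p (extChartAt (𝓡 m) p x) ∈ (extChartAt (𝓡 m) (φ.symm p)).target :=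
    fun p x hx => (extChartAt (𝓡 m) (φ.symm p)).map_source (key p x hx).2
  have hrs : ∀ p, ContMDiffOn (𝓡 m) 𝓘(ℝ, ℝ) ∞ (fun x => r₀ p (extChartAt (𝓡 m) p x)) (N p) := by
    intro p x hx
    have hT1 := contDiffAt_chartMap φ.symm (key p x hx).1 (key p x hx).2
    have hd : ContDiffAt ℝ ∞ (r₀ p) (extChartAt (𝓡 m) p x) := by
      refine ContDiffAt.div (ContDiffAt.mul ?_ ?_) ?_ (dens_pos p (key p x hx).1).ne'
      · have hd1 : ContDiffAt ℝ ∞ (fun y => (fderiv ℝ (T p) y).det) (extChartAt (𝓡 m) p x) :=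
          contDiff_det.contDiffAt.comp _ (hT1.fderiv_right (by simp))
        exact hd1.abs (det_fderiv_chartMap_ne_zero φ.symm (key p x hx).1 (key p x hx).2)
      · exact ((contDiffOn_dens (φ.symm p)).contDiffAt
          (extChartAt_target_mem_nhds_of_mem (hTt p x hx))).comp _ hT1
      · exact (contDiffOn_dens p).contDiffAt (extChartAt_target_mem_nhds_of_mem (key p x hx).1)
    refine (ContMDiffAt.comp x (g := r₀ p) (I' := 𝓘(ℝ, EuclideanSpace ℝ (Fin m)))
      hd.contMDiffAt ?_).contMDiffWithinAt
    exact contMDiffAt_extChartAt' (by rw [← extChartAt_source (𝓡 m)]; exact hx.1)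
  refine exists_smooth_density_of_local (m := m) hNo
    (fun p => ⟨mem_extChartAt_source p, mem_extChartAt_source _⟩) hrs (fun p x hx => ?_) fun p => ?_
  · exact div_pos (mul_pos (abs_pos.2 (det_fderiv_chartMap_ne_zero φ.symm (key p x hx).1
      (key p x hx).2)) (dens_pos _ (hTt p x hx))) (dens_pos p (key p x hx).1)
  · have hm := (hNo p).measurableSet
    refine Measure.ext fun t ht => ?_
    have htN := ht.inter hm
    have hpre : φ ⁻¹' (t ∩ N p) = φ.symm '' (t ∩ N p) := by
      ext x
      exact ⟨fun h => ⟨φ x, h, φ.symm_apply_apply x⟩, by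
        rintro ⟨z, hz, rfl⟩; rw [mem_preimage, φ.apply_symm_apply]; exact hz⟩
    have hsub : φ.symm '' (t ∩ N p) ⊆ (extChartAt (𝓡 m) (φ.symm p)).source := by
      rintro _ ⟨z, hz, rfl⟩; exact hz.2.2
    have hmi : MeasurableSet (φ.symm '' (t ∩ N p)) :=
      φ.symm.toHomeomorph.measurableEmbedding.measurableSet_image.2 htN
    rw [Measure.restrict_apply ht, pushVol, Measure.map_apply φ.continuous.measurable htN, hpre,
      ← Measure.restrict_eq_self (vol m M) hsub, restrict_vol, chartMeasure_image φ.symm p (φ.symm p)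
        _ htN (fun x hx => hx.2.1) hsub, withDensity_apply _ ht, Measure.restrict_restrict ht,
      ← Measure.restrict_restrict_of_subset (s := t ∩ N p) (t := (extChartAt (𝓡 m) p).source)
        (fun x hx => hx.2.1), restrict_vol, setLIntegral_chartMeasure p
        (σ := fun y => volConst m M * dens p y)
        (continuousOn_const.mul (contDiffOn_dens p).continuousOn) htN, chartMeasure_apply _ _ htN]
    · refine setLIntegral_congr_fun (measurableSet_target_inter p htN) fun y hy => ?_
      simp only [r₀, (extChartAt (𝓡 m) p).right_inv hy.1]
      have := dens_pos p hy.1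
      rw [← ENNReal.ofReal_mul (mul_pos volConst_pos this).le]
      congr 1
      simp only [T]
      field_simp
    · refine ContinuousOn.mono (s := N p) ?_ fun x hx => hx.1.2
      exact ENNReal.continuous_ofReal.comp_continuousOn (hrs p).continuousOn

/-- The measure `p(φ)` as an element of `𝒫_∞`. -/
def pushPInf (φ : DiffM m M) : PInf m M :=
  ⟨pushVol φ, inferInstance, exists_smooth_density_pushVol φ⟩

end PushVol


/-! ## Sobolev inequality -/

section CrudeSobolev

/-- Iterated partial derivatives. -/
def pdList : List (Fin m) → (EuclideanSpace ℝ (Fin m) → ℝ) → EuclideanSpace ℝ (Fin m) → ℝ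
  | [], F => F
  | i :: l, F => fun y => fderiv ℝ (pdList l F) y (EuclideanSpace.single i 1)

theorem contDiff_pdList {F : EuclideanSpace ℝ (Fin m) → ℝ} (hF : ContDiff ℝ ∞ F)
    (l : List (Fin m)) : ContDiff ℝ ∞ (pdList l F) := by
  induction l with
  | nil => exact hF
  | cons i l ih => exact (ih.fderiv_right (by simp)).clm_apply contDiff_const

theorem hasCompactSupport_pdList {F : EuclideanSpace ℝ (Fin m) → ℝ} (hF : HasCompactSupport F)
    (l : List (Fin m)) : HasCompactSupport (pdList l F) := by
  induction l with
  | nil => exact hF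
  | cons i l ih => exact ih.fderiv_apply ℝ _

/-- Each coordinate costs one use of the fundamental theorem of calculus: a compactly supported
function is bounded by the integral of its partial derivative along that line. -/
theorem enorm_le_lmarginal_pdList {F : EuclideanSpace ℝ (Fin m) → ℝ} (hF : ContDiff ℝ ∞ F)
    (hc : HasCompactSupport F) (l : List (Fin m)) (hl : l.Nodup) :
    (fun z : Fin m → ℝ => ‖F (WithLp.toLp 2 z)‖ₑ) ≤
      lmarginal (fun _ => volume) l.toFinset
        (fun z : Fin m → ℝ => ‖pdList l F (WithLp.toLp 2 z)‖ₑ) := by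
  have hcont : Continuous (fun z : Fin m → ℝ => (WithLp.toLp 2 z : EuclideanSpace ℝ (Fin m))) :=
    PiLp.continuous_toLp 2 _
  induction l with
  | nil => simp [pdList]
  | cons i l ih =>
    obtain ⟨hi, hl'⟩ := List.nodup_cons.1 hl
    have hmeas : ∀ l, Measurable (fun z : Fin m → ℝ => ‖pdList l F (WithLp.toLp 2 z)‖ₑ) :=
      fun l => ((contDiff_pdList hF l).continuous.comp hcont).enorm.measurable
    refine (ih hl').trans ?_
    rw [List.toFinset_cons, lmarginal_insert' _ (hmeas _) (by simpa using hi)]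
    refine lmarginal_mono fun z => ?_
    set L : ℝ → EuclideanSpace ℝ (Fin m) := fun t => WithLp.toLp 2 (Function.update z i t) with hL
    have hLd : ∀ t, HasDerivAt L (EuclideanSpace.single i 1) t := fun t =>
      (PiLp.continuousLinearEquiv 2 ℝ (fun _ : Fin m => ℝ)).symm.toContinuousLinearMap.hasFDerivAt.comp_hasDerivAt
        t (hasDerivAt_update z i t)
    have hLe : Topology.IsClosedEmbedding L :=
      (PiLp.homeomorph 2 (fun _ : Fin m => ℝ)).symm.isClosedEmbedding.comp
        (isClosedEmbedding_update z i)
    have hLc : ContDiff ℝ 1 L :=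
      (PiLp.continuousLinearEquiv 2 ℝ (fun _ : Fin m => ℝ)).symm.contDiff.comp
        (contDiff_update 1 z i)
    have h1 := HasCompactSupport.enorm_le_lintegral_Ici_deriv (f := pdList l F ∘ L)
      (((contDiff_pdList hF l).of_le (by simp)).comp hLc)
      ((hasCompactSupport_pdList hc l).comp_isClosedEmbedding hLe) (z i)
    have h2 : (pdList l F ∘ L) (z i) = pdList l F (WithLp.toLp 2 z) := by simp [L]
    rw [h2] at h1
    refine h1.trans ((setLIntegral_le_lintegral _ _).trans (lintegral_mono fun t => ?_))
    have h3 := ((contDiff_pdList hF l).differentiable (by simp) (L t)).hasFDerivAt.comp_hasDerivAt t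
      (hLd t)
    rw [h3.deriv]
    rfl

/-- All coordinates together give the crude embedding of `W^{m,1}` in `L^∞`. The loss of `m`
derivatives is harmless, since extensions to `𝒟^j` are allowed with `j` as large as desired. -/
theorem enorm_le_lintegral_pdList {F : EuclideanSpace ℝ (Fin m) → ℝ} (hF : ContDiff ℝ ∞ F)
    (hc : HasCompactSupport F) (y : EuclideanSpace ℝ (Fin m)) :
    ‖F y‖ₑ ≤ ∫⁻ z, ‖pdList (List.finRange m) F z‖ₑ := by
  have h := enorm_le_lmarginal_pdList hF hc (List.finRange m) (List.nodup_finRange m) (WithLp.ofLp y)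
  have h2 : (List.finRange m).toFinset = Finset.univ := by ext; simp
  rw [h2, lmarginal_univ] at h
  refine h.trans (le_of_eq ?_)
  exact ((PiLp.volume_preserving_toLp (Fin m)).lintegral_comp_emb
    (MeasurableEquiv.toLp 2 (Fin m → ℝ)).measurableEmbedding
    fun z : EuclideanSpace ℝ (Fin m) => ‖pdList (List.finRange m) F z‖ₑ)

end CrudeSobolev

/-! ### Functions supported in a chart -/

section PushChart

/-- A function supported in the domain of the chart around `p`, in coordinates. -/
def pushChart (p : M) (f : SmoothFun m M) : EuclideanSpace ℝ (Fin m) → ℝ :=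
  (extChartAt (𝓡 m) p).target.indicator (f ∘ (extChartAt (𝓡 m) p).symm)

theorem pushChart_of_mem {p : M} (f : SmoothFun m M) {y : EuclideanSpace ℝ (Fin m)}
    (hy : y ∈ (extChartAt (𝓡 m) p).target) :
    pushChart p f y = f ((extChartAt (𝓡 m) p).symm y) := indicator_of_mem hy _

theorem pushChart_apply {p x : M} (f : SmoothFun m M) (hx : x ∈ (extChartAt (𝓡 m) p).source) :
    pushChart p f (extChartAt (𝓡 m) p x) = f x := by
  rw [pushChart_of_mem f ((extChartAt (𝓡 m) p).map_source hx), (extChartAt (𝓡 m) p).left_inv hx]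

theorem pushChart_eventuallyEq {p : M} (f : SmoothFun m M) {y : EuclideanSpace ℝ (Fin m)}
    (hy : y ∈ (extChartAt (𝓡 m) p).target) :
    pushChart p f =ᶠ[𝓝 y] f ∘ (extChartAt (𝓡 m) p).symm := by
  filter_upwards [extChartAt_target_mem_nhds_of_mem hy] with z hz using pushChart_of_mem f hz

variable [CompactSpace M]

theorem isCompact_image_tsupport {p : M} {f : SmoothFun m M}
    (hf : tsupport f ⊆ (extChartAt (𝓡 m) p).source) :
    IsCompact (extChartAt (𝓡 m) p '' tsupport f) :=
  (isClosed_tsupport f).isCompact.image_of_continuousOn ((continuousOn_extChartAt p).mono hf)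

theorem tsupport_pushChart {p : M} {f : SmoothFun m M}
    (hf : tsupport f ⊆ (extChartAt (𝓡 m) p).source) :
    tsupport (pushChart p f) ⊆ extChartAt (𝓡 m) p '' tsupport f := by
  refine closure_minimal (fun y hy => ?_) (isCompact_image_tsupport hf).isClosed
  have hyt : y ∈ (extChartAt (𝓡 m) p).target := by
    by_contra h
    exact hy (indicator_of_notMem h _)
  rw [Function.mem_support, pushChart_of_mem f hyt] at hy
  exact ⟨_, subset_tsupport _ hy, (extChartAt (𝓡 m) p).right_inv hyt⟩

theorem image_tsupport_subset_target {p : M} {f : SmoothFun m M}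
    (hf : tsupport f ⊆ (extChartAt (𝓡 m) p).source) :
    extChartAt (𝓡 m) p '' tsupport f ⊆ (extChartAt (𝓡 m) p).target := by
  rintro _ ⟨x, hx, rfl⟩
  exact (extChartAt (𝓡 m) p).map_source (hf hx)

theorem hasCompactSupport_pushChart {p : M} {f : SmoothFun m M}
    (hf : tsupport f ⊆ (extChartAt (𝓡 m) p).source) : HasCompactSupport (pushChart p f) :=
  (isCompact_image_tsupport hf).of_isClosed_subset (isClosed_tsupport _) (tsupport_pushChart hf)

theorem contDiff_pushChart {p : M} {f : SmoothFun m M}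
    (hf : tsupport f ⊆ (extChartAt (𝓡 m) p).source) : ContDiff ℝ ∞ (pushChart p f) := by
  rw [contDiff_iff_contDiffAt]
  intro y
  by_cases hy : y ∈ (extChartAt (𝓡 m) p).target
  · exact ((contDiffOn_comp_extChartAt_symm p f).contDiffAt
      (extChartAt_target_mem_nhds_of_mem hy)).congr_of_eventuallyEq (pushChart_eventuallyEq f hy)
  · have h : y ∉ tsupport (pushChart p f) := fun h =>
      hy (image_tsupport_subset_target hf (tsupport_pushChart hf h))
    refine (contDiffAt_const (c := (0 : ℝ))).congr_of_eventuallyEq ?_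
    filter_upwards [(isClosed_tsupport _).isOpen_compl.mem_nhds h] with z hz
    exact image_eq_zero_of_notMem_tsupport hz

theorem tsupport_dirD_subset (X : VF m M) (f : SmoothFun m M) : tsupport (dirD X f) ⊆ tsupport f := by
  refine closure_minimal (fun x hx => ?_) (isClosed_tsupport f)
  by_contra h
  refine hx ?_
  have h1 : (f : M → ℝ) =ᶠ[𝓝 x] fun _ => 0 := by
    filter_upwards [(isClosed_tsupport f).isOpen_compl.mem_nhds h] with z hz
    exact image_eq_zero_of_notMem_tsupport hz
  have h2 : mvfderiv (𝓡 m) f x = mvfderiv (𝓡 m) (fun _ : M => (0 : ℝ)) x := h1.mfderiv_eq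
  rw [mvfderiv_const] at h2
  exact congrArg (fun L => L (X x)) h2

/-- Coordinate fields cut off outside `K` are global, and for functions supported over `K` they act
as the Euclidean partial derivatives. -/
theorem exists_coordinateFields (p : M) {K : Set (EuclideanSpace ℝ (Fin m))} (hK : IsCompact K)
    (hKt : K ⊆ (extChartAt (𝓡 m) p).target) : ∃ X : Fin m → VF m M,
      (∀ i, ∀ y ∈ K, coordVF p (X i) y = EuclideanSpace.single i 1) ∧
      ∀ f : SmoothFun m M, extChartAt (𝓡 m) p '' tsupport f ⊆ K →
        tsupport f ⊆ (extChartAt (𝓡 m) p).source → ∀ i y,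
        fderiv ℝ (pushChart p f) y (EuclideanSpace.single i 1) = pushChart p (dirD (X i) f) y := by
  obtain ⟨g, hg, hgc, hgs, hg1, -⟩ := exists_cutoff hK (isOpen_extChartAt_target (I := 𝓡 m) p) hKt
  choose X hX _ using fun i : Fin m => exists_chartVF p
    (V := fun y => g y • EuclideanSpace.single i (1 : ℝ)) (hg.smul contDiff_const)
    hgc.smul_right ((tsupport_smul_subset_left g _).trans hgs)
  have hcoord : ∀ i, ∀ y ∈ K, coordVF p (X i) y = EuclideanSpace.single i 1 := by
    intro i y hy
    have h1 := mfderiv_symm_coordVF (X i) (hKt hy)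
    have h2 := hX i _ ((extChartAt (𝓡 m) p).map_target (hKt hy))
    rw [(extChartAt (𝓡 m) p).right_inv (hKt hy),
      (eventually_nhdsSet_iff_forall.1 hg1 y hy).self_of_nhds, one_smul] at h2
    rw [h2] at h1
    have h3 := congrArg (mfderiv (𝓡 m) 𝓘(ℝ, EuclideanSpace ℝ (Fin m)) (extChartAt (𝓡 m) p)
      ((extChartAt (𝓡 m) p).symm y)) h1
    rw [mfderiv_extChartAt_comp_symm (hKt hy), mfderiv_extChartAt_comp_symm (hKt hy)] at h3
    exact h3
  refine ⟨X, hcoord, fun f hf hfs i y => ?_⟩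
  by_cases hy : y ∈ extChartAt (𝓡 m) p '' tsupport f
  · have hyt := hKt (hf hy)
    rw [pushChart_of_mem _ hyt, dirD_chart (X i) f hyt, hcoord i y (hf hy),
      (pushChart_eventuallyEq f hyt).fderiv_eq]
  · have h1 : y ∉ tsupport (pushChart p f) := fun h => hy (tsupport_pushChart hfs h)
    have h2 : fderiv ℝ (pushChart p f) y = 0 :=
      image_eq_zero_of_notMem_tsupport fun h => h1 (tsupport_fderiv_subset ℝ h)
    have h3 : pushChart p (dirD (X i) f) y = 0 := by
      refine image_eq_zero_of_notMem_tsupport fun h => hy ?_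
      exact image_mono (tsupport_dirD_subset (X i) f) (tsupport_pushChart
        ((tsupport_dirD_subset (X i) f).trans hfs) h)
    rw [h2, h3]; rfl

theorem exists_iterD_eq_pdList (p : M) {K : Set (EuclideanSpace ℝ (Fin m))} (hK : IsCompact K)
    (hKt : K ⊆ (extChartAt (𝓡 m) p).target) : ∃ X : Fin m → VF m M,
      ∀ f : SmoothFun m M, extChartAt (𝓡 m) p '' tsupport f ⊆ K →
        tsupport f ⊆ (extChartAt (𝓡 m) p).source → ∀ l : List (Fin m),
        tsupport (iterD (l.map X) f) ⊆ tsupport f ∧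
        pdList l (pushChart p f) = pushChart p (iterD (l.map X) f) := by
  obtain ⟨X, -, hX⟩ := exists_coordinateFields p hK hKt
  refine ⟨X, fun f hf hfs l => ?_⟩
  induction l with
  | nil => exact ⟨subset_rfl, rfl⟩
  | cons i l ih =>
    refine ⟨(tsupport_dirD_subset _ _).trans ih.1, funext fun y => ?_⟩
    show fderiv ℝ (pdList l (pushChart p f)) y _ = pushChart p (dirD (X i) (iterD (l.map X) f)) y
    rw [ih.2]
    exact hX _ ((image_mono ih.1).trans hf) (ih.1.trans hfs) i y

end PushChart


/-! ### Sobolev bounds on the manifold -/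

section SobolevBounds

variable [RiemannianBundle (fun x : M => TangentSpace (𝓡 m) x)]
  [IsContMDiffRiemannianBundle (𝓡 m) ∞ (EuclideanSpace ℝ (Fin m))
    (fun x : M => TangentSpace (𝓡 m) x)]
  [MeasurableSpace M] [BorelSpace M] [CompactSpace M]

/-- The density of `vol` is bounded below on the compact set `K`. -/
theorem exists_lintegral_pushChart_le [Nonempty M] (p : M) {K : Set (EuclideanSpace ℝ (Fin m))}
    (hK : IsCompact K) (hKt : K ⊆ (extChartAt (𝓡 m) p).target) : ∃ B : NNReal,
      ∀ f : SmoothFun m M, extChartAt (𝓡 m) p '' tsupport f ⊆ K →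
        tsupport f ⊆ (extChartAt (𝓡 m) p).source →
        ∫⁻ y, ‖pushChart p f y‖ₑ ≤ B * ∫⁻ x, ‖f x‖ₑ ∂(vol m M) := by
  set e := extChartAt (𝓡 m) p with he
  have hσ : ContinuousOn (fun y => volConst m M * dens p y) e.target :=
    continuousOn_const.mul (contDiffOn_dens p).continuousOn
  have hσ0 : ∀ y ∈ e.target, 0 < volConst m M * dens p y := fun y hy =>
    mul_pos volConst_pos (dens_pos p hy)
  obtain ⟨C, hC⟩ := hK.exists_bound_of_continuousOn
    ((hσ.mono hKt).inv₀ fun y hy => (hσ0 y (hKt hy)).ne')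
  refine ⟨C.toNNReal, fun f hf hfs => ?_⟩
  have hm := measurableSet_target (m := m) p
  have h1 : ∫⁻ y, ‖pushChart p f y‖ₑ = ∫⁻ y in e.target, ‖f (e.symm y)‖ₑ := by
    rw [← lintegral_indicator hm]
    refine lintegral_congr fun y => ?_
    by_cases hy : y ∈ e.target
    · rw [indicator_of_mem hy, pushChart_of_mem f hy]
    · rw [indicator_of_notMem hy, pushChart, indicator_of_notMem hy, enorm_zero]
  have h2 : ∫⁻ x in e.source, ‖f x‖ₑ ∂(vol m M) =
      ∫⁻ y in e.target, ENNReal.ofReal (volConst m M * dens p y) * ‖f (e.symm y)‖ₑ := by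
    rw [restrict_vol, ← Measure.restrict_univ (μ := chartMeasure _ _), setLIntegral_chartMeasure p
      (σ := fun y => volConst m M * dens p y) hσ MeasurableSet.univ
      (f.contMDiff.continuous.enorm.continuousOn), preimage_univ, inter_univ]
  rw [h1]
  refine le_trans ?_ (mul_le_mul_right (setLIntegral_le_lintegral e.source _) _)
  rw [h2, ← lintegral_const_mul' _ _ ENNReal.coe_ne_top]
  refine setLIntegral_mono' hm fun y hy => ?_
  by_cases h0 : f (e.symm y) = 0
  · simp [h0]
  · have hyK : y ∈ K := hf ⟨e.symm y, subset_tsupport _ h0, e.right_inv hy⟩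
    have h3 : 1 ≤ C * (volConst m M * dens p y) := by
      have := hC y hyK
      simp only [Pi.inv_apply, norm_inv, Real.norm_eq_abs, abs_of_pos (hσ0 y hy)] at this
      rwa [inv_le_iff_one_le_mul₀ (hσ0 y hy)] at this
    have h4 : (1 : ENNReal) ≤ C.toNNReal * ENNReal.ofReal (volConst m M * dens p y) := by
      have hC0 : 0 ≤ C := by
        by_contra h
        nlinarith [hσ0 y hy]
      rw [← ENNReal.ofReal, ← ENNReal.ofReal_mul hC0, ← ENNReal.ofReal_one]
      exact ENNReal.ofReal_le_ofReal h3
    rw [← mul_assoc]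
    exact le_mul_of_one_le_left' h4

theorem lintegral_enorm_le_toLpVol [Nonempty M] (f : SmoothFun m M) :
    ∫⁻ x, ‖f x‖ₑ ∂(vol m M) ≤ ENNReal.ofReal ‖toLpVol f‖ := by
  have h1 := ContinuousMap.coeFn_toLp (p := 2) (𝕜 := ℝ) (vol m M) (toC f)
  rw [← eLpNorm_one_eq_lintegral_enorm]
  refine (eLpNorm_le_eLpNorm_of_exponent_le (q := 2) (by norm_num)
    f.contMDiff.continuous.aestronglyMeasurable).trans ?_
  have h2 : ENNReal.ofReal ‖toLpVol f‖ = eLpNorm (toLpVol f : M → ℝ) 2 (vol m M) := by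
    rw [Lp.norm_def, ENNReal.ofReal_toReal (Lp.eLpNorm_ne_top _)]
  rw [h2]
  exact (eLpNorm_congr_ae h1.symm).le

/-- The crude embedding in a chart, with the `m` coordinate fields each used once; the `L¹` norm is
bounded by the `L²` norm because `vol` is a probability measure. -/
theorem exists_sup_bound [Nonempty M] (p : M) (χ : SmoothFun m M)
    (hχ : tsupport χ ⊆ (extChartAt (𝓡 m) p).source) : ∃ (l : List (VF m M)) (C : ℝ),
      l.length = m ∧ ∀ (h : SmoothFun m M) (x : M), |χ x * h x| ≤ C * ‖toLpVol (iterD l (χ * h))‖ := by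
  obtain ⟨X, hX⟩ := exists_iterD_eq_pdList p (isCompact_image_tsupport hχ)
    (image_tsupport_subset_target hχ)
  obtain ⟨B, hB⟩ := exists_lintegral_pushChart_le p (isCompact_image_tsupport hχ)
    (image_tsupport_subset_target hχ)
  refine ⟨(List.finRange m).map X, B, by simp, fun h x => ?_⟩
  have hts : tsupport (χ * h) ⊆ tsupport χ := tsupport_mul_subset_left
  by_cases hx : x ∈ (extChartAt (𝓡 m) p).source
  · obtain ⟨h1, h2⟩ := hX (χ * h) (image_mono hts) (hts.trans hχ) (List.finRange m)
    have h3 := enorm_le_lintegral_pdList (contDiff_pushChart (hts.trans hχ))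
      (hasCompactSupport_pushChart (hts.trans hχ)) (extChartAt (𝓡 m) p x)
    rw [h2, pushChart_apply _ hx] at h3
    have h4 := h3.trans ((hB _ (image_mono (h1.trans hts)) ((h1.trans hts).trans hχ)).trans
      (mul_le_mul_right (lintegral_enorm_le_toLpVol _) _))
    rw [← ENNReal.ofReal_coe_nnreal, ← ENNReal.ofReal_mul B.coe_nonneg, ← ofReal_norm,
      ENNReal.ofReal_le_ofReal_iff (by positivity)] at h4
    exact h4
  · have : χ x = 0 := image_eq_zero_of_notMem_tsupport fun h => hx (hχ h)
    rw [this, zero_mul, abs_zero]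
    positivity

/-- The differential operators of order at most `k`, as combinations of iterated derivatives along
the gradients of the `ι_i`. -/
def diffOps {N : ℕ} (ι : Fin N → SmoothFun m M) (k : ℕ) :
    Submodule (SmoothFun m M) (SmoothFun m M → SmoothFun m M) :=
  Submodule.span _ {P | ∃ β : List (Fin N), β.length ≤ k ∧
    P = fun f => iterD (β.map fun i => grad (ι i)) f}

theorem diffOps_mono {N : ℕ} {ι : Fin N → SmoothFun m M} {k k' : ℕ} (h : k ≤ k') :
    diffOps ι k ≤ diffOps ι k' :=
  Submodule.span_mono fun _ ⟨β, hβ, hP⟩ => ⟨β, hβ.trans h, hP⟩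

/-- Dualizing the frame gives `Y = ∑ ⟨Y, F_i⟩ ∇ξ_i`. Derivatives along arbitrary fields are thus
combinations of derivatives along the gradients that define the Sobolev norms. -/
theorem IsFrame.dirD_grad {n : ℕ} {ξ : Fin n → SmoothFun m M} {F : Fin n → VF m M}
    (h : IsFrame ξ F) (Y : VF m M) (f : SmoothFun m M) :
    dirD Y f = ∑ i, innerFun Y (F i) * dirD (grad (ξ i)) f := by
  have h1 : Y = ∑ i, mulVF (innerFun Y (F i)) (grad (ξ i)) := by
    refine innerFun_ext fun Z => ?_
    rw [innerFun_sum]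
    conv_lhs => rw [innerFun_symm, h.vf_eq Z, innerFun_sum]
    refine Finset.sum_congr rfl fun i _ => ?_
    rw [innerFun_mulVF, innerFun_mulVF, innerFun_grad, innerFun_symm, mul_comm]
  conv_lhs => rw [h1]
  rw [dirD_sum_left]
  simp only [dirD_mulVF]

/-- By the Leibniz rule, differentiating a coefficient leaves the order unchanged and
differentiating an operator raises it by one. -/
theorem dirD_mem_diffOps {n : ℕ} {ξ : Fin n → SmoothFun m M} {F : Fin n → VF m M}
    (h : IsFrame ξ F) {N : ℕ} {ι : Fin N → SmoothFun m M} {σ : Fin n → Fin N}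
    (hσ : ∀ i, ι (σ i) = ξ i) (X : VF m M) {k : ℕ} {P : SmoothFun m M → SmoothFun m M}
    (hP : P ∈ diffOps ι k) : (fun f => dirD X (P f)) ∈ diffOps ι (k + 1) := by
  induction hP using Submodule.span_induction with
  | mem P hP =>
    obtain ⟨β, hβ, rfl⟩ := hP
    have h1 : (fun f => dirD X (iterD (β.map fun i => grad (ι i)) f)) = ∑ i : Fin n,
        innerFun X (F i) • fun f => iterD ((σ i :: β).map fun i => grad (ι i)) f := by
      funext f
      rw [h.dirD_grad, Finset.sum_apply]
      refine Finset.sum_congr rfl fun i _ => ?_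
      rw [← hσ i]; rfl
    rw [h1]
    exact Submodule.sum_mem _ fun i _ => Submodule.smul_mem _ _
      (Submodule.subset_span ⟨σ i :: β, by simpa using hβ, rfl⟩)
  | zero =>
    have : (fun f => dirD X ((0 : SmoothFun m M → SmoothFun m M) f)) = 0 := by
      funext f; exact map_zero _
    rw [this]; exact Submodule.zero_mem _
  | add P Q _ _ hP hQ =>
    have : (fun f => dirD X ((P + Q) f)) = (fun f => dirD X (P f)) + fun f => dirD X (Q f) := by
      funext f; exact map_add _ _ _
    rw [this]; exact Submodule.add_mem _ hP hQ
  | smul a P hP' hP =>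
    have : (fun f => dirD X ((a • P) f)) = dirD X a • P + a • fun f => dirD X (P f) := by
      funext f
      refine (dirD_mul X a (P f)).trans ?_
      (simp [mul_comm]; ring)
    rw [this]
    exact Submodule.add_mem _ (Submodule.smul_mem _ _ (diffOps_mono (Nat.le_succ k) hP'))
      (Submodule.smul_mem _ _ hP)

theorem iterD_mem_diffOps {n : ℕ} {ξ : Fin n → SmoothFun m M} {F : Fin n → VF m M}
    (h : IsFrame ξ F) {N : ℕ} {ι : Fin N → SmoothFun m M} {σ : Fin n → Fin N}
    (hσ : ∀ i, ι (σ i) = ξ i) (l : List (VF m M)) {k : ℕ} {P : SmoothFun m M → SmoothFun m M}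
    (hP : P ∈ diffOps ι k) : (fun f => iterD l (P f)) ∈ diffOps ι (k + l.length) := by
  induction l with
  | nil => exact hP
  | cons X l ih => exact dirD_mem_diffOps h hσ X ih

theorem id_mem_diffOps {N : ℕ} (ι : Fin N → SmoothFun m M) : (fun f => f) ∈ diffOps ι 0 :=
  Submodule.subset_span ⟨[], le_rfl, rfl⟩

theorem norm_toLpVol_mul_le (a f : SmoothFun m M) : ‖toLpVol (a * f)‖ ≤ ‖toC a‖ * ‖toLpVol f‖ := by
  have h1 := ContinuousMap.coeFn_toLp (p := 2) (𝕜 := ℝ) (vol m M) (toC f)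
  have h2 := ContinuousMap.coeFn_toLp (p := 2) (𝕜 := ℝ) (vol m M) (toC (a * f))
  refine Lp.norm_le_mul_norm_of_ae_le_mul ?_
  filter_upwards [h1, h2] with x hx1 hx2
  have e1 : (toLpVol f : M → ℝ) x = f x := hx1
  have e2 : (toLpVol (a * f) : M → ℝ) x = a x * f x := hx2
  rw [e1, e2, norm_mul]
  exact mul_le_mul_of_nonneg_right ((toC a).norm_coe_le_norm x) (norm_nonneg _)

theorem exists_norm_toLpVol_le {N : ℕ} {ι : Fin N → SmoothFun m M} {k : ℕ}
    {P : SmoothFun m M → SmoothFun m M} (hP : P ∈ diffOps ι k) :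
    ∃ C, ∀ f, ‖toLpVol (P f)‖ ≤ C * ‖Sobolev.ofSmooth ι k f‖ := by
  induction hP using Submodule.span_induction with
  | mem P hP =>
    obtain ⟨β, hβ, rfl⟩ := hP
    refine ⟨1, fun f => ?_⟩
    have h1 := norm_le_pi_norm (Sobolev.ofSmooth ι k f).1
      ⟨⟨β.length, Nat.lt_succ_of_le hβ⟩, fun i => β.get i⟩
    rw [one_mul]
    refine le_trans (le_of_eq ?_) h1
    have e : (β.map fun i => grad (ι i)) = List.ofFn fun i => grad (ι (β.get i)) := by
      conv_lhs => rw [← List.ofFn_get β, List.map_ofFn]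
      rfl
    show ‖toLpVol (iterD (β.map _) f)‖ = ‖toLpVol (iterD (List.ofFn fun i => grad (ι (β.get i))) f)‖
    rw [e]
  | zero => exact ⟨0, fun f => by simp [map_zero]⟩
  | add P Q _ _ hP hQ =>
    obtain ⟨C, hC⟩ := hP
    obtain ⟨D, hD⟩ := hQ
    refine ⟨C + D, fun f => ?_⟩
    rw [add_mul]
    refine le_trans ?_ (add_le_add (hC f) (hD f))
    rw [Pi.add_apply, map_add]
    exact norm_add_le _ _
  | smul a P _ hP =>
    obtain ⟨C, hC⟩ := hP
    refine ⟨‖toC a‖ * C, fun f => ?_⟩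
    rw [mul_assoc]
    exact (norm_toLpVol_mul_le a (P f)).trans (mul_le_mul_of_nonneg_left (hC f) (norm_nonneg _))

theorem norm_ofSmooth_mono {N : ℕ} (ι : Fin N → SmoothFun m M) {k k' : ℕ} (h : k ≤ k')
    (f : SmoothFun m M) : ‖Sobolev.ofSmooth ι k f‖ ≤ ‖Sobolev.ofSmooth ι k' f‖ := by
  refine (pi_norm_le_iff_of_nonneg (norm_nonneg _)).2 fun α => ?_
  exact norm_le_pi_norm (Sobolev.ofSmooth ι k' f).1
    ⟨⟨α.1, lt_of_lt_of_le α.1.2 (Nat.succ_le_succ h)⟩, α.2⟩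

/-- A partition of unity reduces to `exists_sup_bound`, whose `m` derivatives turn an operator of
order `k` into one of order `k + m`. -/
theorem exists_sup_norm_le [Nonempty M] {n : ℕ} {ξ : Fin n → SmoothFun m M} {F : Fin n → VF m M}
    (h : IsFrame ξ F) {N : ℕ} {ι : Fin N → SmoothFun m M} {σ : Fin n → Fin N}
    (hσ : ∀ i, ι (σ i) = ξ i) {k : ℕ} {P : SmoothFun m M → SmoothFun m M} (hP : P ∈ diffOps ι k) :
    ∃ C, ∀ f x, |P f x| ≤ C * ‖Sobolev.ofSmooth ι (k + m) f‖ := by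
  obtain ⟨s, ρ, h1, h2, -⟩ := exists_partition (m := m)
    (fun p : M => (extChartAt (𝓡 m) p).source) fun p => extChartAt_source_mem_nhds (I := 𝓡 m) p
  have h3 : ∀ p ∈ s, ∃ C, ∀ f x, |ρ p x * P f x| ≤ C * ‖Sobolev.ofSmooth ι (k + m) f‖ := by
    intro p hp
    obtain ⟨l, C, hl, hC⟩ := exists_sup_bound p (ρ p) (h2 p hp)
    have h4 := iterD_mem_diffOps h hσ l (Submodule.smul_mem _ (ρ p) hP)
    rw [hl] at h4
    obtain ⟨D, hD⟩ := exists_norm_toLpVol_le h4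
    refine ⟨|C| * D, fun f x => (hC (P f) x).trans ?_⟩
    rw [mul_assoc]
    exact mul_le_mul (le_abs_self C) (hD f) (norm_nonneg _) (abs_nonneg _)
  choose! C hC using h3
  refine ⟨∑ p ∈ s, C p, fun f x => ?_⟩
  have h5 : P f x = ∑ p ∈ s, ρ p x * P f x := by
    rw [← Finset.sum_mul, ← smoothFun_sum_apply, h1]; exact (one_mul _).symm
  rw [h5, Finset.sum_mul]
  exact (Finset.abs_sum_le_sum_abs _ _).trans (Finset.sum_le_sum fun p hp => hC p hp f x)

end SobolevBounds


/-! ### Constant fields and uniqueness of brackets and Levi-Civita derivatives -/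

section ConstantFields

variable [RiemannianBundle (fun x : M => TangentSpace (𝓡 m) x)]
  [IsContMDiffRiemannianBundle (𝓡 m) ∞ (EuclideanSpace ℝ (Fin m))
    (fun x : M => TangentSpace (𝓡 m) x)]
  [MeasurableSpace M] [BorelSpace M] [CompactSpace M]

/-- One more derivative gives a Lipschitz bound in the chart, with the Sobolev norm of `f` as a
factor. Uniformity over `f` is what later gives continuity in operator norm. -/
theorem exists_lipschitz_at [Nonempty M] {n : ℕ} {ξ : Fin n → SmoothFun m M} {F : Fin n → VF m M}
    (h : IsFrame ξ F) {N : ℕ} {ι : Fin N → SmoothFun m M} {σ : Fin n → Fin N}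
    (hσ : ∀ i, ι (σ i) = ξ i) {k : ℕ} {P : SmoothFun m M → SmoothFun m M} (hP : P ∈ diffOps ι k)
    (p : M) : ∃ C, ∀ᶠ x in 𝓝 p, ∀ f, |P f x - P f p| ≤
      C * ‖Sobolev.ofSmooth ι (k + 1 + m) f‖ * ‖extChartAt (𝓡 m) p x - extChartAt (𝓡 m) p p‖ := by
  have h1 : ∀ i, ∃ C, ∀ f x, |dirD (F i) (P f) x| ≤ C * ‖Sobolev.ofSmooth ι (k + 1 + m) f‖ :=
    fun i => exists_sup_norm_le h hσ (dirD_mem_diffOps h hσ (F i) hP)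
  choose C hC using h1
  have hp := mem_extChartAt_target (I := 𝓡 m) p
  obtain ⟨r, hr, hrt⟩ := Metric.nhds_basis_closedBall.mem_iff.1
    (extChartAt_target_mem_nhds_of_mem hp)
  have h2 : ∀ i, ∃ D, ∀ y ∈ Metric.closedBall (extChartAt (𝓡 m) p p) r,
      ‖fderiv ℝ (ξ i ∘ (extChartAt (𝓡 m) p).symm) y‖ ≤ D := fun i => by
    refine (isCompact_closedBall _ _).exists_bound_of_continuousOn
      (ContinuousOn.mono ?_ hrt)
    exact (contDiffOn_comp_extChartAt_symm p (ξ i)).continuousOn_fderiv_of_isOpen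
      (isOpen_extChartAt_target p) (by simp)
  choose D hD using h2
  refine ⟨∑ i, |C i| * |D i|, ?_⟩
  have h3 : ∀ᶠ x in 𝓝 p, extChartAt (𝓡 m) p x ∈ Metric.closedBall (extChartAt (𝓡 m) p p) r :=
    (continuousAt_extChartAt (I := 𝓡 m) p).eventually_mem (Metric.closedBall_mem_nhds _ hr)
  filter_upwards [h3, extChartAt_source_mem_nhds (I := 𝓡 m) p] with x hx hxs f
  have h4 : ∀ y ∈ Metric.closedBall (extChartAt (𝓡 m) p p) r,
      ‖fderiv ℝ (P f ∘ (extChartAt (𝓡 m) p).symm) y‖ ≤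
        (∑ i, |C i| * |D i|) * ‖Sobolev.ofSmooth ι (k + 1 + m) f‖ := by
    intro y hy
    rw [h.fderiv_chart p (P f) (hrt hy), Finset.sum_mul]
    refine (norm_sum_le _ _).trans (Finset.sum_le_sum fun i _ => ?_)
    rw [norm_smul, Real.norm_eq_abs]
    have h5 := (hC i f ((extChartAt (𝓡 m) p).symm y)).trans
      (mul_le_mul_of_nonneg_right (le_abs_self (C i)) (norm_nonneg _))
    have h6 := (hD i y hy).trans (le_abs_self _)
    refine (mul_le_mul h5 h6 (norm_nonneg _) (by positivity)).trans (le_of_eq (by ring))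
  have h7 := (convex_closedBall (extChartAt (𝓡 m) p p) r).norm_image_sub_le_of_norm_fderiv_le
    (𝕜 := ℝ) (f := P f ∘ (extChartAt (𝓡 m) p).symm) (fun y hy =>
      ((contDiffOn_comp_extChartAt_symm p (P f)).differentiableOn (by simp)).differentiableAt
        (extChartAt_target_mem_nhds_of_mem (hrt hy))) h4 (Metric.mem_closedBall_self hr.le) hx
  simpa only [Function.comp_apply, (extChartAt (𝓡 m) p).left_inv hxs,
    (extChartAt (𝓡 m) p).left_inv (mem_extChartAt_source (I := 𝓡 m) p), Real.norm_eq_abs] using h7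

theorem denseRange_ofSmoothL {N : ℕ} (ι : Fin N → SmoothFun m M) (s : ℕ) :
    DenseRange (ofSmoothL ι s : SmoothFun m M → Sobolev ι s) := by
  rintro ⟨u, hu⟩
  rw [closure_subtype]
  refine closure_mono ?_ hu
  rintro _ ⟨f, rfl⟩
  exact ⟨ofSmoothL ι s f, ⟨f, rfl⟩, rfl⟩

/-- The supremum bound extends evaluation of a derivative to a bounded functional on `H^j`, and the
Lipschitz bound makes it norm-continuous in the point. In the condition on `j`, the `1` pays for the
Lipschitz bound and `m` for the crude embedding. -/
theorem exists_continuous_eval [Nonempty M] {n : ℕ} {ξ : Fin n → SmoothFun m M}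
    {F : Fin n → VF m M} (h : IsFrame ξ F) {N : ℕ} {ι : Fin N → SmoothFun m M} {σ : Fin n → Fin N}
    (hσ : ∀ i, ι (σ i) = ξ i) (l : List (VF m M)) {j : ℕ} (hj : l.length + 1 + m ≤ j) :
    ∃ L : M → Sobolev ι j →L[ℝ] ℝ, Continuous L ∧
      ∀ x f, L x (Sobolev.ofSmooth ι j f) = iterD l f x := by
  have hP := iterD_mem_diffOps h hσ l (id_mem_diffOps ι)
  rw [zero_add] at hP
  obtain ⟨C, hC⟩ := exists_sup_norm_le h hσ hP
  let ev : M → SmoothFun m M →ₗ[ℝ] ℝ := fun x =>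
    (ContinuousMap.evalCLM ℝ x : C(M, ℝ) →L[ℝ] ℝ).toLinearMap.comp (toC.comp (iterD l))
  have hb : ∀ x, ∃ C, ∀ f, ‖ev x f‖ ≤ C * ‖ofSmoothL ι j f‖ := fun x => ⟨|C|, fun f =>
    (hC f x).trans (mul_le_mul (le_abs_self C) (norm_ofSmooth_mono ι (by omega) f)
      (norm_nonneg _) (abs_nonneg _))⟩
  have hL : ∀ x f, (ev x).extendOfNorm (ofSmoothL ι j) (Sobolev.ofSmooth ι j f) = iterD l f x :=
    fun x f => LinearMap.extendOfNorm_eq (denseRange_ofSmoothL ι j) (hb x) f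
  refine ⟨fun x => (ev x).extendOfNorm (ofSmoothL ι j), continuous_iff_continuousAt.2 fun p => ?_,
    hL⟩
  obtain ⟨K, hK⟩ := exists_lipschitz_at h hσ hP p
  refine (tendsto_iff_norm_sub_tendsto_zero (E := Sobolev ι j →L[ℝ] ℝ)).2 ?_
  have h1 : Tendsto (fun x => |K| * ‖extChartAt (𝓡 m) p x - extChartAt (𝓡 m) p p‖) (𝓝 p) (𝓝 0) := by
    have h2 : ContinuousAt (fun x => |K| * ‖extChartAt (𝓡 m) p x - extChartAt (𝓡 m) p p‖) p :=
      continuousAt_const.mul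
        ((continuousAt_extChartAt (I := 𝓡 m) p).sub continuousAt_const).norm
    simpa [ContinuousAt] using h2
  refine squeeze_zero' (Eventually.of_forall fun _ => by positivity) ?_ h1
  filter_upwards [hK] with x hx
  refine ContinuousLinearMap.opNorm_le_bound _ (by positivity) fun u => ?_
  refine (denseRange_ofSmoothL ι j).induction_on
    (p := fun u => ‖((ev x).extendOfNorm (ofSmoothL ι j) - (ev p).extendOfNorm (ofSmoothL ι j)) u‖ ≤
      |K| * ‖extChartAt (𝓡 m) p x - extChartAt (𝓡 m) p p‖ * ‖u‖) u
    (isClosed_le (by fun_prop) (by fun_prop)) fun f => ?_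
  rw [_root_.sub_apply]
  have h3 := hx f
  have e1 : (ev x).extendOfNorm (ofSmoothL ι j) (ofSmoothL ι j f) = iterD l f x := hL x f
  have e2 : (ev p).extendOfNorm (ofSmoothL ι j) (ofSmoothL ι j f) = iterD l f p := hL p f
  rw [e1, e2, Real.norm_eq_abs]
  refine h3.trans ?_
  rw [mul_right_comm]
  refine mul_le_mul (mul_le_mul_of_nonneg_right (le_abs_self K) (norm_nonneg _))
    (norm_ofSmooth_mono ι hj f) (norm_nonneg _) (by positivity)

/-- With `g` among the coordinates of `ι`, every derivative of `g ∘ φ` at `x` is a continuous linear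
functional of the point of the Sobolev space. Joint continuity of its derivative is norm-continuity
in `x`. -/
theorem isCInfkD_compDiff [Nonempty M] (g : SmoothFun m M) :
    IsCInfkD 1 fun φ : DiffM m M => compDiff g φ := by
  intro l
  obtain ⟨n, ξ, F, h⟩ := exists_isFrame m M
  obtain ⟨N, ι, σ, hι, hσ⟩ := exists_isEmb_extending (Fin.snoc (α := fun _ => SmoothFun m M) ξ g)
  have hσ1 : ∀ i, ι (σ (Fin.castSucc i)) = ξ i := fun i => by rw [hσ, Fin.snoc_castSucc]
  have hσ2 : ι (σ (Fin.last n)) = g := by rw [hσ, Fin.snoc_last]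
  refine ⟨N, ι, hι, fun s _ => ⟨max s (l.length + 1 + m), le_max_left _ _, univ, isOpen_univ,
    subset_univ _, ?_⟩⟩
  obtain ⟨L, hL, hLf⟩ := exists_continuous_eval h hσ1 l (le_max_right s (l.length + 1 + m))
  let L' : M → (Fin N → Sobolev ι (max s (l.length + 1 + m))) →L[ℝ] ℝ := fun x =>
    (L x).comp (ContinuousLinearMap.proj (σ (Fin.last n)))
  have hL' : Continuous L' := hL.clm_comp continuous_const
  refine ⟨fun x u => L' x u, fun x => (L' x).contDiff.contDiffOn, fun i hi => ?_, fun x φ => ?_⟩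
  · refine Continuous.continuousOn ?_
    interval_cases i
    · simp only [iteratedFDeriv_zero_eq_comp]
      exact (LinearIsometryEquiv.continuous _).comp
        ((hL'.comp continuous_fst).clm_apply continuous_snd)
    · simp only [iteratedFDeriv_succ_eq_comp_right, iteratedFDeriv_zero_eq_comp]
      refine (LinearIsometryEquiv.continuous _).comp ((LinearIsometryEquiv.continuous _).comp ?_)
      simp only [ContinuousLinearMap.fderiv]
      exact hL'.comp continuous_fst
  · show L x (inclD ι _ φ (σ (Fin.last n))) = _
    rw [inclD, hLf, hσ2]

/-- These right-invariant fields take every value at a given `φ`, so the Koszul formula tested on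
them determines the derivative. -/
theorem isGammaD_const [Nonempty M] (C : VF m M) : IsGammaD 1 (fun _ : DiffM m M => C) := fun f =>
  isCInfkD_compDiff (dirD C f)

theorem intD_sq_eq_zero [Nonempty M] {φ : DiffM m M} {f : SmoothFun m M} (hf : ∀ x, 0 ≤ f x)
    (h : intD φ f = 0) : f = 0 := by
  have hc : Continuous fun x => f (φ x) := f.contMDiff.continuous.comp φ.continuous
  have h1 := (integral_eq_zero_iff_of_nonneg (μ := vol m M) (fun x => hf (φ x))
    (hc.integrable_of_hasCompactSupport (HasCompactSupport.of_compactSpace _))).1 h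
  have h2 := (Continuous.ae_eq_iff_eq (vol m M) hc continuous_const).1 h1
  ext x
  have h3 : f (φ (φ.symm x)) = 0 := congrFun h2 (φ.symm x)
  rwa [φ.apply_symm_apply] at h3

theorem hasLieDerivD_integral (f g : SmoothFun m M) (φ : DiffM m M) (X : VF m M) :
    HasLieDerivD (fun ψ : DiffM m M => ∫ x, g x * f (ψ x) ∂(vol m M)) φ X
      (∫ x, g x * dirD X f (φ x) ∂(vol m M)) := by
  refine hasLieDerivD_iff.2 fun c hc => ?_
  have h1 := (hc.hasCInfDerivAt f) []
  exact hasDerivAt_integral_continuousMap ((hasDerivAt_const (0 : ℝ) (toC g)).mul h1 |>.congr_deriv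
    (g' := toC g * toC (compDiff (dirD X f) φ)) (by rw [zero_mul, zero_add]; rfl))

/-- Tested on `ψ ↦ ∫ g (f ∘ ψ)` with `g = (X f - Y f) ∘ φ`, two brackets differ by the integral of
`((X f - Y f) ∘ φ)²`. -/
theorem IsBracketD.unique [Nonempty M] {A B : VFD m M} {φ : DiffM m M} {X Y : VF m M}
    (hX : IsBracketD A B φ X) (hY : IsBracketD A B φ Y) : X = Y := by
  refine VF.ext_dirD fun f => ?_
  let g : SmoothFun m M := compDiff (dirD X f - dirD Y f) φ
  obtain ⟨FA, FB, r₁, r₂, h1, h2, h3, h4, h5⟩ := hX _ (isCkD_integral f g)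
  obtain ⟨FA', FB', r₁', r₂', h1', h2', h3', h4', h5'⟩ := hY _ (isCkD_integral f g)
  have eA : FA = FA' := funext fun ψ => (h1 ψ).unique (h1' ψ)
  have eB : FB = FB' := funext fun ψ => (h2 ψ).unique (h2' ψ)
  subst eA eB
  rw [← h3.unique h3', ← h4.unique h4'] at h5'
  have e1 := h5.unique (hasLieDerivD_integral f g φ X)
  have e2 := h5'.unique (hasLieDerivD_integral f g φ Y)
  have e3 : intD φ ((dirD X f - dirD Y f) * dirD X f) = intD φ ((dirD X f - dirD Y f) * dirD Y f) :=
    e1.symm.trans e2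
  have e4 : intD φ ((dirD X f - dirD Y f) * (dirD X f - dirD Y f)) = 0 := by
    rw [mul_sub, map_sub, e3, sub_self]
  have e5 := intD_sq_eq_zero (fun x => mul_self_nonneg _) e4
  ext x
  exact sub_eq_zero.1 (mul_self_eq_zero.1 (congrArg (fun q : SmoothFun m M => q x) e5))

/-- The test field is the constant field `W - W'`; the right-hand sides agree by uniqueness of Lie
derivatives and brackets. -/
theorem IsLeviCivitaD.unique [Nonempty M] {A B : VFD m M} {φ : DiffM m M} {W W' : VF m M}
    (h : IsLeviCivitaD A B φ W) (h' : IsLeviCivitaD A B φ W') : W = W' := by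
  obtain ⟨r₁, r₂, r₃, AB, AC, BC, h1, h2, h3, h4, h5, h6, h7⟩ := h _ (isGammaD_const (W - W'))
  obtain ⟨r₁', r₂', r₃', AB', AC', BC', h1', h2', h3', h4', h5', h6', h7'⟩ :=
    h' _ (isGammaD_const (W - W'))
  rw [← h1.unique h1', ← h2.unique h2', ← h3.unique h3', ← h4.unique h4', ← h5.unique h5',
    ← h6.unique h6', ← h7] at h7'
  have e1 : intD φ (innerFun (W - W') (W - W')) = 0 := by
    rw [innerFun_sub, map_sub]
    rw [metricD_eq, metricD_eq] at h7'
    linarith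
  have e2 := intD_sq_eq_zero (fun x => innerFun_self_nonneg _ x) e1
  ext x
  exact sub_eq_zero.1 (inner_self_eq_zero (E := TangentSpace (𝓡 m) x) (𝕜 := ℝ).1
    (congrArg (fun f : SmoothFun m M => f x) e2))

end ConstantFields


/-! ### Superpositions of translates and integrals along rays -/

section TranslationKernels

/-- The integral is the value at zero of the convolution of the constant one with a reflected kernel
depending on a parameter, so smoothness follows from that of such convolutions. -/
theorem contDiff_integral_param {P Z F : Type*} [NormedAddCommGroup P] [NormedSpace ℝ P]
    [NormedAddCommGroup Z] [NormedSpace ℝ Z] [MeasurableSpace Z] [BorelSpace Z]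
    [NormedAddCommGroup F] [NormedSpace ℝ F] [CompleteSpace F] {μ : Measure Z}
    [IsLocallyFiniteMeasure μ] {g : P → Z → F} (hg : ContDiff ℝ ∞ fun q : P × Z => g q.1 q.2)
    {k : Set Z} (hk : IsCompact k) (h0 : ∀ p, ∀ z ∉ k, g p z = 0) :
    ContDiff ℝ ∞ fun p => ∫ z, g p z ∂μ := by
  have h1 := contDiffOn_convolution_right_with_param_comp (𝕜 := ℝ) (μ := μ) (n := ⊤)
    (ContinuousLinearMap.lsmul ℝ ℝ : ℝ →L[ℝ] F →L[ℝ] F) (s := univ) (v := fun _ : P => (0 : Z))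
    contDiffOn_const (f := fun _ : Z => (1 : ℝ)) (g := fun p z => g p (-z)) (k := -k) isOpen_univ
    hk.neg (fun p z _ hz => h0 p _ hz) (locallyIntegrable_const _)
    ((hg.comp (contDiff_fst.prodMk contDiff_snd.neg)).contDiffOn)
  rw [contDiffOn_univ] at h1
  convert h1 using 2 with p
  simp only [convolution, ContinuousLinearMap.lsmul_apply, one_smul, zero_sub, neg_neg]

theorem sq_lintegral_le {Z : Type*} [MeasurableSpace Z] (ν : Measure Z) {w g : Z → ENNReal}
    (hw : Measurable w) (hg : Measurable g) :
    (∫⁻ z, w z * g z ∂ν) ^ 2 ≤ (∫⁻ z, w z ∂ν) * ∫⁻ z, w z * g z ^ 2 ∂ν := by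
  have h1 := ENNReal.lintegral_mul_le_Lp_mul_Lq (ν.withDensity w) Real.HolderConjugate.two_two
    (f := fun _ => 1) (g := g) aemeasurable_const hg.aemeasurable
  have h2 := ENNReal.rpow_le_rpow h1 (z := 2) (by norm_num)
  rw [ENNReal.mul_rpow_of_nonneg _ _ (by norm_num), ← ENNReal.rpow_mul, ← ENNReal.rpow_mul] at h2
  norm_num at h2
  rw [lintegral_withDensity_eq_lintegral_mul _ hw hg,
    lintegral_withDensity_eq_lintegral_mul _ hw (hg.pow_const 2)] at h2
  exact h2

variable {E : Type*} [NormedAddCommGroup E] [InnerProductSpace ℝ E] [FiniteDimensional ℝ E]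
  [MeasurableSpace E] [BorelSpace E]

/-- Weighted Cauchy-Schwarz, then invariance of Lebesgue measure under each translation. It covers
both mollification and `rayOp`. -/
theorem lintegral_sq_translates_le {Z : Type*} [MeasurableSpace Z] (ν : Measure Z) [SFinite ν]
    {w : Z → ENNReal} (hw : Measurable w) {ζ : Z → E} (hζ : Measurable ζ) {u : E → ENNReal}
    (hu : Measurable u) :
    ∫⁻ y, (∫⁻ z, w z * u (y - ζ z) ∂ν) ^ 2 ≤ (∫⁻ z, w z ∂ν) ^ 2 * ∫⁻ y, u y ^ 2 := by
  have hm : Measurable fun q : E × Z => u (q.1 - ζ q.2) := by fun_prop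
  calc ∫⁻ y, (∫⁻ z, w z * u (y - ζ z) ∂ν) ^ 2
      ≤ ∫⁻ y, (∫⁻ z, w z ∂ν) * ∫⁻ z, w z * u (y - ζ z) ^ 2 ∂ν :=
        lintegral_mono fun y => sq_lintegral_le ν hw (by fun_prop)
    _ = (∫⁻ z, w z ∂ν) * ∫⁻ z, (w z * ∫⁻ y, u y ^ 2) ∂ν := by
        rw [lintegral_const_mul _ (Measurable.lintegral_prod_right'
          (f := fun q : E × Z => w q.2 * u (q.1 - ζ q.2) ^ 2) (by fun_prop)),
          lintegral_lintegral_swap (by fun_prop)]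
        congr 1
        refine lintegral_congr fun z => ?_
        change ∫⁻ y, w z * u (y - ζ z) ^ 2 = _
        rw [lintegral_const_mul _ (by fun_prop)]
        congr 1
        exact lintegral_sub_right_eq_self (fun y => u y ^ 2) (ζ z)
    _ = _ := by rw [lintegral_mul_const _ hw]; ring

/-- The set over which the operator `rayOp` is an integral. -/
abbrev rayStrip (E : Type*) : Set (E × ℝ) := univ ×ˢ Icc (0 : ℝ) 1

/-- The field `∫ a(s) s ∫₀¹ b(y - r s) dr ds`, of divergence `(∫ a) b - a * b`. -/
def rayOp (a b : E → ℝ) (y : E) : E :=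
  ∫ q in rayStrip E, (a q.1 * b (y - q.2 • q.1)) • q.1

theorem measurableSet_rayStrip : MeasurableSet (rayStrip E) :=
  MeasurableSet.univ.prod measurableSet_Icc

theorem contDiff_rayOp {a b : E → ℝ} (ha : ContDiff ℝ ∞ a) (hb : ContDiff ℝ ∞ b)
    (hac : HasCompactSupport a) : ContDiff ℝ ∞ (rayOp a b) := by
  -- A cutoff in the ray parameter, equal to one on `[0, 1]`, gives the integrand compact support
  -- without changing the integral over the strip.
  obtain ⟨κ, hκ, hκc, -, hκ1, -⟩ := exists_cutoff (isCompact_Icc (a := (0 : ℝ)) (b := 1))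
    isOpen_univ (subset_univ _)
  have h1 : ContDiff ℝ ∞ fun y => ∫ q in rayStrip E,
      (κ q.2 * (a q.1 * b (y - q.2 • q.1))) • q.1 := by
    refine contDiff_integral_param (k := tsupport a ×ˢ tsupport κ) ?_
      (hac.isCompact.prod hκc.isCompact) fun y q hq => ?_
    · have e1 : ContDiff ℝ ∞ fun q : E × E × ℝ => κ q.2.2 := hκ.comp (by fun_prop)
      have e2 : ContDiff ℝ ∞ fun q : E × E × ℝ => a q.2.1 := ha.comp (by fun_prop)
      have e3 : ContDiff ℝ ∞ fun q : E × E × ℝ => b (q.1 - q.2.2 • q.2.1) := hb.comp (by fun_prop)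
      exact (e1.mul (e2.mul e3)).smul (by fun_prop)
    · rw [mem_prod, not_and_or] at hq
      rcases hq with hq | hq
      · rw [image_eq_zero_of_notMem_tsupport hq]; simp
      · rw [image_eq_zero_of_notMem_tsupport hq]; simp
  convert h1 using 2 with y
  refine setIntegral_congr_fun measurableSet_rayStrip fun q hq => ?_
  have : κ q.2 = 1 := (eventually_nhdsSet_iff_forall.1 hκ1 _ hq.2).self_of_nhds
  simp only [this, one_mul]

theorem exists_of_rayOp_ne_zero {a b : E → ℝ} {y : E} (h : rayOp a b y ≠ 0) :
    ∃ s, ∃ r ∈ Icc (0 : ℝ) 1, a s ≠ 0 ∧ b (y - r • s) ≠ 0 := by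
  by_contra! hc
  refine h (setIntegral_eq_zero_of_forall_eq_zero fun q hq => ?_)
  by_cases ha : a q.1 = 0
  · simp [ha]
  · simp [hc q.1 q.2 hq.2 ha]

theorem norm_rayOp_le {a b : E → ℝ} {A B ρ : ℝ} (hA : ∀ y, |a y| ≤ A) (hB : ∀ y, |b y| ≤ B)
    (ha : ∀ y, a y ≠ 0 → ‖y‖ ≤ ρ) (y : E) :
    ‖rayOp a b y‖ ≤ A * B * ρ * volume.real (Metric.closedBall (0 : E) ρ) := by
  have hA0 : 0 ≤ A := (abs_nonneg _).trans (hA 0)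
  have hB0 : 0 ≤ B := (abs_nonneg _).trans (hB 0)
  have h1 : rayOp a b y = ∫ q in Metric.closedBall (0 : E) ρ ×ˢ Icc (0 : ℝ) 1,
      (a q.1 * b (y - q.2 • q.1)) • q.1 := by
    refine setIntegral_eq_of_subset_of_forall_sdiff_eq_zero measurableSet_rayStrip
      (prod_mono_left (subset_univ _)) fun q hq => ?_
    have : a q.1 = 0 := by
      by_contra h
      exact hq.2 ⟨mem_closedBall_zero_iff.2 (ha _ h), hq.1.2⟩
    simp [this]
  have h2 : volume (Metric.closedBall (0 : E) ρ ×ˢ Icc (0 : ℝ) 1) =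
      volume (Metric.closedBall (0 : E) ρ) := by
    rw [Measure.volume_eq_prod, Measure.prod_prod]; simp
  rw [h1]
  have h3 := norm_setIntegral_le_of_norm_le_const (μ := volume)
    (s := Metric.closedBall (0 : E) ρ ×ˢ Icc (0 : ℝ) 1)
    (f := fun q : E × ℝ => (a q.1 * b (y - q.2 • q.1)) • q.1) (C := A * B * ρ)
    (by rw [h2]; exact measure_closedBall_lt_top) fun q hq => by
      rw [norm_smul, norm_mul, Real.norm_eq_abs, Real.norm_eq_abs]
      exact mul_le_mul (mul_le_mul (hA _) (hB _) (abs_nonneg _) hA0)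
        (mem_closedBall_zero_iff.1 hq.1) (norm_nonneg _) (by positivity)
  rwa [measureReal_def, h2] at h3

/-- `rayOp` superposes translates of `b` with weight `|a(s)| |s|`. The constant is the first moment
of `a`, which for a mollifier is at most its radius; this smallness is the reason for using rays. -/
theorem lintegral_sq_rayOp_le {a b : E → ℝ} (ha : Continuous a) (hb : Continuous b) :
    ∫⁻ y, ‖rayOp a b y‖ₑ ^ 2 ≤ (∫⁻ s, ‖a s‖ₑ * ‖s‖ₑ) ^ 2 * ∫⁻ y, ‖b y‖ₑ ^ 2 := by
  have h1 := lintegral_sq_translates_le ((volume : Measure (E × ℝ)).restrict (rayStrip E))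
    (w := fun q => ‖a q.1‖ₑ * ‖q.1‖ₑ) (by fun_prop) (ζ := fun q => q.2 • q.1) (by fun_prop)
    (u := fun y => ‖b y‖ₑ) (by fun_prop)
  have h2 : ∫⁻ q in rayStrip E, ‖a q.1‖ₑ * ‖q.1‖ₑ = ∫⁻ s, ‖a s‖ₑ * ‖s‖ₑ := by
    rw [Measure.volume_eq_prod, ← Measure.prod_restrict, Measure.restrict_univ,
      lintegral_prod _ (by fun_prop)]
    simp
  rw [h2] at h1
  refine le_trans (lintegral_mono fun y => ?_) h1
  refine pow_le_pow_left' ((enorm_integral_le_lintegral_enorm _).trans (le_of_eq ?_)) 2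
  refine lintegral_congr fun q => ?_
  rw [enorm_smul, enorm_mul]
  ring

theorem integrableOn_rayStrip {F : Type*} [NormedAddCommGroup F] {G : E × ℝ → F}
    (hG : Continuous G) {L : Set E} (hL : IsCompact L) (h0 : ∀ q : E × ℝ, q.1 ∉ L → G q = 0) :
    IntegrableOn G (rayStrip E) := by
  have h2 : IntegrableOn G (L ×ˢ Icc (0 : ℝ) 1) :=
    hG.continuousOn.integrableOn_compact (hL.prod isCompact_Icc)
  exact h2.of_forall_sdiff_eq_zero measurableSet_rayStrip fun q hq =>
    h0 q fun h => hq.2 ⟨h, hq.1.2⟩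

theorem integrable_rayStrip {F : Type*} [NormedAddCommGroup F] {G : E × E × ℝ → F}
    (hG : Continuous G) {K L : Set E} (hK : IsCompact K) (hL : IsCompact L)
    (h0 : ∀ y s r, r ∈ Icc (0 : ℝ) 1 → G (y, s, r) ≠ 0 → y ∈ K ∧ s ∈ L) :
    Integrable G ((volume : Measure E).prod ((volume : Measure (E × ℝ)).restrict (rayStrip E))) := by
  have h1 : (volume : Measure E).prod ((volume : Measure (E × ℝ)).restrict (rayStrip E)) =
      ((volume : Measure E).prod (volume : Measure (E × ℝ))).restrict (univ ×ˢ rayStrip E) := by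
    rw [← Measure.prod_restrict, Measure.restrict_univ]
  rw [h1]
  change IntegrableOn G _ _
  have h2 : IntegrableOn G (K ×ˢ L ×ˢ Icc (0 : ℝ) 1)
      ((volume : Measure E).prod (volume : Measure (E × ℝ))) :=
    hG.continuousOn.integrableOn_compact (hK.prod (hL.prod isCompact_Icc))
  refine h2.of_forall_sdiff_eq_zero (MeasurableSet.univ.prod measurableSet_rayStrip)
    fun q hq => ?_
  by_contra h
  obtain ⟨h3, h4⟩ := h0 q.1 q.2.1 q.2.2 hq.1.2.2 h
  exact hq.2 ⟨h3, h4, hq.1.2.2⟩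

/-- After translating `y` by `r s`, the integral over `r` is that of the derivative of `f (y + r
s)`, with value `f (y + s) - f y`. -/
theorem integral_fderiv_rayOp {a b f : E → ℝ} (ha : Continuous a) (hac : HasCompactSupport a)
    (hb : Continuous b) (hbc : HasCompactSupport b) (hf : ContDiff ℝ ∞ f) :
    ∫ y, fderiv ℝ f y (rayOp a b y) =
      (∫ y, ∫ s, f (y + s) * a s * b y) - (∫ s, a s) * ∫ y, f y * b y := by
  have hf' : Continuous (fderiv ℝ f) := hf.continuous_fderiv (by simp)
  let ν := (volume : Measure (E × ℝ)).restrict (rayStrip E)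
  let K : Set E := (fun q : E × E × ℝ => q.1 + q.2.2 • q.2.1) ''
    (tsupport b ×ˢ tsupport a ×ˢ Icc (0 : ℝ) 1)
  have hK : IsCompact K := (hbc.isCompact.prod (hac.isCompact.prod isCompact_Icc)).image
    (by fun_prop)
  have hI : ∀ {F : Type _} [NormedAddCommGroup F] [NormedSpace ℝ F] (g : E × E × ℝ → F),
      Continuous g → Integrable (fun q : E × E × ℝ => (a q.2.1 * b (q.1 - q.2.2 • q.2.1)) • g q)
        ((volume : Measure E).prod ν) := by
    intro F _ _ g hg
    refine integrable_rayStrip (K := K) (L := tsupport a) (by fun_prop) hK hac.isCompact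
      fun y s r hr h => ?_
    have h1 : a s ≠ 0 := fun h' => h (by simp [h'])
    have h2 : b (y - r • s) ≠ 0 := fun h' => h (by simp [h'])
    exact ⟨⟨(y - r • s, s, r), ⟨subset_tsupport _ h2, subset_tsupport _ h1, hr⟩, by simp⟩,
      subset_tsupport _ h1⟩
  have h1 : ∀ y, fderiv ℝ f y (rayOp a b y) =
      ∫ q, a q.1 * b (y - q.2 • q.1) * fderiv ℝ f y q.1 ∂ν := by
    intro y
    rw [rayOp, ← ContinuousLinearMap.integral_comp_comm]
    · simp [ν]
    · exact integrableOn_rayStrip (L := tsupport a) (by fun_prop) hac.isCompact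
        fun q hq => by simp [image_eq_zero_of_notMem_tsupport hq]
  have h2 : ∀ y, ∫ q, a q.1 * b y * fderiv ℝ f (y + q.2 • q.1) q.1 ∂ν =
      (∫ s, f (y + s) * a s * b y) - (∫ s, a s) * (f y * b y) := by
    intro y
    have e1 : ∀ s, ∫ r in Icc (0 : ℝ) 1, a s * b y * fderiv ℝ f (y + r • s) s =
        f (y + s) * a s * b y - a s * (f y * b y) := by
      intro s
      rw [integral_const_mul, integral_Icc_eq_integral_Ioc,
        ← intervalIntegral.integral_of_le zero_le_one,
        intervalIntegral.integral_eq_sub_of_hasDerivAt (f := fun r : ℝ => f (y + r • s))]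
      · simp; ring
      · intro r _
        have e2 : HasDerivAt (fun r : ℝ => y + r • s) s r := by
          simpa using ((hasDerivAt_id r).smul_const s).const_add y
        exact ((hf.differentiable (by simp)) _).hasFDerivAt.comp_hasDerivAt r e2
      · exact Continuous.intervalIntegrable (by fun_prop) _ _
    have e3 : IntegrableOn (fun q : E × ℝ => a q.1 * b y * fderiv ℝ f (y + q.2 • q.1) q.1)
        (rayStrip E) := integrableOn_rayStrip (L := tsupport a) (by fun_prop) hac.isCompact
        fun q hq => by simp [image_eq_zero_of_notMem_tsupport hq]
    have e4 : Integrable fun s => f (y + s) * a s * b y :=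
      Continuous.integrable_of_hasCompactSupport (by fun_prop) (hac.mul_left.mul_right)
    rw [show ν = (volume.prod volume).restrict (rayStrip E) from rfl, setIntegral_prod _ e3, Measure.restrict_univ, integral_congr_ae (ae_of_all _ e1),
      integral_sub e4 ((ha.integrable_of_hasCompactSupport hac).mul_const _),
      integral_mul_const (f y * b y) a]
  have h3 : Integrable (fun q : E × E × ℝ => a q.2.1 * b q.1 * fderiv ℝ f (q.1 + q.2.2 • q.2.1) q.2.1)
      ((volume : Measure E).prod ν) := by
    refine integrable_rayStrip (K := tsupport b) (L := tsupport a) (by fun_prop) hbc.isCompact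
      hac.isCompact fun y s r hr h => ⟨?_, ?_⟩
    · exact subset_tsupport _ fun h' => h (by simp [h'])
    · exact subset_tsupport _ fun h' => h (by simp [h'])
  have h4 : Integrable (fun q : E × E => f (q.1 + q.2) * a q.2 * b q.1)
      ((volume : Measure E).prod volume) := by
    refine Continuous.integrable_of_hasCompactSupport (by fun_prop)
      (HasCompactSupport.intro (hbc.isCompact.prod hac.isCompact) fun q hq => ?_)
    rw [mem_prod, not_and_or] at hq
    rcases hq with hq | hq
    · rw [image_eq_zero_of_notMem_tsupport hq, mul_zero]
    · rw [image_eq_zero_of_notMem_tsupport hq, mul_zero, zero_mul]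
  calc ∫ y, fderiv ℝ f y (rayOp a b y)
      = ∫ y, ∫ q, a q.1 * b (y - q.2 • q.1) * fderiv ℝ f y q.1 ∂ν :=
        integral_congr_ae (ae_of_all _ h1)
    _ = ∫ q, (∫ y, a q.1 * b (y - q.2 • q.1) * fderiv ℝ f y q.1) ∂ν :=
        integral_integral_swap (hI (fun q => fderiv ℝ f q.1 q.2.1) (by fun_prop))
    _ = ∫ q, (∫ y, a q.1 * b y * fderiv ℝ f (y + q.2 • q.1) q.1) ∂ν := by
        refine integral_congr_ae (ae_of_all _ fun q => ?_)
        have := integral_add_right_eq_self (μ := (volume : Measure E))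
          (fun y => a q.1 * b (y - q.2 • q.1) * fderiv ℝ f y q.1) (q.2 • q.1)
        simpa using this.symm
    _ = ∫ y, ∫ q, a q.1 * b y * fderiv ℝ f (y + q.2 • q.1) q.1 ∂ν :=
        (integral_integral_swap h3).symm
    _ = ∫ y, ((∫ s, f (y + s) * a s * b y) - (∫ s, a s) * (f y * b y)) :=
        integral_congr_ae (ae_of_all _ h2)
    _ = _ := by
        rw [integral_sub h4.integral_prod_left, integral_const_mul]
        exact (Continuous.integrable_of_hasCompactSupport (by fun_prop) hbc.mul_left).const_mul _

end TranslationKernels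


/-! ### Mollification of fields and of their divergences -/

section Mollification

variable {E : Type*} [NormedAddCommGroup E] [InnerProductSpace ℝ E] [FiniteDimensional ℝ E]
  [MeasurableSpace E] [BorelSpace E]

/-- A smooth probability density supported in the ball of radius `ε`. -/
structure IsMollifier (ε : ℝ) (η : E → ℝ) : Prop where
  smooth : ContDiff ℝ ∞ η
  compact : HasCompactSupport η
  nonneg : ∀ y, 0 ≤ η y
  integral : ∫ y, η y = 1
  support : ∀ y, η y ≠ 0 → ‖y‖ ≤ ε

theorem exists_isMollifier {ε : ℝ} (hε : 0 < ε) : ∃ η : E → ℝ, IsMollifier ε η := by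
  let b : ContDiffBump (0 : E) := ⟨ε / 2, ε, by positivity, by linarith⟩
  refine ⟨b.normed volume, b.contDiff_normed, b.hasCompactSupport_normed, b.nonneg_normed,
    b.integral_normed, fun y hy => ?_⟩
  have h1 : y ∈ Function.support (b.normed volume) := hy
  rw [b.support_normed_eq] at h1
  exact (mem_ball_zero_iff.1 h1).le

variable {ε : ℝ} {η : E → ℝ}

theorem IsMollifier.lintegral (h : IsMollifier ε η) : ∫⁻ y, ‖η y‖ₑ = 1 := by
  rw [← ofReal_integral_norm_eq_lintegral_enorm
    (h.smooth.continuous.integrable_of_hasCompactSupport h.compact)]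
  simp only [Real.norm_of_nonneg (h.nonneg _), h.integral, ENNReal.ofReal_one]

theorem IsMollifier.lintegral_mul (h : IsMollifier ε η) :
    ∫⁻ y, ‖η y‖ₑ * ‖y‖ₑ ≤ ENNReal.ofReal ε := by
  calc ∫⁻ y, ‖η y‖ₑ * ‖y‖ₑ ≤ ∫⁻ y, ‖η y‖ₑ * ENNReal.ofReal ε := lintegral_mono fun y => by
        by_cases hy : η y = 0
        · simp [hy]
        · have : ‖y‖ₑ ≤ ENNReal.ofReal ε := by
            rw [← ofReal_norm]; exact ENNReal.ofReal_le_ofReal (h.support y hy)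
          dsimp only
          gcongr
    _ = _ := by
      have hc := h.smooth.continuous
      rw [lintegral_mul_const _ (by fun_prop), h.lintegral, one_mul]

variable {F : Type*} [NormedAddCommGroup F] [NormedSpace ℝ F] [CompleteSpace F]

/-- The convolution `η * U`. -/
def mollify (η : E → ℝ) (U : E → F) (y : E) : F := ∫ x, η (y - x) • U x

theorem integrable_mollify (hη : Continuous η) {U : E → F} (hU : Continuous U)
    (hc : HasCompactSupport U) (y : E) : Integrable fun x => η (y - x) • U x :=
  Continuous.integrable_of_hasCompactSupport (by fun_prop) hc.smul_left

theorem mollify_sub (hη : Continuous η) {U V : E → F} (hU : Continuous U)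
    (hUc : HasCompactSupport U) (hV : Continuous V) (hVc : HasCompactSupport V) (y : E) :
    mollify η (U - V) y = mollify η U y - mollify η V y := by
  simp only [mollify, Pi.sub_apply, smul_sub]
  exact integral_sub (integrable_mollify hη hU hUc y) (integrable_mollify hη hV hVc y)

theorem contDiff_mollify (hη : ContDiff ℝ ∞ η) {U : E → F} (hU : ContDiff ℝ ∞ U)
    (hc : HasCompactSupport U) : ContDiff ℝ ∞ (mollify η U) := by
  refine contDiff_integral_param (k := tsupport U) ?_ hc.isCompact fun y x hx => by
    rw [image_eq_zero_of_notMem_tsupport hx, smul_zero]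
  have e1 : ContDiff ℝ ∞ fun q : E × E => η (q.1 - q.2) := hη.comp (by fun_prop)
  have e2 : ContDiff ℝ ∞ fun q : E × E => U q.2 := hU.comp (by fun_prop)
  exact e1.smul e2

theorem exists_of_mollify_ne_zero {U : E → F} {y : E} (h : mollify η U y ≠ 0) :
    ∃ x, η (y - x) ≠ 0 ∧ U x ≠ 0 := by
  by_contra! hc
  refine h (integral_eq_zero_of_ae (ae_of_all _ fun x => ?_))
  by_cases hx : η (y - x) = 0
  · simp [hx]
  · simp [hc x hx]

theorem lintegral_sq_mollify_le (hη : Continuous η) {U : E → F} (hU : Continuous U) :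
    ∫⁻ y, ‖mollify η U y‖ₑ ^ 2 ≤ (∫⁻ s, ‖η s‖ₑ) ^ 2 * ∫⁻ y, ‖U y‖ₑ ^ 2 := by
  refine le_trans (lintegral_mono fun y => ?_) (lintegral_sq_translates_le (volume : Measure E)
    (w := fun s => ‖η s‖ₑ) (by fun_prop) (ζ := fun s => s) measurable_id
    (u := fun y => ‖U y‖ₑ) hU.enorm.measurable)
  refine pow_le_pow_left' ((enorm_integral_le_lintegral_enorm _).trans (le_of_eq ?_)) 2
  have := lintegral_sub_left_eq_self (μ := (volume : Measure E))
    (fun x => ‖η x‖ₑ * ‖U (y - x)‖ₑ) y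
  rw [← this]
  refine lintegral_congr fun x => ?_
  rw [enorm_smul, sub_sub_cancel]

theorem IsMollifier.norm_mollify_sub_le (h : IsMollifier ε η) {U : E → F} (hU : Continuous U)
    {L : ℝ} (hL : ∀ x y, ‖U x - U y‖ ≤ L * ‖x - y‖) (hL0 : 0 ≤ L) (hc : HasCompactSupport U)
    (y : E) : ‖mollify η U y - U y‖ ≤ L * ε := by
  have hη := h.smooth.continuous
  have hi : Integrable fun x => η (y - x) :=
    ((h.smooth.continuous.integrable_of_hasCompactSupport h.compact).comp_sub_left y)
  have h1 : U y = ∫ x, η (y - x) • U y := by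
    rw [integral_smul_const, integral_sub_left_eq_self η volume y, h.integral, one_smul]
  have h2 : mollify η U y - U y = ∫ x, η (y - x) • (U x - U y) := by
    conv_lhs => rw [h1, mollify, ← integral_sub (integrable_mollify hη hU hc y) (hi.smul_const _)]
    simp only [smul_sub]
  rw [h2]
  have h3 : ∫ x, η (y - x) * (L * ε) = L * ε := by
    rw [integral_mul_const, integral_sub_left_eq_self η volume y, h.integral, one_mul]
  rw [← h3]
  refine norm_integral_le_of_norm_le (hi.mul_const _) (ae_of_all _ fun x => ?_)
  rw [norm_smul, Real.norm_of_nonneg (h.nonneg _)]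
  by_cases hx : η (y - x) = 0
  · simp [hx]
  · refine mul_le_mul_of_nonneg_left ((hL x y).trans (mul_le_mul_of_nonneg_left ?_ hL0)) (h.nonneg _)
    rw [norm_sub_rev]
    exact h.support _ hx

/-- The density `η * u - ∂η * U`. -/
def mollifyDiv (η : E → ℝ) (U : E → E) (u : E → ℝ) (t : E) : ℝ :=
  ∫ x, (η (t - x) * u x - fderiv ℝ η (t - x) (U x))

theorem contDiff_mollifyDiv (hη : ContDiff ℝ ∞ η) {U : E → E} {u : E → ℝ} (hU : ContDiff ℝ ∞ U)
    (hUc : HasCompactSupport U) (hu : ContDiff ℝ ∞ u) (huc : HasCompactSupport u) :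
    ContDiff ℝ ∞ (mollifyDiv η U u) := by
  refine contDiff_integral_param (k := tsupport U ∪ tsupport u) ?_
    (hUc.isCompact.union huc.isCompact) fun y x hx => ?_
  · have e1 : ContDiff ℝ ∞ fun q : E × E => η (q.1 - q.2) := hη.comp (by fun_prop)
    have e2 : ContDiff ℝ ∞ fun q : E × E => U q.2 := hU.comp (by fun_prop)
    have e3 : ContDiff ℝ ∞ fun q : E × E => u q.2 := hu.comp (by fun_prop)
    have e4 : ContDiff ℝ ∞ fun q : E × E => fderiv ℝ η (q.1 - q.2) :=
      (hη.fderiv_right (m := ∞) (by simp)).comp (by fun_prop)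
    exact (e1.mul e3).sub (e4.clm_apply e2)
  · rw [mem_union, not_or] at hx
    rw [image_eq_zero_of_notMem_tsupport hx.1, image_eq_zero_of_notMem_tsupport hx.2]
    simp

theorem exists_of_mollifyDiv_ne_zero {U : E → E} {u : E → ℝ} {t : E}
    (h : mollifyDiv η U u t ≠ 0) : ∃ x, t - x ∈ tsupport η ∧ (U x ≠ 0 ∨ u x ≠ 0) := by
  by_contra! hc
  refine h (integral_eq_zero_of_ae (ae_of_all _ fun x => ?_))
  by_cases hx : t - x ∈ tsupport η
  · simp [hc x hx]
  · have h1 : fderiv ℝ η (t - x) = 0 :=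
      image_eq_zero_of_notMem_tsupport fun h' => hx (tsupport_fderiv_subset ℝ h')
    simp [image_eq_zero_of_notMem_tsupport hx, h1]

/-- Exhibits the value at `t` as the pairing of `(U, u)` with the single test function `z ↦ η (t -
z)`, so that smallness against gradients yields a pointwise bound. -/
theorem mollifyDiv_eq (hη : ContDiff ℝ ∞ η) (U : E → E) (u : E → ℝ) (t : E) :
    mollifyDiv η U u t =
      ∫ x, (fderiv ℝ (fun z => η (t - z)) x (U x) + η (t - x) * u x) := by
  refine integral_congr_ae (ae_of_all _ fun x => ?_)
  have h1 : HasFDerivAt (fun z => η (t - z)) ((fderiv ℝ η (t - x)).comp (-ContinuousLinearMap.id ℝ E)) x :=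
    ((hη.differentiable (by simp)) (t - x)).hasFDerivAt.comp x ((hasFDerivAt_id x).const_sub t)
  dsimp only
  rw [h1.fderiv]
  simp
  ring

theorem integrable_prod_of_translate {G : E × E → ℝ} (hG : Continuous G) {K L : Set E}
    (hK : IsCompact K) (hL : IsCompact L) (h0 : ∀ y x, G (y, x) ≠ 0 → x ∈ K ∧ y - x ∈ L) :
    Integrable G ((volume : Measure E).prod volume) := by
  refine hG.integrable_of_hasCompactSupport (HasCompactSupport.intro
    (K := (fun q : E × E => (q.2 + q.1, q.1)) '' K ×ˢ L) ((hK.prod hL).image (by fun_prop))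
    fun q hq => ?_)
  by_contra h
  obtain ⟨h1, h2⟩ := h0 q.1 q.2 h
  exact hq ⟨(q.2, q.1 - q.2), ⟨h1, h2⟩, by simp⟩

/-- Integration by parts moves the derivative from `f` to `η`, after exchanging the order of
integration. -/
theorem integral_fderiv_mollify (hη : ContDiff ℝ ∞ η) (hηc : HasCompactSupport η) {U : E → E}
    {u f : E → ℝ} (hU : Continuous U) (hUc : HasCompactSupport U) (hu : Continuous u)
    (huc : HasCompactSupport u) (hf : ContDiff ℝ ∞ f) :
    (∫ y, fderiv ℝ f y (mollify η U y)) + ∫ y, ∫ s, f (y + s) * η s * u y =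
      ∫ t, f t * mollifyDiv η U u t := by
  have hf' : Continuous (fderiv ℝ f) := hf.continuous_fderiv (by simp)
  have hη' : Continuous (fderiv ℝ η) := hη.continuous_fderiv (by simp)
  have hfc := hf.continuous
  have hηc' := hη.continuous
  have i1 : Integrable (fun q : E × E => η (q.1 - q.2) * fderiv ℝ f q.1 (U q.2))
      ((volume : Measure E).prod volume) := by
    refine integrable_prod_of_translate (K := tsupport U) (L := tsupport η) (by fun_prop)
      hUc.isCompact hηc.isCompact fun y x h => ⟨?_, ?_⟩
    · exact subset_tsupport _ fun h' => h (by simp [h'])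
    · exact subset_tsupport _ fun h' => h (by simp [h'])
  have i2 : Integrable (fun q : E × E => -(fderiv ℝ η (q.1 - q.2) (U q.2) * f q.1))
      ((volume : Measure E).prod volume) := by
    refine integrable_prod_of_translate (K := tsupport U) (L := tsupport η) (by fun_prop)
      hUc.isCompact hηc.isCompact fun y x h => ⟨?_, ?_⟩
    · exact subset_tsupport _ fun h' => h (by simp [h'])
    · refine tsupport_fderiv_subset ℝ (subset_tsupport _ fun h' => h (by simp [h']))
  have i3 : Integrable (fun q : E × E => f q.1 * η (q.1 - q.2) * u q.2)
      ((volume : Measure E).prod volume) := by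
    refine integrable_prod_of_translate (K := tsupport u) (L := tsupport η) (by fun_prop)
      huc.isCompact hηc.isCompact fun y x h => ⟨?_, ?_⟩
    · exact subset_tsupport _ fun h' => h (by simp [h'])
    · exact subset_tsupport _ fun h' => h (by simp [h'])
  have e1 : ∀ x, ∫ y, η (y - x) * fderiv ℝ f y (U x) =
      ∫ y, -(fderiv ℝ η (y - x) (U x) * f y) := by
    intro x
    have hc : HasCompactSupport fun y => η (y - x) := hηc.comp_homeomorph (Homeomorph.subRight x)
    have hd : ∀ y, HasFDerivAt (fun y => η (y - x)) (fderiv ℝ η (y - x)) y := fun y =>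
      ((hη.differentiable (by simp)) (y - x)).hasFDerivAt.comp y ((hasFDerivAt_id y).sub_const x)
    have hd' : ∀ y, fderiv ℝ (fun y => η (y - x)) y = fderiv ℝ η (y - x) := fun y => (hd y).fderiv
    have hc' : HasCompactSupport fun y => fderiv ℝ η (y - x) :=
      (hηc.fderiv ℝ).comp_homeomorph (Homeomorph.subRight x)
    rw [integral_mul_fderiv_eq_neg_fderiv_mul_of_integrable (μ := volume)
      (f := fun y => η (y - x)) (g := f) (v := U x), integral_neg]
    · simp only [hd']
    · simp only [hd']
      refine Continuous.integrable_of_hasCompactSupport (by fun_prop) (hc'.mono ?_)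
      exact fun y hy h => hy (by simp [h])
    · exact Continuous.integrable_of_hasCompactSupport (by fun_prop) hc.mul_right
    · exact Continuous.integrable_of_hasCompactSupport (by fun_prop) hc.mul_right
    · exact fun y _ => (hd y).differentiableAt
    · exact fun y _ => (hf.differentiable (by simp)) y
  have e2 : ∫ y, fderiv ℝ f y (mollify η U y) =
      ∫ t, ∫ x, -(fderiv ℝ η (t - x) (U x) * f t) := by
    rw [integral_integral_swap (f := fun t x => -(fderiv ℝ η (t - x) (U x) * f t)) i2,
      ← integral_congr_ae (ae_of_all _ e1),
      ← integral_integral_swap (f := fun y x => η (y - x) * fderiv ℝ f y (U x)) i1]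
    refine integral_congr_ae (ae_of_all _ fun y => ?_)
    dsimp only
    rw [mollify, ← ContinuousLinearMap.integral_comp_comm _ (integrable_mollify hηc' hU hUc y)]
    simp
  have e3 : ∫ y, ∫ s, f (y + s) * η s * u y = ∫ t, ∫ x, f t * η (t - x) * u x := by
    rw [integral_integral_swap (f := fun t x => f t * η (t - x) * u x) i3]
    refine integral_congr_ae (ae_of_all _ fun y => ?_)
    have := integral_add_left_eq_self (μ := (volume : Measure E))
      (fun t => f t * η (t - y) * u y) y
    simpa using this
  rw [e2, e3, ← integral_add i2.integral_prod_left i3.integral_prod_left]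
  refine integral_congr_ae (ae_of_all _ fun t => ?_)
  dsimp only
  rw [mollifyDiv, ← integral_const_mul, ← integral_add]
  · refine integral_congr_ae (ae_of_all _ fun x => ?_)
    dsimp only
    ring
  · refine Continuous.integrable_of_hasCompactSupport (by fun_prop) (hUc.mono fun y hy h => ?_)
    exact hy (by simp [h])
  · exact Continuous.integrable_of_hasCompactSupport (by fun_prop) huc.mul_left

/-- Mollifying `U` turns its divergence into a smooth density but leaves `u` unmollified; since `η`
has integral one, the ray field `rayOp η u` supplies the difference between `η * u` and `u`. The
left side is thus a small correction exchanging the pairing with `(U, u)` for a smooth density. -/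
theorem IsMollifier.integral_fderiv (h : IsMollifier ε η) {U : E → E}
    {u f : E → ℝ} (hU : ContDiff ℝ ∞ U) (hUc : HasCompactSupport U) (hu : ContDiff ℝ ∞ u)
    (huc : HasCompactSupport u) (hf : ContDiff ℝ ∞ f) :
    ∫ y, fderiv ℝ f y (mollify η U y - U y + rayOp η u y) =
      (∫ t, f t * mollifyDiv η U u t) - ∫ y, (fderiv ℝ f y (U y) + f y * u y) := by
  have hf' : Continuous (fderiv ℝ f) := hf.continuous_fderiv (by simp)
  have hfc := hf.continuous
  have h1 := integral_fderiv_mollify h.smooth h.compact hU.continuous hUc hu.continuous huc hf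
  have h2 := integral_fderiv_rayOp h.smooth.continuous h.compact hu.continuous huc hf
  have hUc' := hU.continuous
  have huc' := hu.continuous
  have k1 : Continuous (mollify η U) := (contDiff_mollify h.smooth hU hUc).continuous
  have k2 : Continuous (rayOp η u) := (contDiff_rayOp h.smooth hu h.compact).continuous
  have i1 : Integrable fun y => fderiv ℝ f y (mollify η U y) := by
    refine Continuous.integrable_of_hasCompactSupport (by fun_prop) (HasCompactSupport.intro
      (K := (fun q : E × E => q.2 + q.1) '' (tsupport U ×ˢ tsupport η))
      ((hUc.isCompact.prod h.compact.isCompact).image (by fun_prop)) fun y hy => ?_)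
    by_contra h'
    obtain ⟨x, h3, h4⟩ := exists_of_mollify_ne_zero (y := y) (η := η) (U := U)
      fun h'' => h' (by rw [h'', map_zero])
    exact hy ⟨(x, y - x), ⟨subset_tsupport _ h4, subset_tsupport _ h3⟩, by simp⟩
  have i2 : Integrable fun y => fderiv ℝ f y (rayOp η u y) := by
    refine Continuous.integrable_of_hasCompactSupport (by fun_prop) (HasCompactSupport.intro
      (K := (fun q : E × E × ℝ => q.1 + q.2.2 • q.2.1) '' (tsupport u ×ˢ tsupport η ×ˢ Icc (0 : ℝ) 1))
      ((huc.isCompact.prod (h.compact.isCompact.prod isCompact_Icc)).image (by fun_prop))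
      fun y hy => ?_)
    by_contra h'
    obtain ⟨s, r, hr, h3, h4⟩ := exists_of_rayOp_ne_zero (y := y) (a := η) (b := u)
      fun h'' => h' (by rw [h'', map_zero])
    exact hy ⟨(y - r • s, s, r), ⟨subset_tsupport _ h4, subset_tsupport _ h3, hr⟩, by simp⟩
  have i3 : Integrable fun y => fderiv ℝ f y (U y) :=
    Continuous.integrable_of_hasCompactSupport (by fun_prop)
      (hUc.mono fun y hy h => hy (by simp [h]))
  have i4 : Integrable fun y => f y * u y :=
    Continuous.integrable_of_hasCompactSupport (by fun_prop) huc.mul_left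
  simp only [map_add, map_sub]
  rw [integral_add (f := fun y => fderiv ℝ f y (mollify η U y) - fderiv ℝ f y (U y)) (i1.sub i3) i2,
    integral_sub i1 i3, integral_add i3 i4, h2, h.integral, ← h1]
  ring

end Mollification


/-! ### Measures with smooth density in charts -/

section ChartTransfer

variable [RiemannianBundle (fun x : M => TangentSpace (𝓡 m) x)]
  [IsContMDiffRiemannianBundle (𝓡 m) ∞ (EuclideanSpace ℝ (Fin m))
    (fun x : M => TangentSpace (𝓡 m) x)]
  [MeasurableSpace M] [BorelSpace M] [CompactSpace M]

/-- `θ` is a smooth positive density of `μ` in the chart around `p`. -/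
structure IsChartDensity (μ : Measure M) (p : M) (θ : EuclideanSpace ℝ (Fin m) → ℝ) : Prop where
  smooth : ContDiffOn ℝ ∞ θ (extChartAt (𝓡 m) p).target
  pos : ∀ y ∈ (extChartAt (𝓡 m) p).target, 0 < θ y
  restrict : μ.restrict (extChartAt (𝓡 m) p).source = chartMeasure p θ

theorem exists_isChartDensity_pushVol [Nonempty M] (φ : DiffM m M) (p : M) :
    ∃ θ, IsChartDensity (m := m) (pushVol φ) p θ := by
  obtain ⟨R, hR, hφ⟩ := exists_smooth_density_pushVol φ
  have h1 : ContDiffOn ℝ ∞ (fun y => volConst m M * dens p y) (extChartAt (𝓡 m) p).target :=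
    contDiffOn_const.mul (contDiffOn_dens p)
  refine ⟨fun y => volConst m M * dens p y * R ((extChartAt (𝓡 m) p).symm y),
    h1.mul (contDiffOn_comp_extChartAt_symm p R), fun y hy => ?_, ?_⟩
  · exact mul_pos (mul_pos volConst_pos (dens_pos p hy)) (hR _)
  · refine Measure.ext fun s hs => ?_
    rw [hφ, restrict_withDensity (measurableSet_source (m := m) p), restrict_vol, withDensity_apply _ hs,
      setLIntegral_chartMeasure p h1.continuousOn hs, chartMeasure_apply p _ hs]
    · refine setLIntegral_congr_fun (measurableSet_target_inter p hs) fun y hy => ?_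
      exact (ENNReal.ofReal_mul (mul_pos volConst_pos (dens_pos p hy.1)).le).symm
    · exact (ENNReal.continuous_ofReal.comp R.contMDiff.continuous).continuousOn

/-- The expression of the measure `f μ` in the chart around `p`. -/
def densChart (θ : EuclideanSpace ℝ (Fin m) → ℝ) (p : M) (f : SmoothFun m M)
    (y : EuclideanSpace ℝ (Fin m)) : ℝ := θ y * pushChart p f y

variable {μ : Measure M} {p : M} {θ : EuclideanSpace ℝ (Fin m) → ℝ}

theorem tsupport_densChart (θ : EuclideanSpace ℝ (Fin m) → ℝ) {f : SmoothFun m M}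
    (hf : tsupport f ⊆ (extChartAt (𝓡 m) p).source) :
    tsupport (densChart θ p f) ⊆ extChartAt (𝓡 m) p '' tsupport f := by
  have h1 : Function.support (densChart θ p f) ⊆ Function.support (pushChart p f) :=
    fun y hy h => hy (by rw [densChart, h, mul_zero])
  exact (closure_mono h1).trans (tsupport_pushChart hf)

theorem hasCompactSupport_densChart (θ : EuclideanSpace ℝ (Fin m) → ℝ) {f : SmoothFun m M}
    (hf : tsupport f ⊆ (extChartAt (𝓡 m) p).source) : HasCompactSupport (densChart θ p f) :=
  (isCompact_image_tsupport hf).of_isClosed_subset (isClosed_tsupport _) (tsupport_densChart θ hf)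

theorem contDiff_of_contDiffOn_tsupport {V F : Type*} [NormedAddCommGroup V] [NormedSpace ℝ V]
    [NormedAddCommGroup F] [NormedSpace ℝ F] {g : V → F} {s : Set V} (hs : IsOpen s)
    (hg : ContDiffOn ℝ ∞ g s) (h : tsupport g ⊆ s) : ContDiff ℝ ∞ g := by
  rw [contDiff_iff_contDiffAt]
  intro y
  by_cases hy : y ∈ s
  · exact hg.contDiffAt (hs.mem_nhds hy)
  · refine (contDiffAt_const (c := (0 : F))).congr_of_eventuallyEq ?_
    filter_upwards [(isClosed_tsupport g).isOpen_compl.mem_nhds fun h' => hy (h h')] with z hz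
    exact image_eq_zero_of_notMem_tsupport hz

theorem IsChartDensity.contDiff_densChart (hθ : IsChartDensity μ p θ) {f : SmoothFun m M}
    (hf : tsupport f ⊆ (extChartAt (𝓡 m) p).source) : ContDiff ℝ ∞ (densChart θ p f) :=
  contDiff_of_contDiffOn_tsupport (isOpen_extChartAt_target p)
    (hθ.smooth.mul (contDiff_pushChart hf).contDiffOn)
    ((tsupport_densChart θ hf).trans (image_tsupport_subset_target hf))

theorem IsChartDensity.integral_eq (hθ : IsChartDensity μ p θ) {f : M → ℝ} (hf : Continuous f)
    (h0 : ∀ x ∉ (extChartAt (𝓡 m) p).source, f x = 0) :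
    ∫ x, f x ∂μ = ∫ y in (extChartAt (𝓡 m) p).target, θ y * f ((extChartAt (𝓡 m) p).symm y) := by
  have hm := (hθ.smooth.continuousOn.aemeasurable (μ := volume) (measurableSet_target p)).ennreal_ofReal
  rw [← setIntegral_eq_integral_of_forall_compl_eq_zero h0, hθ.restrict, chartMeasure,
    integral_map ((aemeasurable_symm p (measurableSet_target p) subset_rfl).mono_ac
      (withDensity_absolutelyContinuous _ _)) hf.aestronglyMeasurable,
    integral_withDensity_eq_integral_toReal_smul₀ hm (ae_of_all _ fun _ => ENNReal.ofReal_lt_top)]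
  refine setIntegral_congr_fun (measurableSet_target p) fun y hy => ?_
  simp only [ENNReal.toReal_ofReal (hθ.pos y hy).le, smul_eq_mul]

theorem IsChartDensity.integral_densChart_mul (hθ : IsChartDensity μ p θ) {f : SmoothFun m M}
    (hf : tsupport f ⊆ (extChartAt (𝓡 m) p).source) {h : EuclideanSpace ℝ (Fin m) → ℝ}
    {H : SmoothFun m M} (hH : ∀ x ∈ tsupport f, h (extChartAt (𝓡 m) p x) = H x) :
    ∫ y, densChart θ p f y * h y = ∫ x, (f * H) x ∂μ := by
  have h1 : ∀ x ∉ (extChartAt (𝓡 m) p).source, (f * H) x = 0 := fun x hx => by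
    show f x * H x = 0
    rw [image_eq_zero_of_notMem_tsupport fun h' => hx (hf h'), zero_mul]
  rw [hθ.integral_eq (f * H).contMDiff.continuous h1,
    ← setIntegral_eq_integral_of_forall_compl_eq_zero (s := (extChartAt (𝓡 m) p).target)
      (f := fun y => densChart θ p f y * h y) fun y hy => by
        rw [densChart, pushChart, indicator_of_notMem hy, mul_zero, zero_mul]]
  refine setIntegral_congr_fun (measurableSet_target p) fun y hy => ?_
  rw [densChart, pushChart_of_mem f hy, mul_assoc]
  congr 1
  show _ = f _ * H _
  by_cases hx : (extChartAt (𝓡 m) p).symm y ∈ tsupport f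
  · rw [← hH _ hx, (extChartAt (𝓡 m) p).right_inv hy]
  · rw [image_eq_zero_of_notMem_tsupport hx, zero_mul, zero_mul]

theorem IsChartDensity.lintegral_eq (hθ : IsChartDensity μ p θ) {f : M → ENNReal}
    (hf : Continuous f) (h0 : ∀ x ∉ (extChartAt (𝓡 m) p).source, f x = 0) :
    ∫⁻ x, f x ∂μ = ∫⁻ y in (extChartAt (𝓡 m) p).target,
      ENNReal.ofReal (θ y) * f ((extChartAt (𝓡 m) p).symm y) := by
  have h1 := lintegral_restrict_of_eq_zero (μ := μ) (measurableSet_source (m := m) p)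
    MeasurableSet.univ h0
  rw [hθ.restrict, setLIntegral_chartMeasure p hθ.smooth.continuousOn MeasurableSet.univ
    hf.continuousOn, Measure.restrict_univ] at h1
  simpa using h1

theorem IsChartDensity.exists_bound (hθ : IsChartDensity μ p θ) {S : Set M} (hS : IsClosed S)
    (hSs : S ⊆ (extChartAt (𝓡 m) p).source) : ∃ C : NNReal, ∀ x ∈ S,
      θ (extChartAt (𝓡 m) p x) ≤ C ∧ (θ (extChartAt (𝓡 m) p x))⁻¹ ≤ C := by
  have hK : IsCompact (extChartAt (𝓡 m) p '' S) :=
    hS.isCompact.image_of_continuousOn ((continuousOn_extChartAt p).mono hSs)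
  have hKt : extChartAt (𝓡 m) p '' S ⊆ (extChartAt (𝓡 m) p).target := by
    rintro _ ⟨x, hx, rfl⟩; exact (extChartAt (𝓡 m) p).map_source (hSs hx)
  have hc := hθ.smooth.continuousOn.mono hKt
  obtain ⟨C, hC⟩ := hK.exists_bound_of_continuousOn hc
  obtain ⟨D, hD⟩ := hK.exists_bound_of_continuousOn (hc.inv₀ fun y hy => (hθ.pos y (hKt hy)).ne')
  refine ⟨(max C D).toNNReal, fun x hx => ⟨?_, ?_⟩⟩
  · exact ((le_abs_self _).trans ((hC _ ⟨x, hx, rfl⟩).trans (le_max_left _ _))).trans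
      (Real.le_coe_toNNReal _)
  · exact ((le_abs_self _).trans ((hD _ ⟨x, hx, rfl⟩).trans (le_max_right _ _))).trans
      (Real.le_coe_toNNReal _)

theorem lintegral_densChart (θ : EuclideanSpace ℝ (Fin m) → ℝ) (p : M) (f : SmoothFun m M) :
    ∫⁻ y, ‖densChart θ p f y‖ₑ ^ 2 = ∫⁻ y in (extChartAt (𝓡 m) p).target,
      ‖θ y‖ₑ ^ 2 * ‖f ((extChartAt (𝓡 m) p).symm y)‖ₑ ^ 2 := by
  rw [← lintegral_indicator (measurableSet_target p)]
  refine lintegral_congr fun y => ?_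
  by_cases hy : y ∈ (extChartAt (𝓡 m) p).target
  · rw [indicator_of_mem hy, densChart, pushChart_of_mem f hy, enorm_mul, mul_pow]
  · rw [indicator_of_notMem hy, densChart, pushChart, indicator_of_notMem hy]; simp

/-- On a closed subset of the chart domain, compact because `M` is, the density is bounded above and
below, so the two `L²` norms are equivalent. -/
theorem IsChartDensity.exists_lintegral_densChart_le (hθ : IsChartDensity μ p θ) {S : Set M}
    (hS : IsClosed S) (hSs : S ⊆ (extChartAt (𝓡 m) p).source) : ∃ C : NNReal,
      ∀ f : SmoothFun m M, (∀ x ∉ S, f x = 0) →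
        ∫⁻ y, ‖densChart θ p f y‖ₑ ^ 2 ≤ C * ∫⁻ x, ‖f x‖ₑ ^ 2 ∂μ ∧
        ∫⁻ x, ‖f x‖ₑ ^ 2 ∂μ ≤ C * ∫⁻ y, ‖densChart θ p f y‖ₑ ^ 2 := by
  obtain ⟨C, hC⟩ := hθ.exists_bound hS hSs
  refine ⟨C, fun f hf => ?_⟩
  have h1 : ∫⁻ x, ‖f x‖ₑ ^ 2 ∂μ = ∫⁻ y in (extChartAt (𝓡 m) p).target,
      ENNReal.ofReal (θ y) * ‖f ((extChartAt (𝓡 m) p).symm y)‖ₑ ^ 2 :=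
    hθ.lintegral_eq (f := fun x => ‖f x‖ₑ ^ 2) ((ENNReal.continuous_pow 2).comp f.contMDiff.continuous.enorm) fun x hx => by
      rw [hf x fun h => hx (hSs h)]; simp
  have h2 : ∀ y ∈ (extChartAt (𝓡 m) p).target, f ((extChartAt (𝓡 m) p).symm y) ≠ 0 →
      ENNReal.ofReal (θ y) ≤ C ∧ (ENNReal.ofReal (θ y))⁻¹ ≤ C := by
    intro y hy h
    have h3 := hC _ (not_not.1 fun h' => h (hf _ h'))
    rw [(extChartAt (𝓡 m) p).right_inv hy] at h3
    rw [← ENNReal.ofReal_inv_of_pos (hθ.pos y hy)]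
    exact ⟨ENNReal.ofReal_le_iff_le_toReal ENNReal.coe_ne_top |>.2 h3.1,
      ENNReal.ofReal_le_iff_le_toReal ENNReal.coe_ne_top |>.2 h3.2⟩
  rw [lintegral_densChart, h1, ← lintegral_const_mul' _ _ ENNReal.coe_ne_top,
    ← lintegral_const_mul' _ _ ENNReal.coe_ne_top]
  constructor
  · refine setLIntegral_mono' (measurableSet_target p) fun y hy => ?_
    by_cases h : f ((extChartAt (𝓡 m) p).symm y) = 0
    · rw [h]; simp
    · rw [Real.enorm_of_nonneg (hθ.pos y hy).le, pow_two (ENNReal.ofReal _), ← mul_assoc]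
      gcongr
      exact (h2 y hy h).1
  · refine setLIntegral_mono' (measurableSet_target p) fun y hy => ?_
    by_cases h : f ((extChartAt (𝓡 m) p).symm y) = 0
    · rw [h]; simp
    · rw [Real.enorm_of_nonneg (hθ.pos y hy).le, ← mul_assoc]
      gcongr
      have h3 : ENNReal.ofReal (θ y) ≠ 0 := (ENNReal.ofReal_pos.2 (hθ.pos y hy)).ne'
      calc ENNReal.ofReal (θ y) = (ENNReal.ofReal (θ y))⁻¹ * ENNReal.ofReal (θ y) ^ 2 := by
            rw [pow_two, ← mul_assoc, ENNReal.inv_mul_cancel h3 ENNReal.ofReal_ne_top, one_mul]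
        _ ≤ _ := by gcongr; exact (h2 y hy h).2

end ChartTransfer


/-! ### Transfer of vector fields between chart and manifold -/

section PushPull

variable [RiemannianBundle (fun x : M => TangentSpace (𝓡 m) x)]
  [IsContMDiffRiemannianBundle (𝓡 m) ∞ (EuclideanSpace ℝ (Fin m))
    (fun x : M => TangentSpace (𝓡 m) x)]
  [MeasurableSpace M] [BorelSpace M] [CompactSpace M]

theorem exists_extend_chart {p : M} {S : Set M} (hS : IsClosed S)
    (hSs : S ⊆ (extChartAt (𝓡 m) p).source) {ψ : EuclideanSpace ℝ (Fin m) → ℝ}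
    (hψ : ContDiff ℝ ∞ ψ) :
    ∃ P : SmoothFun m M, ∀ x ∈ S, ∀ᶠ z in 𝓝 x, P z = ψ (extChartAt (𝓡 m) p z) := by
  have hK : IsCompact (extChartAt (𝓡 m) p '' S) :=
    hS.isCompact.image_of_continuousOn ((continuousOn_extChartAt p).mono hSs)
  have hKt : extChartAt (𝓡 m) p '' S ⊆ (extChartAt (𝓡 m) p).target := by
    rintro _ ⟨x, hx, rfl⟩; exact (extChartAt (𝓡 m) p).map_source (hSs hx)
  obtain ⟨κ, h1, h2, h3, h4, -⟩ := exists_cutoff hK (isOpen_extChartAt_target p) hKt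
  obtain ⟨P, hP, -⟩ := exists_chartFun p (h1.mul hψ) h2.mul_right
    ((closure_mono (Function.support_mul_subset_left κ ψ)).trans h3)
  refine ⟨P, fun x hx => ?_⟩
  have h5 := (continuousAt_extChartAt' (I := 𝓡 m) (hSs hx)).eventually
    (eventually_nhdsSet_iff_forall.1 h4 _ ⟨x, hx, rfl⟩)
  filter_upwards [h5, extChartAt_source_mem_nhds' (I := 𝓡 m) (hSs hx)] with z hz hzs
  rw [hP z hzs, hz, one_mul]

theorem dirD_of_eventuallyEq_chart {p x : M} (hx : x ∈ (extChartAt (𝓡 m) p).source) (Y : VF m M)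
    {P : SmoothFun m M} {ψ : EuclideanSpace ℝ (Fin m) → ℝ}
    (h : ∀ᶠ z in 𝓝 x, P z = ψ (extChartAt (𝓡 m) p z)) :
    dirD Y P x = fderiv ℝ ψ (extChartAt (𝓡 m) p x) (coordVF p Y (extChartAt (𝓡 m) p x)) := by
  have hy := (extChartAt (𝓡 m) p).map_source hx
  have h1 := dirD_chart Y P hy
  rw [(extChartAt (𝓡 m) p).left_inv hx] at h1
  rw [h1]
  have h2 : P ∘ (extChartAt (𝓡 m) p).symm =ᶠ[𝓝 (extChartAt (𝓡 m) p x)] ψ := by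
    have hc := continuousAt_extChartAt_symm'' (I := 𝓡 m) hy
    rw [ContinuousAt, (extChartAt (𝓡 m) p).left_inv hx] at hc
    filter_upwards [hc.eventually h, extChartAt_target_mem_nhds_of_mem hy] with z hz hzt
    rw [Function.comp_apply, hz, (extChartAt (𝓡 m) p).right_inv hzt]
  rw [h2.fderiv_eq]

/-- The squared `L²(μ)`-norm of a vector field. -/
def sqNorm (μ : Measure M) (Y : VF m M) : ENNReal := ∫⁻ x, ENNReal.ofReal (innerFun Y Y x) ∂μ

theorem measurable_ofReal_smoothFun (f : SmoothFun m M) : Measurable fun x => ENNReal.ofReal (f x) :=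
  f.contMDiff.continuous.measurable.ennreal_ofReal

theorem sqNorm_add_le (μ : Measure M) (Y Z : VF m M) :
    sqNorm μ (Y + Z) ≤ 2 * (sqNorm μ Y + sqNorm μ Z) := by
  rw [sqNorm, sqNorm, sqNorm, ← lintegral_add_left (measurable_ofReal_smoothFun _),
    ← lintegral_const_mul' _ _ (by simp)]
  refine lintegral_mono fun x => ?_
  rw [← ENNReal.ofReal_add (innerFun_self_nonneg Y x) (innerFun_self_nonneg Z x),
    two_mul, ← ENNReal.ofReal_add (add_nonneg (innerFun_self_nonneg Y x)
      (innerFun_self_nonneg Z x)) (add_nonneg (innerFun_self_nonneg Y x)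
      (innerFun_self_nonneg Z x)), ← two_mul]
  refine ENNReal.ofReal_le_ofReal ?_
  have h1 := innerFun_self_nonneg (Y - Z) x
  have h2 : innerFun (Y - Z) (Y - Z) x = innerFun Y Y x - 2 * innerFun Y Z x + innerFun Z Z x := by
    simp only [innerFun_sub, innerFun_symm _ (Y - Z), innerFun_symm Z Y]
    show innerFun Y Y x - innerFun Y Z x - (innerFun Y Z x - innerFun Z Z x) = _
    ring
  have h3 : innerFun (Y + Z) (Y + Z) x = innerFun Y Y x + 2 * innerFun Y Z x + innerFun Z Z x := by
    simp only [innerFun_add, innerFun_add_right, innerFun_symm Z Y]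
    show innerFun Y Y x + innerFun Y Z x + (innerFun Y Z x + innerFun Z Z x) = _
    ring
  rw [h2] at h1
  rw [h3]
  linarith

theorem sqNorm_sum_le {ι : Type*} (μ : Measure M) (s : Finset ι) (A : ι → VF m M) :
    sqNorm μ (∑ i ∈ s, A i) ≤ 2 ^ s.card * ∑ i ∈ s, sqNorm μ (A i) := by
  classical
  induction s using Finset.induction_on with
  | empty =>
    have h : innerFun (0 : VF m M) 0 = 0 := by
      ext x; exact inner_zero_left (E := TangentSpace (𝓡 m) x) (𝕜 := ℝ) _
    simp [sqNorm, h]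
  | insert i s hi ih =>
    rw [Finset.sum_insert hi, Finset.sum_insert hi, Finset.card_insert_of_notMem hi]
    refine (sqNorm_add_le _ _ _).trans ?_
    rw [pow_succ', mul_assoc, mul_add (2 ^ s.card)]
    gcongr
    exact le_mul_of_one_le_left zero_le (one_le_pow₀ (by norm_num))

theorem exists_lintegral_innerFun_le (μ : Measure M) (A : VF m M) : ∃ C : NNReal, ∀ Y : VF m M,
    ∫⁻ x, ‖innerFun A Y x‖ₑ ^ 2 ∂μ ≤ C * sqNorm μ Y := by
  obtain ⟨C, hC⟩ := isCompact_univ.exists_bound_of_continuousOn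
    (innerFun A A).contMDiff.continuous.continuousOn
  refine ⟨C.toNNReal, fun Y => ?_⟩
  rw [sqNorm, ← lintegral_const_mul' _ _ ENNReal.coe_ne_top]
  refine lintegral_mono fun x => ?_
  have h1 : innerFun A Y x * innerFun A Y x ≤ innerFun A A x * innerFun Y Y x :=
    real_inner_mul_inner_self_le (F := TangentSpace (𝓡 m) x) (A x) (Y x)
  rw [← ofReal_norm, Real.norm_eq_abs, ← ENNReal.ofReal_pow (abs_nonneg _), sq_abs, pow_two]
  refine (ENNReal.ofReal_le_ofReal h1).trans ?_
  rw [ENNReal.ofReal_mul (innerFun_self_nonneg A x)]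
  gcongr
  exact ENNReal.ofReal_le_ofReal ((le_abs_self _).trans (hC x (mem_univ x)))

theorem exists_sqNorm_mulVF_le (μ : Measure M) (A : VF m M) : ∃ C : NNReal, ∀ a : SmoothFun m M,
    sqNorm μ (mulVF a A) ≤ C * ∫⁻ x, ‖a x‖ₑ ^ 2 ∂μ := by
  obtain ⟨C, hC⟩ := isCompact_univ.exists_bound_of_continuousOn
    (innerFun A A).contMDiff.continuous.continuousOn
  refine ⟨C.toNNReal, fun a => ?_⟩
  rw [sqNorm, ← lintegral_const_mul' _ _ ENNReal.coe_ne_top]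
  refine lintegral_mono fun x => ?_
  rw [innerFun_mulVF, innerFun_mulVF_right]
  show ENNReal.ofReal (a x * (a x * innerFun A A x)) ≤ _
  rw [← mul_assoc, mul_comm, ENNReal.ofReal_mul (innerFun_self_nonneg A x), ← ofReal_norm,
    Real.norm_eq_abs, ← ENNReal.ofReal_pow (abs_nonneg _), sq_abs, pow_two]
  gcongr
  exact ENNReal.ofReal_le_ofReal ((le_abs_self _).trans (hC x (mem_univ x)))

variable {μ : Measure M} {p : M} {θ : EuclideanSpace ℝ (Fin m) → ℝ}

/-- The expression of the field `χ Y μ` in the chart around `p`. -/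
def chartField (θ : EuclideanSpace ℝ (Fin m) → ℝ) (p : M) (χ : SmoothFun m M) (Y : VF m M)
    (y : EuclideanSpace ℝ (Fin m)) : EuclideanSpace ℝ (Fin m) :=
  densChart θ p χ y • coordVF p Y y

theorem tsupport_chartField (θ : EuclideanSpace ℝ (Fin m) → ℝ) {χ : SmoothFun m M}
    (hχ : tsupport χ ⊆ (extChartAt (𝓡 m) p).source) (Y : VF m M) :
    tsupport (chartField θ p χ Y) ⊆ extChartAt (𝓡 m) p '' tsupport χ := by
  have h1 : Function.support (chartField θ p χ Y) ⊆ Function.support (densChart θ p χ) :=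
    fun y hy h => hy (by rw [chartField, h, zero_smul])
  exact (closure_mono h1).trans (tsupport_densChart θ hχ)

theorem IsChartDensity.contDiff_chartField (hθ : IsChartDensity μ p θ) {χ : SmoothFun m M}
    (hχ : tsupport χ ⊆ (extChartAt (𝓡 m) p).source) (Y : VF m M) :
    ContDiff ℝ ∞ (chartField θ p χ Y) :=
  contDiff_of_contDiffOn_tsupport (isOpen_extChartAt_target p)
    ((hθ.contDiff_densChart hχ).contDiffOn.smul (contDiffOn_coordVF p Y))
    ((tsupport_chartField θ hχ Y).trans (image_tsupport_subset_target hχ))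

theorem hasCompactSupport_chartField (θ : EuclideanSpace ℝ (Fin m) → ℝ) {χ : SmoothFun m M}
    (hχ : tsupport χ ⊆ (extChartAt (𝓡 m) p).source) (Y : VF m M) :
    HasCompactSupport (chartField θ p χ Y) :=
  (isCompact_image_tsupport hχ).of_isClosed_subset (isClosed_tsupport _) (tsupport_chartField θ hχ Y)

theorem chartField_apply (θ : EuclideanSpace ℝ (Fin m) → ℝ) {χ : SmoothFun m M}
    (hχ : tsupport χ ⊆ (extChartAt (𝓡 m) p).source) (Y : VF m M) {i : Fin m} {ξ : SmoothFun m M}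
    (hξ : ∀ x ∈ tsupport χ, ∀ᶠ z in 𝓝 x, ξ z = extChartAt (𝓡 m) p z i)
    (y : EuclideanSpace ℝ (Fin m)) :
    chartField θ p χ Y y i = densChart θ p (χ * dirD Y ξ) y := by
  by_cases hy : y ∈ (extChartAt (𝓡 m) p).target
  · show densChart θ p χ y * coordVF p Y y i = _
    rw [densChart, densChart, pushChart_of_mem _ hy, pushChart_of_mem _ hy, mul_assoc]
    congr 1
    show _ = χ _ * dirD Y ξ _
    by_cases hx : (extChartAt (𝓡 m) p).symm y ∈ tsupport χ
    · have h1 := dirD_of_eventuallyEq_chart (hχ hx) Y (ψ := fun z => z i) (hξ _ hx)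
      rw [(extChartAt (𝓡 m) p).right_inv hy] at h1
      rw [h1]
      have h2 : HasFDerivAt (fun z : EuclideanSpace ℝ (Fin m) => z i)
        (EuclideanSpace.proj (𝕜 := ℝ) i) y := (EuclideanSpace.proj (𝕜 := ℝ) i).hasFDerivAt
      rw [h2.fderiv]
      rfl
    · rw [image_eq_zero_of_notMem_tsupport hx, zero_mul, zero_mul]
  · show densChart θ p χ y * coordVF p Y y i = _
    rw [densChart, densChart, pushChart, pushChart, indicator_of_notMem hy, indicator_of_notMem hy]
    simp

/-- The product rule for `χ * P`: the term differentiating `P` gives the field in the chart and the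
term differentiating `χ` gives a density of order zero. This pair represents the localized
divergence of `Y`. -/
theorem IsChartDensity.integral_chartField (hθ : IsChartDensity μ p θ) {χ : SmoothFun m M}
    (hχ : tsupport χ ⊆ (extChartAt (𝓡 m) p).source) (Y : VF m M)
    {ψ : EuclideanSpace ℝ (Fin m) → ℝ} (hψ : ContDiff ℝ ∞ ψ) {P : SmoothFun m M}
    (hP : ∀ x ∈ tsupport χ, ∀ᶠ z in 𝓝 x, P z = ψ (extChartAt (𝓡 m) p z)) [IsFiniteMeasure μ] :
    ∫ y, (fderiv ℝ ψ y (chartField θ p χ Y y) + ψ y * densChart θ p (dirD Y χ) y) =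
      ∫ x, dirD Y (χ * P) x ∂μ := by
  have hχ' := (tsupport_dirD_subset Y χ).trans hχ
  have hψ' : Continuous (fderiv ℝ ψ) := hψ.continuous_fderiv (by simp)
  have hψc := hψ.continuous
  have c1 := (hθ.contDiff_chartField hχ Y).continuous
  have c2 := (hθ.contDiff_densChart hχ').continuous
  have hint : ∀ f : SmoothFun m M, Integrable f μ := fun f =>
    f.contMDiff.continuous.integrable_of_hasCompactSupport (HasCompactSupport.of_compactSpace _)
  rw [integral_add]
  · have e1 := hθ.integral_densChart_mul hχ (h := fun y => fderiv ℝ ψ y (coordVF p Y y))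
      (H := dirD Y P) fun x hx => (dirD_of_eventuallyEq_chart (hχ hx) Y (hP x hx)).symm
    have e2 := hθ.integral_densChart_mul hχ' (h := ψ) (H := P) fun x hx =>
      ((hP x (tsupport_dirD_subset Y χ hx)).self_of_nhds).symm
    simp only [chartField, map_smul, smul_eq_mul, mul_comm (ψ _)]
    rw [e1, e2, dirD_mul, ← integral_add (hint _) (hint _)]
    refine integral_congr_ae (ae_of_all _ fun x => ?_)
    show χ x * dirD Y P x + dirD Y χ x * P x = _
    simp
    ring
  · refine Continuous.integrable_of_hasCompactSupport (by fun_prop)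
      ((hasCompactSupport_chartField θ hχ Y).mono fun y hy h => hy (by simp [h]))
  · exact Continuous.integrable_of_hasCompactSupport (by fun_prop)
      (hasCompactSupport_densChart θ hχ').mul_left

theorem enorm_sq_eq_sum (v : EuclideanSpace ℝ (Fin m)) : ‖v‖ₑ ^ 2 = ∑ i, ‖v i‖ₑ ^ 2 := by
  simp only [← ofReal_norm, ← ENNReal.ofReal_pow (norm_nonneg _)]
  rw [EuclideanSpace.norm_sq_eq, ENNReal.ofReal_sum_of_nonneg fun _ _ => by positivity]

/-- The components of the chart field are pairings of `Y` with fixed fields `χ ∇ξ_i`, and `Y χ` is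
its pairing with `∇χ`; Cauchy-Schwarz applies pointwise. -/
theorem IsChartDensity.exists_chartField_le (hθ : IsChartDensity μ p θ) {χ : SmoothFun m M}
    (hχ : tsupport χ ⊆ (extChartAt (𝓡 m) p).source) : ∃ C : NNReal, ∀ Y : VF m M,
      ∫⁻ y, ‖chartField θ p χ Y y‖ₑ ^ 2 ≤ C * sqNorm μ Y ∧
      ∫⁻ y, ‖densChart θ p (dirD Y χ) y‖ₑ ^ 2 ≤ C * sqNorm μ Y := by
  obtain ⟨C, hC⟩ := hθ.exists_lintegral_densChart_le (isClosed_tsupport χ) hχ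
  have h1 := fun i : Fin m => exists_extend_chart (isClosed_tsupport χ) hχ
    (ψ := fun z => z i) (EuclideanSpace.proj (𝕜 := ℝ) i).contDiff
  choose ξ hξ using h1
  have h2 := fun i : Fin m => exists_lintegral_innerFun_le μ (mulVF χ (grad (ξ i)))
  choose D hD using h2
  obtain ⟨D', hD'⟩ := exists_lintegral_innerFun_le μ (grad χ)
  refine ⟨C * (∑ i, D i) + C * D', fun Y => ⟨?_, ?_⟩⟩
  · have h3 : ∀ i, ∫⁻ y, ‖chartField θ p χ Y y i‖ₑ ^ 2 ≤ C * (D i * sqNorm μ Y) := by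
      intro i
      have h4 := (hC (χ * dirD Y (ξ i)) fun x hx => by
        show χ x * _ = 0
        rw [image_eq_zero_of_notMem_tsupport hx, zero_mul]).1
      simp only [chartField_apply θ hχ Y (hξ i)]
      refine h4.trans ?_
      gcongr
      have h5 := hD i Y
      rwa [innerFun_mulVF, innerFun_grad] at h5
    have c1 := (hθ.contDiff_chartField hχ Y).continuous
    have c2 : ∀ i, Continuous fun y => chartField θ p χ Y y i := fun i =>
      (EuclideanSpace.proj (𝕜 := ℝ) i).continuous.comp c1
    rw [lintegral_congr fun y => enorm_sq_eq_sum (chartField θ p χ Y y),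
      lintegral_finsetSum _ fun i _ => (c2 i).enorm.measurable.pow_const 2]
    refine (Finset.sum_le_sum fun i _ => h3 i).trans ?_
    rw [← Finset.mul_sum, ← Finset.sum_mul, ← mul_assoc]
    push_cast
    gcongr
    exact le_self_add
  · refine (hC (dirD Y χ) fun x hx => image_eq_zero_of_notMem_tsupport fun h =>
      hx (tsupport_dirD_subset Y χ h)).1.trans ?_
    have h5 := hD' Y
    rw [innerFun_grad] at h5
    calc _ ≤ C * (D' * sqNorm μ Y) := by gcongr
      _ ≤ _ := by
        rw [← mul_assoc]
        push_cast
        gcongr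
        exact le_add_self

theorem IsChartDensity.exists_pullFun (hθ : IsChartDensity μ p θ)
    {K : Set (EuclideanSpace ℝ (Fin m))} (hK : IsCompact K)
    (hKt : K ⊆ (extChartAt (𝓡 m) p).target) {v : EuclideanSpace ℝ (Fin m) → ℝ}
    (hv : ContDiff ℝ ∞ v) (hvK : tsupport v ⊆ K) : ∃ a : SmoothFun m M,
      densChart θ p a = v ∧ tsupport a ⊆ (extChartAt (𝓡 m) p).symm '' K := by
  have hvc : HasCompactSupport v := hK.of_isClosed_subset (isClosed_tsupport v) hvK
  have hts : tsupport (fun y => (θ y)⁻¹ * v y) ⊆ tsupport v :=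
    closure_mono (Function.support_mul_subset_right _ v)
  have h1 : ContDiff ℝ ∞ fun y => (θ y)⁻¹ * v y :=
    contDiff_of_contDiffOn_tsupport (isOpen_extChartAt_target p)
      ((hθ.smooth.inv fun y hy => (hθ.pos y hy).ne').mul hv.contDiffOn)
      (hts.trans (hvK.trans hKt))
  obtain ⟨a, ha1, ha2⟩ := exists_chartFun p h1 hvc.mul_left (hts.trans (hvK.trans hKt))
  refine ⟨a, funext fun y => ?_, ?_⟩
  · by_cases hy : y ∈ (extChartAt (𝓡 m) p).target
    · rw [densChart, pushChart_of_mem a hy, ha1 _ ((extChartAt (𝓡 m) p).map_target hy),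
        (extChartAt (𝓡 m) p).right_inv hy, mul_inv_cancel_left₀ (hθ.pos y hy).ne']
    · rw [densChart, pushChart, indicator_of_notMem hy, mul_zero,
        image_eq_zero_of_notMem_tsupport fun h => hy (hKt (hvK h))]
  · refine closure_minimal (fun x hx => ?_)
      (hK.image_of_continuousOn ((continuousOn_extChartAt_symm p).mono hKt)).isClosed
    by_contra h
    exact hx (ha2 x fun h' => h (image_mono (hts.trans hvK) h'))

/-- The components of `V` are divided by the density before being transplanted, so that pairing with
differentials against `μ` becomes the Euclidean pairing against Lebesgue measure. -/
theorem IsChartDensity.exists_pullVF (hθ : IsChartDensity μ p θ) [IsFiniteMeasure μ]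
    {K : Set (EuclideanSpace ℝ (Fin m))} (hK : IsCompact K)
    (hKt : K ⊆ (extChartAt (𝓡 m) p).target) : ∃ C : NNReal,
      ∀ V : EuclideanSpace ℝ (Fin m) → EuclideanSpace ℝ (Fin m), ContDiff ℝ ∞ V → tsupport V ⊆ K →
        ∃ Y : VF m M, sqNorm μ Y ≤ C * ∫⁻ y, ‖V y‖ₑ ^ 2 ∧
          ∀ (f : SmoothFun m M) (g : EuclideanSpace ℝ (Fin m) → ℝ), ContDiff ℝ ∞ g →
            (∀ y ∈ K, g =ᶠ[𝓝 y] f ∘ (extChartAt (𝓡 m) p).symm) →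
            ∫ x, dirD Y f x ∂μ = ∫ y, fderiv ℝ g y (V y) := by
  obtain ⟨X, hX, -⟩ := exists_coordinateFields p hK hKt
  have hS : IsClosed ((extChartAt (𝓡 m) p).symm '' K) :=
    (hK.image_of_continuousOn ((continuousOn_extChartAt_symm p).mono hKt)).isClosed
  have hSs : (extChartAt (𝓡 m) p).symm '' K ⊆ (extChartAt (𝓡 m) p).source := by
    rintro _ ⟨y, hy, rfl⟩; exact (extChartAt (𝓡 m) p).map_target (hKt hy)
  obtain ⟨C, hC⟩ := hθ.exists_lintegral_densChart_le hS hSs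
  have h2 := fun i : Fin m => exists_sqNorm_mulVF_le μ (X i)
  choose D hD using h2
  refine ⟨2 ^ m * ((∑ i, D i) * C), fun V hV hVK => ?_⟩
  have h1 : ∀ i, ∃ a : SmoothFun m M, densChart θ p a = (fun y => V y i) ∧
      tsupport a ⊆ (extChartAt (𝓡 m) p).symm '' K := fun i => by
    refine hθ.exists_pullFun hK hKt ((EuclideanSpace.proj (𝕜 := ℝ) i).contDiff.comp hV) ?_
    have h : Function.support (fun y => V y i) ⊆ Function.support V := fun y hy h => hy (by
      dsimp only
      rw [h]; rfl)
    exact (closure_mono h).trans hVK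
  choose a ha haS using h1
  refine ⟨∑ i, mulVF (a i) (X i), ?_, fun f g hg hfg => ?_⟩
  · refine (sqNorm_sum_le _ _ _).trans ?_
    rw [Finset.card_univ, Fintype.card_fin]
    push_cast
    rw [mul_assoc]
    gcongr
    rw [Finset.sum_mul, Finset.sum_mul]
    refine Finset.sum_le_sum fun i _ => (hD i (a i)).trans ?_
    rw [mul_assoc]
    gcongr
    refine (hC (a i) fun x hx => image_eq_zero_of_notMem_tsupport fun h => hx (haS i h)).2.trans ?_
    gcongr with y
    rw [ha i, ← ofReal_norm, ← ofReal_norm]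
    exact ENNReal.ofReal_le_ofReal (PiLp.norm_apply_le _ _)
  · have hg' : Continuous (fderiv ℝ g) := hg.continuous_fderiv (by simp)
    have hVc' := hV.continuous
    have hVc : HasCompactSupport V := hK.of_isClosed_subset (isClosed_tsupport V) hVK
    have hint : ∀ f : SmoothFun m M, Integrable f μ := fun f =>
      f.contMDiff.continuous.integrable_of_hasCompactSupport (HasCompactSupport.of_compactSpace _)
    have e1 : ∀ i, ∫ y, V y i * fderiv ℝ g y (EuclideanSpace.single i 1) =
        ∫ x, (a i * dirD (X i) f) x ∂μ := by
      intro i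
      rw [← hθ.integral_densChart_mul ((haS i).trans hSs)
        (h := fun y => fderiv ℝ g y (EuclideanSpace.single i 1)), ha i]
      intro x hx
      obtain ⟨y, hy, rfl⟩ := haS i hx
      rw [(extChartAt (𝓡 m) p).right_inv (hKt hy), (hfg y hy).fderiv_eq,
        dirD_chart (X i) f (hKt hy), hX i y hy]
    have e2 : ∀ y, fderiv ℝ g y (V y) = ∑ i, V y i * fderiv ℝ g y (EuclideanSpace.single i 1) := by
      intro y
      conv_lhs => rw [single_sum (V y), map_sum]
      simp only [map_smul, smul_eq_mul]
    rw [dirD_sum_left]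
    simp only [e2, dirD_mulVF]
    rw [integral_finsetSum _ fun i _ => ?_]
    · rw [Finset.sum_congr rfl fun i _ => e1 i, ← integral_finsetSum _ fun i _ => hint _]
      refine integral_congr_ae (ae_of_all _ fun x => ?_)
      exact smoothFun_sum_apply _ _ _
    · refine Continuous.integrable_of_hasCompactSupport (by fun_prop) (HasCompactSupport.mul_right ?_)
      refine hVc.mono fun y hy h => hy ?_
      show V y i = 0
      rw [h]; rfl

end PushPull


/-! ### Fields with prescribed divergence -/

section Divergence

variable [RiemannianBundle (fun x : M => TangentSpace (𝓡 m) x)]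
  [IsContMDiffRiemannianBundle (𝓡 m) ∞ (EuclideanSpace ℝ (Fin m))
    (fun x : M => TangentSpace (𝓡 m) x)]
  [MeasurableSpace M] [BorelSpace M] [CompactSpace M]

/-- Commutativity of convolution, tested against `f`; it cancels the double terms in
`exists_hasDiv_local`. -/
theorem integral_translates_comm {E : Type*} [NormedAddCommGroup E] [InnerProductSpace ℝ E]
    [FiniteDimensional ℝ E] [MeasurableSpace E] [BorelSpace E] {a b f : E → ℝ} (ha : Continuous a)
    (hac : HasCompactSupport a) (hb : Continuous b) (hbc : HasCompactSupport b)
    (hf : Continuous f) :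
    ∫ y, ∫ s, f (y + s) * a s * b y = ∫ y, ∫ s, f (y + s) * b s * a y := by
  have h4 : Integrable (fun q : E × E => f (q.1 + q.2) * a q.2 * b q.1)
      ((volume : Measure E).prod volume) := by
    refine Continuous.integrable_of_hasCompactSupport (by fun_prop)
      (HasCompactSupport.intro (hbc.isCompact.prod hac.isCompact) fun q hq => ?_)
    rw [mem_prod, not_and_or] at hq
    rcases hq with hq | hq
    · rw [image_eq_zero_of_notMem_tsupport hq, mul_zero]
    · rw [image_eq_zero_of_notMem_tsupport hq, mul_zero, zero_mul]
  rw [integral_integral_swap (f := fun y s => f (y + s) * a s * b y) h4]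
  refine integral_congr_ae (ae_of_all _ fun y => integral_congr_ae (ae_of_all _ fun s => ?_))
  dsimp only
  rw [add_comm]
  ring

theorem exists_smooth_extension_chart {p : M} {K : Set (EuclideanSpace ℝ (Fin m))}
    (hK : IsCompact K) (hKt : K ⊆ (extChartAt (𝓡 m) p).target) (f : SmoothFun m M) :
    ∃ g : EuclideanSpace ℝ (Fin m) → ℝ, ContDiff ℝ ∞ g ∧
      ∀ y ∈ K, g =ᶠ[𝓝 y] f ∘ (extChartAt (𝓡 m) p).symm := by
  obtain ⟨κ, h1, h2, h3, h4, -⟩ := exists_cutoff hK (isOpen_extChartAt_target p) hKt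
  refine ⟨fun y => κ y * f ((extChartAt (𝓡 m) p).symm y), ?_, fun y hy => ?_⟩
  · exact contDiff_of_contDiffOn_tsupport (isOpen_extChartAt_target p)
      (h1.contDiffOn.mul (contDiffOn_comp_extChartAt_symm p f))
      ((closure_mono (Function.support_mul_subset_left κ _)).trans h3)
  · filter_upwards [eventually_nhdsSet_iff_forall.1 h4 y hy] with z hz
    rw [hz, one_mul, Function.comp_apply]

/-- Integration of smooth functions. -/
def integralL (μ : Measure M) [IsFiniteMeasure μ] : SmoothFun m M →ₗ[ℝ] ℝ where
  toFun f := ∫ x, f x ∂μ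
  map_add' f g := integral_add
    (f.contMDiff.continuous.integrable_of_hasCompactSupport (HasCompactSupport.of_compactSpace _))
    (g.contMDiff.continuous.integrable_of_hasCompactSupport (HasCompactSupport.of_compactSpace _))
  map_smul' r _ := integral_const_mul r _

variable {μ : Measure M} [IsFiniteMeasure μ]

/-- `-h` is the divergence of `Y` with respect to `μ`. -/
def HasDiv (μ : Measure M) [IsFiniteMeasure μ] (Y : VF m M) (h : SmoothFun m M) : Prop :=
  ∀ f : SmoothFun m M, integralL μ (dirD Y f) = integralL μ (f * h)

theorem HasDiv.add {Y Z : VF m M} {h k : SmoothFun m M} (hY : HasDiv μ Y h) (hZ : HasDiv μ Z k) :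
    HasDiv μ (Y + Z) (h + k) := fun f => by
  rw [dirD_add_left, mul_add, map_add, map_add, hY f, hZ f]

theorem HasDiv.sum {ι : Type*} {s : Finset ι} {Y : ι → VF m M} {h : ι → SmoothFun m M}
    (hY : ∀ i ∈ s, HasDiv μ (Y i) (h i)) : HasDiv μ (∑ i ∈ s, Y i) (∑ i ∈ s, h i) := fun f => by
  rw [dirD_sum_left, Finset.mul_sum, map_sum, map_sum]
  exact Finset.sum_congr rfl fun i hi => hY i hi f

theorem HasDiv.smul {Y : VF m M} {h : SmoothFun m M} (hY : HasDiv μ Y h) (r : ℝ) :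
    HasDiv μ (r • Y) (r • h) := fun f => by
  rw [dirD_smul_left, mul_smul_comm, map_smul, map_smul, hY f]

variable {p : M} {θ : EuclideanSpace ℝ (Fin m) → ℝ}

theorem norm_le_of_tsupport_subset_ball {a : EuclideanSpace ℝ (Fin m) → ℝ}
    {c : EuclideanSpace ℝ (Fin m)} {ρ : ℝ} (h : tsupport a ⊆ Metric.ball c ρ)
    (y : EuclideanSpace ℝ (Fin m)) (hy : a (y + c) ≠ 0) : ‖y‖ ≤ ρ := by
  have := h (subset_tsupport a hy)
  rw [Metric.mem_ball, dist_eq_norm, add_sub_cancel_right] at this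
  exact this.le

theorem rayOp_sub_ne_zero {E : Type*} [NormedAddCommGroup E] [InnerProductSpace ℝ E]
    [FiniteDimensional ℝ E] [MeasurableSpace E] [BorelSpace E] {a b : E → ℝ} {ρ : ℝ}
    (ha : ∀ y, a y ≠ 0 → ‖y‖ ≤ ρ) (hb : ∀ y, b y ≠ 0 → ‖y‖ ≤ ρ) {y : E} (h : rayOp a b y ≠ 0) :
    ‖y‖ ≤ 2 * ρ := by
  obtain ⟨s, r, hr, h1, h2⟩ := exists_of_rayOp_ne_zero h
  calc ‖y‖ = ‖(y - r • s) + r • s‖ := by rw [sub_add_cancel]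
    _ ≤ ‖y - r • s‖ + ‖r • s‖ := norm_add_le _ _
    _ ≤ ρ + ρ := by
      refine add_le_add (hb _ h2) ?_
      rw [norm_smul, Real.norm_of_nonneg hr.1]
      exact (mul_le_of_le_one_left (norm_nonneg _) hr.2).trans (ha _ h1)
    _ = _ := (two_mul ρ).symm

/-- For densities `a` of `g` and `b` of `h`, the fields `rayOp b a` and `rayOp a b` pair with `f`
through the same convolution term and through the respective products `(∫ b) a` and `(∫ a) b`. As `∫
a = 1`, their difference solves the problem, with a pointwise bound linear in the supremum of `h`.
-/
theorem IsChartDensity.exists_hasDiv_local (hθ : IsChartDensity μ p θ) :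
    ∃ N ∈ 𝓝 p, ∀ g : SmoothFun m M, tsupport g ⊆ N → integralL μ g = 1 → ∃ C : NNReal,
      ∀ (h : SmoothFun m M) (B : ℝ), tsupport h ⊆ N → (∀ x, |h x| ≤ B) → ∃ Y : VF m M,
        sqNorm μ Y ≤ C * ENNReal.ofReal B ^ 2 ∧ HasDiv μ Y (h - integralL μ h • g) := by
  set c := extChartAt (𝓡 m) p p with hc
  obtain ⟨r, hr, hrt⟩ := Metric.nhds_basis_closedBall.mem_iff.1
    (extChartAt_target_mem_nhds_of_mem (mem_extChartAt_target (I := 𝓡 m) p))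
  -- Ray fields made from densities in the ball of radius `ρ` occupy the ball of radius `2 * ρ`,
  -- which must still lie in the chart.
  set ρ := r / 2 with hρ
  have hρ0 : 0 < ρ := by positivity
  have hKt : Metric.closedBall c (2 * ρ) ⊆ (extChartAt (𝓡 m) p).target := by
    rw [show 2 * ρ = r by rw [hρ]; ring]; exact hrt
  let N : Set M := (extChartAt (𝓡 m) p).source ∩ extChartAt (𝓡 m) p ⁻¹' Metric.ball c ρ
  have hN : N ∈ 𝓝 p := inter_mem (extChartAt_source_mem_nhds p)
    ((continuousAt_extChartAt (I := 𝓡 m) p).preimage_mem_nhds (Metric.ball_mem_nhds _ hρ0))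
  have hsupp : ∀ f : SmoothFun m M, tsupport f ⊆ N →
      tsupport f ⊆ (extChartAt (𝓡 m) p).source ∧
      tsupport (densChart θ p f) ⊆ Metric.ball c ρ := fun f hf =>
    ⟨fun x hx => (hf hx).1, (tsupport_densChart θ fun x hx => (hf hx).1).trans (by
      rintro _ ⟨x, hx, rfl⟩; exact (hf hx).2)⟩
  have hKc : IsCompact (Metric.closedBall c (2 * ρ)) := isCompact_closedBall _ _
  refine ⟨N, hN, fun g hg hg1 => ?_⟩
  obtain ⟨hgs, hgb⟩ := hsupp g hg
  -- The densities are moved to the origin, because a ray field is localized only by the sum of the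
  -- supports of its two arguments.
  let a : EuclideanSpace ℝ (Fin m) → ℝ := fun y => densChart θ p g (y + c)
  have ha : ContDiff ℝ ∞ a := (hθ.contDiff_densChart hgs).comp (contDiff_id.add contDiff_const)
  have hac : HasCompactSupport a :=
    (hasCompactSupport_densChart θ hgs).comp_homeomorph (Homeomorph.addRight c)
  have ha0 : ∀ y, a y ≠ 0 → ‖y‖ ≤ ρ := fun y hy => norm_le_of_tsupport_subset_ball hgb y hy
  obtain ⟨A, hA⟩ := hac.exists_bound_of_continuous ha.continuous
  have hA0 : 0 ≤ A := (norm_nonneg _).trans (hA 0)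
  obtain ⟨T, hT⟩ := hKc.exists_bound_of_continuousOn (hθ.smooth.continuousOn.mono hKt)
  obtain ⟨C, hC⟩ := hθ.exists_pullVF hKc hKt
  let Q : ℝ := 2 * (A * |T| * ρ * volume.real (Metric.closedBall (0 : EuclideanSpace ℝ (Fin m)) ρ))
  have hQ0 : 0 ≤ Q := by positivity
  refine ⟨C * (Q.toNNReal ^ 2 * (volume (Metric.closedBall c (2 * ρ))).toNNReal),
    fun h B hh hB => ?_⟩
  have hB0 : 0 ≤ B := (abs_nonneg _).trans (hB p)
  obtain ⟨hhs, hhb⟩ := hsupp h hh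
  let b : EuclideanSpace ℝ (Fin m) → ℝ := fun y => densChart θ p h (y + c)
  have hb : ContDiff ℝ ∞ b := (hθ.contDiff_densChart hhs).comp (contDiff_id.add contDiff_const)
  have hbc : HasCompactSupport b :=
    (hasCompactSupport_densChart θ hhs).comp_homeomorph (Homeomorph.addRight c)
  have hb0 : ∀ y, b y ≠ 0 → ‖y‖ ≤ ρ := fun y hy => norm_le_of_tsupport_subset_ball hhb y hy
  have hbB : ∀ y, |b y| ≤ |T| * B := by
    intro y
    by_cases hy : b y = 0
    · rw [hy, abs_zero]; positivity
    · have h1 : y + c ∈ Metric.closedBall c (2 * ρ) :=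
        Metric.ball_subset_closedBall.trans (Metric.closedBall_subset_closedBall (by linarith))
          (hhb (subset_tsupport _ hy))
      show |θ _ * pushChart p h _| ≤ _
      rw [abs_mul, pushChart_of_mem h (hKt h1)]
      exact mul_le_mul ((hT _ h1).trans (le_abs_self T)) (hB _) (abs_nonneg _) (abs_nonneg _)
  let V : EuclideanSpace ℝ (Fin m) → EuclideanSpace ℝ (Fin m) := fun y =>
    rayOp b a (y - c) - rayOp a b (y - c)
  have hV : ContDiff ℝ ∞ V :=
    ((contDiff_rayOp hb ha hbc).comp (contDiff_id.sub contDiff_const)).sub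
      ((contDiff_rayOp ha hb hac).comp (contDiff_id.sub contDiff_const))
  have hV0 : ∀ y ∉ Metric.closedBall c (2 * ρ), V y = 0 := by
    intro y hy
    rw [Metric.mem_closedBall, dist_eq_norm] at hy
    have h1 : rayOp b a (y - c) = 0 := by
      by_contra h'; exact hy (rayOp_sub_ne_zero hb0 ha0 h')
    have h2 : rayOp a b (y - c) = 0 := by
      by_contra h'; exact hy (rayOp_sub_ne_zero ha0 hb0 h')
    show rayOp b a (y - c) - rayOp a b (y - c) = 0
    rw [h1, h2, sub_zero]
  have hVK : tsupport V ⊆ Metric.closedBall c (2 * ρ) :=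
    closure_minimal (fun y hy => by_contra fun h' => hy (hV0 y h')) Metric.isClosed_closedBall
  have hVb : ∀ y, ‖V y‖ ≤ Q * B := by
    intro y
    have h1 := norm_rayOp_le hbB (fun y => hA y) hb0 (y - c)
    have h2 := norm_rayOp_le (fun y => hA y) hbB ha0 (y - c)
    refine (norm_sub_le _ _).trans ((add_le_add h1 h2).trans (le_of_eq ?_))
    simp only [Q]
    ring
  obtain ⟨Y, hY1, hY2⟩ := hC V hV hVK
  refine ⟨Y, hY1.trans ?_, fun f => ?_⟩
  · rw [ENNReal.coe_mul, mul_assoc]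
    gcongr
    have h1 : ∫⁻ y, ‖V y‖ₑ ^ 2 = ∫⁻ y in Metric.closedBall c (2 * ρ), ‖V y‖ₑ ^ 2 := by
      rw [← lintegral_indicator Metric.isClosed_closedBall.measurableSet]
      refine lintegral_congr fun y => ?_
      by_cases hy : y ∈ Metric.closedBall c (2 * ρ)
      · rw [indicator_of_mem hy]
      · rw [indicator_of_notMem hy, hV0 y hy]; simp
    rw [h1]
    refine (setLIntegral_mono' (g := fun _ => (ENNReal.ofReal (Q * B)) ^ 2)
      Metric.isClosed_closedBall.measurableSet fun y _ => ?_).trans ?_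
    · rw [← ofReal_norm]
      exact pow_le_pow_left' (ENNReal.ofReal_le_ofReal (hVb y)) 2
    · rw [setLIntegral_const, ENNReal.ofReal_mul hQ0, mul_pow, ENNReal.coe_mul, ENNReal.coe_pow,
        ENNReal.coe_toNNReal measure_closedBall_lt_top.ne]
      exact le_of_eq (by rw [ENNReal.ofReal]; ring)
  · obtain ⟨G, hG, hGf⟩ := exists_smooth_extension_chart hKc hKt f
    let Gc : EuclideanSpace ℝ (Fin m) → ℝ := fun y => G (y + c)
    have hGc : ContDiff ℝ ∞ Gc := hG.comp (contDiff_id.add contDiff_const)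
    have e1 : ∀ f' : SmoothFun m M, tsupport f' ⊆ N →
        ∫ y, Gc y * densChart θ p f' (y + c) = integralL μ (f' * f) := by
      intro f' hf'
      have h1 := hθ.integral_densChart_mul (hsupp f' hf').1 (h := G) (H := f) fun x hx => by
        have h2 : extChartAt (𝓡 m) p x ∈ Metric.closedBall c (2 * ρ) :=
          Metric.ball_subset_closedBall.trans (Metric.closedBall_subset_closedBall (by linarith))
            (hf' hx).2
        rw [(hGf _ h2).self_of_nhds, Function.comp_apply,
          (extChartAt (𝓡 m) p).left_inv (hf' hx).1]
      show _ = ∫ x, (f' * f) x ∂μ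
      rw [← h1, ← integral_add_right_eq_self (fun y => densChart θ p f' y * G y) c]
      exact integral_congr_ae (ae_of_all _ fun y => mul_comm _ _)
    have e2 : ∀ f' : SmoothFun m M, tsupport f' ⊆ N →
        ∫ y, densChart θ p f' (y + c) = integralL μ f' := by
      intro f' hf'
      have h1 := hθ.integral_densChart_mul (hsupp f' hf').1 (h := fun _ => 1) (H := 1)
        fun x hx => rfl
      show _ = ∫ x, f' x ∂μ
      rw [mul_one] at h1
      rw [← h1, ← integral_add_right_eq_self (fun y => densChart θ p f' y * 1) c]
      simp only [mul_one]
    have e3 : ∫ y, fderiv ℝ G y (V y) =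
        (∫ y, fderiv ℝ Gc y (rayOp b a y)) - ∫ y, fderiv ℝ Gc y (rayOp a b y) := by
      have hGc' : Continuous (fderiv ℝ Gc) := hGc.continuous_fderiv (by simp)
      have hi : ∀ {a b : EuclideanSpace ℝ (Fin m) → ℝ}, ContDiff ℝ ∞ a → ContDiff ℝ ∞ b →
          HasCompactSupport a → (∀ y, a y ≠ 0 → ‖y‖ ≤ ρ) → (∀ y, b y ≠ 0 → ‖y‖ ≤ ρ) →
          Integrable fun y => fderiv ℝ Gc y (rayOp a b y) := by
        intro a b ha hb hac ha0 hb0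
        have hr := (contDiff_rayOp ha hb hac).continuous
        refine Continuous.integrable_of_hasCompactSupport (by fun_prop) (HasCompactSupport.intro
          (isCompact_closedBall (0 : EuclideanSpace ℝ (Fin m)) (2 * ρ)) fun y hy => ?_)
        by_contra h'
        exact hy (mem_closedBall_zero_iff.2 (rayOp_sub_ne_zero ha0 hb0 fun h'' =>
          h' (by rw [h'', map_zero])))
      rw [← integral_sub (hi hb ha hbc hb0 ha0) (hi ha hb hac ha0 hb0),
        ← integral_add_right_eq_self (fun y => fderiv ℝ G y (V y)) c]
      refine integral_congr_ae (ae_of_all _ fun y => ?_)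
      simp only [V, Gc, add_sub_cancel_right, fderiv_comp_add_right, map_sub]
    show ∫ x, dirD Y f x ∂μ = _
    rw [hY2 f G hG hGf, e3, integral_fderiv_rayOp hb.continuous hbc ha.continuous hac hGc,
      integral_fderiv_rayOp ha.continuous hac hb.continuous hbc hGc,
      integral_translates_comm hb.continuous hbc ha.continuous hac hGc.continuous]
    have e4 := e1 h hh
    have e5 := e1 g hg
    have e6 := e2 h hh
    have e7 := e2 g hg
    change ∫ y, Gc y * b y = _ at e4
    change ∫ y, Gc y * a y = _ at e5
    change ∫ y, b y = _ at e6
    change ∫ y, a y = _ at e7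
    rw [e4, e5, e6, e7, hg1, mul_sub, map_sub, mul_smul_comm, map_smul, mul_comm f h, mul_comm f g,
      smul_eq_mul]
    ring

theorem HasDiv.sub {Y Z : VF m M} {h k : SmoothFun m M} (hY : HasDiv μ Y h)
    (hZ : HasDiv μ Z k) : HasDiv μ (Y - Z) (h - k) := by
  have := hY.add (hZ.smul (-1))
  rwa [neg_one_smul, neg_one_smul, ← sub_eq_add_neg, ← sub_eq_add_neg] at this

theorem exists_normalized_bump [μ.IsOpenPosMeasure] (p : M) {N : Set M} (hN : N ∈ 𝓝 p) :
    ∃ g : SmoothFun m M, tsupport g ⊆ N ∧ integralL μ g = 1 := by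
  obtain ⟨g, h1, h2, h3⟩ := exists_cutoff_manifold (m := m) (isClosed_singleton (x := p))
    isOpen_interior (singleton_subset_iff.2 (mem_interior_iff_mem_nhds.2 hN))
  have h4 : g p = 1 := (eventually_nhdsSet_iff_forall.1 h2 p rfl).self_of_nhds
  have h5 : 0 < integralL μ g := by
    refine g.contMDiff.continuous.integral_pos_of_hasCompactSupport_nonneg_nonzero
      (HasCompactSupport.of_compactSpace _) (fun x => (h3 x).1) (x := p) ?_
    rw [h4]; exact one_ne_zero
  refine ⟨(integralL μ g)⁻¹ • g, (closure_mono ?_).trans (h1.trans interior_subset), ?_⟩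
  · exact Function.support_const_smul_subset _ _
  · rw [map_smul, smul_eq_mul, inv_mul_cancel₀ h5.ne']

theorem sqNorm_smul (r : ℝ) (Y : VF m M) : sqNorm μ (r • Y) = ENNReal.ofReal (r ^ 2) * sqNorm μ Y := by
  rw [sqNorm, sqNorm, ← lintegral_const_mul' _ _ ENNReal.ofReal_ne_top]
  refine lintegral_congr fun x => ?_
  rw [← ENNReal.ofReal_mul (sq_nonneg r)]
  congr 1
  rw [innerFun_smul_left, innerFun_comm, innerFun_smul_left]
  ring

theorem sqNorm_lt_top (Y : VF m M) : sqNorm μ Y < ⊤ := by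
  have h : Integrable (innerFun Y Y) μ := (innerFun Y Y).contMDiff.continuous.integrable_of_hasCompactSupport
    (HasCompactSupport.of_compactSpace _)
  exact h.lintegral_lt_top

/-- The localized pieces `ρ_p h` are solved up to multiples of the bumps `g p`. By connectedness
these bumps differ by divergences, so all multiples move to a single bump, where they add up to `∫ h
dμ = 0`. -/
theorem exists_hasDiv [ConnectedSpace M] [IsProbabilityMeasure μ] [μ.IsOpenPosMeasure]
    (hμ : ∀ p : M, ∃ θ, IsChartDensity (m := m) μ p θ) : ∃ C : NNReal,
      ∀ (h : SmoothFun m M) (B : ℝ), integralL μ h = 0 → (∀ x, |h x| ≤ B) → ∃ Y : VF m M,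
        sqNorm μ Y ≤ C * ENNReal.ofReal B ^ 2 ∧ HasDiv μ Y h := by
  choose θ hθ using hμ
  have h1 := fun p => (hθ p).exists_hasDiv_local
  choose N hN h2 using h1
  have h3 := fun p => exists_normalized_bump (m := m) (μ := μ) p (hN p)
  choose g hgN hg1 using h3
  have h4 := fun p => h2 p (g p) (hgN p) (hg1 p)
  choose C hC using h4
  -- `P` is symmetric, transitive and holds between nearby points, since a bump in the intersection
  -- of two neighbourhoods is comparable with both; on a connected space it then holds for all
  -- pairs.
  let P : M → M → Prop := fun p q => ∃ Y, HasDiv μ Y (g p - g q)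
  have hbd : ∀ f : SmoothFun m M, ∃ B, ∀ x, |f x| ≤ B := fun f => by
    obtain ⟨B, hB⟩ := isCompact_univ.exists_bound_of_continuousOn f.contMDiff.continuous.continuousOn
    exact ⟨B, fun x => hB x (mem_univ x)⟩
  have hloc : ∀ p (h : SmoothFun m M), tsupport h ⊆ N p → integralL μ h = 1 →
      ∃ Y, HasDiv μ Y (h - g p) := by
    intro p h hh hh1
    obtain ⟨B, hB⟩ := hbd h
    obtain ⟨Y, -, hY⟩ := hC p h B hh hB
    rw [hh1, one_smul] at hY
    exact ⟨Y, hY⟩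
  have : Std.Symm P := ⟨fun p q ⟨Y, hY⟩ => ⟨(-1 : ℝ) • Y, by
    simpa [neg_one_smul] using hY.smul (-1)⟩⟩
  have htr : IsTrans M P := ⟨fun p q r ⟨Y, hY⟩ ⟨Z, hZ⟩ => ⟨Y + Z, by simpa using hY.add hZ⟩⟩
  have hnear : ∀ p, ∀ᶠ q in 𝓝 p, P p q := by
    intro p
    filter_upwards [eventually_mem_nhds_iff.2 (hN p)] with q hq
    obtain ⟨k, hk, hk1⟩ := exists_normalized_bump (m := m) (μ := μ) q (inter_mem hq (hN q))
    obtain ⟨Y, hY⟩ := hloc p k (hk.trans inter_subset_left) hk1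
    obtain ⟨Z, hZ⟩ := hloc q k (hk.trans inter_subset_right) hk1
    exact ⟨Z - Y, by simpa using hZ.sub hY⟩
  have hP : ∀ p q, P p q := PreconnectedSpace.induction₂ P hnear htr
  obtain ⟨p₀⟩ := (inferInstance : Nonempty M)
  have h5 : ∀ p, ∃ Z, HasDiv μ Z (g p - g p₀) := fun p => hP p p₀
  choose Z hZ using h5
  obtain ⟨s, ρ, hρ1, hρN, hρ0⟩ := exists_partition (m := m) N hN
  have h6 := fun p => hbd (ρ p)
  choose R hR using h6
  have hR0 : ∀ p, 0 ≤ R p := fun p => (abs_nonneg _).trans (hR p p₀)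
  refine ⟨2 * (2 ^ s.card * ∑ p ∈ s, C p * (R p).toNNReal ^ 2 +
    2 ^ s.card * ∑ p ∈ s, (R p).toNNReal ^ 2 * (sqNorm μ (Z p)).toNNReal), fun h B hh hB => ?_⟩
  have hB0 : 0 ≤ B := (abs_nonneg _).trans (hB p₀)
  have hρB : ∀ p x, |(ρ p * h) x| ≤ R p * B := fun p x => by
    show |ρ p x * h x| ≤ _
    rw [abs_mul]
    exact mul_le_mul (hR p x) (hB x) (abs_nonneg _) (hR0 p)
  have h7 : ∀ p ∈ s, ∃ Y : VF m M, sqNorm μ Y ≤ C p * ENNReal.ofReal (R p * B) ^ 2 ∧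
      HasDiv μ Y (ρ p * h - integralL μ (ρ p * h) • g p) := fun p hp =>
    hC p (ρ p * h) (R p * B) ((closure_mono (Function.support_mul_subset_left _ _)).trans
      (hρN p hp)) (hρB p)
  choose! Y hY1 hY2 using h7
  have hint : ∀ p, |integralL μ (ρ p * h)| ≤ R p * B := fun p => by
    have := norm_integral_le_of_norm_le_const (μ := μ) (f := ρ p * h) (ae_of_all _ (hρB p))
    rw [probReal_univ, mul_one] at this
    exact this
  refine ⟨∑ p ∈ s, Y p + ∑ p ∈ s, integralL μ (ρ p * h) • Z p, ?_, ?_⟩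
  · refine (sqNorm_add_le _ _ _).trans ?_
    push_cast
    rw [mul_assoc]
    gcongr
    rw [add_mul]
    refine add_le_add ((sqNorm_sum_le _ _ _).trans ?_) ((sqNorm_sum_le _ _ _).trans ?_)
    · rw [mul_assoc, Finset.sum_mul]
      gcongr with p hp
      refine (hY1 p hp).trans (le_of_eq ?_)
      rw [ENNReal.ofReal_mul (hR0 p), mul_pow, ← mul_assoc]
      rfl
    · rw [mul_assoc, Finset.sum_mul]
      gcongr with p hp
      rw [sqNorm_smul, ENNReal.coe_toNNReal (sqNorm_lt_top _).ne, mul_right_comm]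
      gcongr
      rw [← sq_abs]
      refine (ENNReal.ofReal_le_ofReal (pow_le_pow_left₀ (abs_nonneg _) (hint p) 2)).trans
        (le_of_eq ?_)
      rw [ENNReal.ofReal_pow (mul_nonneg (hR0 p) hB0), ENNReal.ofReal_mul (hR0 p), mul_pow]
      rfl
  · have h8 := (HasDiv.sum hY2).add (HasDiv.sum (s := s) fun p _ =>
      (hZ p).smul (integralL μ (ρ p * h)))
    have h9 : ∑ p ∈ s, integralL μ (ρ p * h) = 0 := by
      rw [← map_sum, ← Finset.sum_mul, hρ1, one_mul, hh]
    convert h8 using 1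
    rw [Finset.sum_sub_distrib, ← Finset.sum_mul, hρ1, one_mul]
    simp only [smul_sub]
    rw [Finset.sum_sub_distrib, ← Finset.sum_smul, h9, zero_smul]
    abel

end Divergence

/-! ### Gradient bounds by duality -/

section Helmholtz

variable [RiemannianBundle (fun x : M => TangentSpace (𝓡 m) x)]
  [IsContMDiffRiemannianBundle (𝓡 m) ∞ (EuclideanSpace ℝ (Fin m))
    (fun x : M => TangentSpace (𝓡 m) x)]
  [MeasurableSpace M] [BorelSpace M] [CompactSpace M]

variable {μ : Measure M} [IsFiniteMeasure μ] {p : M} {θ : EuclideanSpace ℝ (Fin m) → ℝ}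

theorem ENNReal.add_sq_le_four (a b : ENNReal) : (a + b) ^ 2 ≤ 4 * (a ^ 2 + b ^ 2) := by
  have key : ∀ {a b : ENNReal}, a ≤ b → (a + b) ^ 2 ≤ 4 * (a ^ 2 + b ^ 2) := fun {a b} h => by
    calc (a + b) ^ 2 ≤ (b + b) ^ 2 := by gcongr
      _ = 4 * b ^ 2 := by ring
      _ ≤ 4 * (a ^ 2 + b ^ 2) := by gcongr; exact le_add_self
  rcases le_total a b with h | h
  · exact key h
  · rw [add_comm a, add_comm (a ^ 2)]; exact key h

theorem sqNorm_eq_ofReal (μ : Measure M) [IsFiniteMeasure μ] (Y : VF m M) :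
    sqNorm μ Y = ENNReal.ofReal (integralL μ (innerFun Y Y)) :=
  (ofReal_integral_eq_lintegral_ofReal
    ((innerFun Y Y).contMDiff.continuous.integrable_of_hasCompactSupport
      (HasCompactSupport.of_compactSpace _)) (ae_of_all _ (innerFun_self_nonneg Y))).symm

theorem sq_setLIntegral_le {E : Type*} [MeasurableSpace E] (ν : Measure E) (K : Set E)
    {g : E → ENNReal} (hg : Measurable g) :
    (∫⁻ y in K, g y ∂ν) ^ 2 ≤ ν K * ∫⁻ y, g y ^ 2 ∂ν := by
  have h := sq_lintegral_le (ν.restrict K) (w := fun _ => 1) measurable_const hg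
  simp only [one_mul, lintegral_one, Measure.restrict_apply_univ] at h
  exact h.trans (by gcongr; exact Measure.restrict_le_self)

/-- With `Y = ∇(χ P)`, the squared norm of `Y` is the pairing of `Y` with `χ P`. In the chart this
is at most `L` times the `L¹` norm of the chart data of `Y`, which is controlled by the norm of `Y`;
one factor is then cancelled. -/
theorem IsChartDensity.exists_sqNorm_grad_le (hθ : IsChartDensity μ p θ) {χ : SmoothFun m M}
    (hχ : tsupport χ ⊆ (extChartAt (𝓡 m) p).source) : ∃ C : NNReal,
      ∀ (ψ : EuclideanSpace ℝ (Fin m) → ℝ) (L : ℝ) (P : SmoothFun m M), ContDiff ℝ ∞ ψ →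
        (∀ y, |ψ y| ≤ L) → (∀ y, ‖fderiv ℝ ψ y‖ ≤ L) →
        (∀ x ∈ tsupport χ, ∀ᶠ z in 𝓝 x, P z = ψ (extChartAt (𝓡 m) p z)) →
        sqNorm μ (grad (χ * P)) ≤ C * ENNReal.ofReal L ^ 2 := by
  obtain ⟨C, hC⟩ := hθ.exists_chartField_le hχ
  have hχ' : ∀ Y, tsupport (dirD Y χ) ⊆ (extChartAt (𝓡 m) p).source := fun Y =>
    (tsupport_dirD_subset Y χ).trans hχ
  set K := extChartAt (𝓡 m) p '' tsupport χ with hK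
  have hKc : IsCompact K := isCompact_image_tsupport hχ
  refine ⟨8 * (volume K).toNNReal * C, fun ψ L P hψ hL hL' hP => ?_⟩
  set Y := grad (χ * P) with hY
  set U := chartField θ p χ Y with hU
  set u := densChart θ p (dirD Y χ) with hu
  have cU : Continuous U := (hθ.contDiff_chartField hχ Y).continuous
  have cu : Continuous u := (hθ.contDiff_densChart (hχ' Y)).continuous
  have hU0 : ∀ y ∉ K, U y = 0 := fun y hy =>
    image_eq_zero_of_notMem_tsupport fun h => hy (tsupport_chartField θ hχ Y h)
  have hu0 : ∀ y ∉ K, u y = 0 := fun y hy =>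
    image_eq_zero_of_notMem_tsupport fun h => hy
      (image_mono (tsupport_dirD_subset Y χ) (tsupport_densChart θ (hχ' Y) h))
  have h1 : sqNorm μ Y ≤ ENNReal.ofReal L * ∫⁻ y in K, (‖U y‖ₑ + ‖u y‖ₑ) := by
    rw [sqNorm_eq_ofReal, hY, innerFun_grad, ← hY]
    change ENNReal.ofReal (∫ x, dirD Y (χ * P) x ∂μ) ≤ _
    rw [← hθ.integral_chartField hχ Y hψ hP]
    have h2 := setIntegral_eq_integral_of_forall_compl_eq_zero (μ := volume) (s := K)
      (f := fun y => fderiv ℝ ψ y (U y) + ψ y * u y) fun y hy => by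
        rw [hU0 y hy, hu0 y hy, map_zero, mul_zero, add_zero]
    rw [← h2, ← lintegral_const_mul' _ _ ENNReal.ofReal_ne_top]
    refine (ENNReal.ofReal_le_ofReal (le_abs_self _)).trans ?_
    rw [← Real.norm_eq_abs, ofReal_norm]
    refine (enorm_integral_le_lintegral_enorm _).trans (lintegral_mono fun y => ?_)
    rw [mul_add]
    refine (enorm_add_le _ _).trans (add_le_add ?_ ?_)
    · refine ((fderiv ℝ ψ y).le_opENorm (U y)).trans ?_
      gcongr
      rw [← ofReal_norm]; exact ENNReal.ofReal_le_ofReal (hL' y)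
    · rw [enorm_mul]
      gcongr
      rw [← ofReal_norm]; exact ENNReal.ofReal_le_ofReal (hL y)
  have h3 : (∫⁻ y in K, (‖U y‖ₑ + ‖u y‖ₑ)) ^ 2 ≤ volume K * (8 * (C * sqNorm μ Y)) := by
    refine (sq_setLIntegral_le volume K (by fun_prop)).trans ?_
    gcongr
    calc ∫⁻ y, (‖U y‖ₑ + ‖u y‖ₑ) ^ 2 ≤ ∫⁻ y, 4 * (‖U y‖ₑ ^ 2 + ‖u y‖ₑ ^ 2) :=
          lintegral_mono fun y => ENNReal.add_sq_le_four _ _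
      _ = 4 * ((∫⁻ y, ‖U y‖ₑ ^ 2) + ∫⁻ y, ‖u y‖ₑ ^ 2) := by
          rw [lintegral_const_mul' _ _ (by simp), lintegral_add_left (by fun_prop)]
      _ ≤ 4 * (C * sqNorm μ Y + C * sqNorm μ Y) := by
          gcongr
          · exact (hC Y).1
          · exact (hC Y).2
      _ = 8 * (C * sqNorm μ Y) := by ring
  push_cast
  rw [ENNReal.coe_toNNReal hKc.measure_lt_top.ne]
  rcases eq_or_ne (sqNorm μ Y) 0 with h0 | h0
  · rw [h0]; exact zero_le
  · rw [← ENNReal.mul_le_mul_iff_left h0 (sqNorm_lt_top Y).ne]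
    calc sqNorm μ Y * sqNorm μ Y
        ≤ (ENNReal.ofReal L * ∫⁻ y in K, (‖U y‖ₑ + ‖u y‖ₑ)) ^ 2 := by rw [← sq]; gcongr
      _ ≤ ENNReal.ofReal L ^ 2 * (volume K * (8 * (C * sqNorm μ Y))) := by
          rw [mul_pow]; gcongr
      _ = _ := by ring

theorem chartField_sub (θ : EuclideanSpace ℝ (Fin m) → ℝ) (p : M) (χ : SmoothFun m M)
    (Y Z : VF m M) :
    chartField θ p χ (Y - Z) = chartField θ p χ Y - chartField θ p χ Z := by
  ext1 y
  rw [Pi.sub_apply, chartField, chartField, chartField, ← smul_sub]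
  congr 1
  exact (mfderiv 𝓘(ℝ, EuclideanSpace ℝ (Fin m)) (𝓡 m) (extChartAt (𝓡 m) p).symm
    y).inverse.map_sub (Y _) (Z _)

theorem IsMollifier.exists_norm_sub_le {E : Type*} [NormedAddCommGroup E] [InnerProductSpace ℝ E]
    [FiniteDimensional ℝ E] [MeasurableSpace E] [BorelSpace E] {ε : ℝ} {η : E → ℝ}
    (h : IsMollifier ε η) {y : E} (hy : y ∈ tsupport η) : ‖y‖ ≤ ε := by
  have h1 : tsupport η ⊆ Metric.closedBall 0 ε := closure_minimal
    (fun y hy => mem_closedBall_zero_iff.2 (h.support y hy)) Metric.isClosed_closedBall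
  exact mem_closedBall_zero_iff.1 (h1 hy)

theorem exists_small (δ κ a : ℝ) (hδ : 0 < δ) (hκ : 0 < κ) :
    ∃ ε : ℝ, 0 < ε ∧ ε ≤ δ ∧ ε ^ 2 ≤ κ ∧ ε ^ 2 * a ≤ κ := by
  have h1 : Tendsto (fun ε : ℝ => ε ^ 2) (𝓝[>] 0) (𝓝 0) :=
    ((continuous_pow 2).tendsto' 0 0 (by simp)).mono_left nhdsWithin_le_nhds
  have h2 : Tendsto (fun ε : ℝ => ε ^ 2 * a) (𝓝[>] 0) (𝓝 0) := by
    simpa using h1.mul_const a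
  obtain ⟨ε, hε⟩ := ((eventually_mem_nhdsWithin.and (Ioc_mem_nhdsGT hδ)).and
    ((h1.eventually (gt_mem_nhds hκ)).and (h2.eventually (gt_mem_nhds hκ)))).exists
  exact ⟨ε, hε.1.1, hε.1.2.2, hε.2.1.le, hε.2.2.le⟩

end Helmholtz

/-! ### Smoothing of the divergence -/

section Smoothing

variable [RiemannianBundle (fun x : M => TangentSpace (𝓡 m) x)]
  [IsContMDiffRiemannianBundle (𝓡 m) ∞ (EuclideanSpace ℝ (Fin m))
    (fun x : M => TangentSpace (𝓡 m) x)]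
  [MeasurableSpace M] [BorelSpace M] [CompactSpace M]

variable {E : Type*} [NormedAddCommGroup E] [InnerProductSpace ℝ E]
  [FiniteDimensional ℝ E] [MeasurableSpace E] [BorelSpace E] {ε : ℝ} {η : E → ℝ}

/-- `U` is split as `U₀` plus a remainder. Mollification contracts the `L²` norm of the remainder
and is uniformly close to the identity on `U₀`, so no derivative of `U` enters the bound. -/
theorem IsMollifier.lintegral_sq_correction_le (h : IsMollifier ε η) {U U₀ : E → E} {u : E → ℝ}
    (hU : ContDiff ℝ ∞ U) (hUc : HasCompactSupport U) (hU₀ : ContDiff ℝ ∞ U₀)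
    (hU₀c : HasCompactSupport U₀) (hu : Continuous u) {B : ℝ} {K : Set E} (hK : MeasurableSet K)
    (hB : ∀ y, ‖mollify η U₀ y - U₀ y‖ ≤ B) (hBK : ∀ y ∉ K, mollify η U₀ y - U₀ y = 0) :
    ∫⁻ y, ‖mollify η U y - U y + rayOp η u y‖ₑ ^ 2 ≤
      64 * (2 * (∫⁻ y, ‖(U - U₀) y‖ₑ ^ 2) + ENNReal.ofReal B ^ 2 * volume K +
        ENNReal.ofReal ε ^ 2 * ∫⁻ y, ‖u y‖ₑ ^ 2) := by
  have hη := h.smooth.continuous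
  have hV : ContDiff ℝ ∞ (U - U₀) := hU.sub hU₀
  have hVc : HasCompactSupport (U - U₀) := by
    rw [sub_eq_add_neg]; exact hUc.add hU₀c.neg
  have m1 : Measurable fun y => ‖mollify η (U - U₀) y‖ₑ ^ 2 :=
    (contDiff_mollify h.smooth hV hVc).continuous.measurable.enorm.pow_const 2
  have m2 : Measurable fun y => ‖(U - U₀) y‖ₑ ^ 2 := hV.continuous.measurable.enorm.pow_const 2
  have m3 : Measurable fun y => ‖mollify η U₀ y - U₀ y‖ₑ ^ 2 :=
    ((contDiff_mollify h.smooth hU₀ hU₀c).continuous.sub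
      hU₀.continuous).measurable.enorm.pow_const 2
  have e1 : ∀ y, ‖mollify η U y - U y + rayOp η u y‖ₑ ^ 2 ≤
      64 * (‖mollify η (U - U₀) y‖ₑ ^ 2 + ‖(U - U₀) y‖ₑ ^ 2 +
        ‖mollify η U₀ y - U₀ y‖ₑ ^ 2 + ‖rayOp η u y‖ₑ ^ 2) := fun y => by
    have e2 : mollify η U y - U y = (mollify η (U - U₀) y - (U - U₀) y) +
        (mollify η U₀ y - U₀ y) := by
      rw [mollify_sub hη hU.continuous hUc hU₀.continuous hU₀c, Pi.sub_apply]; abel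
    rw [e2]
    calc _ ≤ (((‖mollify η (U - U₀) y‖ₑ + ‖(U - U₀) y‖ₑ) + ‖mollify η U₀ y - U₀ y‖ₑ) +
            ‖rayOp η u y‖ₑ) ^ 2 := by
          gcongr
          refine (enorm_add_le _ _).trans ?_
          gcongr
          refine (enorm_add_le _ _).trans ?_
          gcongr
          exact enorm_sub_le
      _ ≤ 4 * (4 * (4 * (‖mollify η (U - U₀) y‖ₑ ^ 2 + ‖(U - U₀) y‖ₑ ^ 2) +
            ‖mollify η U₀ y - U₀ y‖ₑ ^ 2) + ‖rayOp η u y‖ₑ ^ 2) := by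
          refine (ENNReal.add_sq_le_four _ _).trans ?_
          gcongr
          refine (ENNReal.add_sq_le_four _ _).trans ?_
          gcongr
          exact ENNReal.add_sq_le_four _ _
      _ = 64 * (‖mollify η (U - U₀) y‖ₑ ^ 2 + ‖(U - U₀) y‖ₑ ^ 2) +
          16 * ‖mollify η U₀ y - U₀ y‖ₑ ^ 2 + 4 * ‖rayOp η u y‖ₑ ^ 2 := by ring
      _ ≤ 64 * (‖mollify η (U - U₀) y‖ₑ ^ 2 + ‖(U - U₀) y‖ₑ ^ 2) +
          64 * ‖mollify η U₀ y - U₀ y‖ₑ ^ 2 + 64 * ‖rayOp η u y‖ₑ ^ 2 := by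
          gcongr <;> norm_num
      _ = _ := by ring
  have m4 : Measurable fun y => ‖mollify η (U - U₀) y‖ₑ ^ 2 + ‖(U - U₀) y‖ₑ ^ 2 := m1.add m2
  have m5 : Measurable fun y => ‖mollify η (U - U₀) y‖ₑ ^ 2 + ‖(U - U₀) y‖ₑ ^ 2 +
    ‖mollify η U₀ y - U₀ y‖ₑ ^ 2 := m4.add m3
  refine (lintegral_mono e1).trans ?_
  rw [lintegral_const_mul' _ _ (by simp), lintegral_add_left m5, lintegral_add_left m4,
    lintegral_add_left m1]
  gcongr
  · rw [two_mul]
    refine add_le_add ?_ le_rfl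
    refine (lintegral_sq_mollify_le hη hV.continuous).trans ?_
    rw [h.lintegral, one_pow, one_mul]
  · have h1 : ∫⁻ y, ‖mollify η U₀ y - U₀ y‖ₑ ^ 2 =
        ∫⁻ y in K, ‖mollify η U₀ y - U₀ y‖ₑ ^ 2 := by
      rw [← lintegral_indicator hK]
      refine lintegral_congr fun y => ?_
      by_cases hy : y ∈ K
      · rw [indicator_of_mem hy]
      · rw [indicator_of_notMem hy, hBK y hy]; simp
    rw [h1, ← setLIntegral_const]
    refine lintegral_mono fun y => ?_
    rw [← ofReal_norm]
    exact pow_le_pow_left' (ENNReal.ofReal_le_ofReal (hB y)) 2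
  · refine (lintegral_sq_rayOp_le hη hu).trans ?_
    gcongr
    exact h.lintegral_mul

variable {μ : Measure M} [IsFiniteMeasure μ] {p : M} {θ : EuclideanSpace ℝ (Fin m) → ℝ}

/-- The corrector `X` replaces the `χ`-part of the divergence of `Y` by the smooth `S`. The order of
the quantifiers is essential: the scale depends on `Y₀` and `κ` only and fixes `D`, so `Y` can be
chosen afterwards in terms of `D`. -/
theorem IsChartDensity.exists_smoothing (hθ : IsChartDensity μ p θ) {χ : SmoothFun m M}
    (hχ : tsupport χ ⊆ (extChartAt (𝓡 m) p).source) : ∃ C : NNReal, ∀ (Y₀ : VF m M) (κ : NNReal),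
      0 < κ → ∃ D : NNReal, ∀ Y : VF m M, ∃ (X : VF m M) (S : SmoothFun m M),
        sqNorm μ X ≤ C * (κ * (1 + sqNorm μ Y) + sqNorm μ (Y - Y₀)) ∧
        (∀ f, integralL μ (dirD X f) = integralL μ (f * S) - integralL μ (dirD Y (χ * f))) ∧
        ∀ x, ∃ (P : SmoothFun m M) (r : ℝ), S x = r * integralL μ (dirD Y P) ∧ |r| ≤ D ∧
          sqNorm μ (grad P) ≤ D := by
  obtain ⟨C₁, hC₁⟩ := hθ.exists_chartField_le hχ
  obtain ⟨C₂, hC₂⟩ := hθ.exists_sqNorm_grad_le hχ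
  have hχ' : ∀ Y, tsupport (dirD Y χ) ⊆ (extChartAt (𝓡 m) p).source := fun Y =>
    (tsupport_dirD_subset Y χ).trans hχ
  set K := extChartAt (𝓡 m) p '' tsupport χ with hK
  have hKc : IsCompact K := isCompact_image_tsupport hχ
  have hKt : K ⊆ (extChartAt (𝓡 m) p).target := image_tsupport_subset_target hχ
  -- Room around `K` for mollifying at scale at most `δ` without leaving the chart.
  obtain ⟨δ, hδ, hδt⟩ := hKc.exists_cthickening_subset_open (isOpen_extChartAt_target p) hKt
  set K' := Metric.cthickening δ K with hK'
  have hKc' : IsCompact K' := hKc.cthickening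
  have hS : IsClosed ((extChartAt (𝓡 m) p).symm '' K') :=
    (hKc'.image_of_continuousOn ((continuousOn_extChartAt_symm p).mono hδt)).isClosed
  have hSs : (extChartAt (𝓡 m) p).symm '' K' ⊆ (extChartAt (𝓡 m) p).source := by
    rintro _ ⟨y, hy, rfl⟩; exact (extChartAt (𝓡 m) p).map_target (hδt hy)
  obtain ⟨C₃, hC₃⟩ := hθ.exists_pullVF hKc' hδt
  obtain ⟨D₁, hD₁⟩ := hθ.exists_bound hS hSs
  refine ⟨C₃ * (64 * (2 * C₁ + 1)), fun Y₀ κ hκ => ?_⟩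
  have sU : ∀ Y, ContDiff ℝ ∞ (chartField θ p χ Y) := fun Y => hθ.contDiff_chartField hχ Y
  have su : ∀ Y, ContDiff ℝ ∞ (densChart θ p (dirD Y χ)) := fun Y => hθ.contDiff_densChart (hχ' Y)
  have cU : ∀ Y, HasCompactSupport (chartField θ p χ Y) := fun Y =>
    hasCompactSupport_chartField θ hχ Y
  have cu : ∀ Y, HasCompactSupport (densChart θ p (dirD Y χ)) := fun Y =>
    hasCompactSupport_densChart θ (hχ' Y)
  have hUK : ∀ Y y, chartField θ p χ Y y ≠ 0 → y ∈ K := fun Y y hy =>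
    tsupport_chartField θ hχ Y (subset_tsupport _ hy)
  have huK : ∀ Y y, densChart θ p (dirD Y χ) y ≠ 0 → y ∈ K := fun Y y hy =>
    image_mono (tsupport_dirD_subset Y χ) (tsupport_densChart θ (hχ' Y) (subset_tsupport _ hy))
  obtain ⟨L₀, hL₀⟩ := ((sU Y₀).of_le (m := 1) (by simp)).lipschitzWith_of_hasCompactSupport
    (cU Y₀) one_ne_zero
  -- The two smallness conditions serve the ray term and the mollification error of `Y₀`, the latter
  -- being at most `L₀ * ε` on `K'`.
  obtain ⟨ε, hε0, hεδ, hε1, hε2⟩ := exists_small δ κ (L₀ ^ 2 * volume.real K') hδ hκ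
  obtain ⟨η, hη⟩ := exists_isMollifier (E := EuclideanSpace ℝ (Fin m)) hε0
  obtain ⟨B₀, hB₀⟩ := hη.compact.exists_bound_of_continuous hη.smooth.continuous
  obtain ⟨B₁, hB₁⟩ := (hη.compact.fderiv ℝ).exists_bound_of_continuous
    (hη.smooth.continuous_fderiv (by simp))
  have hnear : ∀ {x y : EuclideanSpace ℝ (Fin m)}, x ∈ K → ‖y - x‖ ≤ ε → y ∈ K' :=
    fun {x y} hx h => Metric.mem_cthickening_of_dist_le y x δ K hx
      (by rw [dist_eq_norm]; exact h.trans hεδ)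
  have hmU : ∀ Y, ∀ y ∉ K', mollify η (chartField θ p χ Y) y - chartField θ p χ Y y = 0 := by
    intro Y y hy
    have h1 : mollify η (chartField θ p χ Y) y = 0 := by
      by_contra h'
      obtain ⟨x, hx1, hx2⟩ := exists_of_mollify_ne_zero h'
      exact hy (hnear (hUK Y x hx2) (hη.support _ hx1))
    have h2 : chartField θ p χ Y y = 0 := by
      by_contra h'
      exact hy (Metric.self_subset_cthickening K (hUK Y y h'))
    rw [h1, h2, sub_zero]
  have hmr : ∀ Y, ∀ y ∉ K', rayOp η (densChart θ p (dirD Y χ)) y = 0 := by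
    intro Y y hy
    by_contra h'
    obtain ⟨s, r, hr, h1, h2⟩ := exists_of_rayOp_ne_zero h'
    refine hy (hnear (huK Y _ h2) ?_)
    rw [sub_sub_cancel, norm_smul, Real.norm_of_nonneg hr.1]
    exact (mul_le_of_le_one_left (norm_nonneg _) hr.2).trans (hη.support _ h1)
  set L := max B₀ B₁ with hL
  -- `D₁` bounds the inverse density, and `C₂ L²` the squared gradient norms of the localized
  -- mollifiers, where `L` bounds `η` and its derivative.
  refine ⟨D₁ + C₂ * L.toNNReal ^ 2, fun Y => ?_⟩
  set U := chartField θ p χ Y with hU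
  set u := densChart θ p (dirD Y χ) with hu
  have hVs : ContDiff ℝ ∞ fun y => mollify η U y - U y + rayOp η u y :=
    ((contDiff_mollify hη.smooth (sU Y) (cU Y)).sub (sU Y)).add
      (contDiff_rayOp hη.smooth (su Y) hη.compact)
  have hVK : tsupport (fun y => mollify η U y - U y + rayOp η u y) ⊆ K' :=
    closure_minimal (fun y hy => by_contra fun h' => hy (by
      show mollify η U y - U y + rayOp η u y = 0
      rw [hmU Y y h', hmr Y y h', add_zero])) hKc'.isClosed
  obtain ⟨X, hX1, hX2⟩ := hC₃ _ hVs hVK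
  have hdK : tsupport (mollifyDiv η U u) ⊆ K' :=
    closure_minimal (fun y hy => by
      obtain ⟨x, hx1, hx2⟩ := exists_of_mollifyDiv_ne_zero hy
      exact hnear (hx2.elim (hUK Y x) (huK Y x)) (hη.exists_norm_sub_le hx1)) hKc'.isClosed
  have hdiv := contDiff_mollifyDiv hη.smooth (sU Y) (cU Y) (su Y) (cu Y)
  obtain ⟨S, hS1, hS2⟩ := hθ.exists_pullFun hKc' hδt hdiv hdK
  refine ⟨X, S, ?_, fun f => ?_, fun x => ?_⟩
  · have hB : ∀ y, ‖mollify η (chartField θ p χ Y₀) y - chartField θ p χ Y₀ y‖ ≤ L₀ * ε :=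
      hη.norm_mollify_sub_le (sU Y₀).continuous (fun x y => by
        simpa [dist_eq_norm] using hL₀.dist_le_mul x y) L₀.2 (cU Y₀)
    have h1 := hη.lintegral_sq_correction_le (sU Y) (cU Y) (sU Y₀) (cU Y₀) (su Y).continuous
      hKc'.measurableSet hB (hmU Y₀)
    refine hX1.trans ?_
    push_cast
    rw [mul_assoc, mul_assoc]
    gcongr
    refine h1.trans ?_
    gcongr
    rw [← chartField_sub]
    have k1 := (hC₁ (Y - Y₀)).1
    have k2 := (hC₁ Y).2
    have k3 : ENNReal.ofReal (L₀ * ε) ^ 2 * volume K' ≤ κ := by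
      rw [← ENNReal.ofReal_toReal hKc'.measure_lt_top.ne,
        ← ENNReal.ofReal_pow (by positivity), ← ENNReal.ofReal_mul (by positivity),
        ← ENNReal.ofReal_coe_nnreal]
      refine ENNReal.ofReal_le_ofReal (le_trans (le_of_eq ?_) hε2)
      rw [Measure.real]; ring
    have k4 : ENNReal.ofReal ε ^ 2 ≤ κ := by
      rw [← ENNReal.ofReal_pow hε0.le, ← ENNReal.ofReal_coe_nnreal]
      exact ENNReal.ofReal_le_ofReal hε1
    calc _ ≤ 2 * (C₁ * sqNorm μ (Y - Y₀)) + κ + κ * (C₁ * sqNorm μ Y) := by gcongr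
      _ ≤ (2 * C₁ * sqNorm μ (Y - Y₀) + κ + κ * (C₁ * sqNorm μ Y)) +
          (2 * C₁ * κ + C₁ * κ * sqNorm μ Y + κ * sqNorm μ Y + sqNorm μ (Y - Y₀)) := by
          rw [mul_assoc]; exact le_self_add
      _ = _ := by ring
  · obtain ⟨g, hg, hgf⟩ := exists_smooth_extension_chart hKc' hδt f
    show ∫ x, dirD X f x ∂μ = (∫ x, (f * S) x ∂μ) - ∫ x, dirD Y (χ * f) x ∂μ
    rw [hX2 f g hg hgf, hη.integral_fderiv (sU Y) (cU Y) (su Y) (cu Y) hg, hθ.integral_chartField hχ Y hg]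
    · congr 1
      rw [← hS1, mul_comm f S, ← hθ.integral_densChart_mul (h := g) (H := f) (hS2.trans hSs)]
      · exact integral_congr_ae (ae_of_all _ fun y => mul_comm _ _)
      · intro x hx
        obtain ⟨y, hy, rfl⟩ := hS2 hx
        rw [(extChartAt (𝓡 m) p).right_inv (hδt hy), (hgf y hy).self_of_nhds, Function.comp_apply]
    · intro x hx
      have h1 : extChartAt (𝓡 m) p x ∈ K' := Metric.self_subset_cthickening K ⟨x, hx, rfl⟩
      filter_upwards [(continuousAt_extChartAt' (I := 𝓡 m) (hχ hx)).eventually (hgf _ h1),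
        (isOpen_extChartAt_source p).mem_nhds (hχ hx)] with z hz hzs
      rw [hz, Function.comp_apply, (extChartAt (𝓡 m) p).left_inv hzs]
  · by_cases hx : x ∈ (extChartAt (𝓡 m) p).symm '' K'
    · set t := extChartAt (𝓡 m) p x with ht
      -- `S x` is the mollified divergence at `t` divided by the density, that is, the pairing of
      -- `Y` with the localized reflected mollifier centred at `t`.
      have hψ : ContDiff ℝ ∞ fun z => η (t - z) := hη.smooth.comp (by fun_prop)
      obtain ⟨P, hP⟩ := exists_extend_chart (isClosed_tsupport χ) hχ hψ
      refine ⟨χ * P, (θ t)⁻¹, ?_, ?_, ?_⟩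
      · show _ = _ * ∫ x, dirD Y (χ * P) x ∂μ
        rw [← hθ.integral_chartField hχ Y hψ hP, ← mollifyDiv_eq hη.smooth, ← hS1, densChart,
          pushChart_apply S (hSs hx), inv_mul_cancel_left₀ (hθ.pos t
            ((extChartAt (𝓡 m) p).map_source (hSs hx))).ne']
      · rw [abs_of_nonneg (inv_nonneg.2 (hθ.pos t
          ((extChartAt (𝓡 m) p).map_source (hSs hx))).le)]
        exact ((hD₁ x hx).2).trans (by push_cast; exact le_add_of_nonneg_right (by positivity))
      · refine (hC₂ _ L P hψ (fun y => (hB₀ _).trans (le_max_left _ _)) (fun y => ?_) hP).trans ?_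
        · have h1 : fderiv ℝ (fun z => η (t - z)) y = -fderiv ℝ η (t - y) := by
            have h2 : HasFDerivAt (fun z => η (t - z))
                ((fderiv ℝ η (t - y)).comp (-ContinuousLinearMap.id ℝ _)) y :=
              ((hη.smooth.differentiable (by simp)) (t - y)).hasFDerivAt.comp y
                ((hasFDerivAt_id y).const_sub t)
            rw [h2.fderiv, ContinuousLinearMap.comp_neg, ContinuousLinearMap.comp_id]
          rw [h1, norm_neg]
          exact (hB₁ _).trans (le_max_right _ _)
        · push_cast
          exact le_add_self
    · refine ⟨0, 0, ?_, by rw [abs_zero]; exact NNReal.coe_nonneg _, ?_⟩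
      · rw [zero_mul]
        exact image_eq_zero_of_notMem_tsupport fun h => hx (hS2 h)
      · rw [sqNorm_eq_ofReal, innerFun_grad, map_zero, map_zero, ENNReal.ofReal_zero]
        exact zero_le

end Smoothing

/-! ### Approximation by divergence-free fields -/

section Density

variable [RiemannianBundle (fun x : M => TangentSpace (𝓡 m) x)]
  [IsContMDiffRiemannianBundle (𝓡 m) ∞ (EuclideanSpace ℝ (Fin m))
    (fun x : M => TangentSpace (𝓡 m) x)]
  [MeasurableSpace M] [BorelSpace M] [CompactSpace M]

variable (φ : DiffM m M)

/-- The linear map `A ↦ A ∘ φ` into the completed tangent space. -/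
def toTDL : VF m M →ₗ[ℝ] TbarD φ where
  toFun A := toTD φ A
  map_add' A B :=
    (UniformSpace.Completion.toComplₗᵢ (𝕜 := ℝ) (E := PreL2 (vol m M) φ)).map_add A B
  map_smul' r A :=
    (UniformSpace.Completion.toComplₗᵢ (𝕜 := ℝ) (E := PreL2 (vol m M) φ)).map_smul r A

theorem denseRange_toTDL : DenseRange (toTDL φ) :=
  UniformSpace.Completion.denseRange_coe (α := PreL2 (vol m M) φ)

theorem integralL_pushVol (f : SmoothFun m M) : integralL (pushVol φ) f = intD φ f :=
  integral_map φ.continuous.measurable.aemeasurable f.contMDiff.continuous.aestronglyMeasurable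

theorem inner_toTDL (A B : VF m M) :
    inner ℝ (toTDL φ A) (toTDL φ B) = integralL (pushVol φ) (innerFun A B) := by
  rw [integralL_pushVol]
  exact UniformSpace.Completion.inner_coe (E := PreL2 (vol m M) φ) A B

theorem tangentP_eq (A : VF m M) (f : SmoothFun m M) :
    tangentP φ A f = integralL (pushVol φ) (dirD A f) := (integralL_pushVol φ _).symm

theorem inner_toTDL_grad (f : SmoothFun m M) (A : VF m M) :
    inner ℝ (toTDL φ (grad f)) (toTDL φ A) = integralL (pushVol φ) (dirD A f) := by
  rw [inner_toTDL, innerFun_grad]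

theorem sqNorm_pushVol (A : VF m M) :
    sqNorm (pushVol φ) A = ENNReal.ofReal (‖toTDL φ A‖ ^ 2) := by
  rw [sqNorm_eq_ofReal, ← inner_toTDL, real_inner_self_eq_norm_sq]

theorem norm_toTDL_le {A : VF m M} {r : ℝ} (hr : 0 ≤ r)
    (h : sqNorm (pushVol φ) A ≤ ENNReal.ofReal (r ^ 2)) : ‖toTDL φ A‖ ≤ r := by
  rw [sqNorm_pushVol, ENNReal.ofReal_le_ofReal_iff (by positivity)] at h
  exact (pow_le_pow_iff_left₀ (norm_nonneg _) hr two_ne_zero).1 h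

instance isOpenPosMeasure_pushVol [Nonempty M] : (pushVol φ).IsOpenPosMeasure :=
  φ.continuous.isOpenPosMeasure_map φ.surjective

theorem dirD_one (Y : VF m M) : dirD Y (1 : SmoothFun m M) = 0 := by
  have h := dirD_mul Y 1 1
  simpa using h

/-- A vector field of `T̄_φ 𝒟` orthogonal to all gradients is approximated by divergence free
vector fields. -/
theorem exists_approx_vertical [ConnectedSpace M] (w : TbarD φ)
    (hw : ∀ ψ : SmoothFun m M, inner ℝ (toTDL φ (grad ψ)) w = 0) :
    ∃ R : ℝ, 0 ≤ R ∧ ∀ τ : ℝ, 0 < τ → τ ≤ 1 → ∃ Z : VF m M, tangentP φ Z = 0 ∧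
      ‖w - toTDL φ Z‖ ≤ τ * R := by
  have hμ : ∀ p : M, ∃ θ, IsChartDensity (m := m) (pushVol φ) p θ :=
    fun p => exists_isChartDensity_pushVol φ p
  obtain ⟨C', hC'⟩ := exists_hasDiv hμ
  choose θ hθ using hμ
  obtain ⟨s, ρ, hρ1, hρs, -⟩ := exists_partition (m := m) _
    (fun p : M => extChartAt_source_mem_nhds (I := 𝓡 m) p)
  have h1 := fun p (hp : p ∈ s) => (hθ p).exists_smoothing (hρs p hp)
  choose! C hC using h1
  -- With `κ = τ²`, `‖Y‖ ≤ ‖w‖ + 1` and `‖Y - Y₀‖ ≤ 2 * τ`, the bound on the squared norms of the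
  -- correctors is `τ² * (1 + (‖w‖ + 1)² + 4)` up to the constant `C p`.
  set G : ℝ := (‖w‖ + 1) ^ 2 + 5 with hG
  refine ⟨1 + ∑ p ∈ s, Real.sqrt (C p * G) + Real.sqrt C', by positivity, fun τ hτ hτ1 => ?_⟩
  have hd : ∀ σ : ℝ, 0 < σ → ∃ Y, ‖toTDL φ Y - w‖ ≤ σ := fun σ hσ => by
    obtain ⟨Y, hY⟩ := Metric.denseRange_iff.1 (denseRange_toTDL φ) w σ hσ
    exact ⟨Y, by rw [← dist_eq_norm, dist_comm]; exact hY.le⟩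
  obtain ⟨Y₀, hY₀⟩ := hd τ hτ
  have h2 := fun p (hp : p ∈ s) => hC p hp Y₀ ((τ ^ 2).toNNReal) (by simpa using by positivity)
  choose! D hD using h2
  set D' : ℝ := ∑ p ∈ s, D p * Real.sqrt (D p) with hD'
  have hD0 : 0 ≤ D' := Finset.sum_nonneg fun p _ => by positivity
  -- Only now is `Y` chosen, after `Y₀` and the constants `D p`, and close enough to `w` for the
  -- smoothed divergence to be at most `τ`.
  obtain ⟨Y, hY⟩ := hd (τ / (1 + D')) (by positivity)
  choose! X S hX hXS hS using fun p (hp : p ∈ s) => hD p hp Y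
  have hYτ : ‖toTDL φ Y - w‖ ≤ τ := hY.trans (div_le_self hτ.le (by linarith))
  have hXn : ∀ p ∈ s, ‖toTDL φ (X p)‖ ≤ τ * Real.sqrt (C p * G) := fun p hp => by
    refine norm_toTDL_le φ (by positivity) ((hX p hp).trans ?_)
    rw [sqNorm_pushVol, sqNorm_pushVol, ← ENNReal.ofReal_coe_nnreal,
      ← ENNReal.ofReal_coe_nnreal (p := (τ ^ 2).toNNReal), Real.coe_toNNReal _ (by positivity),
      ← ENNReal.ofReal_one, ← ENNReal.ofReal_add (by positivity) (by positivity),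
      ← ENNReal.ofReal_mul (by positivity), ← ENNReal.ofReal_add (by positivity) (by positivity),
      ← ENNReal.ofReal_mul (by positivity)]
    refine ENNReal.ofReal_le_ofReal ?_
    rw [mul_pow, Real.sq_sqrt (by positivity), mul_left_comm]
    refine mul_le_mul_of_nonneg_left ?_ (by positivity)
    have k1 : ‖toTDL φ Y‖ ≤ ‖w‖ + 1 := by
      calc ‖toTDL φ Y‖ = ‖w + (toTDL φ Y - w)‖ := by rw [add_sub_cancel]
        _ ≤ _ := (norm_add_le _ _).trans (by linarith)
    have k2 : ‖toTDL φ (Y - Y₀)‖ ≤ 2 * τ := by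
      calc ‖toTDL φ (Y - Y₀)‖ = ‖(toTDL φ Y - w) - (toTDL φ Y₀ - w)‖ := by
            rw [map_sub, sub_sub_sub_cancel_right]
        _ ≤ _ := (norm_sub_le _ _).trans (by linarith)
    have k3 : ‖toTDL φ Y‖ ^ 2 ≤ (‖w‖ + 1) ^ 2 := pow_le_pow_left₀ (norm_nonneg _) k1 2
    have k4 : ‖toTDL φ (Y - Y₀)‖ ^ 2 ≤ (2 * τ) ^ 2 := pow_le_pow_left₀ (norm_nonneg _) k2 2
    have k5 : τ ^ 2 * ‖toTDL φ Y‖ ^ 2 ≤ τ ^ 2 * (‖w‖ + 1) ^ 2 :=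
      mul_le_mul_of_nonneg_left k3 (by positivity)
    rw [hG]
    linarith
  have hSb : ∀ p ∈ s, ∀ x, |S p x| ≤ D p * Real.sqrt (D p) * (τ / (1 + D')) := fun p hp x => by
    obtain ⟨P, r, hP1, hP2, hP3⟩ := hS p hp x
    -- Since `w` is orthogonal to gradients, only the small difference `Y - w` contributes.
    have k1 : integralL (pushVol φ) (dirD Y P) =
        inner ℝ (toTDL φ (grad P)) (toTDL φ Y - w) := by
      rw [inner_sub_right, hw, sub_zero, inner_toTDL_grad]
    have k2 : ‖toTDL φ (grad P)‖ ≤ Real.sqrt (D p) := by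
      refine norm_toTDL_le φ (by positivity) (hP3.trans ?_)
      rw [Real.sq_sqrt (NNReal.coe_nonneg _), ENNReal.ofReal_coe_nnreal]
    rw [hP1, abs_mul, k1, mul_assoc]
    refine mul_le_mul hP2 ((abs_real_inner_le_norm _ _).trans ?_) (abs_nonneg _)
      (NNReal.coe_nonneg _)
    exact mul_le_mul k2 hY (norm_nonneg _) (by positivity)
  have hSτ : ∀ x, |(∑ p ∈ s, S p) x| ≤ τ := fun x => by
    rw [smoothFun_sum_apply]
    refine (Finset.abs_sum_le_sum_abs _ _).trans
      ((Finset.sum_le_sum fun p hp => hSb p hp x).trans ?_)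
    rw [← Finset.sum_mul, ← hD', ← mul_div_assoc, div_le_iff₀ (by positivity)]
    nlinarith
  -- The pairings of `Y` with `ρ_p f` add up to its pairing with `f`, so the correctors remove the
  -- divergence of `Y` and leave the sum of the smooth `S p`.
  have hdiv : HasDiv (pushVol φ) (Y + ∑ p ∈ s, X p) (∑ p ∈ s, S p) := fun f => by
    rw [dirD_add_left, dirD_sum_left, map_add, map_sum, Finset.sum_congr rfl fun p hp => hXS p hp f,
      Finset.sum_sub_distrib, ← map_sum, ← map_sum, ← map_sum, ← Finset.mul_sum, ← Finset.sum_mul,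
      hρ1, one_mul, add_sub_cancel]
  -- Testing with the constant function one.
  have hS0 : integralL (pushVol φ) (∑ p ∈ s, S p) = 0 := by
    rw [← one_mul (∑ p ∈ s, S p), ← hdiv 1, dirD_one, map_zero]
  obtain ⟨Y', hY'1, hY'2⟩ := hC' _ τ hS0 hSτ
  have hY'n : ‖toTDL φ Y'‖ ≤ τ * Real.sqrt C' := by
    refine norm_toTDL_le φ (by positivity) (hY'1.trans (le_of_eq ?_))
    rw [mul_pow, Real.sq_sqrt (NNReal.coe_nonneg _), ENNReal.ofReal_mul (by positivity),
      ENNReal.ofReal_coe_nnreal, ENNReal.ofReal_pow hτ.le, mul_comm]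
  refine ⟨Y + ∑ p ∈ s, X p - Y', ?_, ?_⟩
  · funext f
    have := hdiv.sub hY'2 f
    rw [sub_self, mul_zero, map_zero] at this
    rw [tangentP_eq, this]; rfl
  · have k1 : w - toTDL φ (Y + ∑ p ∈ s, X p - Y') =
        (toTDL φ Y' - ∑ p ∈ s, toTDL φ (X p)) - (toTDL φ Y - w) := by
      rw [map_sub, map_add, map_sum]; abel
    rw [k1]
    refine (norm_sub_le _ _).trans ((add_le_add ((norm_sub_le _ _).trans (add_le_add hY'n
      ((norm_sum_le _ _).trans (Finset.sum_le_sum hXn)))) hYτ).trans (le_of_eq ?_))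
    rw [← Finset.mul_sum]; ring

/-- Orthogonality to an approximating divergence-free `Z` gives `‖w‖² = ⟨w - Z, w⟩`, so `‖w‖` is at
most the distance to `Z`, which is arbitrarily small. -/
theorem eq_zero_of_orthogonal [ConnectedSpace M] (w : TbarD φ)
    (hw : ∀ ψ : SmoothFun m M, inner ℝ (toTDL φ (grad ψ)) w = 0)
    (hv : ∀ Y : VF m M, tangentP φ Y = 0 → inner ℝ (toTDL φ Y) w = 0) : w = 0 := by
  obtain ⟨R, hR, h⟩ := exists_approx_vertical φ w hw
  have h1 : ∀ τ : ℝ, 0 < τ → τ ≤ 1 → ‖w‖ ≤ τ * R := fun τ h0 h1 => by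
    obtain ⟨Z, hZ, hZw⟩ := h τ h0 h1
    refine le_trans ?_ hZw
    have h2 : ‖w‖ * ‖w‖ ≤ ‖w - toTDL φ Z‖ * ‖w‖ := by
      calc ‖w‖ * ‖w‖ = inner ℝ (w - toTDL φ Z) w := by
            rw [inner_sub_left, hv Z hZ, sub_zero, real_inner_self_eq_norm_mul_norm]
        _ ≤ _ := real_inner_le_norm _ _
    rcases eq_or_lt_of_le (norm_nonneg w) with h3 | h3
    · rw [← h3]; exact norm_nonneg _
    · exact le_of_mul_le_mul_right h2 h3
  have h2 : ‖w‖ ≤ 0 := by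
    refine ge_of_tendsto (f := fun τ : ℝ => τ * R) (x := 𝓝[>] (0 : ℝ)) ?_ ?_
    · exact ((continuous_mul_const R).tendsto' 0 0 (zero_mul R)).mono_left nhdsWithin_le_nhds
    · filter_upwards [Ioc_mem_nhdsGT (zero_lt_one' ℝ)] with τ hτ
      exact h1 τ hτ.1 hτ.2
  exact norm_le_zero_iff.1 h2

end Density

/-! ### The Helmholtz decomposition -/

section Hodge

variable [RiemannianBundle (fun x : M => TangentSpace (𝓡 m) x)]
  [IsContMDiffRiemannianBundle (𝓡 m) ∞ (EuclideanSpace ℝ (Fin m))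
    (fun x : M => TangentSpace (𝓡 m) x)]
  [MeasurableSpace M] [BorelSpace M] [CompactSpace M]

variable (φ : DiffM m M)

/-- The isometry `A ↦ A ∘ φ` of the completed spaces. -/
def compExtend : L2P (m := m) (pushVol φ) →L[ℝ] TbarD φ :=
  ((UniformSpace.Completion.toComplL (𝕜 := ℝ)).comp (compIsometry φ).toContinuousLinearMap).extend
    (UniformSpace.Completion.toComplL (𝕜 := ℝ))

theorem compExtend_toL2 (A : VF m M) :
    compExtend φ (toL2 (pushVol φ) (Diffeomorph.refl (𝓡 m) M ∞) A) = toTDL φ A :=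
  ContinuousLinearMap.extend_eq _ UniformSpace.Completion.denseRange_coe
    (UniformSpace.Completion.isUniformInducing_coe _) _

theorem inner_toL2 (A B : VF m M) :
    inner ℝ (toL2 (pushVol φ) (Diffeomorph.refl (𝓡 m) M ∞) A)
      (toL2 (pushVol φ) (Diffeomorph.refl (𝓡 m) M ∞) B) = inner ℝ (toTDL φ A) (toTDL φ B) := by
  rw [inner_toTDL]
  exact UniformSpace.Completion.inner_coe
    (E := PreL2 (pushVol φ) (Diffeomorph.refl (𝓡 m) M ∞)) A B

theorem inner_compExtend (A : VF m M) (b : L2P (m := m) (pushVol φ)) :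
    inner ℝ (toTDL φ A) (compExtend φ b) =
      inner ℝ (toL2 (pushVol φ) (Diffeomorph.refl (𝓡 m) M ∞) A) b := by
  induction b using UniformSpace.Completion.induction_on with
  | hp => exact isClosed_eq (by fun_prop) (by fun_prop)
  | ih B => exact (congrArg _ (compExtend_toL2 φ B)).trans (inner_toL2 φ A B).symm

theorem inner_grad_of_mem_vbarD (ψ : SmoothFun m M) {v : TbarD φ} (hv : v ∈ VbarD φ) :
    inner ℝ (toTDL φ (grad ψ)) v = 0 := by
  have h1 : VbarD φ ≤ (innerSL ℝ (toTDL φ (grad ψ))).ker := by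
    refine Submodule.topologicalClosure_minimal _ (Submodule.span_le.2 ?_)
      (ContinuousLinearMap.isClosed_ker _)
    rintro _ ⟨Y, hY, rfl⟩
    show inner ℝ (toTDL φ (grad ψ)) (toTDL φ Y) = 0
    rw [inner_toTDL_grad, ← tangentP_eq, (show tangentP φ Y = 0 from hY)]; rfl
  exact h1 hv

theorem inner_compExtend_of_mem_tbarP {Y : VF m M} (hY : tangentP φ Y = 0)
    {x : L2P (m := m) (pushVol φ)} (hx : x ∈ TbarP (m := m) (pushVol φ)) :
    inner ℝ (toTDL φ Y) (compExtend φ x) = 0 := by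
  rw [inner_compExtend]
  have h1 : TbarP (m := m) (pushVol φ) ≤
      (innerSL ℝ (toL2 (pushVol φ) (Diffeomorph.refl (𝓡 m) M ∞) Y)).ker := by
    refine Submodule.topologicalClosure_minimal _ (Submodule.span_le.2 ?_)
      (ContinuousLinearMap.isClosed_ker _)
    rintro _ ⟨ψ, rfl⟩
    show inner ℝ (toL2 (pushVol φ) (Diffeomorph.refl (𝓡 m) M ∞) Y)
      (toL2 (pushVol φ) (Diffeomorph.refl (𝓡 m) M ∞) (grad ψ)) = 0
    rw [inner_toL2, real_inner_comm, inner_toTDL_grad, ← tangentP_eq, hY]; rfl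
  exact h1 hx

/-- The Helmholtz decomposition of a vector field along `φ`. -/
theorem toTD_eq_horizLift_add [ConnectedSpace M] (B : VF m M) :
    toTD φ B = horizLift φ ((TbarP (m := m) (pushVol φ)).orthogonalProjectionOnto
        (toL2 (pushVol φ) (Diffeomorph.refl (𝓡 m) M ∞) B)) +
      ((VbarD φ).orthogonalProjectionOnto (toTD φ B) : TbarD φ) := by
  set b := toL2 (pushVol φ) (Diffeomorph.refl (𝓡 m) M ∞) B with hb
  set x := (TbarP (m := m) (pushVol φ)).orthogonalProjectionOnto b with hx
  set v := (VbarD φ).orthogonalProjectionOnto (toTDL φ B) with hv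
  show toTDL φ B = compExtend φ x + v
  rw [← sub_eq_zero, ← sub_sub]
  -- The horizontal part is orthogonal to vertical fields and the vertical part to gradients, so the
  -- remainder is orthogonal to both families.
  refine eq_zero_of_orthogonal φ _ (fun ψ => ?_) fun Y hY => ?_
  · rw [inner_sub_right, inner_sub_right, inner_compExtend, inner_grad_of_mem_vbarD φ ψ v.2,
      sub_zero, ← inner_toL2, ← inner_sub_right]
    exact Submodule.sub_starProjection_mem_orthogonal (K := TbarP (m := m) (pushVol φ)) b _
      (gradP (pushVol φ) ψ).2
  · rw [sub_right_comm, inner_sub_right, inner_compExtend_of_mem_tbarP φ hY x.2, sub_zero]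
    exact Submodule.sub_starProjection_mem_orthogonal (K := VbarD φ) (toTDL φ B) _
      (Submodule.le_topologicalClosure _ (Submodule.subset_span ⟨Y, hY, rfl⟩))

end Hodge

/-! ### Lie derivatives on the Wasserstein space and horizontal lifts -/

section Wasserstein

variable [RiemannianBundle (fun x : M => TangentSpace (𝓡 m) x)]
  [IsContMDiffRiemannianBundle (𝓡 m) ∞ (EuclideanSpace ℝ (Fin m))
    (fun x : M => TangentSpace (𝓡 m) x)]
  [MeasurableSpace M] [BorelSpace M] [CompactSpace M]

/-- Uniqueness of integral curves identifies any flow in the definition with `flowFun`. -/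
theorem hasLieDerivP_iff {F : Measure M → ℝ} {μ : Measure M} {ψ : SmoothFun m M} {ℓ : ℝ} :
    HasLieDerivP F μ ψ ℓ ↔ HasDerivAt (fun t => F (μ.map (flowFun (grad ψ) t))) ℓ 0 := by
  constructor
  · rintro ⟨U, h0, hU, h⟩
    convert h using 4 with t
    ext x
    rw [eq_flowFun (grad ψ) (hU x) t, h0, id]
  · exact fun h => ⟨flowFun (grad ψ), funext fun x => flowFun_zero _ x,
      fun x => isMIntegralCurve_flowFun _ x, h⟩

theorem HasLieDerivP.unique {F : Measure M → ℝ} {μ : Measure M} {ψ : SmoothFun m M} {ℓ ℓ' : ℝ}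
    (h : HasLieDerivP F μ ψ ℓ) (h' : HasLieDerivP F μ ψ ℓ') : ℓ = ℓ' :=
  (hasLieDerivP_iff.1 h).unique (hasLieDerivP_iff.1 h')

theorem lieP_eq {ϕ : Measure M → SmoothFun m M} {μ : Measure M} {ψ g : SmoothFun m M}
    (h : ∀ x, HasLieDerivP (fun ν => ϕ ν x) μ ψ (g x)) : lieP ϕ μ ψ = g := by
  have h1 : ∀ x, HasLieDerivP (fun ν => ϕ ν x) μ ψ (lieP ϕ μ ψ x) :=
    Classical.epsilon_spec (p := fun g : SmoothFun m M => ∀ x, HasLieDerivP (fun ν => ϕ ν x) μ ψ (g x))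
      ⟨g, h⟩
  exact ContMDiffMap.ext fun x => (h1 x).unique (h x)

/-- Because `H` vanishes at `t`, the moving point contributes nothing to the derivative and need
only be continuous: the difference quotients are evaluated jointly. -/
theorem hasDerivAt_eval_continuousMap {H : ℝ → C(M, ℝ)} {D : C(M, ℝ)} {t : ℝ}
    (h : HasDerivAt H D t) (h0 : H t = 0) {x : ℝ → M} (hx : ContinuousAt x t) :
    HasDerivAt (fun s => H s (x s)) (D (x t)) t := by
  rw [hasDerivAt_iff_tendsto_slope] at h ⊢
  have h1 : Tendsto (fun s => (slope H t s, x s)) (𝓝[≠] t) (𝓝 (D, x t)) :=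
    h.prodMk_nhds (hx.mono_left nhdsWithin_le_nhds)
  have h2 : Continuous fun q : C(M, ℝ) × M => q.1 q.2 := continuous_eval
  refine ((h2.tendsto (D, x t)).comp h1).congr fun s => ?_
  simp only [Function.comp_apply, slope_def_module, h0, sub_zero, ContinuousMap.zero_apply]
  rfl

theorem pushVol_trans (φ : DiffM m M) (X : VF m M) (t : ℝ) :
    pushVol (φ.trans (flow X t)) = (pushVol φ).map (flowFun X t) :=
  (Measure.map_map (flow X t).continuous.measurable φ.continuous.measurable).symm

theorem dirD_grad_comm (f g : SmoothFun m M) : dirD (grad f) g = dirD (grad g) f := by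
  rw [← innerFun_grad, ← innerFun_grad, innerFun_symm]

/-- The derivative of the horizontal lift of `∇ϕ(·)` is the gradient of the Lie derivative
of `ϕ`. -/
theorem HasPartialD.eq_grad {ϕ : Measure M → SmoothFun m M} {φ : DiffM m M} {ψ k : SmoothFun m M}
    {Bdot : VF m M} (h : HasPartialD (liftD ϕ) φ (grad ψ) Bdot)
    (hk : ∀ (l : List (VF m M)) (x : M),
      HasLieDerivP (fun ν => iterD l (ϕ ν) x) (pushVol φ) ψ (iterD l k x)) : Bdot = grad k := by
  refine VF.ext_dirD fun f => ContMDiffMap.ext fun y => ?_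
  set X := grad ψ with hX
  set c : ℝ → DiffM m M := fun t => φ.trans (flow X t) with hc
  have h1 := h c (isPathD_flow X φ) f []
  have hc0 : c 0 = φ := (isPathD_flow X φ).zero
  set G : ℝ → SmoothFun m M := fun t => compDiff (dirD (liftD ϕ (c t)) f) (c t) with hG
  set D := compDiff (dirD Bdot f + dirD X (dirD (liftD ϕ φ) f)) φ with hD
  change HasDerivAt (fun t => toC (G t)) (toC D) 0 at h1
  have h2 : HasDerivAt (fun t => toC (G t) - toC (G 0)) (toC D) 0 := h1.sub_const _
  have hflow : Continuous fun t : ℝ => flowFun X (-t) y :=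
    (contMDiff_flowFun X).continuous.comp (continuous_neg.prodMk continuous_const)
  -- The point `x t` is the preimage of the fixed `y` under `c t`. Evaluating there removes the
  -- displacement of the base point, since `lieP` compares values at a fixed point of `M`.
  set x : ℝ → M := fun t => φ.symm (flowFun X (-t) y) with hx
  have hxc : Continuous x := φ.symm.continuous.comp hflow
  have hφx : ∀ t, φ (x t) = flowFun X (-t) y := fun t => φ.apply_symm_apply _
  have hcx : ∀ t, c t (x t) = y := fun t => by
    show flowFun X t (φ (x t)) = y
    rw [hφx, ← flowFun_add, add_neg_cancel, flowFun_zero]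
  have h3 := hasDerivAt_eval_continuousMap h2 (sub_self _) hxc.continuousAt
  have h4 : HasDerivAt (fun t => G 0 (x t)) (-dirD X (dirD (liftD ϕ φ) f) y) 0 := by
    have h5 := hasDerivAt_comp_integralCurve (isMIntegralCurve_flowFun X y) (dirD (liftD ϕ φ) f) (-0)
    have h6 := h5.scomp (0 : ℝ) (hasDerivAt_neg (0 : ℝ))
    rw [neg_zero, flowFun_zero, neg_smul, one_smul] at h6
    refine h6.congr_of_eventuallyEq (Eventually.of_forall fun t => ?_)
    show dirD (liftD ϕ (c 0)) f (c 0 (x t)) = dirD (liftD ϕ φ) f (flowFun X (-t) y)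
    rw [hc0, hφx]
  have h5 := h3.add h4
  have h6 := hasLieDerivP_iff.1 (hk [grad f] y)
  -- By symmetry of `⟨∇f, ∇g⟩` the derivation is moved from the varying gradient to the fixed `grad
  -- f`, so the hypothesis on first-order derivatives of `ϕ` applies.
  have e1 : ∀ t, (toC (G t) - toC (G 0)) (x t) + G 0 (x t) =
      iterD [grad f] (ϕ ((pushVol φ).map (flowFun X t))) y := fun t => by
    show G t (x t) - G 0 (x t) + G 0 (x t) = dirD (grad f) _ y
    rw [sub_add_cancel]
    show dirD (grad (ϕ (pushVol (c t)))) f (c t (x t)) = _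
    rw [hcx, dirD_grad_comm, pushVol_trans]
  have h7 := (h5.congr_of_eventuallyEq (Eventually.of_forall fun t => (e1 t).symm)).unique h6
  have e2 : toC D (x 0) = dirD Bdot f y + dirD X (dirD (liftD ϕ φ) f) y := by
    show (dirD Bdot f + dirD X (dirD (liftD ϕ φ) f)) (φ (x 0)) = _
    rw [hφx, neg_zero, flowFun_zero]; rfl
  -- The displacement terms cancel, leaving `Ḃ f` at `y`.
  rw [e2, add_neg_cancel_right] at h7
  rw [h7, dirD_grad_comm]
  rfl

end Wasserstein


end WassersteinDiff

end

/-! ### The connection on the group in terms of the Wasserstein connection -/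

theorem mainTheorem10 {m : ℕ} {M : Type*} [MetricSpace M] [CompactSpace M] [ConnectedSpace M]
    [ChartedSpace (EuclideanSpace ℝ (Fin m)) M] [IsManifold (𝓡 m) ∞ M]
    [RiemannianBundle (fun x : M => TangentSpace (𝓡 m) x)]
    [IsContMDiffRiemannianBundle (𝓡 m) ∞ (EuclideanSpace ℝ (Fin m))
      (fun x : M => TangentSpace (𝓡 m) x)]
    [IsRiemannianManifold (𝓡 m) M] [MeasurableSpace M] [BorelSpace M]
    (ϕ₁ ϕ₂ : Measure M → SmoothFun m M) (h₁ : IsGamma1P ϕ₁) (h₂ : IsGamma1P ϕ₂)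
    (φ : DiffM m M) :
    (∃! W : VF m M, IsLeviCivitaD (liftD ϕ₂) (liftD ϕ₁) φ W) ∧
    toTD φ (nablaD (liftD ϕ₂) (liftD ϕ₁) φ) =
      horizLift φ (nablaP (pushVol φ) ϕ₁ (ϕ₂ (pushVol φ)))
        + (normalTensor φ (liftD ϕ₁ φ) (liftD ϕ₂ φ) : TbarD φ) := by
  have : Nonempty M := inferInstance
  -- The direction is the field `∇ϕ₂(·)`, admissible because `ϕ₂` is of class `C^{∞,0}`; `Lϕ`
  -- supplies the Lie derivative of `ϕ₁` with all space derivatives.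
  obtain ⟨Lϕ, -, hL⟩ := h₁.1.lie_cInf0 ϕ₂ h₂.1.cInf0
  have hk := hL (pushPInf φ)
  change ∀ (l : List (VF m M)) (x : M), HasLieDerivP (fun ν => iterD l (ϕ₁ ν) x) (pushVol φ)
    (ϕ₂ (pushVol φ)) (iterD l (Lϕ (pushVol φ)) x) at hk
  obtain ⟨Bdot, hB⟩ := h₁.2.exists_hasPartialD φ (liftD ϕ₂ φ)
  have hW := isLeviCivitaD_of_hasPartialD h₂.2 h₁.2 hB
  rw [HasPartialD.eq_grad hB hk] at hW
  have hu : ∀ W, IsLeviCivitaD (liftD ϕ₂) (liftD ϕ₁) φ W →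
      W = nabla (liftD ϕ₂ φ) (liftD ϕ₁ φ) + grad (Lϕ (pushVol φ)) := fun W h => h.unique hW
  refine ⟨⟨_, hW, hu⟩, ?_⟩
  have hn : nablaD (liftD ϕ₂) (liftD ϕ₁) φ =
      nabla (liftD ϕ₂ φ) (liftD ϕ₁ φ) + grad (Lϕ (pushVol φ)) :=
    hu _ (Classical.epsilon_spec (p := fun W => IsLeviCivitaD (liftD ϕ₂) (liftD ϕ₁) φ W) ⟨_, hW⟩)
  have hadj : adjNabla (liftD ϕ₁ φ) (liftD ϕ₂ φ) = nabla (liftD ϕ₂ φ) (liftD ϕ₁ φ) :=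
    adjNabla_grad _ _
  have hlie : lieP ϕ₁ (pushVol φ) (ϕ₂ (pushVol φ)) = Lϕ (pushVol φ) :=
    lieP_eq fun x => hk [] x
  rw [hn, normalTensor, hadj, nablaP, hlie, map_add, horizLift_gradP]
  change toTDL φ (_ + _) = _
  rw [map_add]
  change toTD φ _ + toTD φ _ = _
  -- Only the covariant derivative on `M` has to be decomposed; the gradient of the Lie derivative
  -- is already horizontal.
  exact (congrArg (· + toTD φ (grad (Lϕ (pushVol φ)))) (toTD_eq_horizLift_add φ _)).trans
    (add_right_comm (G := TbarD φ) _ _ _)
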